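/- Let $r\ge 2$ and $N\ge 0$ be integers, let $V\in\mathbb C[z]$ be a polynomial of degree $r+1$, write $V'(z)=\sum_{j=1}^{r+1}v_jz^{j-1}$, and let $\lambda_1,\dots,\lambda_N\in\mathbb C$. Assume that the parameters are generic: the roots of $V''$ are simple, $V''(\lambda_i)\ne0$ for all $i$, and $V'(\lambda_i)\neq V'(\lambda_j)$ for $i\ne j$. Put $t=\alpha^{-(r+1)}$, a formal variable. A ciliated Kontsevich graph of type $(0,1)$ is a connected planar map (a graph embedded in the oriented sphere with simply connected faces) with one white vertex of degree $1$ whose other vertices are black and have degrees between $3$ and $r+1$; the face containing the white vertex is decorated with $z$, and each other face is decorated with one of $\lambda_1,\dots,\lambda_N$. Its weight $w(G)$ is the product of $\mathcal P(a,b)=\frac{a-b}{V'(a)-V'(b)}$ (with $\mathcal P(a,a)=1/V''(a)$) over the edges, $a,b$ being the decorations of the two sides, and of $\mathcal V_d(a_1,\dots,a_d)=-\sum_{j\ge d}v_j\sum_{l_1+\dots+l_d=j-d}a_1^{l_1}\cdots a_d^{l_d}$, which is $-\sum_i V'(a_i)/\prod_{j\ne i}(a_i-a_j)$ for distinct $a_i$,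 over the black vertices, $a_1,\dots,a_d$ being the decorations of the $d$ corners. Let $$W_{0,1}(z)=\sum_G w(G)\,t^{\#E(G)-\#V(G)},\qquad y(z)=z+t\,W_{0,1}(z)+t\sum_{j=1}^N\frac1{V'(z)-V'(\lambda_j)},$$ the sum being over isomorphism classes of such graphs; $y$ is a formal power series in $t$ whose coefficients are rational functions of $z$. Below, asymptotic conditions on formal series in $t$ are imposed on each coefficient. Theorem. (1) There are a unique polynomial $Q\in\mathbb C[[t]][\zeta]$ and unique series $\xi_j\in\mathbb C[[t]]$ with $\xi_j=\lambda_j+O(t)$ such that $$Q(\xi_j)=V'(\lambda_j)\ (1\le j\le N),\qquad V'\Big(\zeta+t\sum_{j=1}^N\frac1{Q'(\xi_j)(\zeta-\xi_j)}\Big)-Q(\zeta)=O\Big(\frac1\zeta\Big)\quad(\zeta\to\infty).$$ The polynomial $Q$ has degree $r$ in $\zeta$ and reduces to $V'(\zeta)$ at $t=0$; each $\xi_j$ is the only solution in $\lambda_j+t\,\mathbb C[[t]]$ of $Q(\xi_j)=V'(\lambda_j)$, and $Q'(\xi_j)$ is invertible in $\mathbb C[[t]]$. (2) There is a unique $\zeta=\zeta(z)\in\mathbb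 C(z)[[t]]$ with $Q(\zeta)=V'(z)$ and $\zeta=z+O(1)$ as $z\to\infty$; it reduces to $z$ at $t=0$. (3) In $\mathbb C(z)[[t]]$, $$y(z)=\zeta+t\sum_{j=1}^N\frac{1}{Q'(\xi_j)(\zeta-\xi_j)}.$$ (4) The deck transformations are formal power series in $t$: for each $k\in\{0,\dots,r-1\}$ there is a unique $\zeta^{(k)}\in\mathbb C((1/z))[[t]]$ with $Q(\zeta^{(k)})=Q(\zeta)$ whose coefficient of $t^0$ is $e^{2\pi\mathrm i k/r}z+O(1)$ as $z\to\infty$. -/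

import Mathlib

open Polynomial

/-! ### Local weights

Throughout, `V` is the potential, `K` is a field containing `ℂ` in which the face decorations live,
and `t = PowerSeries.X` stands for `α ^ (-(r + 1))`. -/

/-- The value `V'(a)`. -/
noncomputable def dV {K : Type*} [Field K] [Algebra ℂ K] (V : ℂ[X]) (a : K) : K :=
  aeval a (derivative V)

/-- The value `V''(a)`. -/
noncomputable def ddV {K : Type*} [Field K] [Algebra ℂ K] (V : ℂ[X]) (a : K) : K :=
  aeval a (derivative (derivative V))

open Classical in
/-- The propagator `P(a,b) = (a - b) / (V'(a) - V'(b))`, with `P(a,a) = 1 / V''(a)`. -/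
noncomputable def propagator {K : Type*} [Field K] [Algebra ℂ K] (V : ℂ[X]) (a b : K) : K :=
  if a = b then 1 / ddV V a else (a - b) / (dV V a - dV V b)

/-- The complete homogeneous symmetric polynomial
`h_k(a_1, …, a_d) = ∑_{l_1 + ⋯ + l_d = k} a_1 ^ l_1 ⋯ a_d ^ l_d`,
read off from the product of the series `∑ l, a_i ^ l * T ^ l`. -/
noncomputable def completeHom {K : Type*} [Field K] (s : Multiset K) (k : ℕ) : K :=
  PowerSeries.coeff k (s.map fun a => PowerSeries.mk fun l => a ^ l).prod

/-- The weight of a black vertex whose corners carry the decorations `s = {a_1, …, a_d}`, `d ≥ 1`: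
the symmetric polynomial `- ∑_{j ≥ d} v_j h_{j-d}(a_1, …, a_d)`, where `V = ∑_j (v_j / j) z ^ j`, so
that `v_j` is the coefficient of `z ^ (j - 1)` in `V'`. For distinct `a_i` it is
`∑ i, -V'(a_i) / ∏_{j ≠ i} (a_i - a_j)`, see `vertexWeight_eq_sum`. -/
noncomputable def vertexWeight {K : Type*} [Field K] [Algebra ℂ K] (V : ℂ[X]) (s : Multiset K) :
    K :=
  -∑ j ∈ Finset.Icc (Multiset.card s) V.natDegree,
    algebraMap ℂ K ((derivative V).coeff (j - 1)) * completeHom s (j - Multiset.card s)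

theorem sum_prod_erase_eq_pow {K : Type*} [Field K] [Infinite K] [DecidableEq K] (s : Finset K)
    (hs : s.Nonempty) :
    ∑ a ∈ s, ∏ b ∈ s.erase a, (C (a - b)⁻¹ * (1 - C b * X)) = (X : K[X]) ^ (s.card - 1) := by
  apply eq_of_infinite_eval_eq
  refine Set.Infinite.mono (s := {0}ᶜ) ?_ (Set.finite_singleton (0 : K)).infinite_compl
  intro x hx
  have hx : x ≠ 0 := hx
  have h := congrArg (eval x⁻¹) (Lagrange.sum_basis (s := s) (v := id) (by simp) hs)
  simp only [Lagrange.basis, Lagrange.basisDivisor, eval_finsetSum, eval_prod, eval_mul, eval_C,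
    eval_sub, eval_X, eval_one, id] at h
  change eval x _ = eval x _
  simp only [eval_finsetSum, eval_prod, eval_mul, eval_C,
    eval_sub, eval_X, eval_one, eval_pow]
  have h' := congrArg (fun y => x ^ (s.card - 1) * y) h
  simp only [mul_one, Finset.mul_sum] at h'
  rw [← h']
  refine Finset.sum_congr rfl fun a ha => ?_
  rw [← Finset.card_erase_of_mem ha, ← Finset.prod_const, ← Finset.prod_mul_distrib]
  refine Finset.prod_congr rfl fun b _ => ?_
  field_simp

theorem mk_pow_mul_one_sub {K : Type*} [Field K] (a : K) :
    (PowerSeries.mk fun l => a ^ l) * (1 - PowerSeries.C a * PowerSeries.X) = 1 := by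
  ext n
  cases n with
  | zero => simp [mul_sub]
  | succ n =>
    rw [mul_sub, mul_one, map_sub, mul_comm (PowerSeries.C a), ← mul_assoc,
      PowerSeries.coeff_mul_C, PowerSeries.coeff_succ_mul_X]
    simp [pow_succ, PowerSeries.coeff_one]

/-- `∑ i, a_i ^ m / ∏_{j ≠ i} (a_i - a_j) = h_{m+1-d}(a_1, …, a_d)` for distinct `a_i`. -/
theorem sum_pow_div {K : Type*} [Field K] [Infinite K] [DecidableEq K] (s : Finset K)
    (hs : s.Nonempty) (m : ℕ) :
    ∑ a ∈ s, a ^ m / ∏ b ∈ s.erase a, (a - b) =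
      if s.card ≤ m + 1 then completeHom s.val (m + 1 - s.card) else 0 := by
  have h := congrArg (fun p : K[X] => (p : PowerSeries K) * ∏ a ∈ s, PowerSeries.mk fun l => a ^ l)
    (sum_prod_erase_eq_pow s hs)
  simp only [← Polynomial.coeToPowerSeries.ringHom_apply, map_sum, map_prod, map_pow, map_mul,
    map_sub, map_one] at h
  simp only [Polynomial.coeToPowerSeries.ringHom_apply, Polynomial.coe_X, Polynomial.coe_C] at h
  rw [Finset.sum_mul] at h
  have h2 : ∀ a ∈ s, (∏ b ∈ s.erase a, (PowerSeries.C (a - b)⁻¹ *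
      (1 - PowerSeries.C b * PowerSeries.X))) * ∏ a ∈ s, (PowerSeries.mk fun l => a ^ l) =
      PowerSeries.C (∏ b ∈ s.erase a, (a - b))⁻¹ * PowerSeries.mk fun l => a ^ l := by
    intro a ha
    rw [← Finset.mul_prod_erase s _ ha, mul_comm (PowerSeries.mk _), ← mul_assoc,
      ← Finset.prod_mul_distrib, ← Finset.prod_inv_distrib, map_prod]
    congr 1
    refine Finset.prod_congr rfl fun b _ => ?_
    rw [mul_assoc, mul_comm _ (PowerSeries.mk _), mk_pow_mul_one_sub, mul_one]
  rw [Finset.sum_congr rfl h2] at h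
  have h3 := congrArg (PowerSeries.coeff m) h
  simp only [map_sum, PowerSeries.coeff_C_mul, PowerSeries.coeff_mk, PowerSeries.coeff_X_pow_mul'] at h3
  have hc := hs.card_pos
  simp only [div_eq_inv_mul]
  rw [h3]
  simp only [completeHom, Finset.prod]
  rw [show m + 1 - s.card = m - (s.card - 1) by omega]
  exact if_congr (by omega) rfl rfl

/-- For distinct decorations, the weight of a black vertex is
`∑ i, -V'(a_i) / ∏_{j ≠ i} (a_i - a_j)`. -/
theorem vertexWeight_eq_sum {K : Type*} [Field K] [Algebra ℂ K] [DecidableEq K] (V : ℂ[X])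
    (s : Finset K) (hs : s.Nonempty) :
    vertexWeight V s.val = ∑ a ∈ s, -dV V a / ∏ b ∈ s.erase a, (a - b) := by
  have : Infinite K := Infinite.of_injective _ (algebraMap ℂ K).injective
  have hd : ∀ a : K, dV V a =
      ∑ m ∈ Finset.range V.natDegree, algebraMap ℂ K ((derivative V).coeff m) * a ^ m := by
    intro a
    rcases Nat.eq_zero_or_pos V.natDegree with h0 | h0
    · rw [eq_C_of_natDegree_eq_zero h0]; simp [dV]
    · rw [dV, aeval_eq_sum_range' (n := V.natDegree) (natDegree_derivative_lt h0.ne')]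
      simp [Algebra.smul_def]
  simp only [neg_div, Finset.sum_neg_distrib, hd, Finset.sum_div, vertexWeight]
  rw [Finset.sum_comm]
  simp only [mul_div_assoc, ← Finset.mul_sum, sum_pow_div s hs, mul_ite, mul_zero]
  rw [← Finset.sum_filter]
  congr 1
  have hc := hs.card_pos
  refine Finset.sum_nbij' (fun j => j - 1) (fun m => m + 1) ?_ ?_ ?_ ?_ ?_
  · intro j hj; simp only [Finset.mem_Icc, Finset.mem_filter, Finset.mem_range, Finset.card_val] at *; omega
  · intro j hj; simp only [Finset.mem_Icc, Finset.mem_filter, Finset.mem_range, Finset.card_val] at *; omega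
  · intro j hj; simp only [Finset.mem_Icc, Finset.card_val] at *; omega
  · intro j hj; simp
  · intro j hj
    simp only [Finset.mem_Icc, Finset.card_val] at *
    rw [show j - 1 + 1 = j by omega]

/-! ### Ciliated planar maps -/

/-- The cells (vertices, edges or faces) of a map are the cycles of a permutation of its set of
half-edges. -/
abbrev Cells {D : Type} (π : Equiv.Perm D) : Type := Quotient (Equiv.Perm.SameCycle.setoid π)

/-- A ciliated Kontsevich graph of genus `0` with one cilium, as a rotation system on the
set of half-edges `D`. The vertices are the cycles of `rot` (which turns around the vertices), the
edges are those of the fixed point free involution `opp`, the faces are those of `rot * opp`. The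
corner of a vertex that precedes a half-edge `d` belongs to the face of `d`, and the two sides
of the edge of `d` belong to the faces of `d` and of `opp d`. -/
structure CiliatedMap (r N : ℕ) (D : Type) where
  /-- rotation around the vertices -/
  rot : Equiv.Perm D
  /-- the other half of the same edge -/
  opp : Equiv.Perm D
  /-- the only half-edge at the white vertex -/
  cil : D
  /-- decoration of the face of a half-edge: `none` is the variable `z` of the marked face,
  `some j` is the parameter `λ_j` -/
  color : D → Option (Fin N)
  opp_opp : ∀ d, opp (opp d) = d
  opp_ne : ∀ d, opp d ≠ d
  /-- the white vertex has degree one -/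
  rot_cil : rot cil = cil
  /-- every other vertex is black, of degree between `3` and `r + 1` -/
  black : ∀ d, d ≠ cil →
    3 ≤ Nat.card {e : D // rot.SameCycle d e} ∧ Nat.card {e : D // rot.SameCycle d e} ≤ r + 1
  /-- the map is connected -/
  connected : ∀ d e, ∃ g ∈ Subgroup.closure {rot, opp}, g d = e
  /-- Euler's relation for genus `0` -/
  genus_zero : Nat.card (Cells rot) + Nat.card (Cells (rot * opp)) = Nat.card (Cells opp) + 2
  /-- the decoration is a function of the face -/
  color_face : ∀ d, color ((rot * opp) d) = color d
  /-- the marked face is the face of the cilium, and is the only one decorated with `z` -/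
  color_eq_none : ∀ d, color d = none ↔ (rot * opp).SameCycle cil d

namespace CiliatedMap

variable {r N : ℕ} {D D' : Type}

/-- An isomorphism of decorated ciliated maps. -/
def IsIso (G : CiliatedMap r N D) (G' : CiliatedMap r N D') (f : D ≃ D') : Prop :=
  (∀ d, f (G.rot d) = G'.rot (f d)) ∧ (∀ d, f (G.opp d) = G'.opp (f d)) ∧
    f G.cil = G'.cil ∧ ∀ d, G'.color (f d) = G.color d

/-- A ciliated map has no automorphism besides the identity, so that `1 / #Aut G = 1`. -/
theorem eq_refl_of_isIso (G : CiliatedMap r N D) (f : D ≃ D) (hf : G.IsIso G f) :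
    f = Equiv.refl D := by
  obtain ⟨h1, h2, h3, -⟩ := hf
  have key : ∀ g ∈ Subgroup.closure {G.rot, G.opp}, ∀ d, f (g d) = g (f d) := by
    intro g hg
    induction hg using Subgroup.closure_induction with
    | mem x hx =>
      rcases hx with rfl | hx
      · exact h1
      · rw [Set.mem_singleton_iff] at hx
        subst hx
        exact h2
    | one => intro d; rfl
    | mul x y _ _ hx hy => intro d; rw [Equiv.Perm.mul_apply, hx, hy, Equiv.Perm.mul_apply]
    | inv x _ hx =>
      intro d
      rw [Equiv.Perm.eq_inv_iff_eq, ← hx]; simp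
  ext d
  obtain ⟨g, hg, rfl⟩ := G.connected G.cil d
  rw [key g hg, h3]
  rfl

/-- The decoration of the face of a half-edge. -/
def label {K : Type*} (G : CiliatedMap r N D) (z : K) (lam : Fin N → K) (d : D) : K :=
  (G.color d).elim z lam

open Classical in
/-- The weight of a ciliated map: the product of the propagators of the edges and of the weights of
the black vertices. -/
noncomputable def weight {K : Type*} [Field K] [Algebra ℂ K] [Fintype D] (G : CiliatedMap r N D)
    (V : ℂ[X]) (z : K) (lam : Fin N → K) : K :=
  (∏ e : Cells G.opp, propagator V (G.label z lam e.out) (G.label z lam (G.opp e.out))) *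
    ∏ v ∈ (Finset.univ : Finset (Cells G.rot)).filter fun v => v ≠ ⟦G.cil⟧,
      vertexWeight V
        (((Finset.univ : Finset D).filter fun d => (⟦d⟧ : Cells G.rot) = v).val.map
          (G.label z lam))

end CiliatedMap

/-- Isomorphism of ciliated maps whose half-edges are numbered. -/
def ciliatedSetoid (r N : ℕ) : Setoid (Σ n : ℕ, CiliatedMap r N (Fin n)) where
  r G G' := ∃ f, G.2.IsIso G'.2 f
  iseqv :=
    { refl := fun _ => ⟨Equiv.refl _, fun _ => rfl, fun _ => rfl, rfl, fun _ => rfl⟩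
      symm := by
        rintro G G' ⟨f, h1, h2, h3, h4⟩
        refine ⟨f.symm, fun d => ?_, fun d => ?_, ?_, fun d => ?_⟩
        · rw [Equiv.symm_apply_eq, h1, Equiv.apply_symm_apply]
        · rw [Equiv.symm_apply_eq, h2, Equiv.apply_symm_apply]
        · rw [Equiv.symm_apply_eq, h3]
        · rw [← h4, Equiv.apply_symm_apply]
      trans := by
        rintro G G' G'' ⟨f, h1, h2, h3, h4⟩ ⟨f', h1', h2', h3', h4'⟩
        refine ⟨f.trans f', fun d => ?_, fun d => ?_, ?_, fun d => ?_⟩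
        · simp [h1, h1']
        · simp [h2, h2']
        · simp [h3, h3']
        · simp [h4, h4'] }

/-- The set `𝒲_{0,1}` of ciliated Kontsevich graphs of type `(0,1)`, up to isomorphism. -/
abbrev CiliatedGraphs (r N : ℕ) : Type := Quotient (ciliatedSetoid r N)

/-- The series `α ^ (-(r+1)) * W_{0,1}(z)` in `t = α ^ (-(r+1))`. A map `G` contributes
`w(G) * α ^ (-deg G) = w(G) * t ^ (#E - #V)` to `W_{0,1}`, hence it contributes to the coefficient
of `t ^ m` here when `#E - #V = m - 1`; these are all the maps, since `#E - #V ≥ -1`.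
For each `m` there are finitely many of them. -/
noncomputable def shiftedDisc {K : Type*} [Field K] [Algebra ℂ K] (r : ℕ) {N : ℕ} (V : ℂ[X])
    (z : K) (lam : Fin N → K) : PowerSeries K :=
  PowerSeries.mk fun m =>
    ∑ᶠ G : {G : CiliatedGraphs r N //
        Nat.card (Cells G.out.2.opp) + 1 = Nat.card (Cells G.out.2.rot) + m},
      G.1.out.2.weight V z lam

/-- The function `y(z) = z + α ^ (-(r+1)) W_{0,1}(z) + α ^ (-(r+1)) ∑_j 1 / (V'(z) - V'(λ_j))`,
as a power series in `t` whose coefficients are rational functions of `z`. -/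
noncomputable def discFunction (r : ℕ) {N : ℕ} (V : ℂ[X]) (lam : Fin N → ℂ) :
    PowerSeries (RatFunc ℂ) :=
  PowerSeries.C RatFunc.X + shiftedDisc r V RatFunc.X (fun j => algebraMap ℂ (RatFunc ℂ) (lam j)) +
    PowerSeries.X * ∑ j, PowerSeries.C
      (1 / (dV V (RatFunc.X : RatFunc ℂ) - dV V (algebraMap ℂ (RatFunc ℂ) (lam j))))

/-- Generic parameters: the roots of `V''` are simple, `V''(λ_i) ≠ 0`, and the `V'(λ_i)` are
pairwise distinct. -/
structure GenericParameters {N : ℕ} (V : ℂ[X]) (lam : Fin N → ℂ) : Prop where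
  simple_roots : ∀ b, (derivative (derivative V)).IsRoot b →
    (derivative (derivative V)).rootMultiplicity b = 1
  ddV_ne_zero : ∀ i, ddV V (lam i) ≠ 0
  dV_injective : ∀ i j, i ≠ j → dV V (lam i) ≠ dV V (lam j)

/-! ### The parametrisation -/

/-- Extension of scalars from `ℂ⟦t⟧` to `K⟦t⟧`. -/
noncomputable abbrev scalarSeries (K : Type*) [Field K] [Algebra ℂ K] :
    PowerSeries ℂ →+* PowerSeries K :=
  PowerSeries.map (algebraMap ℂ K)

/-- The value `Q(s)` of `Q ∈ ℂ⟦t⟧[X]` at a series `s ∈ K⟦t⟧`. -/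
noncomputable def evalSeries {K : Type*} [Field K] [Algebra ℂ K] (Q : (PowerSeries ℂ)[X])
    (s : PowerSeries K) : PowerSeries K :=
  Q.eval₂ (scalarSeries K) s

/-- The expression `s + t ∑_j 1 / (Q'(ξ_j) (s - ξ_j))`, for `s ∈ K⟦t⟧`. -/
noncomputable def ratParam {K : Type*} [Field K] [Algebra ℂ K] {N : ℕ} (Q : (PowerSeries ℂ)[X])
    (ξ : Fin N → PowerSeries ℂ) (s : PowerSeries K) : PowerSeries K :=
  s + PowerSeries.X * ∑ j,
    (scalarSeries K ((derivative Q).eval (ξ j)) * (s - scalarSeries K (ξ j)))⁻¹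

/-- `F = O(1)` at infinity: every coefficient in `t` is a rational function without pole at
infinity. -/
def BigOOne (F : PowerSeries (RatFunc ℂ)) : Prop :=
  ∀ n, (PowerSeries.coeff n F).num.degree ≤ (PowerSeries.coeff n F).denom.degree

/-- `F = O(1/ζ)` at infinity: every coefficient in `t` is a rational function that vanishes at
infinity. -/
def BigOInv (F : PowerSeries (RatFunc ℂ)) : Prop :=
  ∀ n, (PowerSeries.coeff n F).num.degree < (PowerSeries.coeff n F).denom.degree

/-- `x ∈ ℂ⟦t⟧` is the solution of `Q(x) = V'(l)` that deforms `l`. -/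
def IsPreimage (V : ℂ[X]) (Q : (PowerSeries ℂ)[X]) (l : ℂ) (x : PowerSeries ℂ) : Prop :=
  PowerSeries.constantCoeff x = l ∧ Q.eval x = PowerSeries.C (dV V l)

/-- The conditions that determine `Q` and the `ξ_j`: `Q(ξ_j) = V'(λ_j)`, and
`V'(y(ζ)) - Q(ζ) = O(1/ζ)` for `y(ζ) = ζ + t ∑_j 1 / (Q'(ξ_j) (ζ - ξ_j))`, where `ζ` is here an
indeterminate. -/
def IsSpectralPolynomial {N : ℕ} (V : ℂ[X]) (lam : Fin N → ℂ) (Q : (PowerSeries ℂ)[X])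
    (ξ : Fin N → PowerSeries ℂ) : Prop :=
  (∀ j, IsPreimage V Q (lam j) (ξ j)) ∧
    BigOInv (aeval (ratParam Q ξ (PowerSeries.C (RatFunc.X : RatFunc ℂ))) (derivative V) -
      evalSeries Q (PowerSeries.C (RatFunc.X : RatFunc ℂ)))

/-- `ζ = ζ(z)` is the implicit function with `Q(ζ) = V'(z)` and `ζ = z + O(1)` as `z → ∞`. -/
def IsUniformizer (V : ℂ[X]) (Q : (PowerSeries ℂ)[X]) (ζ : PowerSeries (RatFunc ℂ)) : Prop :=
  evalSeries Q ζ = PowerSeries.C (dV V RatFunc.X) ∧ BigOOne (ζ - PowerSeries.C RatFunc.X)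

/-! ### Expansion at infinity -/

/-- The variable `z` in the field `ℂ((1/z))`, realised as Laurent series in `1/z`. -/
noncomputable def zInfty : LaurentSeries ℂ := HahnSeries.single (-1) 1

theorem algebraMap_laurent (c : ℂ) : algebraMap ℂ (LaurentSeries ℂ) c = HahnSeries.single 0 c := by
  change HahnSeries.ofPowerSeries ℤ ℂ (algebraMap ℂ (PowerSeries ℂ) c) = _
  rw [PowerSeries.algebraMap_apply, HahnSeries.ofPowerSeries_C]
  rfl

theorem aeval_zInfty_ne_zero (p : ℂ[X]) (hp : p ≠ 0) : aeval zInfty p ≠ 0 := by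
  intro h
  have h2 : (aeval zInfty p : LaurentSeries ℂ).coeff (-(p.natDegree : ℤ)) = p.leadingCoeff := by
    rw [aeval_eq_sum_range, HahnSeries.coeff_sum, Finset.sum_eq_single p.natDegree]
    · simp [zInfty, HahnSeries.single_pow, Algebra.smul_def, algebraMap_laurent]
    · intro b _ hb
      simp [zInfty, HahnSeries.single_pow, Algebra.smul_def, algebraMap_laurent,
        Ne.symm hb]
    · simp
  rw [h] at h2
  exact hp (leadingCoeff_eq_zero.mp (by simpa using h2.symm))

/-- The expansion of a rational function of `z` at `z = ∞`. -/
noncomputable def expandAtInfty : RatFunc ℂ →ₐ[ℂ] LaurentSeries ℂ :=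
  RatFunc.liftAlgHom (aeval zInfty) fun p hp =>
    mem_nonZeroDivisors_of_ne_zero (aeval_zInfty_ne_zero p (nonZeroDivisors.ne_zero hp))

/-- `x = O(1)` as `z → ∞`: no positive power of `z` occurs in `x ∈ ℂ((1/z))`. -/
def LaurentBigOOne (x : LaurentSeries ℂ) : Prop :=
  ∀ n : ℤ, n < 0 → x.coeff n = 0

/-- `ζk` is the `k`-th deck transformation of `ζ`, as a series in `t` with coefficients in
`ℂ((1/z))`: `Q(ζk) = Q(ζ)`, and the constant coefficient of `ζk` is `exp (2πik/r) z + O(1)` as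
`z → ∞`. -/
def IsDeckTransformation (r : ℕ) (Q : (PowerSeries ℂ)[X]) (ζ : PowerSeries (RatFunc ℂ)) (k : Fin r)
    (ζk : PowerSeries (LaurentSeries ℂ)) : Prop :=
  evalSeries Q ζk = evalSeries Q (PowerSeries.map expandAtInfty.toRingHom ζ) ∧
    LaurentBigOOne (PowerSeries.constantCoeff ζk -
      algebraMap ℂ (LaurentSeries ℂ) (Complex.exp (2 * Real.pi * Complex.I * (k : ℕ) / r)) * zInfty)

/-! ### Cycles of permutations and Euler's inequality -/

section CycleCount

variable {D : Type}

/-! The sum over maps is turned into loop equations, and these are solved explicitly by a rational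
parametrisation.

Combinatorics. Drop the degree condition at the vertex next to the cilium, the root vertex. A planar
rooted map is then built in exactly one way: it is a bare cilium, or its first edge is a loop that
separates an inner map from an outer one, or its first edge ends at another vertex and can be
contracted. Planarity enters through `euler_le`: genus defects are nonnegative and add up under
joining (`RMap.loop_good`), and cutting along a loop disconnects the map (`RMap.exists_loop`). The
type `Code` records these constructions; by `Code.exists_map_eq` and `Code.eq_of_map_eq` valid codes
represent the isomorphism classes, so `coeff_shiftedDisc` becomes a sum over codes.

Loop equations. Write `x_a` for `z` or `λ_j`, and `Y_a = V'(x_a)`. Give every corner of the root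
vertex, with decoration `c`, the factor `1/(x - c)`, let `t` count faces, and let `H_a(x)` be the
generating series of the maps whose cilium lies in a face decorated by `a`; the decoration `z`
occurs exactly once if it is `a`, and not at all otherwise. Modulo polynomials in `x`, the product
of `V'(x)` with `∏ 1/(x - c_i)` is a sum of divided differences of `V'` times shorter products.
Vertex weights are minus divided differences and propagators invert those at two points. Hence
contracted maps cancel almost everything, and `(V'(x) - Y_a) H_a - ∑_j H_j H_a` is a polynomial in
`x` (`loop_equation`). The coefficient of `x^(-2)` in `H_z` is `t (z + t W)` (`coeff_genCoeff_two`).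
Together with `H_a = t/x + O(1/x^2)`, vanishing at `t = 0` and poles only at the `x_b`, the
equations have one solution (`IsLoopSolution.unique`).

Solution. Put `y(η) = η + t ∑ c_i/(η - ξ_i)` with `c_i = 1/Q'(ξ_i)`. The equation `y(η) = x` has a
root `η_0` near `x` and roots `η_i` near `λ_i`. Set `H_j = -∏_i (Y_j - Q(η_i)) / ∏_{k ≠ j} (Y_j -
Y_k)` and `H_z = t/(x - y(ζ)) ∏_i (Y_z - Q(η_i))/(Y_z - Y_i)`, where `Q(ζ) = Y_z`. As `Q` is the
polynomial part of `V' ∘ y`, one has `Q(η_0) = V'(x) + O(1/x)`. The trace of `Q` over all roots is a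
polynomial in `x`, and Lagrange interpolation gives `∑ H_j = ∑ (Q(η_i) - Y_i)`; hence `Q(η_0) =
V'(x) - ∑ H_j` (`IsRootData.eval_last`). Each `(Q(η_0) - Y_a) H_a` is essentially a norm, hence a
polynomial, and this is the loop equation. Reading off `x^(-2)` in `H_z` yields `y(ζ) - t ∑ 1/(Y_z -
Y_j)`, which is the formula for `y(z)` (`discFunction_eq_ratParam`).

Existence and uniqueness. The pair (`ξ`, `c`) is the fixed point of a map that is contracting for
the `t`-adic topology (`existsUnique_spectral`). The function `ζ` and the deck transformations come
from Hensel's lemma in `t`, their constant terms from Hensel's lemma in `1/z`. -/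

theorem card_quot_or_le [Finite D] (r : D → D → Prop) (x y : D) :
    Nat.card (Quot r) ≤ Nat.card (Quot fun a b => r a b ∨ (a = x ∧ b = y)) + 1 ∧
    (Quot.mk r x ≠ Quot.mk r y →
      Nat.card (Quot r) = Nat.card (Quot fun a b => r a b ∨ (a = x ∧ b = y)) + 1) ∧
    (Quot.mk r x = Quot.mk r y →
      Nat.card (Quot r) = Nat.card (Quot fun a b => r a b ∨ (a = x ∧ b = y))) := by
  classical
  set r' := fun a b => r a b ∨ (a = x ∧ b = y) with hr'
  let q : Quot r → Quot r' := Quot.lift (Quot.mk r') fun a b h => Quot.sound (Or.inl h)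
  -- The extra pair can only merge the classes of `x` and `y`. The map `g` selects the class of `y`
  -- for the merged class, so `q` is injective away from the class of `x`, which `f` below records
  -- as `none`.
  let g : Quot r' → Quot r := Quot.lift
    (fun a => if Quot.mk r a = Quot.mk r x then Quot.mk r y else Quot.mk r a) (by
      rintro a b (h | ⟨rfl, rfl⟩)
      · simp only [Quot.sound h]
      · simp)
  have hgq : ∀ c, c ≠ Quot.mk r x → g (q c) = c := by
    rintro ⟨a⟩ h
    change (if Quot.mk r a = Quot.mk r x then Quot.mk r y else Quot.mk r a) = _
    rw [if_neg h]
  have hqxy : Quot.mk r' x = Quot.mk r' y := Quot.sound (Or.inr ⟨rfl, rfl⟩)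
  let f : Quot r → Option (Quot r') := fun c => if c = Quot.mk r x then none else some (q c)
  have hf : Function.Injective f := by
    intro c c' h
    by_cases h1 : c = Quot.mk r x <;> by_cases h2 : c' = Quot.mk r x <;> simp [f, h1, h2] at h
    · rw [h1, h2]
    · rw [← hgq c h1, ← hgq c' h2, h]
  refine ⟨?_, ?_, ?_⟩
  · rw [← Finite.card_option]
    exact Nat.card_le_card_of_injective f hf
  · intro hne
    rw [← Finite.card_option]
    refine Nat.card_eq_of_bijective f ⟨hf, ?_⟩
    rintro (_ | a')
    · exact ⟨Quot.mk r x, by simp [f]⟩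
    obtain ⟨a, rfl⟩ := Quot.exists_rep a'
    change ∃ c, f c = some (Quot.mk r' a)
    by_cases h : Quot.mk r a = Quot.mk r x
    · refine ⟨Quot.mk r y, ?_⟩
      have : Quot.mk r' a = Quot.mk r' y := by
        rw [← hqxy]; exact congrArg q h
      simp only [f, if_neg hne.symm]
      exact congrArg some this.symm
    · exact ⟨Quot.mk r a, by simp only [f, if_neg h]; rfl⟩
  · intro he
    refine Nat.card_eq_of_bijective q ⟨?_, ?_⟩
    · have : ∀ c, g (q c) = c := by
        intro c
        by_cases h : c = Quot.mk r x
        · subst h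
          change (if Quot.mk r x = Quot.mk r x then Quot.mk r y else Quot.mk r x) = _
          rw [if_pos rfl, he]
        · exact hgq c h
      exact Function.LeftInverse.injective this
    · rintro ⟨a⟩; exact ⟨Quot.mk r a, rfl⟩

theorem card_quot_congr (r r' : D → D → Prop)
    (h : ∀ a b, r a b → Quot.mk r' a = Quot.mk r' b)
    (h' : ∀ a b, r' a b → Quot.mk r a = Quot.mk r b) : Nat.card (Quot r) = Nat.card (Quot r') :=
  Nat.card_congr
    { toFun := Quot.lift (Quot.mk r') h
      invFun := Quot.lift (Quot.mk r) h'
      left_inv := by rintro ⟨a⟩; rfl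
      right_inv := by rintro ⟨a⟩; rfl }

theorem sameCycle_iff_pow [Finite D] (π : Equiv.Perm D) (x y : D) :
    π.SameCycle x y ↔ ∃ n : ℕ, (π ^ n) x = y :=
  ⟨fun h => by obtain ⟨n, -, h⟩ := h.exists_pow_eq'; exact ⟨n, h⟩,
    fun ⟨n, h⟩ => ⟨n, by simpa using h⟩⟩

/-- A function that is constant along the orbits of `π` is constant on its cycles. -/
theorem sameCycle_invariant [Finite D] {π : Equiv.Perm D} {β : Sort*} {f : D → β}
    (hf : ∀ d, f (π d) = f d) {x y : D} (h : π.SameCycle x y) : f x = f y := by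
  obtain ⟨n, rfl⟩ := (sameCycle_iff_pow π x y).1 h
  clear h
  induction n with
  | zero => rfl
  | succ n ih => rw [pow_succ', Equiv.Perm.mul_apply, hf, ih]

/-- Functions on the cells of `π` from functions on half-edges that are invariant under `π`. -/
def cellLift [Finite D] {π : Equiv.Perm D} {β : Sort*} (f : D → β) (hf : ∀ d, f (π d) = f d) :
    Cells π → β :=
  Quotient.lift f fun _ _ h => sameCycle_invariant hf h

theorem cell_mk_apply (π : Equiv.Perm D) (x : D) : (⟦π x⟧ : Cells π) = ⟦x⟧ :=
  Quotient.sound (Equiv.Perm.sameCycle_apply_left.2 (Equiv.Perm.SameCycle.refl π x))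

theorem card_cells_eq [Finite D] (π : Equiv.Perm D) :
    Nat.card (Cells π) = Nat.card (Quot fun a b => b = π a) :=
  Nat.card_congr
    { toFun := cellLift (Quot.mk fun a b => b = π a) fun d =>
        (Quot.sound (r := fun a b => b = π a) rfl).symm
      invFun := Quot.lift (fun a => (⟦a⟧ : Cells π)) (by
        rintro a b rfl; exact (cell_mk_apply π a).symm)
      left_inv := by rintro ⟨a⟩; rfl
      right_inv := by rintro ⟨a⟩; rfl }

theorem quot_mk_eq_iff [Finite D] (π : Equiv.Perm D) (x y : D) :
    Quot.mk (fun a b => b = π a) x = Quot.mk (fun a b => b = π a) y ↔ π.SameCycle x y := by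
  constructor
  · intro h
    have := congrArg (Quot.lift (fun a => (⟦a⟧ : Cells π)) (by
        rintro a b rfl; exact (cell_mk_apply π a).symm)) h
    exact Quotient.exact this
  · exact sameCycle_invariant fun d => (Quot.sound (r := fun a b => b = π a) rfl).symm

open Classical in
-- The two permutations differ by an exchange of the images of `x` and `y`, which is invisible once
-- `x` and `y` are identified. Comparing cycle numbers thus reduces to `card_quot_or_le`.
theorem card_cells_join [Finite D] (π : Equiv.Perm D) (x y : D) :
    Nat.card (Quot fun a b => b = π a ∨ (a = x ∧ b = y)) =
      Nat.card (Quot fun a b => b = (π * Equiv.swap x y) a ∨ (a = x ∧ b = y)) := by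
  refine card_quot_congr _ _ ?_ ?_
  · rintro a b (rfl | ⟨rfl, rfl⟩)
    · have hxy : Quot.mk (fun a b => b = (π * Equiv.swap x y) a ∨ (a = x ∧ b = y)) x =
        Quot.mk (fun a b => b = (π * Equiv.swap x y) a ∨ (a = x ∧ b = y)) y :=
        Quot.sound (Or.inr ⟨rfl, rfl⟩)
      by_cases hx : a = x
      · subst hx; rw [hxy]; exact Quot.sound (Or.inl (by simp))
      by_cases hy : a = y
      · subst hy; rw [← hxy]; exact Quot.sound (Or.inl (by simp))
      · exact Quot.sound (Or.inl (by simp [Equiv.swap_apply_of_ne_of_ne hx hy]))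
    · exact Quot.sound (Or.inr ⟨rfl, rfl⟩)
  · rintro a b (rfl | ⟨rfl, rfl⟩)
    · have hxy : Quot.mk (fun a b => b = π a ∨ (a = x ∧ b = y)) x =
        Quot.mk (fun a b => b = π a ∨ (a = x ∧ b = y)) y :=
        Quot.sound (Or.inr ⟨rfl, rfl⟩)
      by_cases hx : a = x
      · subst hx; rw [hxy]; exact Quot.sound (Or.inl (by simp))
      by_cases hy : a = y
      · subst hy; rw [← hxy]; exact Quot.sound (Or.inl (by simp))
      · exact Quot.sound (Or.inl (by simp [Equiv.swap_apply_of_ne_of_ne hx hy]))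
    · exact Quot.sound (Or.inr ⟨rfl, rfl⟩)

open Classical in
/-- A transposition that acts on two cycles joins them. -/
theorem card_cells_mul_swap [Finite D] (π : Equiv.Perm D) (x y : D) (h : ¬ π.SameCycle x y) :
    Nat.card (Cells (π * Equiv.swap x y)) + 1 = Nat.card (Cells π) := by
  have h1 := (card_quot_or_le (fun a b => b = π a) x y).2.1
    (by rwa [Ne, quot_mk_eq_iff])
  have hsame : (π * Equiv.swap x y).SameCycle x y := by
    by_contra hn
    -- the cycle of `y` under `π` would be disjoint from the cycle of `x`
    have hxy : x ≠ y := by rintro rfl; exact h (Equiv.Perm.SameCycle.refl _ _)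
    let π' := π * Equiv.swap x y
    -- iterating `π'` from `x` follows the `π`-cycle of `y`
    have key : ∀ n : ℕ, (∃ m, (π' ^ m) x = y) ∨ ∃ m, (π' ^ m) x = (π ^ (n + 1)) y := by
      intro n
      induction n with
      | zero => right; exact ⟨1, by simp [π']⟩
      | succ n ih =>
        rcases ih with ih | ⟨m, hm⟩
        · exact Or.inl ih
        · by_cases hy : (π ^ (n + 1)) y = y
          · exact Or.inl ⟨m, hm.trans hy⟩
          · right
            refine ⟨m + 1, ?_⟩
            have hx : (π ^ (n + 1)) y ≠ x := fun hx =>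
              h (((sameCycle_iff_pow π y x).2 ⟨n + 1, hx⟩).symm)
            rw [pow_succ', Equiv.Perm.mul_apply, hm, pow_succ' π (n + 1), Equiv.Perm.mul_apply]
            simp [Equiv.swap_apply_of_ne_of_ne hx hy]
    obtain ⟨k, hk, hk'⟩ : ∃ k : ℕ, 0 < k ∧ (π ^ k) y = y :=
      ⟨orderOf π, orderOf_pos π, by simp [pow_orderOf_eq_one]⟩
    obtain ⟨k, rfl⟩ : ∃ l, k = l + 1 := ⟨k - 1, by omega⟩
    rcases key k with ⟨m, hm⟩ | ⟨m, hm⟩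
    · exact hn ((sameCycle_iff_pow _ _ _).2 ⟨m, hm⟩)
    · exact hn ((sameCycle_iff_pow _ _ _).2 ⟨m, hm.trans hk'⟩)
  have h2 := (card_quot_or_le (fun a b => b = (π * Equiv.swap x y) a) x y).2.2
    ((quot_mk_eq_iff _ _ _).2 hsame)
  rw [card_cells_eq, card_cells_eq, h1, h2, card_cells_join π x y]

open Classical in
-- Both permutations have the same number of classes once `x` and `y` are identified, and
-- identifying two points lowers the number of classes by at most one.
theorem card_cells_mul_swap_le [Finite D] (π : Equiv.Perm D) (x y : D) :
    Nat.card (Cells (π * Equiv.swap x y)) ≤ Nat.card (Cells π) + 1 := by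
  have h1 := (card_quot_or_le (fun a b => b = (π * Equiv.swap x y) a) x y).1
  have h2 := (card_quot_or_le (fun a b => b = π a) x y)
  rw [card_cells_eq, card_cells_eq]
  rw [← card_cells_join π x y] at h1
  by_cases h : Quot.mk (fun a b => b = π a) x = Quot.mk (fun a b => b = π a) y
  · have := h2.2.2 h; omega
  · have := h2.2.1 h; omega

theorem card_cells_one [Finite D] : Nat.card (Cells (1 : Equiv.Perm D)) = Nat.card D :=
  Nat.card_congr
    { toFun := cellLift id fun d => rfl
      invFun := fun d => ⟦d⟧
      left_inv := by rintro ⟨a⟩; rfl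
      right_inv := by intro a; rfl }

open Classical in
/-- The genus of a (not necessarily connected) map is nonnegative. -/
theorem euler_le [Fintype D] (σ α : Equiv.Perm D) (hα : ∀ d, α (α d) = d) :
    Nat.card (Cells σ) + Nat.card (Cells (σ * α)) + Nat.card (Cells α) ≤
      Nat.card D + 2 * Nat.card (Quot fun a b => b = σ a ∨ b = α a) := by
  -- Edges are removed one at a time. For `α = 1` the vertices, the faces and the components all
  -- coincide.
  induction hn : α.support.card using Nat.strong_induction_on generalizing α with
  | _ n ih =>
  by_cases h1 : α = 1
  · subst h1
    have : Nat.card (Quot fun a b => b = σ a ∨ b = (1 : Equiv.Perm D) a) =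
        Nat.card (Quot fun a b => b = σ a) := by
      refine card_quot_congr _ _ ?_ ?_
      · rintro a b (rfl | rfl)
        · exact Quot.sound rfl
        · rfl
      · rintro a b rfl; exact Quot.sound (Or.inl rfl)
    rw [this, mul_one, card_cells_one, card_cells_eq]
    omega
  · obtain ⟨x, hx⟩ : ∃ x, α x ≠ x := by
      by_contra hc
      push Not at hc
      exact h1 (Equiv.ext hc)
    set y := α x with hy
    set α' := α * Equiv.swap x y with hα'
    have e : α = α' * Equiv.swap x y := by
      rw [hα', mul_assoc, Equiv.swap_mul_self, mul_one]
    have hx' : α' x = x := by simp [hα', hy, hα]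
    have hy' : α' y = y := by simp [hα', ← hy]
    have hne : ∀ d, d ≠ x → d ≠ y → α' d = α d := fun d h1 h2 => by
      simp [hα', Equiv.swap_apply_of_ne_of_ne h1 h2]
    have hinv : ∀ d, α' (α' d) = d := by
      intro d
      by_cases h1 : d = x
      · rw [h1, hx', hx']
      by_cases h2 : d = y
      · rw [h2, hy', hy']
      rw [hne d h1 h2, hne, hα]
      · intro h; apply h2; rw [hy, ← h, hα]
      · intro h; apply h1; rw [hy] at h; exact α.injective h
    have hsupp : α'.support.card < n := by
      rw [← hn]
      refine Finset.card_lt_card (Finset.ssubset_iff_subset_ne.2 (And.intro ?_ ?_))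
      · intro d hd
        rw [Equiv.Perm.mem_support] at hd ⊢
        by_cases h1 : d = x
        · exact absurd (h1 ▸ hx') hd
        by_cases h2 : d = y
        · exact absurd (h2 ▸ hy') hd
        rwa [← hne d h1 h2]
      · intro h
        have := h ▸ Equiv.Perm.mem_support.2 hx
        exact Equiv.Perm.mem_support.1 this hx'
    have IH := ih _ hsupp α' hinv rfl
    have hcα : Nat.card (Cells α) + 1 = Nat.card (Cells α') := by
      conv_lhs => rw [e]
      refine card_cells_mul_swap α' x y ?_
      intro h
      obtain ⟨k, hk⟩ := (sameCycle_iff_pow _ _ _).1 h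
      have : (α' ^ k) x = x := Equiv.Perm.pow_apply_eq_self_of_apply_eq_self hx' k
      exact hx (hk.symm.trans this)
    have horb : Nat.card (Quot fun a b => b = σ a ∨ b = α a) =
        Nat.card (Quot fun a b => (b = σ a ∨ b = α' a) ∨ (a = x ∧ b = y)) := by
      refine card_quot_congr _ _ ?_ ?_
      · rintro a b (rfl | rfl)
        · exact Quot.sound (Or.inl (Or.inl rfl))
        · by_cases h1 : a = x
          · exact Quot.sound (Or.inr ⟨h1, by rw [h1]⟩)
          by_cases h2 : a = y
          · exact (Quot.sound (r := fun a b => (b = σ a ∨ b = α' a) ∨ (a = x ∧ b = y))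
              (Or.inr ⟨by rw [h2, hy, hα], h2⟩)).symm
          · exact Quot.sound (Or.inl (Or.inr (hne a h1 h2).symm))
      · rintro a b ((rfl | rfl) | ⟨rfl, rfl⟩)
        · exact Quot.sound (Or.inl rfl)
        · by_cases h1 : a = x
          · rw [h1, hx']
          by_cases h2 : a = y
          · rw [h2, hy']
          · exact Quot.sound (Or.inr (hne a h1 h2))
        · exact Quot.sound (Or.inr rfl)
    have hj := card_quot_or_le (fun a b => b = σ a ∨ b = α' a) x y
    rw [← horb] at hj
    have hσ : σ * α = σ * α' * Equiv.swap x y := by rw [mul_assoc, ← e]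
    -- If the ends of the edge are still connected without it, putting it back creates at most one
    -- face. Otherwise it is a bridge, which merges two faces and two components. Since `α` has one
    -- cycle less than `α'`, the inequality is preserved in both cases.
    by_cases hs : Quot.mk (fun a b => b = σ a ∨ b = α' a) x =
        Quot.mk (fun a b => b = σ a ∨ b = α' a) y
    · have h3 := hj.2.2 hs
      have h4 := card_cells_mul_swap_le (σ * α') x y
      rw [← hσ] at h4
      omega
    · have h3 := hj.2.1 hs
      have h4 := card_cells_mul_swap (σ * α') x y (by
        intro h
        apply hs
        refine sameCycle_invariant (f := Quot.mk (fun a b => b = σ a ∨ b = α' a)) ?_ h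
        intro d
        rw [Equiv.Perm.mul_apply]
        exact ((Quot.sound (Or.inr rfl) : Quot.mk _ d = Quot.mk _ (α' d)).trans
          (Quot.sound (Or.inl rfl))).symm)
      rw [← hσ] at h4
      omega

end CycleCount

section Rooted

set_option linter.unusedSectionVars false

open Classical

/-! ### Cycles as finite sets and as lists -/

section Orb

variable {D D' : Type}

/-- The cycle of `d` under `π`. -/
noncomputable def orb [Fintype D] (π : Equiv.Perm D) (d : D) : Finset D :=
  Finset.univ.filter fun e => π.SameCycle d e

theorem mem_orb [Fintype D] {π : Equiv.Perm D} {d e : D} : e ∈ orb π d ↔ π.SameCycle d e := by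
  simp [orb]

theorem orb_eq_iff [Fintype D] {π : Equiv.Perm D} {d e : D} :
    orb π d = orb π e ↔ π.SameCycle d e := by
  constructor
  · intro h
    have : e ∈ orb π e := mem_orb.2 (Equiv.Perm.SameCycle.refl _ _)
    rw [← h] at this
    exact mem_orb.1 this
  · intro h
    ext x
    rw [mem_orb, mem_orb]
    exact ⟨fun hx => h.symm.trans hx, fun hx => h.trans hx⟩

/-- A complete invariant of the cycles counts them. Vertices are counted through finite sets of
half-edges and edges through unordered pairs. -/
theorem card_cells_eq_image [Fintype D] {π : Equiv.Perm D} {β : Type} [DecidableEq β]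
    {f : D → β}
    (hf : ∀ x y, f x = f y ↔ π.SameCycle x y) :
    Nat.card (Cells π) = (Finset.univ.image f).card := by
  rw [← Fintype.card_coe, ← Nat.card_eq_fintype_card]
  refine Nat.card_eq_of_bijective
    (Quotient.lift (fun d => (⟨f d, Finset.mem_image_of_mem _ (Finset.mem_univ d)⟩ :
      {C // C ∈ Finset.univ.image f})) fun a b h => Subtype.ext ((hf a b).2 h)) ⟨?_, ?_⟩
  · rintro ⟨a⟩ ⟨b⟩ h
    exact Quotient.sound ((hf a b).1 (congrArg Subtype.val h))
  · rintro ⟨C, hC⟩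
    obtain ⟨d, -, rfl⟩ := Finset.mem_image.1 hC
    exact ⟨⟦d⟧, rfl⟩

theorem pow_map_of_closed {π : Equiv.Perm D} {π' : Equiv.Perm D'} {f : D → D'} {S : D → Prop}
    (hS : ∀ x, S x → S (π x)) (hf : ∀ x, S x → π' (f x) = f (π x)) {x : D} (hx : S x) (n : ℕ) :
    (π' ^ n) (f x) = f ((π ^ n) x) ∧ S ((π ^ n) x) := by
  induction n with
  | zero => exact ⟨rfl, hx⟩
  | succ n ih =>
    rw [pow_succ', Equiv.Perm.mul_apply, ih.1, hf _ ih.2, pow_succ', Equiv.Perm.mul_apply]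
    exact ⟨rfl, hS _ ih.2⟩

/-- Equivariance is needed only on a set closed under `π`. For composed maps this set is that of the
black half-edges of a piece, where its rotation is left unchanged. -/
theorem orb_map [Fintype D] [Fintype D'] {π : Equiv.Perm D} {π' : Equiv.Perm D'} (f : D ↪ D')
    {S : D → Prop}
    (hS : ∀ x, S x → S (π x)) (hf : ∀ x, S x → π' (f x) = f (π x)) {x : D} (hx : S x) :
    orb π' (f x) = (orb π x).map f := by
  ext y
  rw [mem_orb, Finset.mem_map, sameCycle_iff_pow]
  constructor
  · rintro ⟨n, rfl⟩
    exact ⟨(π ^ n) x, mem_orb.2 ((sameCycle_iff_pow _ _ _).2 ⟨n, rfl⟩),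
      (pow_map_of_closed hS hf hx n).1.symm⟩
  · rintro ⟨z, hz, rfl⟩
    obtain ⟨n, rfl⟩ := (sameCycle_iff_pow _ _ _).1 (mem_orb.1 hz)
    exact ⟨n, (pow_map_of_closed hS hf hx n).1⟩

/-- The elements of the list are the successive images of `x` under `π`. -/
def Seg (π : Equiv.Perm D) : D → List D → Prop
  | _, [] => True
  | x, y :: L => π x = y ∧ Seg π y L

theorem seg_append {π : Equiv.Perm D} {x y : D} {L L' : List D} :
    Seg π x (L ++ y :: L') ↔ Seg π x (L ++ [y]) ∧ Seg π y L' := by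
  induction L generalizing x with
  | nil => simp [Seg]
  | cons z L ih => simp [Seg, ih, and_assoc]

/-- The starting point may change from `x` to `x'`, since only the first step involves it. This is
what allows a piece of one cycle to be spliced into another. -/
theorem seg_map {π : Equiv.Perm D} {π' : Equiv.Perm D'} {f : D → D'} {x : D} {x' : D'} {y : D}
    {L : List D} (h : Seg π x (L ++ [y])) (hx : π' x' = f (π x))
    (hL : ∀ a ∈ L, π' (f a) = f (π a)) : Seg π' x' ((L ++ [y]).map f) := by
  induction L generalizing x x' with
  | nil =>
    obtain ⟨h, -⟩ := h
    exact ⟨by rw [hx, h], trivial⟩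
  | cons z L ih =>
    obtain ⟨h, h'⟩ := h
    refine ⟨by rw [hx, h], ih h' (hL z (by simp)) fun a ha => hL a (by simp [ha])⟩

/-- `L ++ [x]` is the cycle of `x` under `π`, listed from `π x` on. -/
structure IsBd (π : Equiv.Perm D) (x : D) (L : List D) : Prop where
  nodup : (L ++ [x]).Nodup
  seg : Seg π x (L ++ [x])

theorem exists_pow_of_seg {π : Equiv.Perm D} {x : D} {L : List D} (h : Seg π x L) :
    ∀ a ∈ L, ∃ n : ℕ, (π ^ n) x = a := by
  induction L generalizing x with
  | nil => simp
  | cons z L ih =>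
    obtain ⟨h, h'⟩ := h
    intro a ha
    rcases List.mem_cons.1 ha with rfl | ha
    · exact ⟨1, by simpa using h⟩
    · obtain ⟨n, hn⟩ := ih h' a ha
      exact ⟨n + 1, by rw [pow_succ, Equiv.Perm.mul_apply, h, hn]⟩

theorem seg_apply_mem {π : Equiv.Perm D} {x y : D} {L : List D} (h : Seg π x (L ++ [y])) :
    ∀ a ∈ x :: L, π a ∈ L ++ [y] := by
  induction L generalizing x with
  | nil =>
    obtain ⟨h, -⟩ := h
    simp [h]
  | cons z L ih =>
    obtain ⟨h, h'⟩ := h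
    intro a ha
    rcases List.mem_cons.1 ha with rfl | ha
    · simp [h]
    · have := ih h' a ha
      simp only [List.cons_append, List.mem_cons]
      exact Or.inr this

theorem IsBd.mem_iff [Finite D] {π : Equiv.Perm D} {x : D} {L : List D} (h : IsBd π x L) (a : D) :
    a ∈ L ++ [x] ↔ π.SameCycle x a := by
  constructor
  · intro ha
    exact (sameCycle_iff_pow _ _ _).2 (exists_pow_of_seg h.seg a ha)
  · intro ha
    obtain ⟨n, rfl⟩ := (sameCycle_iff_pow _ _ _).1 ha
    clear ha
    induction n with
    | zero => simp
    | succ n ih =>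
      rw [pow_succ', Equiv.Perm.mul_apply]
      refine seg_apply_mem h.seg _ ?_
      simp only [List.mem_append, List.mem_singleton] at ih
      simp only [List.mem_cons]
      exact ih.symm

theorem IsBd.orb_eq [Fintype D] {π : Equiv.Perm D} {x : D} {L : List D} (h : IsBd π x L) :
    orb π x = (L ++ [x]).toFinset := by
  ext a
  rw [mem_orb, List.mem_toFinset, h.mem_iff]

theorem IsBd.orb_val [Fintype D] {π : Equiv.Perm D} {x : D} {L : List D} (h : IsBd π x L) :
    (orb π x).val = (L ++ [x] : List D) := by
  rw [h.orb_eq, List.toFinset_val, h.nodup.dedup]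

theorem IsBd.card_orb [Fintype D] {π : Equiv.Perm D} {x : D} {L : List D} (h : IsBd π x L) :
    (orb π x).card = L.length + 1 := by
  rw [h.orb_eq, List.toFinset_card_of_nodup h.nodup]
  simp

theorem seg_unique {π : Equiv.Perm D} {x : D} {L L' : List D} (h : Seg π x L) (h' : Seg π x L')
    (hl : L.length = L'.length) : L = L' := by
  induction L generalizing x L' with
  | nil => cases L' with
    | nil => rfl
    | cons _ _ => simp at hl
  | cons z L ih =>
    cases L' with
    | nil => simp at hl
    | cons z' L' =>
      obtain ⟨h1, h2⟩ := h
      obtain ⟨h1', h2'⟩ := h'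
      obtain rfl : z = z' := by rw [← h1, h1']
      rw [ih h2 h2' (by simpa using hl)]

theorem IsBd.unique [Finite D] {π : Equiv.Perm D} {x : D} {L L' : List D} (h : IsBd π x L)
    (h' : IsBd π x L') : L = L' := by
  have := Fintype.ofFinite D
  have hc : L.length = L'.length := by
    have := h.card_orb; rw [h'.card_orb] at this; omega
  exact List.append_cancel_right (seg_unique h.seg h'.seg (by simp [hc]))

theorem seg_range (π : Equiv.Perm D) (x : D) (k : ℕ) :
    Seg π x ((List.range k).map fun i => (π ^ (i + 1)) x) := by
  induction k generalizing x with
  | zero => trivial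
  | succ k ih =>
    rw [List.range_succ_eq_map, List.map_cons, List.map_map]
    refine ⟨rfl, ?_⟩
    have he : ((fun i => (π ^ (i + 1)) x) ∘ Nat.succ) = fun i => (π ^ (i + 1)) (π x) := by
      funext i
      rfl
    rw [he]
    exact ih (π x)

theorem exists_isBd [Finite D] (π : Equiv.Perm D) (x : D) : ∃ L, IsBd π x L := by
  have hex : ∃ n : ℕ, (π ^ (n + 1)) x = x :=
    ⟨orderOf π - 1, by rw [Nat.sub_add_cancel (orderOf_pos π), pow_orderOf_eq_one]; rfl⟩
  -- The cycle has length `k + 1`; minimality of `k` makes the listed images distinct.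
  set k := Nat.find hex with hk
  have hkx : (π ^ (k + 1)) x = x := Nat.find_spec hex
  have he : ((List.range k).map fun i => (π ^ (i + 1)) x) ++ [x] =
      (List.range (k + 1)).map fun i => (π ^ (i + 1)) x := by
    rw [List.range_succ, List.map_append, List.map_singleton, hkx]
  refine ⟨(List.range k).map fun i => (π ^ (i + 1)) x, ?_, ?_⟩
  · rw [he]
    refine (List.nodup_map_iff_inj_on List.nodup_range).2 ?_
    have aux : ∀ i j : ℕ, i < j → j < k + 1 → (π ^ (i + 1)) x ≠ (π ^ (j + 1)) x := by
      intro i j hij hj h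
      have h2 : (π ^ (j - i)) x = x := by
        apply (π ^ (i + 1)).injective
        rw [← Equiv.Perm.mul_apply, ← pow_add, h]
        congr 2; omega
      have : j - i - 1 < k := by omega
      exact Nat.find_min hex this (by rwa [show j - i - 1 + 1 = j - i by omega])
    intro i hi j hj h
    rw [List.mem_range] at hi hj
    rcases lt_trichotomy i j with hlt | rfl | hlt
    · exact absurd h (aux i j hlt hj)
    · rfl
    · exact absurd h.symm (aux j i hlt hi)
  · rw [he]; exact seg_range π x _

end Orb

/-! ### Rooted maps -/

/-- A rooted map, decorated by `I`. It is like a `CiliatedMap`, but the vertex at the other end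
of the edge of the cilium, the root vertex, may have any degree. -/
structure RMap (I D : Type) where
  rot : Equiv.Perm D
  opp : Equiv.Perm D
  cil : D
  color : D → I

namespace RMap

variable {I D D₁ D₂ : Type}

/-- The half-edge of the cilium at the root vertex. -/
def root (M : RMap I D) : D := M.opp M.cil

/-- Half-edges at the vertices that are neither the vertex of the cilium nor the root vertex. -/
def Black (M : RMap I D) (d : D) : Prop := d ≠ M.cil ∧ ¬ M.rot.SameCycle M.root d

noncomputable def blacks [Fintype D] (M : RMap I D) : Finset (Finset D) :=
  (Finset.univ.filter M.Black).image (orb M.rot)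

/-- The edges besides that of the cilium. -/
noncomputable def edges [Fintype D] (M : RMap I D) : Finset (Sym2 D) :=
  (Finset.univ.filter fun d => d ≠ M.cil ∧ d ≠ M.root).image fun d => s(d, M.opp d)

/-- The local conditions only. They suffice for all bookkeeping under joining and splitting;
connectedness, degrees and genus are in `Good`. -/
structure Pre (M : RMap I D) : Prop where
  opp_opp : ∀ d, M.opp (M.opp d) = d
  opp_ne : ∀ d, M.opp d ≠ d
  rot_cil : M.rot M.cil = M.cil
  color_face : ∀ d, M.color ((M.rot * M.opp) d) = M.color d

/-- Connectedness as an induction principle from the cilium. Closure under inverses is automatic on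
finite sets of half-edges. -/
def Conn (M : RMap I D) : Prop :=
  ∀ p : D → Prop, p M.cil → (∀ d, p d → p (M.rot d)) → (∀ d, p d → p (M.opp d)) → ∀ d, p d

/-- The set `blacks` omits two vertices (white and root) and `edges` omits one edge, so Euler's
relation `#V + #F = #E + 2` takes the form stated in `genus`. The root vertex is exempt from the
degree condition. -/
structure Good [Fintype D] (r : ℕ) (M : RMap I D) : Prop extends M.Pre where
  black : ∀ C ∈ M.blacks, 3 ≤ C.card ∧ C.card ≤ r + 1
  conn : M.Conn
  genus : M.blacks.card + Nat.card (Cells (M.rot * M.opp)) = M.edges.card + 1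

/-- The weight of a rooted map, for weights `fV` of the black vertices and `fE` of the edges. -/
noncomputable def wt [Fintype D] {K : Type*} [CommMonoid K] (fV : Multiset I → K) (fE : Sym2 I → K)
    (M : RMap I D) : K :=
  (∏ e ∈ M.edges, fE (e.map M.color)) * ∏ C ∈ M.blacks, fV (C.val.map M.color)

namespace Pre

variable {M : RMap I D} (h : M.Pre)
include h

theorem opp_root : M.opp M.root = M.cil := h.opp_opp _

theorem root_ne_cil : M.root ≠ M.cil := h.opp_ne _

theorem rot_eq_cil {d : D} (hd : M.rot d = M.cil) : d = M.cil :=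
  M.rot.injective (hd.trans h.rot_cil.symm)

theorem not_sameCycle_cil [Finite D] {d : D} (hd : d ≠ M.cil) : ¬ M.rot.SameCycle d M.cil := by
  intro hs
  obtain ⟨n, hn⟩ := (sameCycle_iff_pow _ _ _).1 hs.symm
  exact hd (hn.symm.trans (Equiv.Perm.pow_apply_eq_self_of_apply_eq_self h.rot_cil n))

theorem cil_not_mem [Finite D] {L : List D} (hL : IsBd M.rot M.root L) : M.cil ∉ L ++ [M.root] := by
  intro hc
  exact h.not_sameCycle_cil h.root_ne_cil ((hL.mem_iff _).1 hc)

theorem black_rot {d : D} (hd : M.Black d) : M.Black (M.rot d) :=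
  ⟨fun he => hd.1 (h.rot_eq_cil he),
    fun he => hd.2 (Equiv.Perm.sameCycle_apply_right.1 he)⟩

/-- The face goes around the white vertex, which has degree one: `rot (opp root) = rot cil = cil`.
-/
theorem color_root : M.color M.root = M.color M.cil := by
  have := h.color_face M.root
  rw [Equiv.Perm.mul_apply, h.opp_root, h.rot_cil] at this
  exact this.symm

theorem color_rot_root : M.color (M.rot M.root) = M.color M.cil := h.color_face M.cil

theorem opp_eq_iff {d e : D} : M.opp d = e ↔ d = M.opp e :=
  ⟨fun hd => by rw [← hd, h.opp_opp], fun hd => by rw [hd, h.opp_opp]⟩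

end Pre

theorem Pre.card_cells_rot [Fintype D] {M : RMap I D} (h : M.Pre) :
    Nat.card (Cells M.rot) = M.blacks.card + 2 := by
  rw [card_cells_eq_image (f := orb M.rot) fun x y => orb_eq_iff]
  have : Finset.univ.image (orb M.rot) = insert (orb M.rot M.cil) (insert (orb M.rot M.root)
      M.blacks) := by
    ext C
    simp only [blacks, Finset.mem_insert, Finset.mem_image, Finset.mem_filter, Finset.mem_univ,
      true_and]
    constructor
    · rintro ⟨d, rfl⟩
      by_cases h1 : d = M.cil
      · exact Or.inl (by rw [h1])
      by_cases h2 : M.rot.SameCycle M.root d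
      · exact Or.inr (Or.inl (orb_eq_iff.2 h2.symm))
      · exact Or.inr (Or.inr ⟨d, ⟨h1, h2⟩, rfl⟩)
    · rintro (rfl | rfl | ⟨d, -, rfl⟩) <;> exact ⟨_, rfl⟩
  rw [this, Finset.card_insert_of_notMem, Finset.card_insert_of_notMem]
  · simp only [blacks, Finset.mem_image, Finset.mem_filter, Finset.mem_univ, true_and, not_exists,
      not_and, orb_eq_iff]
    exact fun d hd hs => hd.2 hs.symm
  · simp only [blacks, Finset.mem_insert, Finset.mem_image, Finset.mem_filter, Finset.mem_univ,
      true_and, not_or, not_exists, not_and, orb_eq_iff]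
    exact ⟨fun hs => h.not_sameCycle_cil h.root_ne_cil hs.symm,
      fun d hd hs => h.not_sameCycle_cil hd.1 hs⟩

theorem Pre.sameCycle_opp [Finite D] {M : RMap I D} (h : M.Pre) (x y : D) :
    s(x, M.opp x) = s(y, M.opp y) ↔ M.opp.SameCycle x y := by
  constructor
  · intro he
    rcases Sym2.eq_iff.1 he with ⟨rfl, -⟩ | ⟨rfl, -⟩
    · exact Equiv.Perm.SameCycle.refl _ _
    · exact Equiv.Perm.sameCycle_apply_left.2 (Equiv.Perm.SameCycle.refl _ _)
  · intro hs
    exact sameCycle_invariant (f := fun x => s(x, M.opp x))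
      (fun d => by rw [h.opp_opp]; exact Sym2.eq_swap) hs

theorem Pre.image_edges [Fintype D] {M : RMap I D} (h : M.Pre) :
    (Finset.univ.image fun d => s(d, M.opp d)) = insert s(M.cil, M.root) M.edges := by
  ext e
  simp only [edges, Finset.mem_insert, Finset.mem_image, Finset.mem_filter, Finset.mem_univ,
      true_and]
  constructor
  · rintro ⟨d, rfl⟩
    by_cases h1 : d = M.cil
    · exact Or.inl (by rw [h1]; rfl)
    by_cases h2 : d = M.root
    · exact Or.inl (by rw [h2, h.opp_root]; exact Sym2.eq_swap)
    · exact Or.inr ⟨d, ⟨h1, h2⟩, rfl⟩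
  · rintro (rfl | ⟨d, -, rfl⟩)
    · exact ⟨M.cil, rfl⟩
    · exact ⟨d, rfl⟩

theorem Pre.cil_not_mem_edges [Fintype D] {M : RMap I D} : s(M.cil, M.root) ∉ M.edges := by
  simp only [edges, Finset.mem_image, Finset.mem_filter, Finset.mem_univ, true_and, not_exists,
    not_and, Sym2.eq_iff, not_or]
  exact fun d hd => ⟨fun h1 => absurd h1 hd.1, fun h1 => absurd h1 hd.2⟩

theorem Pre.card_cells_opp [Fintype D] {M : RMap I D} (h : M.Pre) :
    Nat.card (Cells M.opp) = M.edges.card + 1 := by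
  rw [card_cells_eq_image h.sameCycle_opp, h.image_edges,
    Finset.card_insert_of_notMem cil_not_mem_edges]

theorem Pre.card_eq [Fintype D] {M : RMap I D} (h : M.Pre) :
    Nat.card D = 2 * (M.edges.card + 1) := by
  rw [← Finset.card_insert_of_notMem (cil_not_mem_edges (M := M)), ← h.image_edges,
    Nat.card_eq_fintype_card, ← Finset.card_univ,
    Finset.card_eq_sum_card_image (fun d => s(d, M.opp d)) Finset.univ, mul_comm]
  refine Finset.sum_const_nat fun e he => ?_
  obtain ⟨d, -, rfl⟩ := Finset.mem_image.1 he
  have : (Finset.univ.filter fun a => s(a, M.opp a) = s(d, M.opp d)) = {d, M.opp d} := by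
    ext a
    simp only [Finset.mem_filter, Finset.mem_univ, true_and, Sym2.eq_iff, Finset.mem_insert,
      Finset.mem_singleton]
    constructor
    · rintro (⟨h1, -⟩ | ⟨h1, -⟩)
      · exact Or.inl h1
      · exact Or.inr h1
    · rintro (rfl | rfl)
      · exact Or.inl ⟨rfl, rfl⟩
      · exact Or.inr ⟨rfl, h.opp_opp _⟩
  rw [this, Finset.card_pair (h.opp_ne d).symm]

/-- The genus of a rooted map is nonnegative. -/
theorem Pre.euler_le [Fintype D] {M : RMap I D} (h : M.Pre) (hc : M.Conn) :
    M.blacks.card + Nat.card (Cells (M.rot * M.opp)) ≤ M.edges.card + 1 := by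
  have h1 := _root_.euler_le M.rot M.opp h.opp_opp
  have h2 : Nat.card (Quot fun a b => b = M.rot a ∨ b = M.opp a) = 1 := by
    rw [Nat.card_eq_one_iff_exists]
    refine ⟨Quot.mk _ M.cil, ?_⟩
    rintro ⟨d⟩
    refine hc (fun d => Quot.mk (fun a b => b = M.rot a ∨ b = M.opp a) d = Quot.mk _ M.cil) rfl
      ?_ ?_ d
    · intro d hd; rw [← hd]; exact (Quot.sound (r := fun a b => b = M.rot a ∨ b = M.opp a) (Or.inl rfl)).symm
    · intro d hd; rw [← hd]; exact (Quot.sound (r := fun a b => b = M.rot a ∨ b = M.opp a) (Or.inr rfl)).symm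
  rw [h2, h.card_cells_rot, h.card_cells_opp, h.card_eq] at h1
  omega

end RMap

end Rooted

set_option linter.unusedSectionVars false

/-! ### Decorated faces and maps whose first edge is a loop -/

section Rooted

open Classical

namespace RMap

variable {I D D' D₁ D₂ : Type}

/-- The decoration of a face. -/
noncomputable def faceColor (M : RMap I D) (F : Cells (M.rot * M.opp)) : I := M.color F.out

theorem Pre.faceColor_mk [Finite D] {M : RMap I D} (h : M.Pre) (d : D) :
    M.faceColor ⟦d⟧ = M.color d :=
  sameCycle_invariant (f := M.color) h.color_face
    (Quotient.exact (Quotient.out_eq (⟦d⟧ : Cells (M.rot * M.opp))))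

/-- The number of faces whose decoration satisfies `P`. -/
noncomputable def faceCard (M : RMap I D) (P : I → Prop) : ℕ :=
  Nat.card {F : Cells (M.rot * M.opp) // P (M.faceColor F)}

theorem faceCard_true (M : RMap I D) :
    M.faceCard (fun _ => True) = Nat.card (Cells (M.rot * M.opp)) :=
  Nat.card_congr (Equiv.subtypeUnivEquiv fun _ => trivial)

/-! ### Joining two maps by a loop -/

/-- The map with inner part `A` and outer part `B`, whose first edge is a loop. -/
noncomputable def loop (A : RMap I D₁) (B : RMap I D₂) : RMap I (D₁ ⊕ D₂) where
  -- The cycle of the root vertex becomes `B.root`, `A.cil`, then the root vertex of `A` from `A.rot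
  -- A.root` to `A.root`, then `B.rot B.root` and so on. The cilium edge of `A` is reused as the
  -- loop.
  rot := Equiv.sumCongr A.rot B.rot *
    (Equiv.swap (Sum.inr B.root) (Sum.inl A.cil) * Equiv.swap (Sum.inl A.cil) (Sum.inl A.root))
  opp := Equiv.sumCongr A.opp B.opp
  cil := Sum.inr B.cil
  -- The half-edge `A.cil` now lies on the outer side of the loop, in the marked face of `B`.
  color := Sum.elim (fun d => if d = A.cil then B.color B.cil else A.color d) B.color

section Loop

variable {A : RMap I D₁} {B : RMap I D₂}

@[simp] theorem loop_opp_inl (d : D₁) : (loop A B).opp (Sum.inl d) = Sum.inl (A.opp d) := rfl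

@[simp] theorem loop_opp_inr (d : D₂) : (loop A B).opp (Sum.inr d) = Sum.inr (B.opp d) := rfl

@[simp] theorem loop_cil : (loop A B).cil = Sum.inr B.cil := rfl

@[simp] theorem loop_root : (loop A B).root = Sum.inr B.root := rfl

@[simp] theorem loop_color_inr (d : D₂) : (loop A B).color (Sum.inr d) = B.color d := rfl

@[simp] theorem loop_color_cil : (loop A B).color (Sum.inl A.cil) = B.color B.cil := by
  simp [loop]

theorem loop_color_inl {d : D₁} (hd : d ≠ A.cil) : (loop A B).color (Sum.inl d) = A.color d := by
  simp [loop, hd]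

theorem loop_rot_inr_root (hA : A.Pre) : (loop A B).rot (Sum.inr B.root) = Sum.inl A.cil := by
  simp [loop, Equiv.swap_apply_def, hA.rot_cil]

theorem loop_rot_cil (hA : A.Pre) : (loop A B).rot (Sum.inl A.cil) = Sum.inl (A.rot A.root) := by
  simp [loop, Equiv.swap_apply_def, hA.root_ne_cil]

theorem loop_rot_root : (loop A B).rot (Sum.inl A.root) = Sum.inr (B.rot B.root) := by
  simp [loop]

theorem loop_rot_inl {d : D₁} (h1 : d ≠ A.cil) (h2 : d ≠ A.root) :
    (loop A B).rot (Sum.inl d) = Sum.inl (A.rot d) := by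
  simp [loop, Equiv.swap_apply_def, h1, h2]

theorem loop_rot_inr {d : D₂} (h : d ≠ B.root) :
    (loop A B).rot (Sum.inr d) = Sum.inr (B.rot d) := by
  simp [loop, Equiv.swap_apply_def, h]

theorem loop_pre (hA : A.Pre) (hB : B.Pre) : (loop A B).Pre where
  opp_opp := by rintro (d | d) <;> simp [hA.opp_opp, hB.opp_opp]
  opp_ne := by rintro (d | d) <;> simp [hA.opp_ne, hB.opp_ne]
  rot_cil := by rw [loop_cil, loop_rot_inr hB.root_ne_cil.symm, hB.rot_cil]
  color_face := by
    rintro (d | d)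
    · rw [Equiv.Perm.mul_apply, loop_opp_inl]
      by_cases h1 : d = A.cil
      · rw [h1]
        change (loop A B).color ((loop A B).rot (Sum.inl A.root)) = _
        rw [loop_rot_root, loop_color_inr, loop_color_cil, hB.color_rot_root]
      by_cases h2 : d = A.root
      · rw [h2, hA.opp_root, loop_rot_cil hA, loop_color_inl, loop_color_inl hA.root_ne_cil,
          hA.color_rot_root, hA.color_root]
        exact fun h => hA.root_ne_cil (hA.rot_eq_cil h)
      · have h3 : A.opp d ≠ A.cil := fun h => h2 (hA.opp_eq_iff.1 h)
        have h4 : A.opp d ≠ A.root := fun h => h1 (A.opp.injective h)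
        rw [loop_rot_inl h3 h4, loop_color_inl h1, loop_color_inl fun h => h3 (hA.rot_eq_cil h)]
        exact hA.color_face d
    · rw [Equiv.Perm.mul_apply, loop_opp_inr]
      by_cases h1 : d = B.cil
      · rw [h1]
        change (loop A B).color ((loop A B).rot (Sum.inr B.root)) = _
        rw [loop_rot_inr_root hA, loop_color_cil, loop_color_inr]
      · rw [loop_rot_inr fun h => h1 (B.opp.injective h), loop_color_inr, loop_color_inr]
        exact hB.color_face d

theorem isBd_loop [Finite D₁] (hA : A.Pre) {LA : List D₁} {LB : List D₂}
    (hLA : IsBd A.rot A.root LA) (hLB : IsBd B.rot B.root LB) :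
    IsBd (loop A B).rot (loop A B).root
      (Sum.inl A.cil :: ((LA ++ [A.root]).map Sum.inl ++ LB.map Sum.inr)) := by
  have e : (Sum.inl A.cil :: ((LA ++ [A.root]).map Sum.inl ++ LB.map Sum.inr)) ++
      [(loop A B).root] = Sum.inl A.cil :: ((LA ++ [A.root]).map Sum.inl ++
        (LB ++ [B.root]).map Sum.inr) := by simp
  have hcA := hA.cil_not_mem hLA
  have hnA := hLA.nodup
  have hnB := hLB.nodup
  constructor
  · rw [e, List.nodup_cons, List.nodup_append', List.nodup_map_iff Sum.inl_injective,
      List.nodup_map_iff Sum.inr_injective]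
    refine ⟨?_, hnA, hnB, ?_⟩
    · simpa using hcA
    · intro x hx hy
      obtain ⟨a, -, rfl⟩ := List.mem_map.1 hx
      simp at hy
  · rw [e, loop_root]
    refine ⟨loop_rot_inr_root hA, ?_⟩
    rw [List.map_append, List.map_singleton, List.append_assoc, List.singleton_append, seg_append]
    constructor
    · have := seg_map (f := Sum.inl) hLA.seg (loop_rot_cil (B := B) hA) (by
        intro a ha
        refine loop_rot_inl ?_ ?_
        · rintro rfl; exact hcA (by simp [ha])
        · rintro rfl
          rw [List.nodup_append'] at hnA
          exact hnA.2.2 ha (by simp))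
      simpa using this
    · refine seg_map hLB.seg loop_rot_root ?_
      intro a ha
      refine loop_rot_inr ?_
      rintro rfl
      rw [List.nodup_append'] at hnB
      exact hnB.2.2 ha (by simp)

theorem loop_black_inl [Finite D₁] [Finite D₂] (hA : A.Pre) (d : D₁) :
    (loop A B).Black (Sum.inl d) ↔ A.Black d := by
  obtain ⟨LA, hLA⟩ := exists_isBd A.rot A.root
  obtain ⟨LB, hLB⟩ := exists_isBd B.rot B.root
  have := (isBd_loop hA hLA hLB).mem_iff (Sum.inl d)
  rw [Black, Black, ← this, ← hLA.mem_iff]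
  simp

theorem loop_black_inr [Finite D₁] [Finite D₂] (hA : A.Pre) (d : D₂) :
    (loop A B).Black (Sum.inr d) ↔ B.Black d := by
  obtain ⟨LA, hLA⟩ := exists_isBd A.rot A.root
  obtain ⟨LB, hLB⟩ := exists_isBd B.rot B.root
  have := (isBd_loop hA hLA hLB).mem_iff (Sum.inr d)
  rw [Black, Black, ← this, ← hLB.mem_iff]
  simp

variable [Fintype D₁] [Fintype D₂]

theorem mem_blacks {D : Type} [Fintype D] {M : RMap I D} {C : Finset D} :
    C ∈ M.blacks ↔ ∃ d, M.Black d ∧ orb M.rot d = C := by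
  simp [blacks]

theorem mem_edges {D : Type} [Fintype D] {M : RMap I D} {e : Sym2 D} :
    e ∈ M.edges ↔ ∃ d, (d ≠ M.cil ∧ d ≠ M.root) ∧ s(d, M.opp d) = e := by
  simp [edges]

theorem not_black_root {D : Type} {M : RMap I D} : ¬ M.Black M.root :=
  fun h => h.2 (Equiv.Perm.SameCycle.refl _ _)

theorem orb_loop_inl (hA : A.Pre) {d : D₁} (hd : A.Black d) :
    orb (loop A B).rot (Sum.inl d) = (orb A.rot d).map Function.Embedding.inl :=
  orb_map Function.Embedding.inl (S := A.Black) (fun x hx => hA.black_rot hx)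
    (fun x hx => loop_rot_inl hx.1 (by rintro rfl; exact not_black_root hx)) hd

theorem orb_loop_inr (hB : B.Pre) {d : D₂} (hd : B.Black d) :
    orb (loop A B).rot (Sum.inr d) = (orb B.rot d).map Function.Embedding.inr :=
  orb_map Function.Embedding.inr (S := B.Black) (fun x hx => hB.black_rot hx)
    (fun x hx => loop_rot_inr (by rintro rfl; exact not_black_root hx)) hd

/-- Finite subsets of the left summand. -/
def inlSet (D₁ D₂ : Type) : Finset D₁ ↪ Finset (D₁ ⊕ D₂) :=
  ⟨Finset.map Function.Embedding.inl, Finset.map_injective _⟩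

/-- Finite subsets of the right summand. -/
def inrSet (D₁ D₂ : Type) : Finset D₂ ↪ Finset (D₁ ⊕ D₂) :=
  ⟨Finset.map Function.Embedding.inr, Finset.map_injective _⟩

theorem nonempty_of_mem_blacks {D : Type} [Fintype D] {M : RMap I D} {C : Finset D}
    (hC : C ∈ M.blacks) : C.Nonempty := by
  obtain ⟨d, -, rfl⟩ := mem_blacks.1 hC
  exact ⟨d, mem_orb.2 (Equiv.Perm.SameCycle.refl _ _)⟩

theorem loop_blacks_disjoint : Disjoint (A.blacks.map (inlSet D₁ D₂))
    (B.blacks.map (inrSet D₁ D₂)) := by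
  rw [Finset.disjoint_left]
  intro C h1 h2
  obtain ⟨C1, hC1, rfl⟩ := Finset.mem_map.1 h1
  obtain ⟨C2, -, h3⟩ := Finset.mem_map.1 h2
  obtain ⟨x, hx⟩ := nonempty_of_mem_blacks hC1
  have h4 : Sum.inl x ∈ inrSet D₁ D₂ C2 := by
    rw [h3]; exact Finset.mem_map_of_mem Function.Embedding.inl hx
  obtain ⟨y, -, hy⟩ := Finset.mem_map.1 h4
  exact absurd hy (by simp)

theorem loop_blacks (hA : A.Pre) (hB : B.Pre) : (loop A B).blacks =
    (A.blacks.map (inlSet D₁ D₂)).disjUnion (B.blacks.map (inrSet D₁ D₂))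
      loop_blacks_disjoint := by
  ext C
  rw [mem_blacks, Finset.mem_disjUnion, Finset.mem_map, Finset.mem_map]
  constructor
  · rintro ⟨d | d, hd, rfl⟩
    · rw [loop_black_inl hA] at hd
      exact Or.inl ⟨_, mem_blacks.2 ⟨d, hd, rfl⟩, (orb_loop_inl hA hd).symm⟩
    · rw [loop_black_inr hA] at hd
      exact Or.inr ⟨_, mem_blacks.2 ⟨d, hd, rfl⟩, (orb_loop_inr hB hd).symm⟩
  · rintro (⟨C, hC, rfl⟩ | ⟨C, hC, rfl⟩)
    · obtain ⟨d, hd, rfl⟩ := mem_blacks.1 hC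
      exact ⟨_, (loop_black_inl hA d).2 hd, orb_loop_inl hA hd⟩
    · obtain ⟨d, hd, rfl⟩ := mem_blacks.1 hC
      exact ⟨_, (loop_black_inr hA d).2 hd, orb_loop_inr hB hd⟩

theorem loop_blacks_card (hA : A.Pre) (hB : B.Pre) :
    (loop A B).blacks.card = A.blacks.card + B.blacks.card := by
  rw [loop_blacks hA hB, Finset.card_disjUnion, Finset.card_map, Finset.card_map]

/-- Unordered pairs in the left summand. -/
def inlSym (D₁ D₂ : Type) : Sym2 D₁ ↪ Sym2 (D₁ ⊕ D₂) :=
  ⟨Sym2.map Sum.inl, Sym2.map.injective Sum.inl_injective⟩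

/-- Unordered pairs in the right summand. -/
def inrSym (D₁ D₂ : Type) : Sym2 D₂ ↪ Sym2 (D₁ ⊕ D₂) :=
  ⟨Sym2.map Sum.inr, Sym2.map.injective Sum.inr_injective⟩

theorem loop_edges_disjoint : Disjoint (A.edges.map (inlSym D₁ D₂))
    (B.edges.map (inrSym D₁ D₂)) := by
  rw [Finset.disjoint_left]
  intro e h1 h2
  obtain ⟨e1, h1, rfl⟩ := Finset.mem_map.1 h1
  obtain ⟨e2, h2, h3⟩ := Finset.mem_map.1 h2
  induction e1 with | _ a b
  induction e2 with | _ c d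
  simp [inlSym, inrSym] at h3

theorem loop_edge_not_mem : (s(Sum.inl A.cil, Sum.inl A.root) : Sym2 (D₁ ⊕ D₂)) ∉
    (A.edges.map (inlSym D₁ D₂)).disjUnion (B.edges.map (inrSym D₁ D₂)) loop_edges_disjoint := by
  rw [Finset.mem_disjUnion, not_or]
  constructor
  · intro h
    obtain ⟨e, h1, h2⟩ := Finset.mem_map.1 h
    have : inlSym D₁ D₂ e = inlSym D₁ D₂ s(A.cil, A.root) := h2
    rw [(inlSym D₁ D₂).injective this] at h1
    exact Pre.cil_not_mem_edges h1
  · intro h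
    obtain ⟨e, h1, h2⟩ := Finset.mem_map.1 h
    induction e with | _ a b
    simp [inrSym] at h2

/-- The edge of the cilium of `A` was not counted in `A.edges`; as the loop it is an ordinary edge.
This accounts for the extra edge. -/
theorem loop_edges (hA : A.Pre) : (loop A B).edges =
    Finset.cons s(Sum.inl A.cil, Sum.inl A.root)
      ((A.edges.map (inlSym D₁ D₂)).disjUnion (B.edges.map (inrSym D₁ D₂)) loop_edges_disjoint)
      loop_edge_not_mem := by
  ext e
  rw [mem_edges, Finset.mem_cons, Finset.mem_disjUnion, Finset.mem_map, Finset.mem_map]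
  constructor
  · rintro ⟨d | d, hd, rfl⟩
    · by_cases h1 : d = A.cil
      · rw [h1]; exact Or.inl rfl
      by_cases h2 : d = A.root
      · rw [h2, loop_opp_inl, hA.opp_root]; exact Or.inl Sym2.eq_swap
      · exact Or.inr (Or.inl ⟨_, mem_edges.2 ⟨d, ⟨h1, h2⟩, rfl⟩, rfl⟩)
    · refine Or.inr (Or.inr ⟨_, mem_edges.2 ⟨d, ⟨?_, ?_⟩, rfl⟩, rfl⟩)
      · rintro rfl; exact hd.1 rfl
      · rintro rfl; exact hd.2 rfl
  · rintro (rfl | ⟨e, he, rfl⟩ | ⟨e, he, rfl⟩)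
    · exact ⟨Sum.inl A.cil, ⟨by simp, by simp⟩, rfl⟩
    · obtain ⟨d, hd, rfl⟩ := mem_edges.1 he
      exact ⟨Sum.inl d, ⟨by simp, by simp⟩, rfl⟩
    · obtain ⟨d, hd, rfl⟩ := mem_edges.1 he
      exact ⟨Sum.inr d, ⟨by simpa using hd.1, by simpa using hd.2⟩, rfl⟩

theorem loop_edges_card (hA : A.Pre) :
    (loop A B).edges.card = A.edges.card + B.edges.card + 1 := by
  rw [loop_edges hA, Finset.card_cons, Finset.card_disjUnion, Finset.card_map, Finset.card_map]

theorem black_of_mem_blacks {M : RMap I D} [Fintype D] (h : M.Pre) {C : Finset D} (hC : C ∈ M.blacks)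
    {d : D} (hd : d ∈ C) : M.Black d := by
  obtain ⟨e, he, rfl⟩ := mem_blacks.1 hC
  rw [mem_orb] at hd
  refine ⟨?_, fun hs => he.2 (hs.trans hd.symm)⟩
  rintro rfl
  exact h.not_sameCycle_cil he.1 hd

theorem loop_wt {K : Type*} [CommMonoid K] (fV : Multiset I → K) (fE : Sym2 I → K) (hA : A.Pre)
    (hB : B.Pre) : (loop A B).wt fV fE =
      fE s(B.color B.cil, A.color A.cil) * A.wt fV fE * B.wt fV fE := by
  rw [wt, loop_edges hA, Finset.prod_cons, Finset.prod_disjUnion, loop_blacks hA hB,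
    Finset.prod_disjUnion, Finset.prod_map, Finset.prod_map, Finset.prod_map, Finset.prod_map]
  have e1 : ∀ e ∈ A.edges, fE ((inlSym D₁ D₂ e).map (loop A B).color) = fE (e.map A.color) := by
    intro e he
    obtain ⟨d, hd, rfl⟩ := mem_edges.1 he
    change fE s(_, _) = fE s(_, _)
    rw [loop_color_inl hd.1, loop_color_inl]
    exact fun h => hd.2 (hA.opp_eq_iff.1 h)
  have e2 : ∀ e ∈ B.edges, fE ((inrSym D₁ D₂ e).map (loop A B).color) = fE (e.map B.color) := by
    intro e he
    induction e with | _ a b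
    rfl
  have e3 : ∀ C ∈ A.blacks, fV ((inlSet D₁ D₂ C).val.map (loop A B).color) =
      fV (C.val.map A.color) := by
    intro C hC
    change fV ((C.map Function.Embedding.inl).val.map (loop A B).color) = _
    rw [Finset.map_val, Multiset.map_map]
    congr 1
    refine Multiset.map_congr rfl fun d hd => ?_
    exact loop_color_inl (black_of_mem_blacks hA hC hd).1
  have e4 : ∀ C ∈ B.blacks, fV ((inrSet D₁ D₂ C).val.map (loop A B).color) =
      fV (C.val.map B.color) := by
    intro C hC
    change fV ((C.map Function.Embedding.inr).val.map (loop A B).color) = _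
    rw [Finset.map_val, Multiset.map_map]
    rfl
  rw [Finset.prod_congr rfl e1, Finset.prod_congr rfl e2, Finset.prod_congr rfl e3,
    Finset.prod_congr rfl e4, wt, wt]
  have e5 : Sym2.map (loop A B).color s(Sum.inl A.cil, Sum.inl A.root) =
      s(B.color B.cil, A.color A.cil) := by
    change s(_, _) = _
    rw [loop_color_cil, loop_color_inl hA.root_ne_cil, hA.color_root]
  rw [e5]
  ac_rfl

/-- The face of `A` or `B` that a half-edge of `loop A B` belongs to. -/
noncomputable def loopFace (A : RMap I D₁) (B : RMap I D₂) (d : D₁ ⊕ D₂) :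
    Cells (A.rot * A.opp) ⊕ Cells (B.rot * B.opp) :=
  Sum.elim (fun d => if d = A.cil then Sum.inr ⟦B.cil⟧ else Sum.inl ⟦d⟧) (fun d => Sum.inr ⟦d⟧) d

theorem loopFace_cil : loopFace A B (Sum.inl A.cil) = Sum.inr ⟦B.cil⟧ := by simp [loopFace]

theorem loopFace_inl {d : D₁} (hd : d ≠ A.cil) : loopFace A B (Sum.inl d) = Sum.inl ⟦d⟧ := by
  simp [loopFace, hd]

theorem loopFace_inr (d : D₂) : loopFace A B (Sum.inr d) = Sum.inr ⟦d⟧ := rfl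

theorem face_rot {D : Type} (M : RMap I D) (d : D) :
    (⟦M.rot (M.opp d)⟧ : Cells (M.rot * M.opp)) = ⟦d⟧ := cell_mk_apply (M.rot * M.opp) d

theorem face_rot_root {D : Type} (M : RMap I D) :
    (⟦M.rot M.root⟧ : Cells (M.rot * M.opp)) = ⟦M.cil⟧ := face_rot M M.cil

theorem Pre.face_cil {D : Type} {M : RMap I D} (h : M.Pre) :
    (⟦M.cil⟧ : Cells (M.rot * M.opp)) = ⟦M.root⟧ := by
  rw [← face_rot M M.root, h.opp_root, h.rot_cil]

theorem loopFace_rot_opp (hA : A.Pre) (d : D₁ ⊕ D₂) :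
    loopFace A B (((loop A B).rot * (loop A B).opp) d) = loopFace A B d := by
  rw [Equiv.Perm.mul_apply]
  rcases d with d | d
  · by_cases h1 : d = A.cil
    · rw [h1, show (loop A B).opp (Sum.inl A.cil) = Sum.inl A.root from rfl, loop_rot_root,
        loopFace_inr, loopFace_cil, face_rot_root]
    by_cases h2 : d = A.root
    · rw [h2, loop_opp_inl, hA.opp_root, loop_rot_cil hA, loopFace_inl hA.root_ne_cil,
        loopFace_inl fun h => hA.root_ne_cil (hA.rot_eq_cil h), face_rot_root, hA.face_cil]
    · have h3 : A.opp d ≠ A.cil := fun h => h2 (hA.opp_eq_iff.1 h)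
      have h4 : A.opp d ≠ A.root := fun h => h1 (A.opp.injective h)
      rw [loop_opp_inl, loop_rot_inl h3 h4, loopFace_inl h1,
        loopFace_inl fun h => h3 (hA.rot_eq_cil h), face_rot]
  · by_cases h1 : d = B.cil
    · rw [h1, show (loop A B).opp (Sum.inr B.cil) = Sum.inr B.root from rfl, loop_rot_inr_root hA,
        loopFace_inr, loopFace_cil]
    · rw [loop_opp_inr, loop_rot_inr fun h => h1 (B.opp.injective h), loopFace_inr, loopFace_inr,
        face_rot]

theorem loop_face_cil (hA : A.Pre) :
    (⟦Sum.inl A.cil⟧ : Cells ((loop A B).rot * (loop A B).opp)) = ⟦Sum.inr B.cil⟧ := by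
  rw [← face_rot (loop A B) (Sum.inr B.cil),
    show (loop A B).opp (Sum.inr B.cil) = Sum.inr B.root from rfl, loop_rot_inr_root hA]

/-- The face of `loop A B` that a half-edge of `A` belongs to. -/
noncomputable def loopFaceInl (A : RMap I D₁) (B : RMap I D₂) (d : D₁) :
    Cells ((loop A B).rot * (loop A B).opp) :=
  -- `A.cil` has moved to the outer face, but `A.root` still lies in the face that it shared with
  -- `A.cil`.
  if d = A.cil then ⟦Sum.inl A.root⟧ else ⟦Sum.inl d⟧

theorem loopFaceInl_cil : loopFaceInl A B A.cil = ⟦Sum.inl A.root⟧ := by simp [loopFaceInl]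

theorem loopFaceInl_ne {d : D₁} (hd : d ≠ A.cil) : loopFaceInl A B d = ⟦Sum.inl d⟧ := by
  simp [loopFaceInl, hd]

theorem loopFaceInl_rot_opp (hA : A.Pre) (d : D₁) :
    loopFaceInl A B ((A.rot * A.opp) d) = loopFaceInl A B d := by
  rw [Equiv.Perm.mul_apply]
  by_cases h1 : d = A.cil
  · rw [h1, show A.opp A.cil = A.root from rfl, loopFaceInl_cil,
      loopFaceInl_ne fun h => hA.root_ne_cil (hA.rot_eq_cil h),
      ← face_rot (loop A B) (Sum.inl A.root), loop_opp_inl, hA.opp_root, loop_rot_cil hA]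
  by_cases h2 : d = A.root
  · rw [h2, hA.opp_root, hA.rot_cil, loopFaceInl_cil, loopFaceInl_ne hA.root_ne_cil]
  · have h3 : A.opp d ≠ A.cil := fun h => h2 (hA.opp_eq_iff.1 h)
    have h4 : A.opp d ≠ A.root := fun h => h1 (A.opp.injective h)
    rw [loopFaceInl_ne h1, loopFaceInl_ne fun h => h3 (hA.rot_eq_cil h), ← loop_rot_inl h3 h4,
      ← loop_opp_inl (B := B), face_rot]

theorem loopFaceInr_rot_opp (hA : A.Pre) (d : D₂) :
    (⟦Sum.inr ((B.rot * B.opp) d)⟧ : Cells ((loop A B).rot * (loop A B).opp)) = ⟦Sum.inr d⟧ := by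
  rw [Equiv.Perm.mul_apply]
  by_cases h1 : d = B.cil
  · rw [h1, show B.opp B.cil = B.root from rfl, ← loop_face_cil hA,
      ← face_rot (loop A B) (Sum.inl A.cil),
      show (loop A B).opp (Sum.inl A.cil) = Sum.inl A.root from rfl, loop_rot_root]
  · rw [← loop_rot_inr (A := A) fun h => h1 (B.opp.injective h), ← loop_opp_inr (A := A), face_rot]

/-- The faces of `loop A B` are those of `A` and those of `B`. -/
noncomputable def loopFaces (hA : A.Pre) :
    Cells ((loop A B).rot * (loop A B).opp) ≃ Cells (A.rot * A.opp) ⊕ Cells (B.rot * B.opp) where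
  toFun := cellLift (loopFace A B) (loopFace_rot_opp hA)
  invFun := Sum.elim (cellLift (loopFaceInl A B) (loopFaceInl_rot_opp hA))
    (cellLift (fun d => ⟦Sum.inr d⟧) (loopFaceInr_rot_opp hA))
  left_inv F := by
    induction F using Quotient.inductionOn with | _ d
    change Sum.elim _ _ (loopFace A B d) = _
    rcases d with d | d
    · by_cases h1 : d = A.cil
      · rw [h1, loopFace_cil]
        exact (loop_face_cil hA).symm
      · rw [loopFace_inl h1]
        exact loopFaceInl_ne h1
    · rfl
  right_inv F := by
    rcases F with F | F
    · induction F using Quotient.inductionOn with | _ d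
      change cellLift _ _ (loopFaceInl A B d) = _
      by_cases h1 : d = A.cil
      · rw [h1, loopFaceInl_cil, hA.face_cil]
        exact loopFace_inl hA.root_ne_cil
      · rw [loopFaceInl_ne h1]
        exact loopFace_inl h1
    · induction F using Quotient.inductionOn with | _ d
      rfl

theorem loopFaces_color (hA : A.Pre) (hB : B.Pre) (F : Cells ((loop A B).rot * (loop A B).opp)) :
    (loop A B).faceColor F = Sum.elim A.faceColor B.faceColor (loopFaces hA F) := by
  induction F using Quotient.inductionOn with | _ d
  rw [(loop_pre hA hB).faceColor_mk]
  change _ = Sum.elim _ _ (loopFace A B d)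
  rcases d with d | d
  · by_cases h1 : d = A.cil
    · rw [h1, loopFace_cil, loop_color_cil, Sum.elim_inr, hB.faceColor_mk]
    · rw [loopFace_inl h1, loop_color_inl h1, Sum.elim_inl, hA.faceColor_mk]
  · rw [loopFace_inr, loop_color_inr, Sum.elim_inr, hB.faceColor_mk]

theorem loop_faceCard (hA : A.Pre) (hB : B.Pre) (P : I → Prop) :
    (loop A B).faceCard P = A.faceCard P + B.faceCard P := by
  rw [faceCard, Nat.card_congr ((loopFaces hA).subtypeEquiv (q := fun F =>
    P (Sum.elim A.faceColor B.faceColor F)) fun F => by rw [loopFaces_color hA hB]),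
    Nat.card_congr (Equiv.subtypeSum), Nat.card_sum]
  rfl

/-- A predicate on one part is extended by `True` on the other part. Conversely, one first runs
through `B`, whose root leads to `A.cil`, and from there through `A`. -/
theorem loop_conn (hA : A.Pre) : (loop A B).Conn ↔ A.Conn ∧ B.Conn := by
  constructor
  · intro h
    constructor
    · intro p h1 h2 h3
      have := h (Sum.elim p fun _ => True) trivial (by
        rintro (d | d) hd
        · by_cases e1 : d = A.cil
          · rw [e1, loop_rot_cil hA]; exact h2 _ (h3 _ h1)
          by_cases e2 : d = A.root
          · rw [e2, loop_rot_root]; trivial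
          · rw [loop_rot_inl e1 e2]; exact h2 _ hd
        · by_cases e1 : d = B.root
          · rw [e1, loop_rot_inr_root hA]; exact h1
          · rw [loop_rot_inr e1]; trivial) (by
        rintro (d | d) hd
        · exact h3 _ hd
        · trivial)
      exact fun d => this (Sum.inl d)
    · intro p h1 h2 h3
      have := h (Sum.elim (fun _ => True) p) h1 (by
        rintro (d | d) hd
        · by_cases e1 : d = A.cil
          · rw [e1, loop_rot_cil hA]; trivial
          by_cases e2 : d = A.root
          · rw [e2, loop_rot_root]; exact h2 _ (h3 _ h1)
          · rw [loop_rot_inl e1 e2]; trivial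
        · by_cases e1 : d = B.root
          · rw [e1, loop_rot_inr_root hA]; trivial
          · rw [loop_rot_inr e1]; exact h2 _ hd) (by
        rintro (d | d) hd
        · trivial
        · exact h3 _ hd)
      exact fun d => this (Sum.inr d)
  · rintro ⟨cA, cB⟩ p h1 h2 h3
    have kB : ∀ d, p (Sum.inr d) := by
      refine cB (fun d => p (Sum.inr d)) h1 ?_ ?_
      · intro d hd
        by_cases e1 : d = B.root
        · have := h2 _ (h3 _ (h2 _ hd))
          rw [e1, loop_rot_inr_root hA] at this
          change p ((loop A B).rot (Sum.inl A.root)) at this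
          rwa [loop_rot_root, ← e1] at this
        · have := h2 _ hd
          rwa [loop_rot_inr e1] at this
      · exact fun d hd => h3 _ hd
    have kc : p (Sum.inl A.cil) := by
      have := h2 _ (kB B.root)
      rwa [loop_rot_inr_root hA] at this
    rintro (d | d)
    · refine cA (fun d => p (Sum.inl d)) kc ?_ ?_ d
      · intro d hd
        by_cases e1 : d = A.cil
        · rw [e1, hA.rot_cil]; exact kc
        by_cases e2 : d = A.root
        · have := h2 _ kc
          rwa [loop_rot_cil hA, ← e2] at this
        · have := h2 _ hd
          rwa [loop_rot_inl e1 e2] at this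
      · exact fun d hd => h3 _ hd
    · exact kB d

/-- The defect `edges + 1 - blacks - faces` of the joined map is the sum of the defects of the
parts. Both are nonnegative by `Pre.euler_le`, so the sum vanishes only if both do. -/
theorem loop_good {r : ℕ} (hA : A.Pre) (hB : B.Pre) :
    (loop A B).Good r ↔ A.Good r ∧ B.Good r := by
  have hF := loop_faceCard hA hB fun _ => True
  rw [faceCard_true, faceCard_true, faceCard_true] at hF
  have hb := loop_blacks_card hA hB
  have he := loop_edges_card (B := B) hA
  constructor
  · intro h
    obtain ⟨cA, cB⟩ := (loop_conn hA).1 h.conn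
    have eA := hA.euler_le cA
    have eB := hB.euler_le cB
    have := h.genus
    refine ⟨⟨hA, ?_, cA, by omega⟩, ⟨hB, ?_, cB, by omega⟩⟩
    · intro C hC
      have := h.black (inlSet D₁ D₂ C) (by
        rw [loop_blacks hA hB, Finset.mem_disjUnion]
        exact Or.inl (Finset.mem_map_of_mem _ hC))
      simpa [inlSet] using this
    · intro C hC
      have := h.black (inrSet D₁ D₂ C) (by
        rw [loop_blacks hA hB, Finset.mem_disjUnion]
        exact Or.inr (Finset.mem_map_of_mem _ hC))
      simpa [inrSet] using this
  · rintro ⟨gA, gB⟩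
    have e1 := gA.genus
    have e2 := gB.genus
    refine ⟨loop_pre hA hB, ?_, (loop_conn hA).2 ⟨gA.conn, gB.conn⟩, by omega⟩
    intro C hC
    rw [loop_blacks hA hB, Finset.mem_disjUnion] at hC
    rcases hC with hC | hC
    · obtain ⟨C, hC', rfl⟩ := Finset.mem_map.1 hC
      simpa [inlSet] using gA.black C hC'
    · obtain ⟨C, hC', rfl⟩ := Finset.mem_map.1 hC
      simpa [inrSet] using gB.black C hC'

end Loop

end RMap

end Rooted

set_option linter.unusedSectionVars false

section Rooted

open Classical

namespace RMap

variable {I D : Type}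

/-! ### Splitting off a black vertex -/

/-- The map obtained from `A` by splitting a black vertex off the root vertex: the half-edges
that follow the root up to `g` go to the new vertex, which is joined to the root vertex by a new
first edge. -/
noncomputable def split (A : RMap I D) (g : D) : RMap I (D ⊕ Bool) where
  -- The half-edge `inr false` is the end of the new edge at the root vertex, `inr true` its end at
  -- the new vertex. The root vertex becomes `root`, `inr false`, `rot g`, and so on; the new vertex
  -- is `inr true`, `rot root`, up to `g`.
  rot := Equiv.sumCongr A.rot (Equiv.refl Bool) *
    (Equiv.swap (Sum.inl A.root) (Sum.inr false) * Equiv.swap (Sum.inl g) (Sum.inr true) *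
      Equiv.swap (Sum.inr false) (Sum.inr true))
  opp := Equiv.sumCongr A.opp (Equiv.swap false true)
  cil := Sum.inl A.cil
  color := Sum.elim A.color fun b => bif b then A.color (A.rot g) else A.color A.cil

section Split

variable {A : RMap I D} {g : D}

@[simp] theorem split_opp_inl (d : D) : (split A g).opp (Sum.inl d) = Sum.inl (A.opp d) := rfl

@[simp] theorem split_opp_false : (split A g).opp (Sum.inr false) = Sum.inr true := by simp [split]

@[simp] theorem split_opp_true : (split A g).opp (Sum.inr true) = Sum.inr false := by simp [split]

@[simp] theorem split_cil : (split A g).cil = Sum.inl A.cil := rfl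

@[simp] theorem split_root : (split A g).root = Sum.inl A.root := rfl

@[simp] theorem split_color_inl (d : D) : (split A g).color (Sum.inl d) = A.color d := rfl

@[simp] theorem split_color_false : (split A g).color (Sum.inr false) = A.color A.cil := rfl

@[simp] theorem split_color_true : (split A g).color (Sum.inr true) = A.color (A.rot g) := rfl

theorem split_rot_root (hg : g ≠ A.root) :
    (split A g).rot (Sum.inl A.root) = Sum.inr false := by
  simp [split, Equiv.swap_apply_def, hg.symm]

theorem split_rot_false (hg : g ≠ A.root) :
    (split A g).rot (Sum.inr false) = Sum.inl (A.rot g) := by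
  simp [split, Equiv.swap_apply_def, hg]

theorem split_rot_true : (split A g).rot (Sum.inr true) = Sum.inl (A.rot A.root) := by
  simp [split, Equiv.swap_apply_def]

theorem split_rot_self : (split A g).rot (Sum.inl g) = Sum.inr true := by
  simp [split, Equiv.swap_apply_def]

theorem split_rot_inl {d : D} (h1 : d ≠ A.root) (h2 : d ≠ g) :
    (split A g).rot (Sum.inl d) = Sum.inl (A.rot d) := by
  simp [split, Equiv.swap_apply_def, h1, h2]

theorem split_pre (hA : A.Pre) (hg : g ≠ A.root) (hg' : g ≠ A.cil) : (split A g).Pre where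
  opp_opp := by rintro (d | _ | _) <;> simp [hA.opp_opp]
  opp_ne := by rintro (d | _ | _) <;> simp [hA.opp_ne]
  rot_cil := by rw [split_cil, split_rot_inl hA.root_ne_cil.symm hg'.symm, hA.rot_cil]
  color_face := by
    rintro (d | _ | _)
    · rw [Equiv.Perm.mul_apply, split_opp_inl]
      by_cases h1 : A.opp d = A.root
      · rw [h1, split_rot_root hg, split_color_false, split_color_inl, A.opp.injective h1]
      by_cases h2 : A.opp d = g
      · rw [h2, split_rot_self, split_color_true, split_color_inl, ← h2]
        exact hA.color_face d
      · rw [split_rot_inl h1 h2]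
        exact hA.color_face d
    · rw [Equiv.Perm.mul_apply, split_opp_false, split_rot_true, split_color_inl,
        split_color_false, hA.color_rot_root]
    · rw [Equiv.Perm.mul_apply, split_opp_true, split_rot_false hg, split_color_inl,
        split_color_true]

variable {G R : List D}

theorem isBd_split [Finite D] (hL : IsBd A.rot A.root (G ++ g :: R)) :
    IsBd (split A g).rot (split A g).root (Sum.inr false :: R.map Sum.inl) ∧
    IsBd (split A g).rot (Sum.inr true) ((G ++ [g]).map Sum.inl) := by
  have hn := hL.nodup
  have hs := hL.seg
  rw [List.append_assoc, List.cons_append] at hn hs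
  rw [seg_append] at hs
  have hn' : G.Nodup ∧ (g ∉ R ∧ g ≠ A.root) ∧ (R ++ [A.root]).Nodup ∧ ∀ a ∈ G, a ≠ g ∧ a ≠ A.root := by
    rw [List.nodup_append', List.nodup_cons] at hn
    refine ⟨hn.1, by simpa using hn.2.1.1, hn.2.1.2, fun a ha => ⟨?_, ?_⟩⟩
    · rintro rfl; exact hn.2.2 ha (by simp)
    · rintro rfl; exact hn.2.2 ha (by simp)
  obtain ⟨hG, hg, hR, hGg⟩ := hn'
  refine ⟨⟨?_, ?_⟩, ⟨?_, ?_⟩⟩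
  · have e : Sum.inr false :: R.map Sum.inl ++ [(split A g).root] =
        (Sum.inr false : D ⊕ Bool) :: (R ++ [A.root]).map Sum.inl := by simp
    rw [e, List.nodup_cons, List.nodup_map_iff Sum.inl_injective]
    exact ⟨by simp, hR⟩
  · have e : Sum.inr false :: R.map Sum.inl ++ [(split A g).root] =
        (Sum.inr false : D ⊕ Bool) :: (R ++ [A.root]).map Sum.inl := by simp
    rw [e]
    refine ⟨split_rot_root hg.2, seg_map hs.2 (split_rot_false hg.2) ?_⟩
    intro a ha
    refine split_rot_inl ?_ ?_
    · rintro rfl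
      rw [List.nodup_append'] at hR
      exact hR.2.2 ha (by simp)
    · rintro rfl; exact hg.1 ha
  · rw [List.nodup_append', List.nodup_map_iff Sum.inl_injective, List.nodup_append']
    refine ⟨⟨hG, by simp, fun a ha hb => ?_⟩, by simp, fun a ha hb => ?_⟩
    · rw [List.mem_singleton] at hb
      exact (hGg a ha).1 hb
    · rw [List.mem_singleton] at hb
      subst hb
      simp at ha
  · have := seg_map (f := Sum.inl) hs.1 (split_rot_true (A := A) (g := g))
      fun a ha => split_rot_inl (hGg a ha).2 (hGg a ha).1
    rw [List.map_append, List.append_assoc]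
    rw [List.map_append] at this
    refine seg_append.2 ⟨this, split_rot_self, trivial⟩

theorem ne_root_of_isBd (hL : IsBd A.rot A.root (G ++ g :: R)) : g ≠ A.root := by
  have hn := hL.nodup
  rw [List.nodup_append'] at hn
  rintro rfl
  exact hn.2.2 (by simp) (by simp : A.root ∈ [A.root])

theorem ne_cil_of_isBd [Finite D] (hA : A.Pre) (hL : IsBd A.rot A.root (G ++ g :: R)) :
    g ≠ A.cil := by
  rintro rfl
  exact hA.cil_not_mem hL (by simp)

theorem split_black_inl [Finite D] (hL : IsBd A.rot A.root (G ++ g :: R)) (hA : A.Pre) (d : D) :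
    (split A g).Black (Sum.inl d) ↔ A.Black d ∨ d ∈ G ++ [g] := by
  have h1 := (isBd_split hL).1.mem_iff (Sum.inl d)
  have h2 := hA.cil_not_mem hL
  have h3 := hL.nodup
  have e : ∀ a, a ∈ G ++ g :: R ++ [A.root] ↔ a ∈ G ++ [g] ∨ a ∈ R ++ [A.root] := by
    intro a; simp only [List.mem_append, List.mem_cons, List.not_mem_nil, or_false]; tauto
  have h4 : d ∈ G ++ [g] → d ∉ R ++ [A.root] := by
    rw [show G ++ g :: R ++ [A.root] = (G ++ [g]) ++ (R ++ [A.root]) by simp,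
      List.nodup_append'] at h3
    exact fun hd => h3.2.2 hd
  have h5 : Sum.inl d ∈ (Sum.inr false :: R.map Sum.inl ++ [(split A g).root] : List (D ⊕ Bool)) ↔
      d ∈ R ++ [A.root] := by simp
  rw [Black, Black, ← h1, ← hL.mem_iff, h5, e]
  rw [e, not_or] at h2
  have h6 : (Sum.inl d ≠ (split A g).cil) ↔ d ≠ A.cil := by simp
  rw [h6]
  constructor
  · rintro ⟨h7, h8⟩
    by_cases h9 : d ∈ G ++ [g]
    · exact Or.inr h9
    · exact Or.inl ⟨h7, fun h => h.elim h9 h8⟩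
  · rintro (⟨h7, h8⟩ | h7)
    · exact ⟨h7, fun h => h8 (Or.inr h)⟩
    · refine ⟨?_, h4 h7⟩
      rintro rfl
      exact h2.1 h7

theorem split_black_true [Finite D] (hL : IsBd A.rot A.root (G ++ g :: R)) :
    (split A g).Black (Sum.inr true) := by
  have h1 := (isBd_split hL).1.mem_iff (Sum.inr true)
  rw [Black, ← h1]
  simp

theorem split_black_false [Finite D] (hL : IsBd A.rot A.root (G ++ g :: R)) :
    ¬ (split A g).Black (Sum.inr false) := by
  have h1 := (isBd_split hL).1.mem_iff (Sum.inr false)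
  rw [Black, ← h1]
  simp

variable [Fintype D]

theorem orb_split_inl (hL : IsBd A.rot A.root (G ++ g :: R)) (hA : A.Pre) {d : D} (hd : A.Black d) :
    orb (split A g).rot (Sum.inl d) = (orb A.rot d).map Function.Embedding.inl :=
  orb_map Function.Embedding.inl (S := A.Black) (fun x hx => hA.black_rot hx)
    (fun x hx => split_rot_inl (by rintro rfl; exact not_black_root hx) (by
      rintro rfl
      exact hx.2 ((hL.mem_iff x).1 (by simp)))) hd

theorem split_new_not_mem :
    orb (split A g).rot (Sum.inr true) ∉ A.blacks.map (inlSet D Bool) := by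
  intro h
  obtain ⟨C, -, hC⟩ := Finset.mem_map.1 h
  have : Sum.inr true ∈ inlSet D Bool C := by
    rw [hC]; exact mem_orb.2 (Equiv.Perm.SameCycle.refl _ _)
  simp [inlSet] at this

theorem split_blacks (hL : IsBd A.rot A.root (G ++ g :: R)) (hA : A.Pre) :
    (split A g).blacks = Finset.cons (orb (split A g).rot (Sum.inr true))
      (A.blacks.map (inlSet D Bool)) split_new_not_mem := by
  ext C
  rw [mem_blacks, Finset.mem_cons, Finset.mem_map]
  constructor
  · rintro ⟨d | _ | _, hd, rfl⟩
    · rw [split_black_inl hL hA] at hd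
      rcases hd with hd | hd
      · exact Or.inr ⟨_, mem_blacks.2 ⟨d, hd, rfl⟩, (orb_split_inl hL hA hd).symm⟩
      · left
        rw [orb_eq_iff]
        exact ((isBd_split hL).2.mem_iff _ |>.1 (by simpa using hd)).symm
    · exact absurd hd (split_black_false hL)
    · exact Or.inl rfl
  · rintro (rfl | ⟨C, hC, rfl⟩)
    · exact ⟨_, split_black_true hL, rfl⟩
    · obtain ⟨d, hd, rfl⟩ := mem_blacks.1 hC
      exact ⟨_, (split_black_inl hL hA d).2 (Or.inl hd), orb_split_inl hL hA hd⟩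

theorem split_edge_not_mem : (s(Sum.inr false, Sum.inr true) : Sym2 (D ⊕ Bool)) ∉
    A.edges.map (inlSym D Bool) := by
  intro h
  obtain ⟨e, -, h2⟩ := Finset.mem_map.1 h
  induction e with | _ a b
  simp [inlSym] at h2

theorem split_edges : (split A g).edges =
    Finset.cons s(Sum.inr false, Sum.inr true) (A.edges.map (inlSym D Bool))
      split_edge_not_mem := by
  ext e
  rw [mem_edges, Finset.mem_cons, Finset.mem_map]
  constructor
  · rintro ⟨d | _ | _, hd, rfl⟩
    · refine Or.inr ⟨_, mem_edges.2 ⟨d, ⟨?_, ?_⟩, rfl⟩, rfl⟩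
      · rintro rfl; exact hd.1 rfl
      · rintro rfl; exact hd.2 rfl
    · rw [split_opp_false]; exact Or.inl rfl
    · rw [split_opp_true]; exact Or.inl Sym2.eq_swap
  · rintro (rfl | ⟨e, he, rfl⟩)
    · exact ⟨Sum.inr false, ⟨by simp, by simp⟩, by rw [split_opp_false]⟩
    · obtain ⟨d, hd, rfl⟩ := mem_edges.1 he
      exact ⟨Sum.inl d, ⟨by simpa using hd.1, by simpa using hd.2⟩, rfl⟩

theorem split_wt {K : Type*} [CommMonoid K] (fV : Multiset I → K) (fE : Sym2 I → K)
    (hL : IsBd A.rot A.root (G ++ g :: R)) (hA : A.Pre) :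
    (split A g).wt fV fE = fE s(A.color A.cil, A.color (A.rot g)) *
      fV (((G ++ [g]).map A.color ++ [A.color (A.rot g)] : List I) : Multiset I) * A.wt fV fE := by
  rw [wt, split_edges, Finset.prod_cons, split_blacks hL hA, Finset.prod_cons, Finset.prod_map,
    Finset.prod_map]
  have e1 : ∀ e ∈ A.edges, fE ((inlSym D Bool e).map (split A g).color) = fE (e.map A.color) := by
    intro e he
    induction e with | _ a b
    rfl
  have e2 : ∀ C ∈ A.blacks, fV ((inlSet D Bool C).val.map (split A g).color) =
      fV (C.val.map A.color) := by
    intro C hC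
    change fV ((C.map Function.Embedding.inl).val.map (split A g).color) = _
    rw [Finset.map_val, Multiset.map_map]
    rfl
  have e3 : (orb (split A g).rot (Sum.inr true)).val.map (split A g).color =
      (((G ++ [g]).map A.color ++ [A.color (A.rot g)] : List I) : Multiset I) := by
    rw [(isBd_split hL).2.orb_val, Multiset.map_coe, List.map_append, List.map_map]
    rfl
  rw [Finset.prod_congr rfl e1, Finset.prod_congr rfl e2, e3, wt]
  have e5 : Sym2.map (split A g).color s(Sum.inr false, Sum.inr true) =
      s(A.color A.cil, A.color (A.rot g)) := rfl
  rw [e5]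
  ac_rfl

/-- The face of `A` that a half-edge of `split A g` belongs to. -/
def splitFace (A : RMap I D) (g : D) (d : D ⊕ Bool) : Cells (A.rot * A.opp) :=
  Sum.elim (fun d => ⟦d⟧) (fun b => bif b then ⟦A.rot g⟧ else ⟦A.cil⟧) d

theorem splitFace_rot_opp (hg : g ≠ A.root) (d : D ⊕ Bool) :
    splitFace A g (((split A g).rot * (split A g).opp) d) = splitFace A g d := by
  rw [Equiv.Perm.mul_apply]
  rcases d with d | _ | _
  · by_cases h1 : A.opp d = A.root
    · rw [split_opp_inl, h1, split_rot_root hg, A.opp.injective h1]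
      rfl
    by_cases h2 : A.opp d = g
    · rw [split_opp_inl, h2, split_rot_self]
      change ⟦A.rot g⟧ = _
      rw [← h2, face_rot]
      rfl
    · rw [split_opp_inl, split_rot_inl h1 h2]
      exact face_rot A d
  · rw [split_opp_false, split_rot_true]
    exact face_rot_root A
  · rw [split_opp_true, split_rot_false hg]
    rfl

theorem splitFaceInl_rot_opp (hg : g ≠ A.root) (d : D) :
    (⟦Sum.inl ((A.rot * A.opp) d)⟧ : Cells ((split A g).rot * (split A g).opp)) =
      ⟦Sum.inl d⟧ := by
  rw [Equiv.Perm.mul_apply]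
  by_cases h1 : A.opp d = A.root
  · rw [h1, ← split_rot_true (g := g), ← split_opp_false (A := A) (g := g), face_rot,
      ← split_rot_root hg, ← h1, ← split_opp_inl (g := g), face_rot]
  by_cases h2 : A.opp d = g
  · rw [h2, ← face_rot (split A g) (Sum.inl d), split_opp_inl, h2, split_rot_self,
      ← face_rot (split A g) (Sum.inr true), split_opp_true, split_rot_false hg]
  · rw [← split_rot_inl h1 h2, ← split_opp_inl (g := g), face_rot]

/-- The faces of `split A g` are those of `A`. -/
noncomputable def splitFaces (hg : g ≠ A.root) :
    Cells ((split A g).rot * (split A g).opp) ≃ Cells (A.rot * A.opp) where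
  toFun := cellLift (splitFace A g) (splitFace_rot_opp hg)
  invFun := cellLift (fun d => ⟦Sum.inl d⟧) (splitFaceInl_rot_opp hg)
  left_inv F := by
    induction F using Quotient.inductionOn with | _ d
    rcases d with d | _ | _
    · rfl
    · change ⟦Sum.inl A.cil⟧ = _
      rw [← face_rot (split A g) (Sum.inl A.cil), split_opp_inl]
      change ⟦(split A g).rot (Sum.inl A.root)⟧ = _
      rw [split_rot_root hg]
    · change ⟦Sum.inl (A.rot g)⟧ = _
      rw [← face_rot (split A g) (Sum.inr true), split_opp_true, split_rot_false hg]
  right_inv F := by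
    induction F using Quotient.inductionOn with | _ d
    rfl

theorem split_faceCard (hA : A.Pre) (hg : g ≠ A.root) (hg' : g ≠ A.cil) (P : I → Prop) :
    (split A g).faceCard P = A.faceCard P := by
  refine Nat.card_congr ((splitFaces hg).subtypeEquiv fun F => ?_)
  have : (split A g).faceColor F = A.faceColor (splitFaces hg F) := by
    induction F using Quotient.inductionOn with | _ d
    rw [(split_pre hA hg hg').faceColor_mk]
    rcases d with d | _ | _
    · exact (hA.faceColor_mk d).symm
    · exact (hA.faceColor_mk A.cil).symm
    · exact (hA.faceColor_mk (A.rot g)).symm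
  rw [this]

theorem split_conn (hL : IsBd A.rot A.root (G ++ g :: R)) : (split A g).Conn ↔ A.Conn := by
  have hg := ne_root_of_isBd hL
  constructor
  · intro h p h1 h2 h3
    -- In the split map `inr false` leads to `rot g`, so the predicate has to be known on the whole
    -- root vertex of `A` beforehand.
    have hw : ∀ a, A.rot.SameCycle A.root a → p a := by
      intro a ha
      obtain ⟨n, rfl⟩ := (sameCycle_iff_pow _ _ _).1 ha
      clear ha
      induction n with
      | zero => exact h3 _ h1
      | succ n ih => rw [pow_succ', Equiv.Perm.mul_apply]; exact h2 _ ih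
    have := h (Sum.elim p fun _ => True) h1 (by
      rintro (d | _ | _) hd
      · by_cases e1 : d = A.root
        · rw [e1, split_rot_root hg]; trivial
        by_cases e2 : d = g
        · rw [e2, split_rot_self]; trivial
        · rw [split_rot_inl e1 e2]; exact h2 _ hd
      · rw [split_rot_false hg]
        exact h2 _ (hw _ ((hL.mem_iff g).1 (by simp)))
      · rw [split_rot_true]
        exact h2 _ (h3 _ h1)) (by
      rintro (d | _ | _) hd
      · exact h3 _ hd
      · trivial
      · trivial)
    exact fun d => this (Sum.inl d)
  · rintro c p h1 h2 h3
    have k0 : p (Sum.inr false) := by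
      have := h2 _ (h3 _ h1)
      rw [split_cil, split_opp_inl] at this
      change p ((split A g).rot (Sum.inl A.root)) at this
      rwa [split_rot_root hg] at this
    have k1 : p (Sum.inr true) := by
      have := h3 _ k0
      rwa [split_opp_false] at this
    have : ∀ d, p (Sum.inl d) := by
      refine c (fun d => p (Sum.inl d)) h1 ?_ fun d hd => h3 _ hd
      intro d hd
      by_cases e1 : d = A.root
      · rw [e1]
        have := h2 _ k1
        rwa [split_rot_true] at this
      by_cases e2 : d = g
      · rw [e2]
        have := h2 _ k0
        rwa [split_rot_false hg] at this
      · have := h2 _ hd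
        rwa [split_rot_inl e1 e2] at this
    rintro (d | _ | _)
    exacts [this d, k0, k1]

/-- One vertex and one edge are added while the faces stay the same, so the defect is unchanged. The
new vertex has degree `G.length + 2`, whence the bounds. -/
theorem split_good {r : ℕ} (hL : IsBd A.rot A.root (G ++ g :: R)) (hA : A.Pre) :
    (split A g).Good r ↔ A.Good r ∧ 1 ≤ G.length ∧ G.length + 2 ≤ r + 1 := by
  have hg := ne_root_of_isBd hL
  have hg' := ne_cil_of_isBd hA hL
  have hF := split_faceCard hA hg hg' fun _ => True
  rw [faceCard_true, faceCard_true] at hF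
  have hb : (split A g).blacks.card = A.blacks.card + 1 := by
    rw [split_blacks hL hA, Finset.card_cons, Finset.card_map]
  have he : (split A g).edges.card = A.edges.card + 1 := by
    rw [split_edges, Finset.card_cons, Finset.card_map]
  have hq : (orb (split A g).rot (Sum.inr true)).card = G.length + 2 := by
    rw [(isBd_split hL).2.card_orb]; simp
  constructor
  · intro h
    have := h.genus
    refine ⟨⟨hA, ?_, (split_conn hL).1 h.conn, by omega⟩, ?_⟩
    · intro C hC
      have := h.black (inlSet D Bool C) (by
        rw [split_blacks hL hA, Finset.mem_cons]
        exact Or.inr (Finset.mem_map_of_mem _ hC))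
      simpa [inlSet] using this
    · have := h.black (orb (split A g).rot (Sum.inr true)) (by
        rw [split_blacks hL hA, Finset.mem_cons]
        exact Or.inl rfl)
      omega
  · rintro ⟨gA, h1, h2⟩
    have := gA.genus
    refine ⟨split_pre hA hg hg', ?_, (split_conn hL).2 gA.conn, by omega⟩
    intro C hC
    rw [split_blacks hL hA, Finset.mem_cons] at hC
    rcases hC with rfl | hC
    · omega
    · obtain ⟨C, hC', rfl⟩ := Finset.mem_map.1 hC
      simpa [inlSet] using gA.black C hC'

end Split

end RMap

end Rooted

set_option linter.unusedSectionVars false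

section Rooted

open Classical

namespace RMap

variable {I D D' : Type}

/-! ### Isomorphic maps -/

/-- The map `M` with its half-edges renamed by `f`. -/
def map (f : D ≃ D') (M : RMap I D) : RMap I D' where
  rot := f.permCongr M.rot
  opp := f.permCongr M.opp
  cil := f M.cil
  color := M.color ∘ f.symm

section Map

variable {M : RMap I D} {f : D ≃ D'}

@[simp] theorem map_rot (d : D) : (map f M).rot (f d) = f (M.rot d) := by
  simp [map, Equiv.permCongr_apply]

@[simp] theorem map_opp (d : D) : (map f M).opp (f d) = f (M.opp d) := by
  simp [map, Equiv.permCongr_apply]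

@[simp] theorem map_cil : (map f M).cil = f M.cil := rfl

@[simp] theorem map_root : (map f M).root = f M.root := by
  rw [root, map_cil, map_opp]; rfl

@[simp] theorem map_color (d : D) : (map f M).color (f d) = M.color d := by simp [map]

theorem eq_map {M' : RMap I D'} (h1 : ∀ d, M'.rot (f d) = f (M.rot d))
    (h2 : ∀ d, M'.opp (f d) = f (M.opp d)) (h3 : M'.cil = f M.cil)
    (h4 : ∀ d, M'.color (f d) = M.color d) : M' = map f M := by
  cases M' with | mk a b c e
  have e1 : a = (map f M).rot := by
    ext x; obtain ⟨d, rfl⟩ := f.surjective x; rw [map_rot]; exact h1 d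
  have e2 : b = (map f M).opp := by
    ext x; obtain ⟨d, rfl⟩ := f.surjective x; rw [map_opp]; exact h2 d
  have e4 : e = (map f M).color := by
    funext x; obtain ⟨d, rfl⟩ := f.surjective x; rw [map_color]; exact h4 d
  subst e1 e2 e4
  simp only at h3
  rw [h3]
  rfl

theorem map_symm_map : map f.symm (map f M) = M := by
  refine (eq_map (f := f.symm) ?_ ?_ ?_ ?_).symm
  · intro d; obtain ⟨d, rfl⟩ := f.surjective d; simp
  · intro d; obtain ⟨d, rfl⟩ := f.surjective d; simp
  · simp
  · intro d; obtain ⟨d, rfl⟩ := f.surjective d; simp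

theorem map_map {D'' : Type} (g : D' ≃ D'') : map g (map f M) = map (f.trans g) M := by
  refine eq_map ?_ ?_ ?_ ?_
  · intro d; simp
  · intro d; simp
  · simp
  · intro d; simp

theorem Pre.map (h : M.Pre) (f : D ≃ D') : (map f M).Pre where
  opp_opp := by intro d; obtain ⟨d, rfl⟩ := f.surjective d; simp [h.opp_opp]
  opp_ne := by intro d; obtain ⟨d, rfl⟩ := f.surjective d; simp [h.opp_ne]
  rot_cil := by simp [h.rot_cil]
  color_face := by
    intro d; obtain ⟨d, rfl⟩ := f.surjective d
    have := h.color_face d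
    rw [Equiv.Perm.mul_apply] at this ⊢
    simp [this]

theorem sameCycle_map {π : Equiv.Perm D} {π' : Equiv.Perm D'} (h : ∀ d, π' (f d) = f (π d))
    (x y : D) : π'.SameCycle (f x) (f y) ↔ π.SameCycle x y := by
  have : π' = f.permCongr π := by
    ext z; obtain ⟨d, rfl⟩ := f.surjective z; simp [h, Equiv.permCongr_apply]
  subst this
  have hz : ∀ (n : ℕ) x, ((f.permCongr π) ^ n) (f x) = f ((π ^ n) x) := by
    intro n
    induction n with
    | zero => simp
    | succ n ih => intro x; rw [pow_succ, pow_succ, Equiv.Perm.mul_apply, Equiv.Perm.mul_apply,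
        Equiv.permCongr_apply, Equiv.symm_apply_apply, ih]
  constructor
  · rintro ⟨n | n, hn⟩
    · refine ⟨n, ?_⟩
      simp only [Int.ofNat_eq_natCast, zpow_natCast] at hn ⊢
      rw [hz] at hn; exact f.injective hn
    · refine ⟨Int.negSucc n, ?_⟩
      rw [zpow_negSucc] at hn ⊢
      rw [Equiv.Perm.inv_eq_iff_eq, hz] at hn
      rw [Equiv.Perm.inv_eq_iff_eq]
      exact f.injective hn
  · rintro ⟨n | n, hn⟩
    · refine ⟨n, ?_⟩
      simp only [Int.ofNat_eq_natCast, zpow_natCast] at hn ⊢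
      rw [hz, hn]
    · refine ⟨Int.negSucc n, ?_⟩
      rw [zpow_negSucc] at hn ⊢
      rw [Equiv.Perm.inv_eq_iff_eq] at hn
      rw [Equiv.Perm.inv_eq_iff_eq, hz, hn]

theorem map_black (d : D) : (map f M).Black (f d) ↔ M.Black d := by
  rw [Black, Black, map_root, sameCycle_map map_rot, map_cil, f.injective.ne_iff]

theorem isBd_map {π : Equiv.Perm D} {π' : Equiv.Perm D'} (h : ∀ d, π' (f d) = f (π d)) {x : D}
    {L : List D} (hL : IsBd π x L) : IsBd π' (f x) (L.map f) := by
  constructor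
  · have := (List.nodup_map_iff f.injective).2 hL.nodup
    simpa using this
  · have := seg_map (f := f) hL.seg (h x) fun a _ => h a
    simpa using this

theorem map_conn : (map f M).Conn ↔ M.Conn := by
  constructor
  · intro h p h1 h2 h3 d
    have := h (fun d => p (f.symm d)) (by simpa using h1) (by
      intro d; obtain ⟨d, rfl⟩ := f.surjective d; simpa using h2 d) (by
      intro d; obtain ⟨d, rfl⟩ := f.surjective d; simpa using h3 d) (f d)
    simpa using this
  · intro h p h1 h2 h3 d
    obtain ⟨d, rfl⟩ := f.surjective d
    refine h (fun d => p (f d)) h1 ?_ ?_ d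
    · intro d hd; simpa using h2 _ hd
    · intro d hd; simpa using h3 _ hd

/-- The faces of `map f M`. -/
def mapFaces (f : D ≃ D') (M : RMap I D) :
    Cells (M.rot * M.opp) ≃ Cells ((map f M).rot * (map f M).opp) :=
  Quotient.congr f fun a b =>
    (sameCycle_map (π := M.rot * M.opp) (π' := (map f M).rot * (map f M).opp)
      (fun d => by simp) a b).symm

theorem map_faceCard [Finite D] (h : M.Pre) (P : I → Prop) :
    (map f M).faceCard P = M.faceCard P := by
  have := Finite.of_equiv D f
  symm
  refine Nat.card_congr ((mapFaces f M).subtypeEquiv fun F => ?_)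
  induction F using Quotient.inductionOn with | _ d
  rw [show mapFaces f M ⟦d⟧ = ⟦f d⟧ from rfl, h.faceColor_mk, (h.map f).faceColor_mk, map_color]

variable [Fintype D] [Fintype D']

theorem map_blacks : (map f M).blacks = M.blacks.map (Finset.mapEmbedding f.toEmbedding).toEmbedding := by
  have ho : ∀ d, orb (map f M).rot (f d) = (orb M.rot d).map f.toEmbedding := fun d =>
    orb_map f.toEmbedding (S := fun _ => True) (fun _ _ => trivial) (fun x _ => map_rot x) trivial
  ext C
  rw [mem_blacks, Finset.mem_map]
  constructor
  · rintro ⟨d, hd, rfl⟩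
    obtain ⟨d, rfl⟩ := f.surjective d
    exact ⟨_, mem_blacks.2 ⟨d, map_black d |>.1 hd, rfl⟩, (ho d).symm⟩
  · rintro ⟨C, hC, rfl⟩
    obtain ⟨d, hd, rfl⟩ := mem_blacks.1 hC
    exact ⟨f d, (map_black d).2 hd, ho d⟩

theorem map_edges : (map f M).edges = M.edges.map f.toEmbedding.sym2Map := by
  ext e
  rw [mem_edges, Finset.mem_map]
  constructor
  · rintro ⟨d, hd, rfl⟩
    obtain ⟨d, rfl⟩ := f.surjective d
    refine ⟨_, mem_edges.2 ⟨d, ?_, rfl⟩, ?_⟩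
    · simpa using hd
    · rw [map_opp]; rfl
  · rintro ⟨e, he, rfl⟩
    obtain ⟨d, hd, rfl⟩ := mem_edges.1 he
    exact ⟨f d, by simpa using hd, by rw [map_opp]; rfl⟩

theorem map_good {r : ℕ} (h : M.Good r) (f : D ≃ D') : (map f M).Good r where
  toPre := h.toPre.map f
  black := by
    intro C hC
    rw [map_blacks, Finset.mem_map] at hC
    obtain ⟨C, hC, rfl⟩ := hC
    simpa using h.black C hC
  conn := map_conn.2 h.conn
  genus := by
    have := map_faceCard (f := f) h.toPre fun _ => True
    rw [faceCard_true, faceCard_true] at this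
    rw [map_blacks, map_edges, Finset.card_map, Finset.card_map, this, h.genus]

theorem map_good_iff {r : ℕ} : (map f M).Good r ↔ M.Good r :=
  ⟨fun h => by have := map_good h f.symm; rwa [map_symm_map] at this, fun h => map_good h f⟩

theorem map_wt {K : Type*} [CommMonoid K] (fV : Multiset I → K) (fE : Sym2 I → K) :
    (map f M).wt fV fE = M.wt fV fE := by
  rw [wt, wt, map_blacks, map_edges, Finset.prod_map, Finset.prod_map]
  congr 1
  · refine Finset.prod_congr rfl fun e _ => ?_
    induction e with | _ a b
    change fE s((map f M).color (f a), (map f M).color (f b)) = fE s(M.color a, M.color b)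
    rw [map_color, map_color]
  · refine Finset.prod_congr rfl fun C _ => ?_
    change fV ((C.map f.toEmbedding).val.map _) = _
    rw [Finset.map_val, Multiset.map_map]
    congr 1
    exact Multiset.map_congr rfl fun d _ => map_color d

end Map

/-! ### Decomposition of a map at its first edge -/

theorem not_sameCycle_of_closed [Finite D] {π : Equiv.Perm D} {S : D → Prop}
    (hS : ∀ x, S x → S (π x)) {x y : D} (hx : S x) (hy : ¬ S y) : ¬ π.SameCycle x y := by
  intro h
  obtain ⟨n, rfl⟩ := (sameCycle_iff_pow _ _ _).1 h
  apply hy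
  clear hy h
  induction n with
  | zero => exact hx
  | succ n ih => rw [pow_succ', Equiv.Perm.mul_apply]; exact hS _ ih

section First

variable {M : RMap I D}

/-- The first half-edge at the root vertex. -/
def first (M : RMap I D) : D := M.rot M.root

theorem Pre.first_ne_cil (h : M.Pre) : M.first ≠ M.cil :=
  fun he => h.root_ne_cil (h.rot_eq_cil he)

theorem Pre.opp_first_ne_root (h : M.Pre) : M.opp M.first ≠ M.root :=
  fun he => h.first_ne_cil (M.opp.injective he)

theorem Pre.opp_first_ne_cil (h : M.Pre) (hf : M.first ≠ M.root) : M.opp M.first ≠ M.cil :=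
  fun he => hf (h.opp_eq_iff.1 he)

/-- The first edge joins distinct vertices and can be contracted. The half-edge `g` is the
predecessor of `q` around its vertex; `hfix` ensures that it differs from `q`. -/
theorem exists_split [Fintype D] (h : M.Pre) (hf : M.first ≠ M.root)
    (hb : M.Black (M.opp M.first)) (hfix : M.rot (M.opp M.first) ≠ M.opp M.first) :
    ∃ (D₀ : Type) (_ : Fintype D₀) (A : RMap I D₀) (g : D₀) (f : D₀ ⊕ Bool ≃ D) (G R : List D₀),
      A.Pre ∧ IsBd A.rot A.root (G ++ g :: R) ∧ M = map f (split A g) := by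
  set p := M.first with hp
  set q := M.opp p with hq
  set ρ := M.root with hρ
  obtain ⟨L, hL⟩ := exists_isBd M.rot q
  obtain ⟨G, g, rfl⟩ : ∃ G g, L = G ++ [g] := by
    rcases List.eq_nil_or_concat L with rfl | ⟨G, g, hG⟩
    · exact absurd hL.seg.1 hfix
    · exact ⟨G, g, by simpa using hG⟩
  have hseg : Seg M.rot q (G ++ [g]) := (seg_append.1 (by simpa using hL.seg)).1
  have hgq : M.rot g = q := by
    have := (seg_append (L := G) (L' := [q])).1 (by simpa using hL.seg)
    exact this.2.1
  have hnd : (G ++ [g] ++ [q]).Nodup := hL.nodup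
  have hblack : ∀ a ∈ G ++ [g], M.Black a := by
    intro a ha
    have hs : M.rot.SameCycle q a := (hL.mem_iff a).1 (List.mem_append_left _ ha)
    refine ⟨?_, fun hs' => hb.2 (hs'.trans hs.symm)⟩
    rintro rfl
    exact h.not_sameCycle_cil hb.1 hs
  have hpw : M.rot.SameCycle ρ p := Equiv.Perm.sameCycle_apply_right.2 (Equiv.Perm.SameCycle.refl _ _)
  have hρp : ρ ≠ p := hf.symm
  have hqp : q ≠ p := h.opp_ne p
  have hρq : ρ ≠ q := h.opp_first_ne_root.symm
  have hbg : M.Black g := hblack g (by simp)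
  have hgρ : g ≠ ρ := by rintro rfl; exact not_black_root hbg
  have hgp : g ≠ p := by rintro rfl; exact hbg.2 hpw
  have hgq' : g ≠ q := by
    rintro rfl
    rw [List.nodup_append'] at hnd
    exact hnd.2.2 (by simp : q ∈ G ++ [q]) (by simp)
  have hqq : M.opp q = p := h.opp_opp p
  -- The permutation `σ` joins the two cycles and bypasses the edge: `ρ` goes to `rot q`, `g` goes
  -- to `rot p`, and `p`, `q` are fixed, so it restricts to the other half-edges.
  set σ : Equiv.Perm D := M.rot * Equiv.swap p q * Equiv.swap g q * Equiv.swap ρ p with hσ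
  have σp : σ p = p := by
    simp only [hσ, Equiv.Perm.mul_apply, Equiv.swap_apply_right]
    rw [Equiv.swap_apply_of_ne_of_ne hgρ.symm hρq, Equiv.swap_apply_of_ne_of_ne hρp hρq]
    rfl
  have σq : σ q = q := by
    simp only [hσ, Equiv.Perm.mul_apply]
    rw [Equiv.swap_apply_of_ne_of_ne hρq.symm hqp, Equiv.swap_apply_right,
      Equiv.swap_apply_of_ne_of_ne hgp hgq', hgq]
  have σρ : σ ρ = M.rot q := by
    simp only [hσ, Equiv.Perm.mul_apply, Equiv.swap_apply_left]
    rw [Equiv.swap_apply_of_ne_of_ne hgp.symm hqp.symm, Equiv.swap_apply_left]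
  have σg : σ g = M.rot p := by
    simp only [hσ, Equiv.Perm.mul_apply]
    rw [Equiv.swap_apply_of_ne_of_ne hgρ hgp, Equiv.swap_apply_left, Equiv.swap_apply_right]
  have σd : ∀ d, d ≠ ρ → d ≠ g → d ≠ p → d ≠ q → σ d = M.rot d := by
    intro d h1 h2 h3 h4
    simp only [hσ, Equiv.Perm.mul_apply]
    rw [Equiv.swap_apply_of_ne_of_ne h1 h3, Equiv.swap_apply_of_ne_of_ne h2 h4,
      Equiv.swap_apply_of_ne_of_ne h3 h4]
  let D₀ := {d : D // d ≠ p ∧ d ≠ q}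
  have hclosed : ∀ d, (σ d ≠ p ∧ σ d ≠ q) ↔ (d ≠ p ∧ d ≠ q) := by
    intro d
    have e1 : σ d ≠ p ↔ d ≠ p := by rw [← σp, σ.injective.ne_iff, σp]
    have e2 : σ d ≠ q ↔ d ≠ q := by rw [← σq, σ.injective.ne_iff, σq]
    rw [e1, e2]
  have hclosed' : ∀ d, (M.opp d ≠ p ∧ M.opp d ≠ q) ↔ (d ≠ p ∧ d ≠ q) := by
    intro d
    have e1 : M.opp d ≠ p ↔ d ≠ q := by rw [← hqq, M.opp.injective.ne_iff]
    have e2 : M.opp d ≠ q ↔ d ≠ p := by rw [hq, M.opp.injective.ne_iff]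
    rw [e1, e2, and_comm]
  let A : RMap I D₀ :=
    { rot := σ.subtypePerm hclosed
      opp := M.opp.subtypePerm hclosed'
      cil := ⟨M.cil, h.first_ne_cil.symm, (h.opp_first_ne_cil hf).symm⟩
      color := fun d => M.color d.1 }
  have Aroot : A.root.1 = ρ := rfl
  let g₀ : D₀ := ⟨g, hgp, hgq'⟩
  let f : D₀ ⊕ Bool ≃ D := Equiv.ofBijective
    (Sum.elim Subtype.val fun b => bif b then q else p) (by
    constructor
    · rintro (⟨d, h1, h2⟩ | _ | _) (⟨d', h1', h2'⟩ | _ | _) he <;>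
        simp only [Sum.elim_inl, Sum.elim_inr, cond_true, cond_false] at he
      · subst he; rfl
      · exact absurd he h1
      · exact absurd he h2
      · exact absurd he.symm h1'
      · rfl
      · exact absurd he.symm hqp
      · exact absurd he.symm h2'
      · exact absurd he hqp
      · rfl
    · intro d
      by_cases h1 : d = p
      · exact ⟨Sum.inr false, h1.symm⟩
      by_cases h2 : d = q
      · exact ⟨Sum.inr true, h2.symm⟩
      · exact ⟨Sum.inl ⟨d, h1, h2⟩, rfl⟩)
  have fl : ∀ d : D₀, f (Sum.inl d) = d.1 := fun _ => rfl
  have ff : f (Sum.inr false) = p := rfl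
  have ft : f (Sum.inr true) = q := rfl
  have Arot : ∀ d : D₀, (A.rot d).1 = σ d.1 := fun _ => rfl
  have hg₀ρ : g₀ ≠ A.root := fun he => hgρ (congrArg Subtype.val he)
  have hgc : g ≠ M.cil := hbg.1
  have colorq : M.color (M.rot p) = M.color q := by
    have := h.color_face q
    rwa [Equiv.Perm.mul_apply, hqq] at this
  have colorp : M.color (M.rot q) = M.color p := h.color_face p
  have colorc : M.color p = M.color M.cil := h.color_rot_root
  have hA : A.Pre :=
    { opp_opp := fun d => Subtype.ext (h.opp_opp d.1)
      opp_ne := fun d he => h.opp_ne d.1 (congrArg Subtype.val he)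
      rot_cil := by
        refine Subtype.ext ?_
        change σ M.cil = M.cil
        rw [σd _ h.root_ne_cil.symm hgc.symm h.first_ne_cil.symm
          (h.opp_first_ne_cil hf).symm, h.rot_cil]
      color_face := by
        rintro ⟨d, h1, h2⟩
        change M.color (σ (M.opp d)) = M.color d
        by_cases e1 : M.opp d = ρ
        · rw [e1, σρ, colorp, colorc, M.opp.injective e1]
        by_cases e2 : M.opp d = g
        · rw [e2, σg, colorq, ← hgq, ← e2]
          exact h.color_face d
        · rw [σd _ e1 e2]
          · exact h.color_face d
          · exact ((hclosed' d).2 ⟨h1, h2⟩).1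
          · exact ((hclosed' d).2 ⟨h1, h2⟩).2 }
  -- From `ρ`, the iterates of `σ` follow the former vertex of `q` up to `g`.
  have hcyc : A.rot.SameCycle A.root g₀ := by
    have hs : Seg σ ρ (G ++ [g]) := by
      have := seg_map (f := id) (π' := σ) (x' := ρ) hseg σρ (by
        intro a ha
        have hba := hblack a (by simp [ha])
        refine σd a ?_ ?_ ?_ ?_
        · rintro rfl; exact not_black_root hba
        · rintro rfl
          rw [List.append_assoc, List.nodup_append'] at hnd
          exact hnd.2.2 ha (by simp)
        · rintro rfl; exact hba.2 hpw
        · rintro rfl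
          rw [List.append_assoc, List.nodup_append'] at hnd
          exact hnd.2.2 ha (by simp))
      simpa using this
    obtain ⟨n, hn⟩ := exists_pow_of_seg hs g (by simp)
    refine (sameCycle_iff_pow _ _ _).2 ⟨n, Subtype.ext ?_⟩
    change ((σ.subtypePerm hclosed ^ n) A.root).1 = g
    rw [Equiv.Perm.subtypePerm_pow]
    exact hn
  obtain ⟨L', hL'⟩ := exists_isBd A.rot A.root
  have hmem : g₀ ∈ L' := by
    have := (hL'.mem_iff g₀).2 hcyc
    rw [List.mem_append, List.mem_singleton] at this
    exact this.resolve_right hg₀ρ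
  obtain ⟨G', R', rfl⟩ := List.append_of_mem hmem
  refine ⟨D₀, inferInstance, A, g₀, f, G', R', hA, hL', eq_map ?_ ?_ ?_ ?_⟩
  · rintro (d | _ | _)
    · by_cases e1 : d = A.root
      · rw [e1, split_rot_root hg₀ρ]; rfl
      by_cases e2 : d = g₀
      · rw [e2, split_rot_self]; exact hgq
      · rw [split_rot_inl e1 e2, fl, fl, Arot, σd]
        · exact fun e => e1 (Subtype.ext e)
        · exact fun e => e2 (Subtype.ext e)
        · exact d.2.1
        · exact d.2.2
    · rw [split_rot_false hg₀ρ, fl, Arot, ff]; exact σg.symm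
    · rw [split_rot_true, fl, Arot, ft]; exact σρ.symm
  · rintro (d | _ | _)
    · rfl
    · rw [split_opp_false]; rfl
    · rw [split_opp_true]; exact hqq
  · rfl
  · rintro (d | _ | _)
    · rfl
    · exact colorc
    · rw [split_color_true]
      change M.color q = M.color (σ g)
      rw [σg, colorq]

/-- The first edge is a loop at the root vertex. Cutting the root vertex along it separates inside
from outside by planarity; the component of the cilium is the outer part. -/
theorem exists_loop [Fintype D] {r : ℕ} (h : M.Good r) (hf : M.first ≠ M.root)
    (hb : ¬ M.Black (M.opp M.first)) :
    ∃ (D₁ D₂ : Type) (_ : Fintype D₁) (_ : Fintype D₂) (A : RMap I D₁) (B : RMap I D₂)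
      (f : D₁ ⊕ D₂ ≃ D), A.Pre ∧ B.Pre ∧ M = map f (loop A B) := by
  set p := M.first with hp
  set q := M.opp p with hq
  set ρ := M.root with hρ
  have hqc : q ≠ M.cil := h.opp_first_ne_cil hf
  have hpc : p ≠ M.cil := h.first_ne_cil
  have hρc : ρ ≠ M.cil := h.root_ne_cil
  have hqw : M.rot.SameCycle ρ q := by
    by_contra hc; exact hb ⟨hqc, hc⟩
  have hρp : ρ ≠ p := hf.symm
  have hqp : q ≠ p := h.opp_ne p
  have hρq : ρ ≠ q := h.opp_first_ne_root.symm
  have hqq : M.opp q = p := h.opp_opp p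
  have hrp : M.rot ρ = p := rfl
  have hoc : M.opp M.cil = ρ := rfl
  have hoρ : M.opp ρ = M.cil := h.opp_root
  have inj : ∀ {a b : D}, M.rot a = M.rot b → a = b := fun h => M.rot.injective h
  -- The root vertex is cut into three cycles: `p` alone, the half-edges from `rot p` to `q`, and
  -- those from `rot q` to `ρ`. The half-edge `p` becomes the cilium of the inner map.
  set σ : Equiv.Perm D := M.rot * (Equiv.swap p q * Equiv.swap ρ p) with hσ
  have σρ : σ ρ = M.rot q := by simp [hσ]
  have σp : σ p = p := by
    simp only [hσ, Equiv.Perm.mul_apply, Equiv.swap_apply_right]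
    rw [Equiv.swap_apply_of_ne_of_ne hρp hρq, hrp]
  have σq : σ q = M.rot p := by
    simp only [hσ, Equiv.Perm.mul_apply]
    rw [Equiv.swap_apply_of_ne_of_ne hρq.symm hqp, Equiv.swap_apply_right]
  have σd : ∀ d, d ≠ ρ → d ≠ p → d ≠ q → σ d = M.rot d := by
    intro d h1 h3 h4
    simp only [hσ, Equiv.Perm.mul_apply]
    rw [Equiv.swap_apply_of_ne_of_ne h1 h3, Equiv.swap_apply_of_ne_of_ne h3 h4]
  -- the half-edges in the component of the cilium
  let s : D → D → Prop := fun a b => b = σ a ∨ b = M.opp a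
  let C : D → Prop := fun d => Quot.mk s d = Quot.mk s M.cil
  have Cσ : ∀ d, C (σ d) ↔ C d := fun d => by
    change Quot.mk s _ = _ ↔ Quot.mk s _ = _
    rw [← Quot.sound (r := s) (a := d) (b := σ d) (Or.inl rfl)]
  have Co : ∀ d, C (M.opp d) ↔ C d := fun d => by
    change Quot.mk s _ = _ ↔ Quot.mk s _ = _
    rw [← Quot.sound (r := s) (a := d) (b := M.opp d) (Or.inr rfl)]
  have Cc : C M.cil := rfl
  have Cρ : C ρ := (Co M.cil).2 Cc
  -- The Jordan curve argument: if `p` were still connected to the cilium, the cut map would be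
  -- connected, with two more vertices, as many edges and no fewer faces, against Euler's
  -- inequality.
  have hCp : ¬ C p := by
    intro Cp
    have Cq : C q := (Co p).2 Cp
    have hall : ∀ d, C d := by
      refine h.conn C Cc ?_ fun d => (Co d).2
      intro d hd
      by_cases e1 : d = ρ
      · rw [e1]; exact Cp
      by_cases e2 : d = p
      · rw [e2, ← σq]; exact (Cσ _).2 Cq
      by_cases e3 : d = q
      · rw [e3, ← σρ]; exact (Cσ _).2 Cρ
      · rw [← σd d e1 e2 e3]; exact (Cσ _).2 hd
    have hone : Nat.card (Quot s) = 1 := by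
      rw [Nat.card_eq_one_iff_exists]
      exact ⟨Quot.mk _ M.cil, by rintro ⟨d⟩; exact hall d⟩
    have heul := _root_.euler_le σ M.opp h.opp_opp
    rw [show (Quot fun a b => b = σ a ∨ b = M.opp a) = Quot s from rfl, hone, h.card_cells_opp,
      h.card_eq] at heul
    -- the number of vertices has grown by two
    have hv1 := card_cells_mul_swap σ ρ p (fun hs => hρp (by
      obtain ⟨n, hn⟩ := (sameCycle_iff_pow _ _ _).1 hs.symm
      exact hn.symm.trans (Equiv.Perm.pow_apply_eq_self_of_apply_eq_self σp n)))
    have e1 : σ * Equiv.swap ρ p = M.rot * Equiv.swap p q := by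
      rw [hσ, mul_assoc, mul_assoc, Equiv.swap_mul_self, mul_one]
    obtain ⟨L, hL⟩ := exists_isBd M.rot ρ
    have hqL : q ∈ L := by
      have := (hL.mem_iff q).2 hqw
      rw [List.mem_append, List.mem_singleton] at this
      exact this.resolve_right hρq.symm
    obtain ⟨L1, L2, hL12⟩ := List.append_of_mem hqL
    have hnd := hL.nodup
    have hsg := hL.seg
    rw [hL12, List.append_assoc, List.cons_append] at hnd hsg
    rw [seg_append] at hsg
    have hq2 : q ∉ L2 ++ [ρ] := by
      rw [List.nodup_append', List.nodup_cons] at hnd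
      exact hnd.2.1.1
    have hp2 : p ∉ L2 := by
      obtain ⟨z, L1', hz⟩ : ∃ z L1', L1 = z :: L1' := by
        rcases L1 with _ | ⟨z, L1'⟩
        · exact absurd (hrp.symm.trans hsg.1.1) hqp.symm
        · exact ⟨z, L1', rfl⟩
      subst hz
      have hzp : z = p := (hsg.1.1).symm.trans hrp
      subst hzp
      rw [List.nodup_append'] at hnd
      intro hp2
      exact hnd.2.2 (by simp : p ∈ p :: L1') (by simp [hp2])
    have hv2 := card_cells_mul_swap (σ * Equiv.swap ρ p) p q (by
      rw [e1]
      refine not_sameCycle_of_closed (S := fun x => x = p ∨ x ∈ L2 ++ [ρ]) ?_ (Or.inl rfl)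
        (not_or.2 ⟨hqp, hq2⟩)
      intro x hx
      have hmem := seg_apply_mem hsg.2
      by_cases hxp : x = p
      · right
        rw [hxp, Equiv.Perm.mul_apply, Equiv.swap_apply_left]
        exact hmem q (by simp)
      · have hx2 := hx.resolve_left hxp
        have hxq : x ≠ q := by rintro rfl; exact hq2 hx2
        rw [Equiv.Perm.mul_apply, Equiv.swap_apply_of_ne_of_ne hxp hxq]
        rw [List.mem_append, List.mem_singleton] at hx2
        rcases hx2 with hx2 | rfl
        · exact Or.inr (hmem x (by simp [hx2]))
        · exact Or.inl hrp)
    rw [e1, mul_assoc, Equiv.swap_mul_self, mul_one, ← e1] at hv2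
    rw [h.card_cells_rot] at hv2
    -- the number of faces has not decreased
    have hF : Nat.card (Cells (M.rot * M.opp)) ≤ Nat.card (Cells (σ * M.opp)) := by
      have fc : ∀ d, (⟦M.rot (M.opp d)⟧ : Cells (M.rot * M.opp)) = ⟦d⟧ := face_rot M
      -- After the cut, `p` follows `q` in its face, so it is sent to the old face of `q`. Elsewhere
      -- the map is the identity on half-edges.
      refine Nat.card_le_card_of_surjective
        (cellLift (fun d => (⟦if d = p then q else d⟧ : Cells (M.rot * M.opp))) ?_) ?_
      · intro d
        rw [Equiv.Perm.mul_apply]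
        by_cases h1 : d = q
        · rw [h1, hqq, σp, if_pos rfl, if_neg hqp]
        by_cases h2 : d = p
        · rw [h2, ← hq, σq, if_pos rfl, if_neg, ← fc q, hqq]
          intro h3; exact hρp (inj (hrp.trans h3.symm))
        by_cases h3 : d = M.cil
        · rw [h3, hoc, σρ, if_neg, if_neg hpc.symm, ← fc M.cil, hoc, hrp, ← fc p]
          intro h4; exact hρq (inj (hrp.trans h4.symm))
        · have o1 : M.opp d ≠ ρ := fun h4 => h3 (M.opp.injective h4)
          rw [σd _ o1 (fun h4 => h1 (h.opp_eq_iff.1 h4)) (fun h4 => h2 (M.opp.injective h4)),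
            if_neg, if_neg h2, fc]
          intro h4; exact o1 (inj (h4.trans hrp.symm))
      · intro F
        induction F using Quotient.inductionOn with | _ d
        by_cases h1 : d = p
        · refine ⟨⟦M.cil⟧, ?_⟩
          change ⟦if M.cil = p then q else M.cil⟧ = _
          rw [if_neg hpc.symm, h1, ← fc M.cil, hoc, hrp]
        · refine ⟨⟦d⟧, ?_⟩
          change ⟦if d = p then q else d⟧ = _
          rw [if_neg h1]
    have := h.genus
    omega
  have hCq : ¬ C q := fun hc => hCp ((Co p).1 hc)
  let D₁ := {d : D // ¬ C d}
  let D₂ := {d : D // C d}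
  let A : RMap I D₁ :=
    { rot := σ.subtypePerm fun d => not_congr (Cσ d)
      opp := M.opp.subtypePerm fun d => not_congr (Co d)
      cil := ⟨p, hCp⟩
      color := fun d => if d.1 = p then M.color q else M.color d.1 }
  let B : RMap I D₂ :=
    { rot := σ.subtypePerm Cσ
      opp := M.opp.subtypePerm Co
      cil := ⟨M.cil, Cc⟩
      color := fun d => M.color d.1 }
  have colorq : M.color (M.rot p) = M.color q := by
    have := h.color_face q
    rwa [Equiv.Perm.mul_apply, hqq] at this
  have colorp : M.color (M.rot q) = M.color p := h.color_face p
  have colorc : M.color p = M.color M.cil := h.color_rot_root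
  have hrpp : M.rot p ≠ p := fun h3 => hρp (inj (hrp.trans h3.symm))
  have hA : A.Pre :=
    { opp_opp := fun d => Subtype.ext (h.opp_opp d.1)
      opp_ne := fun d he => h.opp_ne d.1 (congrArg Subtype.val he)
      rot_cil := Subtype.ext σp
      color_face := by
        rintro ⟨d, hd⟩
        change (if σ (M.opp d) = p then M.color q else M.color (σ (M.opp d))) =
          if d = p then M.color q else M.color d
        by_cases e1 : d = p
        · rw [e1, ← hq, σq, if_neg hrpp, if_pos rfl, colorq]
        by_cases e2 : d = q
        · rw [e2, hqq, σp, if_pos rfl, if_neg hqp]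
        · have o1 : M.opp d ≠ ρ := fun h4 => hd ((Co d).1 (h4 ▸ Cρ))
          rw [σd _ o1 (fun h4 => e2 (h.opp_eq_iff.1 h4)) (fun h4 => e1 (M.opp.injective h4)),
            if_neg e1, if_neg]
          · exact h.color_face d
          · intro h4; exact o1 (inj (h4.trans hrp.symm)) }
  have hB : B.Pre :=
    { opp_opp := fun d => Subtype.ext (h.opp_opp d.1)
      opp_ne := fun d he => h.opp_ne d.1 (congrArg Subtype.val he)
      rot_cil := by
        refine Subtype.ext ?_
        change σ M.cil = M.cil
        rw [σd _ hρc.symm hpc.symm hqc.symm, h.rot_cil]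
      color_face := by
        rintro ⟨d, hd⟩
        change M.color (σ (M.opp d)) = M.color d
        by_cases e1 : d = M.cil
        · rw [e1, hoc, σρ, colorp, colorc]
        · have o1 : M.opp d ≠ ρ := fun h4 => e1 (M.opp.injective h4)
          rw [σd _ o1]
          · exact h.color_face d
          · intro h4; exact hCp (h4 ▸ (Co d).2 hd)
          · intro h4; exact hCq (h4 ▸ (Co d).2 hd) }
  let f : D₁ ⊕ D₂ ≃ D := (Equiv.sumComm _ _).trans (Equiv.sumCompl C)
  have fl : ∀ d : D₁, f (Sum.inl d) = d.1 := fun _ => rfl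
  have fr : ∀ d : D₂, f (Sum.inr d) = d.1 := fun _ => rfl
  refine ⟨D₁, D₂, inferInstance, inferInstance, A, B, f, hA, hB, eq_map ?_ ?_ ?_ ?_⟩
  · rintro (d | d)
    · by_cases e1 : d = A.cil
      · rw [e1, loop_rot_cil hA]; exact σq.symm
      by_cases e2 : d = A.root
      · rw [e2, loop_rot_root]; exact σρ.symm
      · rw [loop_rot_inl e1 e2, fl, fl]
        refine (σd _ ?_ ?_ ?_).symm
        · intro e; exact d.2 (e ▸ Cρ)
        · exact fun e => e1 (Subtype.ext e)
        · exact fun e => e2 (Subtype.ext e)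
    · by_cases e1 : d = B.root
      · rw [e1, loop_rot_inr_root hA]; rfl
      · rw [loop_rot_inr e1, fr, fr]
        refine (σd _ ?_ ?_ ?_).symm
        · exact fun e => e1 (Subtype.ext e)
        · intro e; exact hCp (e ▸ d.2)
        · intro e; exact hCq (e ▸ d.2)
  · rintro (d | d) <;> rfl
  · rfl
  · rintro (d | d)
    · by_cases e1 : d = A.cil
      · rw [e1, loop_color_cil]; exact colorc
      · rw [loop_color_inl e1]
        exact (if_neg fun e => e1 (Subtype.ext e)).symm
    · rfl

end First

end RMap

end Rooted

set_option linter.unusedSectionVars false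

/-! ### Codes of planar rooted maps -/

section Rooted

open Classical

/-- Codes for planar rooted maps: a map is a single root vertex, or its first edge is a
loop that encloses a map, or its first edge can be contracted. -/
inductive Code (I : Type) : Type
  | nil (c : I) : Code I
  | loop (a b : Code I) : Code I
  | contract (k : ℕ) (m : Code I) : Code I

namespace Code

variable {I : Type}

/-- The decoration of the face of the cilium. -/
def base : Code I → I
  | nil c => c
  | loop _ b => b.base
  | contract _ m => m.base

/-- The decorations of the corners of the root vertex. -/
def path : Code I → List I
  | nil c => [c]
  -- The extra corner precedes the loop, on its outer side.
  | loop a b => b.base :: (a.path ++ b.path)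
  | contract k m => m.base :: m.path.drop (k + 1)

/-- The black vertices have degree between `3` and `r + 1`. -/
def Valid (r : ℕ) : Code I → Prop
  | nil _ => True
  | loop a b => a.Valid r ∧ b.Valid r
  | contract k m => m.Valid r ∧ 1 ≤ k ∧ k + 2 ≤ r + 1 ∧ k + 2 ≤ m.path.length

/-- The number of faces whose decoration satisfies `P`. -/
noncomputable def leaves (P : I → Prop) : Code I → ℕ
  | nil c => if P c then 1 else 0
  | loop a b => a.leaves P + b.leaves P
  | contract _ m => m.leaves P

def size : Code I → ℕ
  | nil _ => 0
  | loop a b => a.size + b.size + 1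
  | contract _ m => m.size + 1

def wt {K : Type*} [CommMonoid K] (fV : Multiset I → K) (fE : Sym2 I → K) : Code I → K
  | nil _ => 1
  | loop a b => fE s(b.base, a.base) * a.wt fV fE * b.wt fV fE
  -- The split-off vertex takes the first `k + 1` half-edges of the root vertex, and the new edge
  -- adds a corner with decoration number `k + 1`; its degree is `k + 2`. The default `m.base` is
  -- not reached for valid codes.
  | contract k m => fE s(m.base, m.path.getD (k + 1) m.base) *
      fV (m.path.take (k + 2) : List I) * m.wt fV fE

theorem path_eq_cons (c : Code I) : ∃ p, c.path = c.base :: p := by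
  cases c <;> exact ⟨_, rfl⟩

theorem length_path_pos (c : Code I) : 0 < c.path.length := by
  obtain ⟨p, hp⟩ := c.path_eq_cons
  simp [hp]

theorem leaves_pos (c : Code I) : 0 < c.leaves fun _ => True := by
  induction c with
  | nil => simp [leaves]
  | loop a b ha hb => simp only [leaves]; omega
  | contract k m hm => exact hm

theorem leaves_base_pos (c : Code I) {P : I → Prop} (h : P c.base) : 0 < c.leaves P := by
  induction c with
  | nil c => rw [leaves, if_pos (show P c from h)]; exact Nat.one_pos
  | loop a b ha hb => have := hb h; simp only [leaves]; omega
  | contract k m hm => exact hm h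

variable {r : ℕ}

/-- A contraction shortens the path by `k ≥ 1`, because black vertices have degree at least three.
This pays for its edge, and so the number of faces bounds the size. -/
theorem size_le (c : Code I) (h : c.Valid r) :
    c.size + c.path.length + 2 ≤ 3 * c.leaves fun _ => True := by
  induction c with
  | nil => simp [leaves, path, size]
  | loop a b ha hb =>
    have := ha h.1
    have := hb h.2
    simp only [leaves, path, size, List.length_cons, List.length_append]
    omega
  | contract k m hm =>
    have := hm h.1
    obtain ⟨-, h1, -, h2⟩ := h
    simp only [leaves, path, size, List.length_cons, List.length_drop]
    omega

theorem finite_size_le [Finite I] (r n : ℕ) : {c : Code I | c.Valid r ∧ c.size ≤ n}.Finite := by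
  induction n with
  | zero =>
    refine (Set.finite_range (nil (I := I))).subset ?_
    rintro c ⟨-, h⟩
    cases c with
    | nil c => exact ⟨c, rfl⟩
    | loop => simp [size] at h
    | contract => simp [size] at h
  | succ n ih =>
    refine (((Set.finite_range (nil (I := I))).union (ih.image2 loop ih)).union
      ((Set.finite_Iic r).image2 contract ih)).subset ?_
    rintro c ⟨hv, h⟩
    cases c with
    | nil c => exact Or.inl (Or.inl ⟨c, rfl⟩)
    | loop a b =>
      simp only [size] at h
      exact Or.inl (Or.inr ⟨a, ⟨hv.1, by omega⟩, b, ⟨hv.2, by omega⟩, rfl⟩)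
    | contract k m =>
      simp only [size] at h
      have := hv.2.2.1
      exact Or.inr ⟨k, Set.mem_Iic.2 (by omega), m, ⟨hv.1, by omega⟩, rfl⟩

theorem finite_leaves [Finite I] (r n : ℕ) :
    {c : Code I | c.Valid r ∧ (c.leaves fun _ => True) = n}.Finite := by
  refine (finite_size_le r (3 * n)).subset ?_
  rintro c ⟨h1, rfl⟩
  have := c.size_le h1
  exact ⟨h1, by omega⟩

/-- The map with a single edge. -/
def _root_.RMap.single (c : I) : RMap I Bool where
  rot := 1
  opp := Equiv.swap false true
  cil := false
  color _ := c

/-- The map described by a code. -/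
noncomputable def realize : Code I → Σ D : Type, RMap I D
  | nil c => ⟨Bool, RMap.single c⟩
  | loop a b => ⟨_, RMap.loop a.realize.2 b.realize.2⟩
  -- The `(k + 1)`-st image of the root has index `k` in the boundary list; the prefix called `G` in
  -- the lemmas on `split` has length `k`.
  | contract k m => ⟨_, RMap.split m.realize.2 ((m.realize.2.rot ^ (k + 1)) m.realize.2.root)⟩

/-- The half-edges of the map described by a code. -/
abbrev HalfEdge (c : Code I) : Type := c.realize.1

noncomputable abbrev toRMap (c : Code I) : RMap I c.HalfEdge := c.realize.2

noncomputable instance fintypeHalfEdge : (c : Code I) → Fintype c.HalfEdge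
  | nil _ => inferInstanceAs (Fintype Bool)
  | loop a b =>
    letI := fintypeHalfEdge a
    letI := fintypeHalfEdge b
    inferInstanceAs (Fintype (a.HalfEdge ⊕ b.HalfEdge))
  | contract _ m =>
    letI := fintypeHalfEdge m
    inferInstanceAs (Fintype (m.HalfEdge ⊕ Bool))

theorem _root_.exists_isBd_split {D : Type} {π : Equiv.Perm D} {x : D} {L : List D} (h : IsBd π x L)
    {k : ℕ} (hk : k < L.length) :
    ∃ G R, L = G ++ (π ^ (k + 1)) x :: R ∧ G.length = k := by
  have key : ∀ (L : List D) (x : D) (k : ℕ) (hk : k < L.length), Seg π x L →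
      L[k] = (π ^ (k + 1)) x := by
    intro L
    induction L with
    | nil => intro x k hk; simp at hk
    | cons z L ih =>
      rintro x (_ | k) hk ⟨h1, h2⟩
      · simp [h1]
      · have := ih z k (by simpa using hk) h2
        rw [List.getElem_cons_succ, this, ← h1, pow_succ (n := k + 1), Equiv.Perm.mul_apply]
  have h2 := key (L ++ [x]) x k (by simp; omega) h.seg
  rw [List.getElem_append_left hk] at h2
  refine ⟨L.take k, L.drop (k + 1), ?_, by simp; omega⟩
  rw [← h2, List.cons_getElem_drop_succ, List.take_append_drop]

open RMap

theorem _root_.RMap.single_root (c : I) : (RMap.single c).root = true := rfl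

theorem _root_.RMap.single_pre (c : I) : (RMap.single c).Pre :=
  ⟨by rintro (_ | _) <;> rfl, by rintro (_ | _) <;> exact Bool.noConfusion, rfl, fun _ => rfl⟩

theorem _root_.RMap.single_good (c : I) : (RMap.single c).Good r ∧ (RMap.single c).edges = ∅ ∧
    (RMap.single c).blacks = ∅ := by
  have hp := RMap.single_pre c
  have hroot := RMap.single_root c
  have he : (RMap.single c).edges = ∅ := by
    rw [Finset.eq_empty_iff_forall_notMem]
    intro e he
    obtain ⟨d, hd, -⟩ := mem_edges.1 he
    cases d with
    | false => exact hd.1 rfl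
    | true => exact hd.2 rfl
  have hb : (RMap.single c).blacks = ∅ := by
    rw [Finset.eq_empty_iff_forall_notMem]
    intro e he
    obtain ⟨d, hd, -⟩ := mem_blacks.1 he
    cases d with
    | false => exact hd.1 rfl
    | true => exact hd.2 (Equiv.Perm.SameCycle.refl _ _)
  refine ⟨⟨hp, by simp [hb], ?_, ?_⟩, he, hb⟩
  · intro p h1 h2 h3 d
    cases d with
    | false => exact h1
    | true => exact h3 _ h1
  · rw [he, hb]
    simp only [Finset.card_empty, zero_add]
    rw [Nat.card_eq_one_iff_exists]
    refine ⟨⟦(RMap.single c).cil⟧, fun F => ?_⟩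
    induction F using Quotient.inductionOn with | _ d
    cases d with
    | false => rfl
    | true => rw [hp.face_cil, hroot]

theorem realize_nil (c : I) : (nil c).toRMap.Good r ∧ (nil c).toRMap.edges = ∅ ∧
    (nil c).toRMap.blacks = ∅ := RMap.single_good c

theorem _root_.RMap.loop_path {D₁ D₂ : Type} [Finite D₁] {A : RMap I D₁} {B : RMap I D₂}
    (hA : A.Pre) {LA : List D₁} (hLA : IsBd A.rot A.root LA) (LB : List D₂) :
    ((Sum.inl A.cil :: ((LA ++ [A.root]).map Sum.inl ++ LB.map Sum.inr)) ++
      [(RMap.loop A B).root]).map (RMap.loop A B).color =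
    B.color B.cil :: ((LA ++ [A.root]).map A.color ++ (LB ++ [B.root]).map B.color) := by
  have hcil := hA.cil_not_mem hLA
  have e1 : ((LA ++ [A.root]).map Sum.inl).map (RMap.loop A B).color =
      (LA ++ [A.root]).map A.color := by
    rw [List.map_map]
    refine List.map_congr_left fun d hd => loop_color_inl ?_
    rintro rfl; exact hcil hd
  rw [← e1]
  simp [Function.comp_def]

theorem _root_.RMap.split_path {D : Type} (A : RMap I D) (g : D) (G R : List D) :
    ((Sum.inr false :: R.map Sum.inl) ++ [(RMap.split A g).root]).map (RMap.split A g).color =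
    A.color A.cil :: ((G ++ g :: R ++ [A.root]).map A.color).drop (G.length + 1) := by
  simp [List.drop_append, Function.comp_def]

/-- The invariant that makes inductions on codes work: the decorations read around the root vertex
are exactly those computed by `path`, so validity of a code and admissibility of its map correspond
at every step. -/
theorem realize_spec (c : Code I) (h : c.Valid r) :
    c.toRMap.Good r ∧ (∃ L, IsBd c.toRMap.rot c.toRMap.root L ∧
      (L ++ [c.toRMap.root]).map c.toRMap.color = c.path) ∧ c.toRMap.color c.toRMap.cil = c.base := by
  induction c with
  | nil c =>
    exact ⟨(realize_nil c).1, ⟨[], ⟨by simp, rfl, trivial⟩, rfl⟩, rfl⟩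
  | loop a b ha hb =>
    obtain ⟨ga, ⟨LA, hLA, pa⟩, ba⟩ := ha h.1
    obtain ⟨gb, ⟨LB, hLB, pb⟩, bb⟩ := hb h.2
    refine ⟨(loop_good ga.toPre gb.toPre).2 ⟨ga, gb⟩, ⟨_, isBd_loop ga.toPre hLA hLB, ?_⟩, bb⟩
    rw [path, ← pa, ← pb, ← bb]
    exact loop_path ga.toPre hLA LB
  | contract k m hm =>
    obtain ⟨gm, ⟨L, hL, pm⟩, bm⟩ := hm h.1
    have hlen : L.length + 1 = m.path.length := by rw [← pm]; simp
    obtain ⟨-, h1, h2, h3⟩ := h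
    obtain ⟨G, R, rfl, hG⟩ := exists_isBd_split hL (k := k) (by omega)
    refine ⟨(split_good hL gm.toPre).2 ⟨gm, by omega, by omega⟩, ⟨_, (isBd_split hL).1, ?_⟩, bm⟩
    rw [path, ← pm, ← bm, ← hG]
    exact split_path _ _ G R

theorem wt_eq {K : Type*} [CommMonoid K] (fV : Multiset I → K) (fE : Sym2 I → K) (c : Code I)
    (h : c.Valid r) : c.toRMap.wt fV fE = c.wt fV fE := by
  induction c with
  | nil c =>
    obtain ⟨-, h1, h2⟩ := realize_nil (r := r) c
    rw [RMap.wt, h1, h2]; simp [wt]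
  | loop a b ha hb =>
    obtain ⟨ga, ⟨LA, hLA, pa⟩, ba⟩ := a.realize_spec h.1
    obtain ⟨gb, ⟨LB, hLB, pb⟩, bb⟩ := b.realize_spec h.2
    rw [wt, ← ha h.1, ← hb h.2, ← ba, ← bb]
    exact loop_wt fV fE ga.toPre gb.toPre
  | contract k m hm =>
    obtain ⟨gm, ⟨L, hL, pm⟩, bm⟩ := m.realize_spec h.1
    have hlen : L.length + 1 = m.path.length := by rw [← pm]; simp
    obtain ⟨h0, h1, h2, h3⟩ := h
    obtain ⟨G, R, hGR, hG⟩ := exists_isBd_split hL (k := k) (by omega)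
    set g := (m.toRMap.rot ^ (k + 1)) m.toRMap.root with hg
    rw [hGR] at hL pm
    have e3 : ∃ R', R ++ [m.toRMap.root] = m.toRMap.rot g :: R' := by
      have := hL.seg
      rw [List.append_assoc, List.cons_append] at this
      have h4 := (seg_append.1 this).2
      rcases R with _ | ⟨x, R⟩
      · exact ⟨[], by rw [h4.1]; rfl⟩
      · exact ⟨R ++ [m.toRMap.root], by rw [h4.1]; rfl⟩
    obtain ⟨R', hR'⟩ := e3
    have e4 : m.path = (G ++ [g]).map m.toRMap.color ++
        m.toRMap.color (m.toRMap.rot g) :: R'.map m.toRMap.color := by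
      rw [← pm, List.append_assoc, List.cons_append, hR']
      simp
    rw [wt, ← hm h0, ← bm, e4]
    have hl : ((G ++ [g]).map m.toRMap.color).length = k + 1 := by simp [hG]
    have e5 : ((G ++ [g]).map m.toRMap.color ++
        m.toRMap.color (m.toRMap.rot g) :: R'.map m.toRMap.color).getD (k + 1)
          (m.toRMap.color m.toRMap.cil) = m.toRMap.color (m.toRMap.rot g) := by
      rw [List.getD_eq_getElem?_getD, List.getElem?_append_right (by omega), hl]
      simp
    have e6 : ((G ++ [g]).map m.toRMap.color ++
        m.toRMap.color (m.toRMap.rot g) :: R'.map m.toRMap.color).take (k + 2) =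
        (G ++ [g]).map m.toRMap.color ++ [m.toRMap.color (m.toRMap.rot g)] := by
      rw [List.take_append, List.take_of_length_le (by omega), hl]
      simp
    rw [e5, e6]
    exact split_wt fV fE hL gm.toPre

theorem faceCard_eq (P : I → Prop) (c : Code I) (h : c.Valid r) :
    c.toRMap.faceCard P = c.leaves P := by
  induction c with
  | nil c =>
    obtain ⟨hg, h1, h2⟩ := realize_nil (r := r) c
    have h3 := hg.genus
    rw [h1, h2, Finset.card_empty, zero_add] at h3
    obtain ⟨F, hF⟩ := Nat.card_eq_one_iff_exists.1 h3
    have hc : ∀ F, (nil c).toRMap.faceColor F = c := fun _ => rfl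
    by_cases hP : P c
    · rw [leaves, if_pos hP, RMap.faceCard, Nat.card_eq_one_iff_exists]
      exact ⟨⟨F, by rw [hc]; exact hP⟩, fun F' => Subtype.ext (hF _)⟩
    · rw [leaves, if_neg hP, RMap.faceCard, Nat.card_eq_zero]
      exact Or.inl ⟨fun F => hP (by have := F.2; rwa [hc] at this)⟩
  | loop a b ha hb =>
    rw [leaves, ← ha h.1, ← hb h.2]
    exact loop_faceCard (a.realize_spec h.1).1.toPre (b.realize_spec h.2).1.toPre P
  | contract k m hm =>
    obtain ⟨gm, ⟨L, hL, pm⟩, bm⟩ := m.realize_spec h.1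
    have hlen : L.length + 1 = m.path.length := by rw [← pm]; simp
    obtain ⟨h0, h1, h2, h3⟩ := h
    obtain ⟨G, R, rfl, hG⟩ := exists_isBd_split hL (k := k) (by omega)
    rw [leaves, ← hm h0]
    exact split_faceCard gm.toPre (ne_root_of_isBd hL) (ne_cil_of_isBd gm.toPre hL) P

end Code

end Rooted

set_option linter.unusedSectionVars false

/-! ### Codes classify rooted maps up to isomorphism -/

section Rooted

open Classical

namespace RMap

variable {I D D' D₁ D₂ D₁' D₂' : Type}

theorem ext_apply {M M' : RMap I D} (h1 : ∀ d, M'.rot d = M.rot d) (h2 : ∀ d, M'.opp d = M.opp d)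
    (h3 : M'.cil = M.cil) (h4 : ∀ d, M'.color d = M.color d) : M = M' := by
  have := eq_map (f := Equiv.refl D) h1 h2 h3 h4
  rw [this]; rfl

theorem split_map (e : D ≃ D') (A : RMap I D) (g : D) :
    split (map e A) (e g) = map (Equiv.sumCongr e (Equiv.refl Bool)) (split A g) := by
  refine eq_map ?_ ?_ rfl ?_
  · rintro (d | _ | _)
    · by_cases h1 : d = A.root
      · subst h1
        by_cases h2 : g = A.root
        · subst h2
          simp [split, Equiv.swap_apply_def]
        · rw [split_rot_root h2, Equiv.sumCongr_apply, Sum.map_inl, ← map_root, split_rot_root (by simpa using h2)]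
          rfl
      · by_cases h2 : d = g
        · subst h2
          rw [split_rot_self, Equiv.sumCongr_apply, Sum.map_inl, split_rot_self]
          rfl
        · rw [split_rot_inl h1 h2, Equiv.sumCongr_apply, Sum.map_inl,
            split_rot_inl (by simpa using h1) (by simpa using h2), map_rot]
          rfl
    · simp [split, Equiv.swap_apply_def]
      split_ifs <;> simp
    · rw [split_rot_true, Equiv.sumCongr_apply, Sum.map_inr, Equiv.refl_apply, split_rot_true]
      simp
  · rintro (d | _ | _) <;> simp
  · rintro (d | _ | _) <;> simp

theorem loop_map (e₁ : D₁ ≃ D₁') (e₂ : D₂ ≃ D₂') (A : RMap I D₁) (B : RMap I D₂) (hA : A.Pre) :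
    loop (map e₁ A) (map e₂ B) = map (Equiv.sumCongr e₁ e₂) (loop A B) := by
  refine eq_map ?_ ?_ rfl ?_
  · rintro (d | d)
    · by_cases h1 : d = A.cil
      · subst h1
        rw [loop_rot_cil hA, Equiv.sumCongr_apply, Sum.map_inl, ← map_cil, loop_rot_cil (hA.map e₁)]
        simp
      · by_cases h2 : d = A.root
        · subst h2
          rw [loop_rot_root, Equiv.sumCongr_apply, Sum.map_inl, ← map_root, loop_rot_root]
          simp
        · rw [loop_rot_inl h1 h2, Equiv.sumCongr_apply, Sum.map_inl,
            loop_rot_inl (by simpa using h1) (by simpa using h2)]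
          simp
    · by_cases h1 : d = B.root
      · subst h1
        rw [loop_rot_inr_root hA, Equiv.sumCongr_apply, Sum.map_inr, ← map_root,
          loop_rot_inr_root (hA.map e₁)]
        simp
      · rw [loop_rot_inr h1, Equiv.sumCongr_apply, Sum.map_inr, loop_rot_inr (by simpa using h1)]
        simp
  · rintro (d | d) <;> simp
  · rintro (d | d)
    · by_cases h1 : d = A.cil
      · subst h1
        rw [Equiv.sumCongr_apply, Sum.map_inl, ← map_cil, loop_color_cil, loop_color_cil]
        simp
      · rw [Equiv.sumCongr_apply, Sum.map_inl, loop_color_inl h1, loop_color_inl (by simpa using h1)]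
        simp
    · simp

theorem map_first (f : D ≃ D') (M : RMap I D) : (map f M).first = f M.first := by
  simp [first]

theorem loop_first (A : RMap I D₁) (B : RMap I D₂) (hA : A.Pre) :
    (loop A B).first = Sum.inl A.cil := loop_rot_inr_root hA

theorem split_first {A : RMap I D} {g : D} (hg : g ≠ A.root) :
    (split A g).first = Sum.inr false := split_rot_root hg

/-- A map of half-edges that sends the first half-edges to each other sends the inner part of one
loop to the inner part of the other. -/
theorem loop_closed {A : RMap I D₁} {B : RMap I D₂} {A' : RMap I D₁'} {B' : RMap I D₂'}
    (hA : A.Pre) (hA' : A'.Pre) (cA : A.Conn) (cB : B.Conn) {f : D₁ ⊕ D₂ ≃ D₁' ⊕ D₂'}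
    (h : map f (loop A B) = loop A' B') :
    (∀ d, ∃ d', f (Sum.inl d) = Sum.inl d') ∧ (∀ d, ∃ d', f (Sum.inr d) = Sum.inr d') := by
  have hr : ∀ d, (loop A' B').rot (f d) = f ((loop A B).rot d) := by intro d; rw [← h, map_rot]
  have ho : ∀ d, (loop A' B').opp (f d) = f ((loop A B).opp d) := by intro d; rw [← h, map_opp]
  have h1 : f (Sum.inr B.cil) = Sum.inr B'.cil := by
    have := congrArg RMap.cil h
    simpa using this
  have h2 : f (Sum.inr B.root) = Sum.inr B'.root := by
    have := congrArg RMap.root h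
    simpa using this
  have h3 : f (Sum.inl A.cil) = Sum.inl A'.cil := by
    have := congrArg RMap.first h
    rwa [map_first, loop_first _ _ hA, loop_first _ _ hA'] at this
  have h4 : f (Sum.inl A.root) = Sum.inl A'.root := by
    have := ho (Sum.inl A.cil)
    rw [h3] at this
    exact this.symm
  constructor
  · refine cA (fun d => ∃ d', f (Sum.inl d) = Sum.inl d') ⟨_, h3⟩ ?_ ?_
    · rintro d ⟨d', hd⟩
      by_cases e1 : d = A.cil
      · subst e1; rw [hA.rot_cil]; exact ⟨d', hd⟩
      by_cases e2 : d = A.root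
      · subst e2
        have := hr (Sum.inl A.cil)
        rw [loop_rot_cil hA, h3, loop_rot_cil hA'] at this
        exact ⟨_, this.symm⟩
      · have := hr (Sum.inl d)
        rw [loop_rot_inl e1 e2, hd, loop_rot_inl] at this
        · exact ⟨_, this.symm⟩
        · rintro rfl; exact e1 (Sum.inl_injective (f.injective (hd.trans h3.symm)))
        · rintro rfl; exact e2 (Sum.inl_injective (f.injective (hd.trans h4.symm)))
    · rintro d ⟨d', hd⟩
      have := ho (Sum.inl d)
      rw [hd] at this
      exact ⟨_, this.symm⟩
  · refine cB (fun d => ∃ d', f (Sum.inr d) = Sum.inr d') ⟨_, h1⟩ ?_ ?_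
    · rintro d ⟨d', hd⟩
      by_cases e2 : d = B.root
      · subst e2
        have := hr (Sum.inl A.root)
        rw [loop_rot_root, h4, loop_rot_root] at this
        exact ⟨_, this.symm⟩
      · have := hr (Sum.inr d)
        rw [loop_rot_inr e2, hd, loop_rot_inr] at this
        · exact ⟨_, this.symm⟩
        · rintro rfl; exact e2 (Sum.inr_injective (f.injective (hd.trans h2.symm)))
    · rintro d ⟨d', hd⟩
      have := ho (Sum.inr d)
      rw [hd] at this
      exact ⟨_, this.symm⟩

theorem exists_sumCongr {f : D₁ ⊕ D₂ ≃ D₁' ⊕ D₂'} (h1 : ∀ d, ∃ d', f (Sum.inl d) = Sum.inl d')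
    (h2 : ∀ d, ∃ d', f (Sum.inr d) = Sum.inr d') :
    ∃ (f₁ : D₁ ≃ D₁') (f₂ : D₂ ≃ D₂'), f = Equiv.sumCongr f₁ f₂ := by
  choose g1 hg1 using h1
  choose g2 hg2 using h2
  have b1 : Function.Bijective g1 := by
    constructor
    · intro a b hab
      exact Sum.inl_injective (f.injective (by rw [hg1, hg1, hab]))
    · intro d'
      obtain ⟨d | d, hd⟩ := f.surjective (Sum.inl d')
      · exact ⟨d, Sum.inl_injective ((hg1 d).symm.trans hd)⟩
      · rw [hg2] at hd; cases hd
  have b2 : Function.Bijective g2 := by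
    constructor
    · intro a b hab
      exact Sum.inr_injective (f.injective (by rw [hg2, hg2, hab]))
    · intro d'
      obtain ⟨d | d, hd⟩ := f.surjective (Sum.inr d')
      · rw [hg1] at hd; cases hd
      · exact ⟨d, Sum.inr_injective ((hg2 d).symm.trans hd)⟩
  refine ⟨Equiv.ofBijective g1 b1, Equiv.ofBijective g2 b2, ?_⟩
  ext (d | d)
  · simp [hg1]
  · simp [hg2]

/-- An isomorphism matches cilia, roots and first half-edges, hence, by connectedness of the parts,
respects the two summands. Each part is then recovered from the restriction of the rotation. -/
theorem loop_inj {A : RMap I D₁} {B : RMap I D₂} {A' : RMap I D₁'} {B' : RMap I D₂'}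
    (hA : A.Pre) (hA' : A'.Pre) (cA : A.Conn) (cB : B.Conn) {f : D₁ ⊕ D₂ ≃ D₁' ⊕ D₂'}
    (h : map f (loop A B) = loop A' B') :
    (∃ f₁ : D₁ ≃ D₁', map f₁ A = A') ∧ (∃ f₂ : D₂ ≃ D₂', map f₂ B = B') := by
  obtain ⟨h1, h2⟩ := loop_closed hA hA' cA cB h
  obtain ⟨f₁, f₂, rfl⟩ := exists_sumCongr h1 h2
  rw [← loop_map _ _ _ _ hA] at h
  have hr : ∀ d, (loop (map f₁ A) (map f₂ B)).rot d = (loop A' B').rot d := by rw [h]; exact fun _ => rfl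
  have ho : ∀ d, (loop (map f₁ A) (map f₂ B)).opp d = (loop A' B').opp d := by rw [h]; exact fun _ => rfl
  have hc : ∀ d, (loop (map f₁ A) (map f₂ B)).color d = (loop A' B').color d := by
    rw [h]; exact fun _ => rfl
  have hcB : (map f₂ B).cil = B'.cil := Sum.inr_injective (congrArg RMap.cil h)
  have hrB : (map f₂ B).root = B'.root := Sum.inr_injective (congrArg RMap.root h)
  have hA1 := hA.map f₁
  have hcA : (map f₁ A).cil = A'.cil := by
    have := congrArg RMap.first h
    rw [loop_first _ _ hA1, loop_first _ _ hA'] at this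
    exact Sum.inl_injective this
  have hrA : (map f₁ A).root = A'.root := by
    have := ho (Sum.inl (map f₁ A).cil)
    nth_rewrite 2 [hcA] at this
    exact Sum.inl_injective this
  constructor
  · refine ⟨f₁, ?_⟩
    refine ext_apply ?_ ?_ hcA.symm ?_
    · intro d
      by_cases e1 : d = A'.cil
      · rw [e1, hA'.rot_cil, ← hcA, hA1.rot_cil]
      by_cases e2 : d = A'.root
      · have := hr (Sum.inl A'.cil)
        rw [← hcA, loop_rot_cil hA1, hcA, loop_rot_cil hA'] at this
        rw [e2, ← Sum.inl_injective this, hrA]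
      · have := hr (Sum.inl d)
        rw [loop_rot_inl e1 e2, loop_rot_inl (by rwa [hcA]) (by rwa [hrA])] at this
        exact (Sum.inl_injective this).symm
    · intro d
      exact (Sum.inl_injective (ho (Sum.inl d))).symm
    · intro d
      have key : ∀ d, d ≠ A'.cil → A'.color d = (map f₁ A).color d := by
        intro d e1
        have := hc (Sum.inl d)
        rw [loop_color_inl e1, loop_color_inl (by rwa [hcA])] at this
        exact this.symm
      -- Joining overwrites the color of the inner cilium, but in each part it equals that of the
      -- root half-edge.
      by_cases e1 : d = A'.cil
      · rw [e1, ← hA'.color_root, key _ hA'.root_ne_cil, ← hrA, hA1.color_root, hcA]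
      · exact key d e1
  · refine ⟨f₂, ?_⟩
    refine ext_apply ?_ ?_ hcB.symm ?_
    · intro d
      by_cases e2 : d = B'.root
      · have := hr (Sum.inl A'.root)
        rw [loop_rot_root, ← hrA, loop_rot_root] at this
        rw [e2, ← Sum.inr_injective this, hrB]
      · have := hr (Sum.inr d)
        rw [loop_rot_inr e2, loop_rot_inr (by rwa [hrB])] at this
        exact (Sum.inr_injective this).symm
    · intro d
      exact (Sum.inr_injective (ho (Sum.inr d))).symm
    · intro d
      exact (hc (Sum.inr d)).symm

theorem split_inj {A : RMap I D} {g : D} {A' : RMap I D'} {g' : D'} (hg : g ≠ A.root)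
    (hg' : g' ≠ A'.root) {f : D ⊕ Bool ≃ D' ⊕ Bool} (h : map f (split A g) = split A' g') :
    ∃ f₁ : D ≃ D', map f₁ A = A' := by
  have hr : ∀ d, (split A' g').rot (f d) = f ((split A g).rot d) := by intro d; rw [← h, map_rot]
  have ho : ∀ d, (split A' g').opp (f d) = f ((split A g).opp d) := by intro d; rw [← h, map_opp]
  have h1 : f (Sum.inr false) = Sum.inr false := by
    have := congrArg RMap.first h
    rwa [map_first, split_first hg, split_first hg'] at this
  have h2 : f (Sum.inr true) = Sum.inr true := by
    have := ho (Sum.inr false)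
    rw [h1] at this
    simpa using this.symm
  obtain ⟨f₁, f₂, rfl⟩ := exists_sumCongr (f := f) (fun d => by
      rcases hd : f (Sum.inl d) with d' | _ | _
      · exact ⟨_, rfl⟩
      · exact absurd (f.injective (hd.trans h1.symm)) (by simp)
      · exact absurd (f.injective (hd.trans h2.symm)) (by simp)) (by
      rintro (_ | _)
      · exact ⟨_, h1⟩
      · exact ⟨_, h2⟩)
  obtain rfl : f₂ = Equiv.refl Bool := by
    ext (_ | _)
    · exact Sum.inr_injective h1
    · exact Sum.inr_injective h2
  rw [← split_map] at h
  have hro : (map f₁ A).root = A'.root := Sum.inl_injective (congrArg RMap.root h)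
  have hr : ∀ d, (split (map f₁ A) (f₁ g)).rot d = (split A' g').rot d := by
    rw [h]; exact fun _ => rfl
  have hgg : f₁ g = g' := by
    have := (split_rot_self (A := map f₁ A) (g := f₁ g)).trans (split_rot_self (A := A') (g := g')).symm
    rw [hr] at this
    exact Sum.inl_injective ((split A' g').rot.injective this)
  refine ⟨f₁, ?_⟩
  refine ext_apply ?_ ?_ (Sum.inl_injective (congrArg RMap.cil h)).symm ?_
  · intro d
    by_cases e1 : d = A'.root
    · have := hr (Sum.inr true)
      rw [split_rot_true, split_rot_true, hro] at this
      rw [e1, Sum.inl_injective this]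
    by_cases e2 : d = g'
    · have := hr (Sum.inr false)
      rw [split_rot_false (by rwa [hgg, hro]), split_rot_false hg', hgg] at this
      rw [e2, Sum.inl_injective this]
    · have := hr (Sum.inl d)
      rw [split_rot_inl e1 e2, split_rot_inl (by rwa [hro]) (by rwa [hgg])] at this
      exact (Sum.inl_injective this).symm
  · intro d
    have : (split (map f₁ A) (f₁ g)).opp (Sum.inl d) = (split A' g').opp (Sum.inl d) := by rw [h]
    exact (Sum.inl_injective this).symm
  · intro d
    have : (split (map f₁ A) (f₁ g)).color (Sum.inl d) = (split A' g').color (Sum.inl d) := by rw [h]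
    exact this.symm

theorem map_symm_eq {M : RMap I D} {M' : RMap I D'} {f : D ≃ D'} (h : map f M = M') :
    map f.symm M' = M := by
  rw [← h, map_symm_map]

theorem color_eq_of_map_single {a b : I} {f : Bool ≃ Bool} (h : map f (single a) = single b) :
    a = b := by
  have : (map f (single a)).color (f false) = (single b).color (f false) := by rw [h]
  rwa [map_color] at this

theorem map_single_ne_loop {a : I} {A : RMap I D₁} {B : RMap I D₂} (hA : A.Pre)
    {f : Bool ≃ D₁ ⊕ D₂} : map f (single a) ≠ loop A B := by
  intro h
  have h1 : (map f (single a)).first = (map f (single a)).root := by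
    rw [map_first, map_root]; rfl
  rw [h, loop_first _ _ hA, loop_root] at h1
  cases h1

theorem map_single_ne_split {a : I} {A : RMap I D} {g : D} (hg : g ≠ A.root)
    {f : Bool ≃ D ⊕ Bool} : map f (single a) ≠ split A g := by
  intro h
  have h1 : (map f (single a)).first = (map f (single a)).root := by
    rw [map_first, map_root]; rfl
  rw [h, split_first hg, split_root] at h1
  cases h1

/-- The far end of the first edge distinguishes the cases: it lies at the root vertex of a loop, and
at a black vertex of a split map. -/
theorem map_loop_ne_split [Finite D₁] [Finite D₂] [Finite D] {A : RMap I D₁} {B : RMap I D₂}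
    {A' : RMap I D} {G R : List D} {g : D} (hA : A.Pre) (hB : B.Pre)
    (hL : IsBd A'.rot A'.root (G ++ g :: R)) {f : D₁ ⊕ D₂ ≃ D ⊕ Bool} :
    map f (loop A B) ≠ split A' g := by
  intro h
  have h1 := split_black_true hL
  have h2 : (map f (loop A B)).opp (map f (loop A B)).first = Sum.inr true := by
    rw [h, split_first (ne_root_of_isBd hL), split_opp_false]
  rw [← h2, ← h, map_first, map_opp, map_black, loop_first _ _ hA, loop_opp_inl,
    loop_black_inl hA] at h1
  exact not_black_root h1

end RMap

namespace Code

open RMap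

variable {I : Type} {r : ℕ}

theorem length_path_eq {c c' : Code I} (h : c.Valid r) (h' : c'.Valid r)
    {f : c.HalfEdge ≃ c'.HalfEdge} (hf : map f c.toRMap = c'.toRMap) :
    c.path.length = c'.path.length := by
  obtain ⟨-, ⟨L, hL, hp⟩, -⟩ := c.realize_spec h
  obtain ⟨-, ⟨L', hL', hp'⟩, -⟩ := c'.realize_spec h'
  have h1 := isBd_map (π' := c'.toRMap.rot) (f := f) (fun d => by rw [← hf, map_rot]) hL
  rw [← map_root, hf] at h1
  rw [← hp, ← hp', ← h1.unique hL']
  simp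

theorem contract_aux {k : ℕ} {m : Code I} (h : (contract k m).Valid r) :
    ∃ G g R, (contract k m).toRMap = RMap.split m.toRMap g ∧
      IsBd m.toRMap.rot m.toRMap.root (G ++ g :: R) := by
  obtain ⟨gm, ⟨L, hL, pm⟩, bm⟩ := m.realize_spec h.1
  have hlen : L.length + 1 = m.path.length := by rw [← pm]; simp
  obtain ⟨h0, h1, h2, h3⟩ := h
  obtain ⟨G, R, rfl, hG⟩ := exists_isBd_split hL (k := k) (by omega)
  exact ⟨G, _, R, rfl, hL⟩

/-- The first edge determines the constructor, and `loop_inj` and `split_inj` give isomorphisms of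
the smaller maps. For a contraction, `k` is the difference of the lengths of the paths before and
after, which are invariants. -/
theorem eq_of_map_eq {c c' : Code I} (h : c.Valid r) (h' : c'.Valid r)
    {f : c.HalfEdge ≃ c'.HalfEdge} (hf : map f c.toRMap = c'.toRMap) : c = c' := by
  have hl := length_path_eq h h' hf
  induction c generalizing c' with
  | nil a =>
    cases c' with
    | nil b => exact congrArg nil (color_eq_of_map_single hf)
    | loop a' b' => exact absurd hf (map_single_ne_loop (a'.realize_spec h'.1).1.toPre)
    | contract k' m' =>
      obtain ⟨G, g, R, hg, hL⟩ := contract_aux h'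
      rw [hg] at hf
      exact absurd hf (map_single_ne_split (ne_root_of_isBd hL))
  | loop a b iha ihb =>
    have ga := (a.realize_spec h.1).1
    have gb := (b.realize_spec h.2).1
    cases c' with
    | nil b =>
      exact absurd (map_symm_eq hf) (map_single_ne_loop ga.toPre)
    | loop a' b' =>
      have ga' := (a'.realize_spec h'.1).1
      obtain ⟨⟨f₁, e₁⟩, ⟨f₂, e₂⟩⟩ := loop_inj ga.toPre ga'.toPre ga.conn gb.conn hf
      rw [iha h.1 h'.1 e₁ (length_path_eq h.1 h'.1 e₁),
        ihb h.2 h'.2 e₂ (length_path_eq h.2 h'.2 e₂)]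
    | contract k' m' =>
      obtain ⟨G, g, R, hg, hL⟩ := contract_aux h'
      rw [hg] at hf
      exact absurd hf (map_loop_ne_split ga.toPre gb.toPre hL)
  | contract k m ih =>
    obtain ⟨G, g, R, hg, hL⟩ := contract_aux h
    cases c' with
    | nil b =>
      rw [hg] at hf
      exact absurd (map_symm_eq hf) (map_single_ne_split (ne_root_of_isBd hL))
    | loop a' b' =>
      rw [hg] at hf
      exact absurd (map_symm_eq hf) (map_loop_ne_split (a'.realize_spec h'.1).1.toPre
        (b'.realize_spec h'.2).1.toPre hL)
    | contract k' m' =>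
      obtain ⟨G', g', R', hg', hL'⟩ := contract_aux h'
      rw [hg, hg'] at hf
      obtain ⟨f₁, e₁⟩ := split_inj (ne_root_of_isBd hL) (ne_root_of_isBd hL') hf
      have hm := length_path_eq h.1 h'.1 e₁
      have := h.2.2.2
      have := h'.2.2.2
      simp only [path, List.length_cons, List.length_drop] at hl
      rw [ih h.1 h'.1 e₁ hm, show k = k' by omega]

/-- Strong induction on the number of half-edges: if the root vertex has no edge besides the cilium
the map is a single edge; otherwise its first edge is split off or cut along, which leaves smaller
good maps. -/
theorem exists_map_eq {D : Type} [Fintype D] {M : RMap I D} (hM : M.Good r) :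
    ∃ c : Code I, c.Valid r ∧ ∃ f : c.HalfEdge ≃ D, map f c.toRMap = M := by
  induction hn : Fintype.card D using Nat.strong_induction_on generalizing D with | _ n ih
  by_cases hf : M.first = M.root
  · refine ⟨nil (M.color M.cil), trivial, ?_⟩
    have hall : ∀ d, d = M.cil ∨ d = M.root := by
      refine hM.conn _ (Or.inl rfl) ?_ ?_
      · rintro d (rfl | rfl)
        · exact Or.inl hM.rot_cil
        · exact Or.inr hf
      · rintro d (rfl | rfl)
        · exact Or.inr rfl
        · exact Or.inl hM.toPre.opp_root
    have hb : Function.Bijective (fun b : Bool => bif b then M.root else M.cil) := by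
      constructor
      · rintro (_ | _) (_ | _) h
        · rfl
        · exact absurd h.symm hM.toPre.root_ne_cil
        · exact absurd h hM.toPre.root_ne_cil
        · rfl
      · intro d
        rcases hall d with rfl | rfl
        · exact ⟨false, rfl⟩
        · exact ⟨true, rfl⟩
    refine ⟨Equiv.ofBijective _ hb, (eq_map (M := RMap.single _) ?_ ?_ rfl ?_).symm⟩
    · rintro (_ | _)
      · exact hM.rot_cil
      · exact hf
    · rintro (_ | _)
      · rfl
      · exact hM.toPre.opp_root
    · rintro (_ | _)
      · rfl
      · exact hM.toPre.color_root
  by_cases hb : M.Black (M.opp M.first)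
  · have hfix : M.rot (M.opp M.first) ≠ M.opp M.first := by
      intro he
      have h1 := (hM.black _ (mem_blacks.2 ⟨_, hb, rfl⟩)).1
      have h2 : IsBd M.rot (M.opp M.first) [] := ⟨by simp, by simpa [Seg] using he⟩
      rw [h2.card_orb] at h1
      simp at h1
    obtain ⟨D₀, _, A, g, f, G, R, hA, hL, rfl⟩ := exists_split hM.toPre hf hb hfix
    obtain ⟨gA, hG1, hG2⟩ := (split_good hL hA).1 (map_good_iff.1 hM)
    have hcard : Fintype.card D₀ < n := by
      rw [← hn, ← Fintype.card_congr f, Fintype.card_sum]; simp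
    obtain ⟨m, hm, e, rfl⟩ := ih _ hcard gA rfl
    obtain ⟨gm, ⟨L, hL', pm⟩, bm⟩ := m.realize_spec hm
    have h1 := isBd_map (π' := (map e m.toRMap).rot) (f := e) (fun d => by rw [map_rot]) hL'
    rw [← map_root] at h1
    have h2 := h1.unique hL
    have hlen : L.length = G.length + 1 + R.length := by
      have := congrArg List.length h2
      simp only [List.length_map, List.length_append, List.length_cons] at this
      omega
    have hlen2 : L.length + 1 = m.path.length := by rw [← pm]; simp
    obtain ⟨G', R', hGR, hG'⟩ := exists_isBd_split hL' (k := G.length) (by omega)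
    have hg : e ((m.toRMap.rot ^ (G.length + 1)) m.toRMap.root) = g := by
      rw [hGR, List.map_append, List.map_cons] at h2
      exact (List.cons.inj (List.append_inj h2 (by simp [hG'])).2).1
    refine ⟨contract G.length m, ⟨hm, hG1, hG2, by omega⟩,
      (Equiv.sumCongr e (Equiv.refl Bool)).trans f, ?_⟩
    rw [← hg, split_map, map_map]
    rfl
  · obtain ⟨D₁, D₂, _, _, A, B, f, hA, hB, rfl⟩ := exists_loop hM hf hb
    obtain ⟨gA, gB⟩ := (loop_good hA hB).1 (map_good_iff.1 hM)
    have c1 : Fintype.card D₁ + Fintype.card D₂ = n := by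
      rw [← hn, ← Fintype.card_congr f, Fintype.card_sum]
    have c2 : 0 < Fintype.card D₁ := Fintype.card_pos_iff.2 ⟨A.cil⟩
    have c3 : 0 < Fintype.card D₂ := Fintype.card_pos_iff.2 ⟨B.cil⟩
    obtain ⟨a, ha, e, rfl⟩ := ih _ (by omega) gA rfl
    obtain ⟨b, hb', e', rfl⟩ := ih _ (by omega) gB rfl
    refine ⟨loop a b, ⟨ha, hb'⟩, (Equiv.sumCongr e e').trans f, ?_⟩
    rw [loop_map _ _ _ _ (a.realize_spec ha).1.toPre, map_map]
    rfl

end Code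

end Rooted

set_option linter.unusedSectionVars false

/-! ### From ciliated maps to sums over codes -/

section Rooted

open Classical

theorem propagator_comm {K : Type*} [Field K] [Algebra ℂ K] (V : ℂ[X]) (a b : K) :
    propagator V a b = propagator V b a := by
  unfold propagator
  by_cases h : a = b
  · rw [h]
  · rw [if_neg h, if_neg (Ne.symm h), ← neg_sub b a, ← neg_sub (dV V b), neg_div_neg_eq]

/-- The weight of an edge in terms of its sides. -/
noncomputable def edgeWeight {K I : Type*} [Field K] [Algebra ℂ K] (V : ℂ[X]) (x : I → K) :
    Sym2 I → K :=
  Sym2.lift ⟨fun a b => propagator V (x a) (x b), fun _ _ => propagator_comm V _ _⟩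

/-- The weight of a black vertex in terms of its corners. -/
noncomputable def cornerWeight {K I : Type*} [Field K] [Algebra ℂ K] (V : ℂ[X]) (x : I → K)
    (s : Multiset I) : K :=
  vertexWeight V (s.map x)

/-- The values of the decorations. -/
def decoration {K : Type*} {N : ℕ} (z : K) (lam : Fin N → K) (a : Option (Fin N)) : K := a.elim z lam

namespace CiliatedMap

open RMap

variable {r N : ℕ} {D D' : Type}

/-- The underlying rooted map of a ciliated map. -/
def toRMap (G : CiliatedMap r N D) : RMap (Option (Fin N)) D := ⟨G.rot, G.opp, G.cil, G.color⟩

theorem toRMap_pre (G : CiliatedMap r N D) : G.toRMap.Pre :=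
  ⟨G.opp_opp, G.opp_ne, G.rot_cil, G.color_face⟩

theorem card_orb_rot [Fintype D] (G : CiliatedMap r N D) {d : D} (hd : d ≠ G.cil) :
    3 ≤ (orb G.rot d).card ∧ (orb G.rot d).card ≤ r + 1 := by
  have h := G.black d hd
  have e : Nat.card {e : D // G.rot.SameCycle d e} = (orb G.rot d).card := by
    rw [Nat.card_eq_fintype_card, Fintype.card_subtype]
    rfl
  rwa [e] at h

theorem toRMap_good [Fintype D] (G : CiliatedMap r N D) : G.toRMap.Good r where
  toPre := G.toRMap_pre
  black := by
    intro C hC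
    obtain ⟨d, hd, rfl⟩ := mem_blacks.1 hC
    exact G.card_orb_rot hd.1
  conn := by
    intro p h1 h2 h3 d
    obtain ⟨g, hg, rfl⟩ := G.connected G.cil d
    have key : ∀ d, p d → p (g d) := by
      induction hg using Subgroup.closure_induction with
      | mem x hx =>
        rcases hx with rfl | hx
        · exact h2
        · rw [Set.mem_singleton_iff] at hx
          subst hx
          exact h3
      | one => exact fun d h => h
      | mul x y _ _ hx hy => exact fun d h => hx _ (hy _ h)
      | inv x _ hx =>
        intro d hd
        -- On a finite set the inverse of `x` is reached at `d` by iterating `x`.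
        obtain ⟨n, hn⟩ := (sameCycle_iff_pow x d (x⁻¹ d)).1
          ⟨-1, by simp⟩
        rw [← hn]
        clear hn
        induction n with
        | zero => exact hd
        | succ n ih => rw [pow_succ', Equiv.Perm.mul_apply]; exact hx _ ih
    exact key _ h1
  genus := by
    have h1 := G.genus_zero
    have h2 := G.toRMap_pre.card_cells_rot
    have h3 := G.toRMap_pre.card_cells_opp
    change Nat.card (Cells G.rot) = _ at h2
    change Nat.card (Cells G.opp) = _ at h3
    change _ + Nat.card (Cells (G.rot * G.opp)) = _
    omega

/-- A good rooted map whose root vertex has an admissible degree and whose marked face is the face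
of the cilium is a ciliated map. -/
def ofRMap [Fintype D] (M : RMap (Option (Fin N)) D) (h : M.Good r)
    (hd : 3 ≤ (orb M.rot M.root).card ∧ (orb M.rot M.root).card ≤ r + 1)
    (hc : ∀ d, M.color d = none ↔ (M.rot * M.opp).SameCycle M.cil d) : CiliatedMap r N D where
  rot := M.rot
  opp := M.opp
  cil := M.cil
  color := M.color
  opp_opp := h.opp_opp
  opp_ne := h.opp_ne
  rot_cil := h.rot_cil
  black := by
    intro d hd'
    have e : Nat.card {e : D // M.rot.SameCycle d e} = (orb M.rot d).card := by
      rw [Nat.card_eq_fintype_card, Fintype.card_subtype]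
      rfl
    rw [e]
    by_cases hs : M.rot.SameCycle M.root d
    · rwa [orb_eq_iff.2 hs.symm]
    · exact h.black _ (mem_blacks.2 ⟨d, ⟨hd', hs⟩, rfl⟩)
  connected := by
    have key : ∀ d, ∃ g ∈ Subgroup.closure {M.rot, M.opp}, g M.cil = d := by
      refine h.conn _ ⟨1, Subgroup.one_mem _, rfl⟩ ?_ ?_
      · rintro _ ⟨g, hg, rfl⟩
        exact ⟨M.rot * g, Subgroup.mul_mem _ (Subgroup.subset_closure (by simp)) hg, rfl⟩
      · rintro _ ⟨g, hg, rfl⟩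
        exact ⟨M.opp * g, Subgroup.mul_mem _ (Subgroup.subset_closure (by simp)) hg, rfl⟩
    intro d e
    obtain ⟨g, hg, rfl⟩ := key d
    obtain ⟨g', hg', rfl⟩ := key e
    exact ⟨g' * g⁻¹, Subgroup.mul_mem _ hg' (Subgroup.inv_mem _ hg), by simp⟩
  genus_zero := by
    have h1 := h.genus
    have h2 := h.toPre.card_cells_rot
    have h3 := h.toPre.card_cells_opp
    omega
  color_face := h.color_face
  color_eq_none := hc

theorem isIso_iff (G : CiliatedMap r N D) (G' : CiliatedMap r N D') (f : D ≃ D') :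
    G.IsIso G' f ↔ map f G.toRMap = G'.toRMap := by
  constructor
  · rintro ⟨h1, h2, h3, h4⟩
    exact (eq_map (M := G.toRMap) (M' := G'.toRMap) (fun d => (h1 d).symm) (fun d => (h2 d).symm)
      h3.symm h4).symm
  · intro h
    refine ⟨fun d => ?_, fun d => ?_, ?_, fun d => ?_⟩
    · change _ = G'.toRMap.rot (f d); rw [← h, map_rot]; rfl
    · change _ = G'.toRMap.opp (f d); rw [← h, map_opp]; rfl
    · change _ = G'.toRMap.cil; rw [← h, map_cil]; rfl
    · change G'.toRMap.color (f d) = _; rw [← h, map_color]; rfl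

theorem faceCard_none [Finite D] (G : CiliatedMap r N D) : G.toRMap.faceCard (· = none) = 1 := by
  rw [RMap.faceCard, Nat.card_eq_one_iff_exists]
  refine ⟨⟨⟦G.cil⟧, ?_⟩, ?_⟩
  · rw [G.toRMap_pre.faceColor_mk]
    exact (G.color_eq_none _).2 (Equiv.Perm.SameCycle.refl _ _)
  · rintro ⟨F, hF⟩
    refine Subtype.ext ?_
    induction F using Quotient.inductionOn with | _ d
    rw [G.toRMap_pre.faceColor_mk] at hF
    exact Quotient.sound ((G.color_eq_none _).1 hF).symm

theorem color_eq_none_of_faceCard [Finite D] {M : RMap (Option (Fin N)) D} (h : M.Pre)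
    (h1 : M.faceCard (· = none) = 1) (h2 : M.color M.cil = none) (d : D) :
    M.color d = none ↔ (M.rot * M.opp).SameCycle M.cil d := by
  constructor
  · intro hd
    rw [RMap.faceCard, Nat.card_eq_one_iff_exists] at h1
    obtain ⟨F, hF⟩ := h1
    have e1 := hF ⟨⟦d⟧, by rw [h.faceColor_mk]; exact hd⟩
    have e2 := hF ⟨⟦M.cil⟧, by rw [h.faceColor_mk]; exact h2⟩
    exact Quotient.exact (congrArg Subtype.val (e2.trans e1.symm))
  · intro hs
    rw [← h2]
    exact (sameCycle_invariant (f := M.color) h.color_face hs).symm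

/-- Passes from products over chosen representatives of cycles to products over the sets or pairs
that `wt` uses. -/
theorem prod_cells {K E : Type*} [CommMonoid K] [DecidableEq E] [Fintype D] {π : Equiv.Perm D} {e : D → E}
    (he : ∀ x y, e x = e y ↔ π.SameCycle x y) (s : Finset D) (hs : ∀ x y, π.SameCycle x y → x ∈ s → y ∈ s)
    (g : E → K) :
    ∏ c ∈ (Finset.univ : Finset (Cells π)).filter fun c => c.out ∈ s, g (e c.out) =
      ∏ x ∈ s.image e, g x := by
  refine Finset.prod_bij (fun c _ => e c.out) ?_ ?_ ?_ ?_
  · intro c hc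
    exact Finset.mem_image_of_mem _ (Finset.mem_filter.1 hc).2
  · intro c _ c' _ h
    rw [he] at h
    rw [← Quotient.out_eq c, ← Quotient.out_eq c']
    exact Quotient.sound h
  · intro x hx
    obtain ⟨d, hd, rfl⟩ := Finset.mem_image.1 hx
    have h1 : π.SameCycle d (⟦d⟧ : Cells π).out :=
      (Quotient.exact (Quotient.out_eq (⟦d⟧ : Cells π))).symm
    exact ⟨⟦d⟧, Finset.mem_filter.2 ⟨Finset.mem_univ _, hs _ _ h1 hd⟩, (he _ _).2 h1.symm⟩
  · intros; rfl

/-- `wt` leaves out the edge of the cilium and the root vertex. Both sides of that edge lie in the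
marked face, which gives `P(z,z)`, and the root vertex of a ciliated map is an ordinary black
vertex. -/
theorem weight_eq {K : Type*} [Field K] [Algebra ℂ K] [Fintype D] (G : CiliatedMap r N D)
    (V : ℂ[X]) (z : K) (lam : Fin N → K) :
    G.weight V z lam = propagator V z z * cornerWeight V (decoration z lam)
      ((orb G.rot G.toRMap.root).val.map G.color) *
      G.toRMap.wt (cornerWeight V (decoration z lam)) (edgeWeight V (decoration z lam)) := by
  have hp := G.toRMap_pre
  have h1 : ∏ e : Cells G.opp, propagator V (G.label z lam e.out) (G.label z lam (G.opp e.out)) =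
      propagator V z z * ∏ e ∈ G.toRMap.edges,
        edgeWeight V (decoration z lam) (e.map G.toRMap.color) := by
    have := prod_cells (π := G.opp) (e := fun d => s(d, G.opp d))
      (fun x y => hp.sameCycle_opp x y) Finset.univ (fun _ _ _ _ => Finset.mem_univ _)
      (fun e => edgeWeight V (decoration z lam) (e.map G.toRMap.color))
    simp only [Finset.mem_univ, Finset.filter_true] at this
    refine (Eq.trans ?_ this).trans ?_
    · exact Finset.prod_congr rfl fun e _ => rfl
    · have h2 := hp.image_edges
      change (Finset.univ.image fun d => s(d, G.opp d)) = _ at h2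
      rw [h2, Finset.prod_insert Pre.cil_not_mem_edges]
      congr 1
      change propagator V (decoration z lam (G.toRMap.color _)) (decoration z lam (G.toRMap.color _)) = _
      rw [hp.color_root, show G.toRMap.color G.toRMap.cil = none from
        (G.color_eq_none _).2 (Equiv.Perm.SameCycle.refl _ _)]
      rfl
  have h2 : ∏ v ∈ (Finset.univ : Finset (Cells G.rot)).filter fun v => v ≠ ⟦G.cil⟧,
      vertexWeight V (((Finset.univ : Finset D).filter fun d => (⟦d⟧ : Cells G.rot) = v).val.map
          (G.label z lam)) = cornerWeight V (decoration z lam)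
      ((orb G.rot G.toRMap.root).val.map G.color) * ∏ C ∈ G.toRMap.blacks,
        cornerWeight V (decoration z lam) (C.val.map G.toRMap.color) := by
    have := prod_cells (π := G.rot) (e := orb G.rot) (fun x y => orb_eq_iff)
      (Finset.univ.filter fun d => d ≠ G.cil) (by
        intro x y hxy hx
        simp only [Finset.mem_filter, Finset.mem_univ, true_and] at hx ⊢
        rintro rfl
        exact hp.not_sameCycle_cil hx hxy)
      (fun C => cornerWeight V (decoration z lam) (C.val.map G.toRMap.color))
    refine (Eq.trans ?_ this).trans ?_
    · refine Finset.prod_congr ?_ ?_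
      · ext v
        simp only [Finset.mem_filter, Finset.mem_univ, true_and]
        rw [not_iff_not]
        constructor
        · rintro rfl
          by_contra hne
          exact hp.not_sameCycle_cil hne (Quotient.exact (Quotient.out_eq (⟦G.cil⟧ : Cells G.rot)))
        · intro h; rw [← h, Quotient.out_eq]
      · intro v _
        rw [cornerWeight, Multiset.map_map]
        have : (Finset.univ : Finset D).filter (fun d => (⟦d⟧ : Cells G.rot) = v) = orb G.rot v.out := by
          ext d
          rw [mem_orb]
          simp only [Finset.mem_filter, Finset.mem_univ, true_and]
          constructor
          · rintro rfl
            exact Quotient.exact (Quotient.out_eq (⟦d⟧ : Cells G.rot))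
          · intro h
            rw [← Quotient.out_eq v]
            exact Quotient.sound h.symm
        rw [this]
        rfl
    · have : (Finset.univ.filter fun d => d ≠ G.cil).image (orb G.rot) =
          insert (orb G.rot G.toRMap.root) G.toRMap.blacks := by
        ext C
        rw [Finset.mem_insert, Finset.mem_image, mem_blacks]
        constructor
        · rintro ⟨d, hd, rfl⟩
          by_cases hs : G.rot.SameCycle G.toRMap.root d
          · exact Or.inl (orb_eq_iff.2 hs.symm)
          · exact Or.inr ⟨d, ⟨(Finset.mem_filter.1 hd).2, hs⟩, rfl⟩
        · rintro (rfl | ⟨d, hd, rfl⟩)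
          · exact ⟨_, Finset.mem_filter.2 ⟨Finset.mem_univ _, hp.root_ne_cil⟩, rfl⟩
          · exact ⟨d, Finset.mem_filter.2 ⟨Finset.mem_univ _, hd.1⟩, rfl⟩
      rw [this, Finset.prod_insert]
      · rfl
      · rw [mem_blacks]
        rintro ⟨d, hd, h⟩
        exact hd.2 (orb_eq_iff.1 h).symm
  rw [weight, mul_assoc, wt, mul_left_comm (cornerWeight _ _ _), ← mul_assoc, ← h1, ← h2]

end CiliatedMap

/-- The codes of the ciliated maps with a given Euler characteristic. -/
def Code.Cilium (r N m : ℕ) (c : Code (Option (Fin N))) : Prop :=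
  c.Valid r ∧ (3 ≤ c.path.length ∧ c.path.length ≤ r + 1) ∧ c.base = none ∧
    c.leaves (· = none) = 1 ∧ (c.leaves fun _ => True) = m + 1

namespace CiliatedMap

open RMap

variable {r N : ℕ} {D : Type}

theorem code_spec [Fintype D] (G : CiliatedMap r N D) {c : Code (Option (Fin N))} (hc : c.Valid r)
    {f : c.HalfEdge ≃ D} (h : map f c.toRMap = G.toRMap) :
    (3 ≤ c.path.length ∧ c.path.length ≤ r + 1) ∧ c.base = none ∧
    c.leaves (· = none) = 1 ∧ (c.leaves fun _ => True) = Nat.card (Cells (G.rot * G.opp)) ∧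
    ((orb G.rot G.toRMap.root).val.map G.color) = (c.path : Multiset (Option (Fin N))) := by
  obtain ⟨gc, ⟨L, hL, hp⟩, hb⟩ := c.realize_spec hc
  have h1 := isBd_map (π' := (map f c.toRMap).rot) (f := f) (fun d => by rw [map_rot]) hL
  rw [← map_root, h] at h1
  have h2 : c.path.length = (orb G.rot G.toRMap.root).card := by
    have := h1.card_orb
    change (orb G.rot G.toRMap.root).card = _ at this
    rw [this, ← hp]; simp
  have h3 : (orb G.rot G.toRMap.root).val.map G.color = (c.path : Multiset (Option (Fin N))) := by
    have e1 : (orb G.rot G.toRMap.root).val = (L.map f ++ [G.toRMap.root] : List D) := h1.orb_val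
    rw [e1, Multiset.map_coe, ← hp]
    congr 1
    have e2 : G.color = (map f c.toRMap).color := by rw [h]; rfl
    rw [e2, ← h, map_root, List.map_append, List.map_map, List.map_append]
    have e3 : (map f c.toRMap).color ∘ f = c.toRMap.color := funext fun d => map_color d
    rw [e3, List.map_singleton, List.map_singleton, map_color]
  refine ⟨by rw [h2]; exact G.card_orb_rot G.toRMap_pre.root_ne_cil, ?_, ?_, ?_, h3⟩
  · have e2 : G.toRMap.color G.toRMap.cil = c.base := by rw [← h, map_cil, map_color, hb]
    rw [← e2]
    exact (G.color_eq_none _).2 (Equiv.Perm.SameCycle.refl _ _)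
  · rw [← Code.faceCard_eq _ _ hc, ← map_faceCard (f := f) gc.toPre, h, G.faceCard_none]
  · rw [← Code.faceCard_eq _ _ hc, ← map_faceCard (f := f) gc.toPre, h, faceCard_true]
    rfl

theorem exists_ciliatedMap {m : ℕ} {c : Code (Option (Fin N))} (hc : c.Cilium r N m) :
    ∃ (n : ℕ) (G : CiliatedMap r N (Fin n)) (f : c.HalfEdge ≃ Fin n), map f c.toRMap = G.toRMap := by
  obtain ⟨h1, h2, h3, h4, h5⟩ := hc
  obtain ⟨gc, ⟨L, hL, hp⟩, hb⟩ := c.realize_spec h1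
  let f : c.HalfEdge ≃ Fin (Fintype.card c.HalfEdge) := Fintype.equivFin _
  have h1' := isBd_map (π' := (map f c.toRMap).rot) (f := f) (fun d => by rw [map_rot]) hL
  rw [← map_root] at h1'
  have gM := map_good gc f
  refine ⟨_, ofRMap (map f c.toRMap) gM ?_ ?_, f, rfl⟩
  · rw [h1'.card_orb]
    rw [← hp] at h2
    simpa using h2
  · refine color_eq_none_of_faceCard gM.toPre ?_ ?_
    · rw [map_faceCard gc.toPre, Code.faceCard_eq _ _ h1, h4]
    · rw [map_cil, map_color, hb, h3]

end CiliatedMap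

/-- Valid codes represent the isomorphism classes. By Euler's relation the condition `#E + 1 = #V +
m` says that there are `m + 1` faces, which are the leaves of the code. -/
theorem coeff_shiftedDisc {K : Type*} [Field K] [Algebra ℂ K] (r : ℕ) {N : ℕ} (V : ℂ[X])
    (z : K) (lam : Fin N → K) (m : ℕ) :
    PowerSeries.coeff m (shiftedDisc r V z lam) = ∑ᶠ c : {c : Code (Option (Fin N)) // c.Cilium r N m},
      propagator V z z * cornerWeight V (decoration z lam) c.1.path *
        c.1.wt (cornerWeight V (decoration z lam)) (edgeWeight V (decoration z lam)) := by
  have hex : ∀ G : CiliatedGraphs r N, ∃ c : Code (Option (Fin N)), c.Valid r ∧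
      ∃ f : c.HalfEdge ≃ Fin G.out.1, RMap.map f c.toRMap = G.out.2.toRMap :=
    fun G => Code.exists_map_eq G.out.2.toRMap_good
  choose c hc f hf using hex
  have hcil : ∀ G : CiliatedGraphs r N, (c G).Cilium r N m ↔
      Nat.card (Cells G.out.2.opp) + 1 = Nat.card (Cells G.out.2.rot) + m := by
    intro G
    obtain ⟨h1, h2, h3, h4, -⟩ := G.out.2.code_spec (hc G) (hf G)
    have h5 := G.out.2.genus_zero
    rw [Code.Cilium, h4]
    constructor
    · rintro ⟨-, -, -, -, h⟩; omega
    · intro h; exact ⟨hc G, h1, h2, h3, by omega⟩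
  rw [shiftedDisc, PowerSeries.coeff_mk]
  refine finsum_eq_of_bijective (fun G => ⟨c G.1, (hcil G.1).2 G.2⟩) ⟨?_, ?_⟩ ?_
  · rintro ⟨G, hG⟩ ⟨G', hG'⟩ h
    have h' : c G = c G' := congrArg Subtype.val h
    refine Subtype.ext ?_
    change G = G'
    have h1 := hf G
    have h2 := hf G'
    rw [← Quotient.out_eq G, ← Quotient.out_eq G']
    -- The code occurs in the type of the bijection, so the bijections are generalized before the
    -- two codes are identified.
    revert h1 h2
    generalize f G = e
    generalize f G' = e'
    revert e e'
    rw [← h']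
    intro e e' h1 h2
    refine Quotient.sound ⟨e.symm.trans e', (CiliatedMap.isIso_iff _ _ _).2 ?_⟩
    rw [← h1, RMap.map_map, ← h2]
    congr 1
    ext x
    simp
  · rintro ⟨c₀, h₀⟩
    obtain ⟨n, G, e, he⟩ := CiliatedMap.exists_ciliatedMap h₀
    let G' : CiliatedGraphs r N := ⟦⟨n, G⟩⟧
    obtain ⟨e', h'⟩ := Quotient.mk_out (s := ciliatedSetoid r N) ⟨n, G⟩
    rw [CiliatedMap.isIso_iff] at h'
    have key : c G' = c₀ := by
      refine Code.eq_of_map_eq (hc G') h₀.1 (f := ((f G').trans e').trans e.symm) ?_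
      rw [← RMap.map_map, ← RMap.map_map, hf]
      exact (congrArg (RMap.map e.symm) (h'.trans he.symm)).trans RMap.map_symm_map
    exact ⟨⟨G', (hcil G').1 (by rw [key]; exact h₀)⟩, Subtype.ext key⟩
  · rintro ⟨G, hG⟩
    obtain ⟨-, -, -, -, h1⟩ := G.out.2.code_spec (hc G) (hf G)
    rw [CiliatedMap.weight_eq, h1, ← Code.wt_eq _ _ _ (hc G), ← hf, RMap.map_wt]

end Rooted

/-! ### Laurent series in 1/x, polynomials and resolvents -/

section LaurentInfinity

variable {K : Type*} [Field K]

/-- The variable `x` of `K((1/x))`. -/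
noncomputable def xInf (K : Type*) [Field K] : LaurentSeries K := HahnSeries.single (-1) 1

theorem algebraMap_laurentSeries (c : K) :
    algebraMap K (LaurentSeries K) c = HahnSeries.single 0 c := by
  change HahnSeries.ofPowerSeries ℤ K (algebraMap K (PowerSeries K) c) = _
  rw [PowerSeries.algebraMap_apply, HahnSeries.ofPowerSeries_C]
  rfl

theorem coeff_algebraMap_mul (c : K) (f : LaurentSeries K) (n : ℤ) :
    (algebraMap K (LaurentSeries K) c * f).coeff n = c * f.coeff n := by
  rw [algebraMap_laurentSeries, HahnSeries.coeff_single_zero_mul]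

theorem coeff_aeval_xInf (p : K[X]) (n : ℤ) :
    (aeval (xInf K) p).coeff n = if n ≤ 0 then p.coeff (-n).toNat else 0 := by
  induction p using Polynomial.induction_on' with
  | add p q hp hq =>
    rw [map_add, HahnSeries.coeff_add, hp, hq, coeff_add]
    split_ifs <;> simp
  | monomial k a =>
    rw [aeval_monomial, xInf, HahnSeries.single_pow, algebraMap_laurentSeries,
      HahnSeries.single_mul_single, HahnSeries.coeff_single, coeff_monomial]
    simp only [one_pow, mul_one, nsmul_eq_mul, zero_add, mul_neg]
    split_ifs <;> first | rfl | omega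

/-- The Laurent series in `1/x` that are `O(x ^ (-m))`. -/
def VanishAt (K : Type*) [Field K] (m : ℤ) : Submodule K (LaurentSeries K) where
  carrier := {f | ∀ k < m, f.coeff k = 0}
  add_mem' := by
    intro f g hf hg k hk
    rw [HahnSeries.coeff_add, hf k hk, hg k hk, add_zero]
  zero_mem' := fun k _ => rfl
  smul_mem' := by
    intro c f hf k hk
    rw [HahnSeries.coeff_smul, hf k hk, smul_zero]

theorem mem_ord {m : ℤ} {f : LaurentSeries K} : f ∈ VanishAt K m ↔ ∀ k < m, f.coeff k = 0 := Iff.rfl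

theorem ord_mono {m n : ℤ} (h : m ≤ n) : VanishAt K n ≤ VanishAt K m :=
  fun _ hf k hk => hf k (lt_of_lt_of_le hk h)

theorem xInf_ne_zero : xInf K ≠ 0 := by
  rw [xInf]; simp

theorem ord_zero_iff {f : LaurentSeries K} :
    f ∈ VanishAt K 0 ↔ ∃ g : PowerSeries K, HahnSeries.ofPowerSeries ℤ K g = f := by
  constructor
  · intro hf
    refine ⟨PowerSeries.mk fun n => f.coeff n, ?_⟩
    ext k
    rcases lt_or_ge k 0 with hk | hk
    · rw [hf k hk, PowerSeries.coeff_coe, if_pos hk]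
    · obtain ⟨n, rfl⟩ := Int.eq_ofNat_of_zero_le hk
      simp
  · rintro ⟨g, rfl⟩ k hk
    rw [PowerSeries.coeff_coe, if_pos hk]

theorem mem_ord_iff {m : ℤ} {f : LaurentSeries K} :
    f ∈ VanishAt K m ↔ HahnSeries.single (-m) 1 * f ∈ VanishAt K 0 := by
  have h : ∀ k, (HahnSeries.single (-m) 1 * f).coeff k = f.coeff (k + m) := by
    intro k
    have := HahnSeries.coeff_single_mul_add (r := (1 : K)) (x := f) (a := k + m) (b := -m)
    rw [one_mul, show k + m + -m = k by ring] at this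
    exact this
  constructor
  · intro hf k hk
    rw [h]
    exact hf _ (by omega)
  · intro hf k hk
    have := hf (k - m) (by omega)
    rwa [h, sub_add_cancel] at this

theorem mul_mem_ord {m n : ℤ} {f g : LaurentSeries K} (hf : f ∈ VanishAt K m) (hg : g ∈ VanishAt K n) :
    f * g ∈ VanishAt K (m + n) := by
  obtain ⟨a, ha⟩ := ord_zero_iff.1 (mem_ord_iff.1 hf)
  obtain ⟨b, hb⟩ := ord_zero_iff.1 (mem_ord_iff.1 hg)
  refine mem_ord_iff.2 (ord_zero_iff.2 ⟨a * b, ?_⟩)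
  rw [map_mul, ha, hb, mul_mul_mul_comm, HahnSeries.single_mul_single, one_mul, neg_add]

theorem coeff_mul_of_ord {m n : ℤ} {f g : LaurentSeries K} (hf : f ∈ VanishAt K m) (hg : g ∈ VanishAt K n) :
    (f * g).coeff (m + n) = f.coeff m * g.coeff n := by
  have hs : ∀ (m : ℤ) (f : LaurentSeries K), f.coeff m = (HahnSeries.single (-m) 1 * f).coeff 0 := by
    intro m f
    have := HahnSeries.coeff_single_mul_add (r := (1 : K)) (x := f) (a := m) (b := -m)
    rw [one_mul, show m + -m = 0 by ring] at this
    exact this.symm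
  rw [hs, hs m f, hs n g]
  obtain ⟨a, ha⟩ := ord_zero_iff.1 (mem_ord_iff.1 hf)
  obtain ⟨b, hb⟩ := ord_zero_iff.1 (mem_ord_iff.1 hg)
  have e : HahnSeries.single (-(m + n)) 1 * (f * g) = HahnSeries.ofPowerSeries ℤ K (a * b) := by
    rw [map_mul, ha, hb, mul_mul_mul_comm, HahnSeries.single_mul_single, one_mul, neg_add]
  rw [e, ← ha, ← hb]
  rw [PowerSeries.coeff_coe, PowerSeries.coeff_coe, PowerSeries.coeff_coe]
  simp

/-- The polynomials in `x`. -/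
noncomputable def PolX (K : Type*) [Field K] : Subalgebra K (LaurentSeries K) :=
  (aeval (xInf K)).range

theorem mem_pol {f : LaurentSeries K} : f ∈ PolX K ↔ ∃ p : K[X], aeval (xInf K) p = f := Iff.rfl

theorem aeval_mem_pol (p : K[X]) : aeval (xInf K) p ∈ PolX K := ⟨p, rfl⟩

theorem xInf_mem_pol : xInf K ∈ PolX K := ⟨X, aeval_X _⟩

theorem aeval_mem_ord_iff {p : K[X]} {m : ℕ} :
    aeval (xInf K) p ∈ VanishAt K (-m) ↔ p.natDegree ≤ m := by
  constructor
  · intro h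
    rw [natDegree_le_iff_coeff_eq_zero]
    intro k hk
    have := h (-k) (by omega)
    rw [coeff_aeval_xInf, if_pos (by omega)] at this
    simpa using this
  · intro h k hk
    rw [coeff_aeval_xInf, if_pos (by omega)]
    exact coeff_eq_zero_of_natDegree_lt (by omega)

theorem aeval_mem_ord_one {p : K[X]} (h : aeval (xInf K) p ∈ VanishAt K 1) : p = 0 := by
  ext k
  have := h (-k) (by omega)
  rw [coeff_aeval_xInf, if_pos (by omega)] at this
  simpa using this

theorem aeval_xInf_injective : Function.Injective (aeval (R := K) (xInf K)) := by
  rw [injective_iff_map_eq_zero]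
  intro p hp
  refine aeval_mem_ord_one ?_
  rw [hp]
  exact Submodule.zero_mem _

/-- Liouville's argument in algebraic form. All identities between functions of `x` below are
obtained by showing that a difference is polynomial and vanishes at infinity. -/
theorem eq_zero_of_mem_pol_of_mem_ord {f : LaurentSeries K} (h1 : f ∈ PolX K) (h2 : f ∈ VanishAt K 1) :
    f = 0 := by
  obtain ⟨p, rfl⟩ := mem_pol.1 h1
  rw [aeval_mem_ord_one h2, map_zero]

theorem xInf_sub_ne_zero (c : K) : xInf K - algebraMap K (LaurentSeries K) c ≠ 0 := by
  intro h
  have : aeval (xInf K) (X - C c) = aeval (xInf K) (0 : K[X]) := by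
    rw [map_sub, aeval_X, aeval_C, h, map_zero]
  exact X_sub_C_ne_zero c (aeval_xInf_injective this)

/-- The resolvent `1 / (x - c)`. -/
noncomputable def resolv (c : K) : LaurentSeries K := (xInf K - algebraMap K _ c)⁻¹

theorem resolvent_eq (c : K) :
    resolv c = HahnSeries.ofPowerSeries ℤ K (PowerSeries.X * PowerSeries.mk fun l => c ^ l) := by
  rw [resolv, inv_eq_iff_eq_inv, eq_comm, inv_eq_iff_eq_inv, eq_comm]
  refine inv_eq_of_mul_eq_one_right ?_
  have h : xInf K - algebraMap K _ c =
      xInf K * HahnSeries.ofPowerSeries ℤ K (1 - PowerSeries.C c * PowerSeries.X) := by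
    rw [map_sub, map_one, map_mul, HahnSeries.ofPowerSeries_C, HahnSeries.ofPowerSeries_X,
      algebraMap_laurentSeries, mul_sub, mul_one, xInf, HahnSeries.C_apply,
      HahnSeries.single_mul_single, HahnSeries.single_mul_single]
    simp
  have h2 : xInf K * HahnSeries.ofPowerSeries ℤ K PowerSeries.X = 1 := by
    rw [HahnSeries.ofPowerSeries_X, xInf, HahnSeries.single_mul_single]
    simp
  rw [h, map_mul, mul_mul_mul_comm, h2, one_mul, ← map_mul, mul_comm, mk_pow_mul_one_sub, map_one]

theorem resolvent_mem_ord (c : K) : resolv c ∈ VanishAt K 1 := by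
  intro k hk
  rw [resolvent_eq, PowerSeries.coeff_coe]
  split_ifs with h
  · rfl
  · obtain rfl : k = 0 := by omega
    simp

theorem coeff_one_resolvent (c : K) : (resolv c).coeff 1 = 1 := by
  rw [resolvent_eq, PowerSeries.coeff_coe, if_neg (by omega), mul_comm]
  exact (PowerSeries.coeff_succ_mul_X 0 _).trans (by simp)

theorem coeff_two_resolvent (c : K) : (resolv c).coeff 2 = c := by
  rw [resolvent_eq, PowerSeries.coeff_coe, if_neg (by omega), mul_comm]
  exact (PowerSeries.coeff_succ_mul_X 1 _).trans (by simp)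

theorem mul_resolvent (c : K) : (xInf K - algebraMap K _ c) * resolv c = 1 :=
  mul_inv_cancel₀ (xInf_sub_ne_zero c)

end LaurentInfinity

/-! ### Divided differences -/

section DividedDifference

variable {K : Type*} [Field K]

/-- The divided difference of `X ^ k` at the points of a list. -/
noncomputable def divPow (k : ℕ) (p : List K) : K :=
  -- In the variable `1/x`, each factor is `1/(x - c)`. The coefficient of `x^(-k-1)` is the residue
  -- of `x^k ∏ 1/(x - c)` at infinity, up to sign.
  PowerSeries.coeff (k + 1) (p.map fun c => PowerSeries.X * PowerSeries.mk fun l => c ^ l).prod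

theorem divPow_nil (k : ℕ) : divPow k ([] : List K) = 0 := by
  simp [divPow, PowerSeries.coeff_one]

theorem divPow_eq (k : ℕ) (p : List K) :
    divPow k p = if p.length ≤ k + 1 then completeHom (p : Multiset K) (k + 1 - p.length) else 0 := by
  have : (p.map fun c => PowerSeries.X * PowerSeries.mk fun l => c ^ l).prod =
      (PowerSeries.X : PowerSeries K) ^ p.length *
        ((p : Multiset K).map fun a => PowerSeries.mk fun l => a ^ l).prod := by
    rw [List.prod_map_mul, List.map_const', List.prod_replicate, Multiset.map_coe, Multiset.prod_coe]
  rw [divPow, this, PowerSeries.coeff_X_pow_mul', completeHom]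

theorem divPow_zero (c : K) (p : List K) : divPow 0 (c :: p) = if p = [] then 1 else 0 := by
  rw [divPow_eq]
  cases p with
  | nil => simp [completeHom]
  | cons c p => simp

/-- From `x/(x - c) = 1 + c/(x - c)`, applied to the first factor. For the empty list `divPow` is
`0`, so the recursion also holds for a single point. -/
theorem divPow_succ (k : ℕ) (c : K) (p : List K) :
    divPow (k + 1) (c :: p) = c * divPow k (c :: p) + divPow k p := by
  have h : (((c :: p).map fun c => PowerSeries.X * PowerSeries.mk fun l => c ^ l).prod) =
      PowerSeries.C c * PowerSeries.X *
        (((c :: p).map fun c => PowerSeries.X * PowerSeries.mk fun l => c ^ l).prod) +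
      PowerSeries.X * ((p.map fun c => PowerSeries.X * PowerSeries.mk fun l => c ^ l).prod) := by
    have h1 := mk_pow_mul_one_sub c
    rw [List.map_cons, List.prod_cons]
    linear_combination ((p.map fun c => PowerSeries.X * PowerSeries.mk fun l => c ^ l).prod) *
      PowerSeries.X * h1
  rw [divPow, h, map_add, mul_comm (PowerSeries.C c), mul_assoc, mul_comm PowerSeries.X,
    PowerSeries.coeff_succ_mul_X, PowerSeries.coeff_C_mul, mul_comm PowerSeries.X,
    PowerSeries.coeff_succ_mul_X]
  rfl

theorem divPow_singleton (k : ℕ) (c : K) : divPow k [c] = c ^ k := by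
  induction k with
  | zero => simp [divPow_zero]
  | succ k ih => rw [divPow_succ, ih, divPow_nil, pow_succ']; ring

/-- The resolvent `∏ 1 / (x - c)`. -/
noncomputable def resolventProd (p : List K) : LaurentSeries K := (p.map resolv).prod

theorem resolventProd_cons (c : K) (p : List K) :
    (xInf K - algebraMap K _ c) * resolventProd (c :: p) = resolventProd p := by
  rw [resolventProd, List.map_cons, List.prod_cons, ← mul_assoc, mul_resolvent, one_mul]
  rfl

theorem resolventProd_append (p q : List K) :
    resolventProd (p ++ q) = resolventProd p * resolventProd q := by
  simp [resolventProd]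

/-- Newton's expansion: each power of `x` either produces a factor `c` or removes the first
resolvent. The last point of the divided difference is also the first point of the remaining
product, which explains the overlap of `take (i + 1)` and `drop i`. -/
theorem xInf_pow_mul_resolventProd (k : ℕ) (p : List K) :
    xInf K ^ k * resolventProd p - ∑ i ∈ Finset.range p.length,
      algebraMap K _ (divPow k (p.take (i + 1))) * resolventProd (p.drop i) ∈ PolX K := by
  induction k generalizing p with
  | zero =>
    cases p with
    | nil => simp [resolventProd]
    | cons c p =>
      rw [List.length_cons, Finset.sum_range_succ', Finset.sum_eq_zero]
      · simp [divPow_zero]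
      · intro i hi
        rw [List.take_succ_cons, divPow_zero, if_neg, map_zero, zero_mul]
        rw [Finset.mem_range] at hi
        intro h
        rw [List.take_eq_nil_iff] at h
        rcases h with h | h
        · omega
        · rw [h] at hi; simp at hi
  | succ k ih =>
    cases p with
    | nil =>
      simpa [resolventProd] using Subalgebra.pow_mem _ xInf_mem_pol _
    | cons c p =>
      have h1 := Subalgebra.mul_mem _ (Subalgebra.algebraMap_mem (PolX K) c) (ih (c :: p))
      have h2 := ih p
      convert Subalgebra.add_mem _ h1 h2 using 1
      have e1 : xInf K ^ (k + 1) * resolventProd (c :: p) =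
          algebraMap K _ c * (xInf K ^ k * resolventProd (c :: p)) + xInf K ^ k * resolventProd p := by
        linear_combination (xInf K ^ k) * resolventProd_cons c p
      rw [e1, mul_sub, Finset.mul_sum]
      have e2 : ∑ i ∈ Finset.range (c :: p).length,
          algebraMap K _ (divPow (k + 1) ((c :: p).take (i + 1))) * resolventProd ((c :: p).drop i) =
          ∑ i ∈ Finset.range (c :: p).length,
            algebraMap K (LaurentSeries K) c * (algebraMap K _ (divPow k ((c :: p).take (i + 1))) *
              resolventProd ((c :: p).drop i)) +
          ∑ i ∈ Finset.range p.length,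
            algebraMap K _ (divPow k (p.take (i + 1))) * resolventProd (p.drop i) := by
        have e3 : ∑ i ∈ Finset.range p.length,
            algebraMap K _ (divPow k (p.take (i + 1))) * resolventProd (p.drop i) =
            ∑ i ∈ Finset.range (c :: p).length,
              algebraMap K _ (divPow k (p.take i)) * resolventProd ((c :: p).drop i) := by
          rw [List.length_cons, Finset.sum_range_succ']
          simp [divPow_nil]
        rw [e3, ← Finset.sum_add_distrib]
        refine Finset.sum_congr rfl fun i _ => ?_
        rw [List.take_succ_cons, divPow_succ, map_add, map_mul]
        ring
      rw [e2]
      ring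

theorem divPow_pair (k : ℕ) (a b : K) : (a - b) * divPow k [a, b] = a ^ k - b ^ k := by
  induction k with
  | zero => simp [divPow_zero]
  | succ k ih =>
    rw [divPow_succ, divPow_singleton, mul_add, mul_left_comm, ih]
    ring

theorem divPow_pair_self (k : ℕ) (a : K) : divPow k [a, a] = k * a ^ (k - 1) := by
  induction k with
  | zero => simp [divPow_zero]
  | succ k ih =>
    rw [divPow_succ, divPow_singleton, ih]
    cases k with
    | zero => simp
    | succ k => push_cast; ring

variable [Algebra ℂ K] (V : ℂ[X])

/-- The divided difference of `V'` at the points of a list. -/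
noncomputable def divDer (p : List K) : K :=
  ∑ j ∈ Finset.range V.natDegree, algebraMap ℂ K ((derivative V).coeff j) * divPow j p

/-- This is the form of the vertex weight, valid without distinctness of the points, in which black
vertices cancel terms of the expansion of `V'(x)`. -/
theorem divDer_eq_neg_vertexWeight {p : List K} (hp : p ≠ []) :
    divDer V p = -vertexWeight V (p : Multiset K) := by
  rw [divDer, vertexWeight, neg_neg, Multiset.coe_card]
  have hc : 0 < p.length := List.length_pos_iff.2 hp
  simp only [divPow_eq, mul_ite, mul_zero]
  rw [← Finset.sum_filter]
  refine Finset.sum_nbij' (fun m => m + 1) (fun j => j - 1) ?_ ?_ ?_ ?_ ?_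
  · intro j hj; simp only [Finset.mem_Icc, Finset.mem_filter, Finset.mem_range] at *; omega
  · intro j hj; simp only [Finset.mem_Icc, Finset.mem_filter, Finset.mem_range] at *; omega
  · intro j hj; simp
  · intro j hj; simp only [Finset.mem_Icc] at *; omega
  · intro j hj; simp

theorem divDer_eq_zero {p : List K} (hp : V.natDegree < p.length) : divDer V p = 0 := by
  refine Finset.sum_eq_zero fun j hj => ?_
  rw [Finset.mem_range] at hj
  rw [divPow_eq, if_neg (by omega), mul_zero]

theorem dV_eq_sum (a : K) : dV V a =
    ∑ j ∈ Finset.range V.natDegree, algebraMap ℂ K ((derivative V).coeff j) * a ^ j := by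
  rcases Nat.eq_zero_or_pos V.natDegree with h0 | h0
  · rw [eq_C_of_natDegree_eq_zero h0]; simp [dV]
  · rw [dV, aeval_eq_sum_range' (n := V.natDegree) (natDegree_derivative_lt h0.ne')]
    simp [Algebra.smul_def]

theorem divDer_singleton (a : K) : divDer V [a] = dV V a := by
  rw [dV_eq_sum, divDer]
  simp only [divPow_singleton]

theorem divDer_pair (a b : K) : (a - b) * divDer V [a, b] = dV V a - dV V b := by
  rw [divDer, Finset.mul_sum, dV_eq_sum, dV_eq_sum, ← Finset.sum_sub_distrib]
  refine Finset.sum_congr rfl fun j _ => ?_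
  rw [mul_left_comm, divPow_pair, mul_sub]

theorem divDer_pair_self (a : K) : divDer V [a, a] = ddV V a := by
  rw [divDer, ddV, derivative_apply (derivative V), Polynomial.sum, map_sum,
    ← Finset.sum_subset (s₁ := (derivative V).support)]
  · refine Finset.sum_congr rfl fun j _ => ?_
    rw [divPow_pair_self]
    simp
    ring
  · intro j hj
    rw [Finset.mem_range]
    by_contra hn
    rw [mem_support_iff] at hj
    apply hj
    rcases Nat.eq_zero_or_pos V.natDegree with h0 | h0
    · rw [eq_C_of_natDegree_eq_zero h0]; simp
    · exact coeff_eq_zero_of_natDegree_lt (lt_of_lt_of_le (natDegree_derivative_lt h0.ne') (by omega))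
  · intro j _ hj
    rw [notMem_support_iff.1 hj]
    simp

/-- The propagator is the inverse of the divided difference of `V'` at two points, also when they
coincide. This cancels the weight of the first edge. -/
theorem propagator_mul_divDer {a b : K} (h : a ≠ b → dV V a ≠ dV V b) (h' : a = b → ddV V a ≠ 0) :
    propagator V a b * divDer V [a, b] = 1 := by
  by_cases hab : a = b
  · subst hab
    rw [propagator, if_pos rfl, divDer_pair_self, one_div_mul_cancel (h' rfl)]
  · rw [propagator, if_neg hab, div_mul_eq_mul_div, divDer_pair,
      div_self (sub_ne_zero.2 (h hab))]

theorem dV_xInf_mul_resolventProd (p : List K) :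
    aeval (xInf K) ((derivative V).map (algebraMap ℂ K)) * resolventProd p -
      ∑ i ∈ Finset.range p.length,
        algebraMap K _ (divDer V (p.take (i + 1))) * resolventProd (p.drop i) ∈ PolX K := by
  have e1 : aeval (xInf K) ((derivative V).map (algebraMap ℂ K)) =
      ∑ j ∈ Finset.range V.natDegree,
        algebraMap K _ (algebraMap ℂ K ((derivative V).coeff j)) * xInf K ^ j := by
    rcases Nat.eq_zero_or_pos V.natDegree with h0 | h0
    · rw [eq_C_of_natDegree_eq_zero h0]; simp
    · rw [aeval_eq_sum_range' (n := V.natDegree)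
        (lt_of_le_of_lt (natDegree_map_le) (natDegree_derivative_lt h0.ne'))]
      simp [Algebra.smul_def]
  have e2 : ∑ i ∈ Finset.range p.length,
        algebraMap K _ (divDer V (p.take (i + 1))) * resolventProd (p.drop i) =
      ∑ j ∈ Finset.range V.natDegree, algebraMap K (LaurentSeries K)
        (algebraMap ℂ K ((derivative V).coeff j)) * ∑ i ∈ Finset.range p.length,
        algebraMap K _ (divPow j (p.take (i + 1))) * resolventProd (p.drop i) := by
    simp only [Finset.mul_sum]
    rw [Finset.sum_comm]
    refine Finset.sum_congr rfl fun i _ => ?_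
    rw [divDer, map_sum, Finset.sum_mul]
    refine Finset.sum_congr rfl fun j _ => ?_
    rw [map_mul, mul_assoc]
  rw [e1, e2, Finset.sum_mul, ← Finset.sum_sub_distrib]
  refine Subalgebra.sum_mem _ fun j _ => ?_
  rw [mul_assoc, ← mul_sub]
  exact Subalgebra.mul_mem _ (Subalgebra.algebraMap_mem _ _) (xInf_pow_mul_resolventProd j p)

end DividedDifference

set_option linter.unusedSectionVars false

/-! ### Generating functions and loop equations -/

section LoopEquation

open Classical

namespace Code

variable {N : ℕ}

/-- The codes with base `a` and `m` leaves, for which `z` decorates no leaf if `a = some j`, and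
exactly one if `a = none`. -/
noncomputable def family (r : ℕ) (a : Option (Fin N)) (m : ℕ) : Finset (Code (Option (Fin N))) :=
  (finite_leaves r m).toFinset.filter fun c => c.base = a ∧
    c.leaves (· = none) = if a = none then 1 else 0

theorem mem_family {r : ℕ} {a : Option (Fin N)} {m : ℕ} {c : Code (Option (Fin N))} :
    c ∈ family r a m ↔ c.Valid r ∧ (c.leaves fun _ => True) = m ∧ c.base = a ∧
      c.leaves (· = none) = if a = none then 1 else 0 := by
  simp [family, and_assoc]

theorem loop_mem_family {r : ℕ} {a : Option (Fin N)} {m : ℕ} {c d : Code (Option (Fin N))} :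
    loop c d ∈ family r a m ↔ ∃ (b : Fin N) (i j : ℕ), i + j = m ∧ c ∈ family r (some b) i ∧
      d ∈ family r a j := by
  constructor
  · intro h
    obtain ⟨⟨h1, h2⟩, h3, h4, h5⟩ := mem_family.1 h
    simp only [leaves] at h3 h5
    have h4 : d.base = a := h4
    -- A leaf decorated by `z` is the base face of `d` when `a = none` and is absent otherwise, so
    -- the inner part has none.
    have hc : c.leaves (· = none) = 0 := by
      by_cases ha : a = none
      · have := d.leaves_base_pos (P := (· = none)) (h4.trans ha)
        rw [if_pos ha] at h5; omega
      · rw [if_neg ha] at h5; omega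
    rcases hb : c.base with _ | b
    · have := c.leaves_base_pos (P := (· = none)) hb
      omega
    · refine ⟨b, _, _, h3, mem_family.2 ⟨h1, rfl, hb, by simpa using hc⟩,
        mem_family.2 ⟨h2, rfl, h4, by omega⟩⟩
  · rintro ⟨b, i, j, rfl, hc, hd⟩
    obtain ⟨c1, c2, c3, c4⟩ := mem_family.1 hc
    obtain ⟨d1, d2, d3, d4⟩ := mem_family.1 hd
    refine mem_family.2 ⟨⟨c1, d1⟩, ?_, d3, ?_⟩
    · simp only [leaves]; omega
    · simp only [leaves, c4, d4]; simp

theorem contract_mem_family {r : ℕ} {a : Option (Fin N)} {m k : ℕ} {c : Code (Option (Fin N))} :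
    contract k c ∈ family r a m ↔ c ∈ family r a m ∧ 1 ≤ k ∧ k + 2 ≤ r + 1 ∧ k + 2 ≤ c.path.length := by
  rw [mem_family, mem_family, Valid, leaves, leaves, base]
  tauto

theorem nil_mem_family {r : ℕ} {a b : Option (Fin N)} {m : ℕ} :
    nil b ∈ family r a m ↔ b = a ∧ m = 1 := by
  rw [mem_family, leaves, leaves, base, if_pos trivial]
  constructor
  · rintro ⟨-, h1, h2, -⟩
    exact ⟨h2, h1.symm⟩
  · rintro ⟨rfl, rfl⟩
    exact ⟨trivial, rfl, rfl, by congr⟩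

/-- The constructor of a code. -/
def kind {I : Type} : Code I → Fin 3
  | nil _ => 0
  | loop _ _ => 1
  | contract _ _ => 2

variable {M : Type*} [AddCommMonoid M]

theorem sum_family_loop (r : ℕ) (a : Option (Fin N)) (m : ℕ) (f : Code (Option (Fin N)) → M) :
    ∑ c ∈ (family r a m).filter (fun c => c.kind = 1), f c =
      ∑ b : Fin N, ∑ ij ∈ Finset.HasAntidiagonal.antidiagonal m,
        ∑ p ∈ family r (some b) ij.1 ×ˢ family r a ij.2, f (loop p.1 p.2) := by
  rw [Finset.sum_sigma', Finset.sum_sigma']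
  symm
  refine Finset.sum_nbij (fun p => loop p.2.1 p.2.2) ?_ ?_ ?_ fun _ _ => rfl
  · rintro ⟨⟨b, i, j⟩, c, d⟩ h
    simp only [Finset.mem_sigma, Finset.mem_univ, true_and, Finset.HasAntidiagonal.mem_antidiagonal,
      Finset.mem_product] at h
    exact Finset.mem_filter.2 ⟨loop_mem_family.2 ⟨b, i, j, h.1, h.2.1, h.2.2⟩, rfl⟩
  · rintro ⟨⟨b, i, j⟩, c, d⟩ h ⟨⟨b', i', j'⟩, c', d'⟩ h' he
    simp only [Finset.coe_sigma, Set.mem_sigma_iff, Finset.mem_coe, Finset.mem_univ, true_and, Finset.HasAntidiagonal.mem_antidiagonal,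
      Finset.mem_product] at h h'
    simp only [loop.injEq] at he
    obtain ⟨rfl, rfl⟩ := he
    obtain ⟨-, h1, h2, -⟩ := mem_family.1 h.2.1
    obtain ⟨-, h3, h4, -⟩ := mem_family.1 h'.2.1
    obtain ⟨-, h5, -, -⟩ := mem_family.1 h.2.2
    obtain ⟨-, h6, -, -⟩ := mem_family.1 h'.2.2
    obtain rfl : i = i' := h1.symm.trans h3
    obtain rfl : j = j' := h5.symm.trans h6
    obtain rfl : b = b' := Option.some_injective _ (h2.symm.trans h4)
    rfl
  · intro c hc
    obtain ⟨h1, h2⟩ := Finset.mem_filter.1 hc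
    cases c with
    | nil => simp [kind] at h2
    | contract => simp [kind] at h2
    | loop c d =>
      obtain ⟨b, i, j, hij, hc, hd⟩ := loop_mem_family.1 h1
      refine ⟨⟨⟨b, i, j⟩, c, d⟩, ?_, rfl⟩
      simp only [Finset.mem_coe, Finset.mem_sigma, Finset.mem_univ, true_and,
        Finset.HasAntidiagonal.mem_antidiagonal, Finset.mem_product]
      exact ⟨hij, hc, hd⟩

theorem sum_family_contract (r : ℕ) (a : Option (Fin N)) (m : ℕ)
    (f : Code (Option (Fin N)) → M) :
    ∑ c ∈ (family r a m).filter (fun c => c.kind = 2), f c =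
      ∑ c ∈ family r a m, ∑ k ∈ (Finset.range (c.path.length - 1)).filter
        (fun k => 1 ≤ k ∧ k + 2 ≤ r + 1), f (contract k c) := by
  rw [Finset.sum_sigma']
  symm
  refine Finset.sum_nbij (fun p => contract p.2 p.1) ?_ ?_ ?_ fun _ _ => rfl
  · rintro ⟨c, k⟩ h
    simp only [Finset.mem_sigma, Finset.mem_filter, Finset.mem_range] at h
    have h' : k < c.path.length - 1 := h.2.1
    exact Finset.mem_filter.2 ⟨contract_mem_family.2 ⟨h.1, h.2.2.1, h.2.2.2, by
      change k + 2 ≤ c.path.length; omega⟩, rfl⟩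
  · rintro ⟨c, k⟩ h ⟨c', k'⟩ h' he
    simp only [contract.injEq] at he
    obtain ⟨rfl, rfl⟩ := he
    rfl
  · intro c hc
    obtain ⟨h1, h2⟩ := Finset.mem_filter.1 hc
    cases c with
    | nil => simp [kind] at h2
    | loop => simp [kind] at h2
    | contract k c =>
      obtain ⟨h3, h4, h5, h6⟩ := contract_mem_family.1 h1
      refine ⟨⟨c, k⟩, ?_, rfl⟩
      simp only [Finset.mem_coe, Finset.mem_sigma, Finset.mem_filter, Finset.mem_range]
      exact ⟨h3, by omega, h4, h5⟩

theorem sum_family (r : ℕ) (a : Option (Fin N)) (m : ℕ) (f : Code (Option (Fin N)) → M) :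
    ∑ c ∈ family r a m, f c = ∑ c ∈ (family r a m).filter (fun c => c.kind = 0), f c +
      ∑ c ∈ (family r a m).filter (fun c => c.kind = 1), f c +
      ∑ c ∈ (family r a m).filter (fun c => c.kind = 2), f c := by
  rw [← Finset.sum_fiberwise (family r a m) kind f, Fin.sum_univ_three]

theorem path_eq_concat {I : Type} {r : ℕ} (c : Code I) (h : c.Valid r) :
    ∃ p, c.path = p ++ [c.base] := by
  induction c with
  | nil c => exact ⟨[], rfl⟩
  | loop a b ha hb =>
    obtain ⟨p, hp⟩ := hb h.2
    exact ⟨b.base :: (a.path ++ p), by simp [path, hp, base]⟩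
  | contract k m hm =>
    obtain ⟨p, hp⟩ := hm h.1
    have := h.2.2.2
    rw [hp] at this
    simp only [List.length_append, List.length_singleton] at this
    exact ⟨m.base :: p.drop (k + 1), by
      rw [path, hp, List.drop_append_of_le_length (by omega)]; rfl⟩

theorem kind_of_length_le_two {I : Type} (c : Code I) (h : c.path.length ≤ 2) : c.kind ≠ 1 := by
  cases c with
  | nil => simp [kind]
  | contract => simp [kind]
  | loop a b =>
    have := a.length_path_pos
    have := b.length_path_pos
    simp only [path, List.length_cons, List.length_append] at h
    omega

end Code

open Code

variable {K : Type*} [Field K] [Algebra ℂ K] {N : ℕ} (V : ℂ[X]) (x : Option (Fin N) → K)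

/-- The weight of a code. -/
noncomputable def codeWeight (c : Code (Option (Fin N))) : K :=
  c.wt (cornerWeight V x) (edgeWeight V x)

/-- The coefficients of the generating series of the codes with a given base. -/
noncomputable def genCoeff (r : ℕ) (a : Option (Fin N)) (m : ℕ) : LaurentSeries K :=
  ∑ c ∈ family r a m, algebraMap K _ (codeWeight V x c) * resolventProd (c.path.map x)

/-- `V'(x)`, as a Laurent series in `1/x`. -/
noncomputable def dVInf (K : Type*) [Field K] [Algebra ℂ K] (V : ℂ[X]) : LaurentSeries K :=
  aeval (xInf K) ((derivative V).map (algebraMap ℂ K))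

/-- The terms that occur when `V'` is expanded at the points of the path of a code. -/
noncomputable def pathTerm (c : Code (Option (Fin N))) (i : ℕ) : LaurentSeries K :=
  algebraMap K _ (codeWeight V x c) * (algebraMap K _ (divDer V ((c.path.map x).take (i + 1))) *
    resolventProd ((c.path.map x).drop i))

/-- The divided difference at the first point alone is `V'(x_a)`, as every path starts with the
base. The remaining terms of the expansion are indexed from `1` on. -/
theorem genCoeff_sub_mem (r : ℕ) (a : Option (Fin N)) (m : ℕ) :
    (dVInf K V - algebraMap K _ (dV V (x a))) * genCoeff V x r a m -
      ∑ c ∈ family r a m, ∑ i ∈ Finset.range (c.path.length - 1), pathTerm V x c (i + 1) ∈ PolX K := by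
  rw [genCoeff, Finset.mul_sum, ← Finset.sum_sub_distrib]
  refine Subalgebra.sum_mem _ fun c hc => ?_
  have h1 := Subalgebra.mul_mem _ (Subalgebra.algebraMap_mem (PolX K) (codeWeight V x c))
    (dV_xInf_mul_resolventProd V (c.path.map x))
  convert h1 using 1
  obtain ⟨p, hp⟩ := c.path_eq_cons
  have hb : c.base = a := (mem_family.1 hc).2.2.1
  rw [List.length_map, hp, List.length_cons, Finset.sum_range_succ', Nat.add_sub_cancel]
  simp only [pathTerm, hp, List.map_cons, List.take_succ_cons, zero_add, List.take_zero, List.drop_zero,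
    divDer_singleton, hb, ← Finset.mul_sum]
  rw [dVInf]
  ring

variable {V x}

/-- The propagator of the contracted edge cancels the divided difference at the first two corners,
and the weight of the contracted vertex is minus the divided difference at the first `k + 2` corners
of `c`. The remaining resolvents agree. -/
theorem pathTerm_contract {r k : ℕ} {c : Code (Option (Fin N))}
    (h1 : ∀ a b, x a ≠ x b → dV V (x a) ≠ dV V (x b)) (h2 : ∀ a, ddV V (x a) ≠ 0)
    (h : (contract k c).Valid r) : pathTerm V x (contract k c) 1 = -pathTerm V x c (k + 1) := by
  have hlen := h.2.2.2
  have hk : k + 1 < c.path.length := by omega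
  obtain ⟨q, hq⟩ : ∃ q, c.path.drop (k + 1) = c.path[k + 1] :: q :=
    ⟨_, (List.cons_getElem_drop_succ (h := hk)).symm⟩
  have e1 : (contract k c).path = c.base :: c.path[k + 1] :: q := by rw [path, hq]
  have e2 : codeWeight V x (contract k c) = propagator V (x c.base) (x c.path[k + 1]) *
      cornerWeight V x (c.path.take (k + 2) : List _) * codeWeight V x c := by
    rw [codeWeight, wt, List.getD_eq_getElem _ _ hk]
    rfl
  have e3 : cornerWeight V x (c.path.take (k + 2) : List _) =
      -divDer V ((c.path.map x).take (k + 2)) := by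
    rw [divDer_eq_neg_vertexWeight, neg_neg, ← List.map_take]
    · rfl
    · obtain ⟨p, hp⟩ := c.path_eq_cons
      simp [hp]
  rw [pathTerm, pathTerm, e1, e2, e3, ← List.map_drop, ← List.map_drop, hq]
  have e4 := propagator_mul_divDer V (h1 c.base c.path[k + 1]) (fun _ => h2 c.base)
  simp only [List.map_cons, List.take_succ_cons, List.take_zero, List.drop_succ_cons, List.drop_zero]
  rw [← mul_assoc, ← mul_assoc, ← neg_mul, ← map_mul, ← map_mul, ← map_neg]
  congr 2
  linear_combination (-divDer V ((c.path.map x).take (k + 2)) * codeWeight V x c) * e4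

/-- Once the propagator of the loop has cancelled the divided difference, the rest of the path is
that of `c` followed by that of `d`. -/
theorem pathTerm_loop {c d : Code (Option (Fin N))}
    (h1 : ∀ a b, x a ≠ x b → dV V (x a) ≠ dV V (x b)) (h2 : ∀ a, ddV V (x a) ≠ 0) :
    pathTerm V x (loop c d) 1 =
      (algebraMap K _ (codeWeight V x c) * resolventProd (c.path.map x)) *
      (algebraMap K _ (codeWeight V x d) * resolventProd (d.path.map x)) := by
  obtain ⟨q, hq⟩ := c.path_eq_cons
  have e2 : codeWeight V x (loop c d) = propagator V (x d.base) (x c.base) *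
      codeWeight V x c * codeWeight V x d := rfl
  have e4 := propagator_mul_divDer V (h1 d.base c.base) (fun _ => h2 d.base)
  have e1 : (loop c d).path = d.base :: (c.path ++ d.path) := rfl
  rw [pathTerm, e1, e2]
  have e3 : ((d.base :: (c.path ++ d.path)).map x).take (1 + 1) = [x d.base, x c.base] := by
    simp [hq]
  rw [e3, List.map_cons, List.drop_succ_cons, List.drop_zero, List.map_append, resolventProd_append,
    mul_mul_mul_comm, ← mul_assoc, ← map_mul, ← map_mul]
  congr 2
  linear_combination (codeWeight V x c * codeWeight V x d) * e4

/-- The loop equations. -/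
theorem loop_equation {r : ℕ} (hV : V.natDegree = r + 1)
    (h1 : ∀ a b, x a ≠ x b → dV V (x a) ≠ dV V (x b)) (h2 : ∀ a, ddV V (x a) ≠ 0)
    (a : Option (Fin N)) (m : ℕ) :
    (dVInf K V - algebraMap K _ (dV V (x a))) * genCoeff V x r a m -
      ∑ b : Fin N, ∑ ij ∈ Finset.HasAntidiagonal.antidiagonal m,
        genCoeff V x r (some b) ij.1 * genCoeff V x r a ij.2 ∈ PolX K := by
  convert genCoeff_sub_mem V x r a m using 2
  -- The terms with `k + 2 > r + 1` vanish because `V'` has degree `r`. This matches the bound on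
  -- the degrees of black vertices.
  have e1 : ∀ c : Code (Option (Fin N)), ∑ i ∈ Finset.range (c.path.length - 1), pathTerm V x c (i + 1) =
      (if 2 ≤ c.path.length then pathTerm V x c 1 else 0) +
        ∑ i ∈ (Finset.range (c.path.length - 1)).filter (fun k => 1 ≤ k ∧ k + 2 ≤ r + 1),
          pathTerm V x c (i + 1) := by
    intro c
    have e2 : ∑ i ∈ (Finset.range (c.path.length - 1)).filter (fun k => 1 ≤ k ∧ k + 2 ≤ r + 1),
          pathTerm V x c (i + 1) =
        ∑ i ∈ (Finset.range (c.path.length - 1)).filter (fun k => ¬ k = 0),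
          pathTerm V x c (i + 1) := by
      refine Finset.sum_subset ?_ ?_
      · intro k hk
        simp only [Finset.mem_filter, Finset.mem_range] at hk ⊢
        omega
      · intro k hk hk'
        simp only [Finset.mem_filter, Finset.mem_range] at hk hk'
        rw [pathTerm, divDer_eq_zero, map_zero, zero_mul, mul_zero]
        rw [List.length_take, List.length_map]
        omega
    rw [e2, ← Finset.sum_filter_add_sum_filter_not _ (fun k => k = 0)]
    congr 1
    split_ifs with h
    · have : (Finset.range (c.path.length - 1)).filter (fun k => k = 0) = {0} := by
        ext k
        simp only [Finset.mem_filter, Finset.mem_range, Finset.mem_singleton]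
        omega
      rw [this, Finset.sum_singleton]
    · refine Finset.sum_eq_zero fun k hk => ?_
      simp only [Finset.mem_filter, Finset.mem_range] at hk
      omega
  rw [Finset.sum_congr rfl fun c _ => e1 c, Finset.sum_add_distrib, sum_family]
  have e3 : ∑ c ∈ (family r a m).filter (fun c => c.kind = 0),
      (if 2 ≤ c.path.length then pathTerm V x c 1 else 0) = 0 := by
    refine Finset.sum_eq_zero fun c hc => ?_
    have hk := (Finset.mem_filter.1 hc).2
    cases c with
    | nil => simp [path]
    | loop => simp [kind] at hk
    | contract => simp [kind] at hk
  -- The first terms of all contracted codes cancel the terms with `k ≥ 1` of all codes. Only the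
  -- first terms of loops survive.
  have e4 : ∑ c ∈ (family r a m).filter (fun c => c.kind = 2),
      (if 2 ≤ c.path.length then pathTerm V x c 1 else 0) =
      - ∑ c ∈ family r a m, ∑ i ∈ (Finset.range (c.path.length - 1)).filter
        (fun k => 1 ≤ k ∧ k + 2 ≤ r + 1), pathTerm V x c (i + 1) := by
    rw [sum_family_contract, ← Finset.sum_neg_distrib]
    refine Finset.sum_congr rfl fun c hc => ?_
    rw [← Finset.sum_neg_distrib]
    refine Finset.sum_congr rfl fun k hk => ?_
    simp only [Finset.mem_filter, Finset.mem_range] at hk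
    have hv : (contract k c).Valid r := ⟨(mem_family.1 hc).1, hk.2.1, hk.2.2, by omega⟩
    rw [if_pos, pathTerm_contract h1 h2 hv]
    simp only [path, List.length_cons, List.length_drop]
    omega
  rw [e3, e4, sum_family_loop, zero_add, neg_add_cancel_right]
  refine Finset.sum_congr rfl fun b _ => Finset.sum_congr rfl fun ij _ => ?_
  rw [genCoeff, genCoeff, Finset.sum_mul_sum, ← Finset.sum_product']
  refine Finset.sum_congr rfl fun p _ => ?_
  rw [if_pos, pathTerm_loop h1 h2]
  have := p.1.length_path_pos
  simp only [path, List.length_cons, List.length_append]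
  omega

theorem algebraMap_mul_mem_ord {K : Type*} [Field K] {m : ℤ} (c : K) {f : LaurentSeries K}
    (hf : f ∈ VanishAt K m) : algebraMap K _ c * f ∈ VanishAt K m := by
  intro k hk
  rw [coeff_algebraMap_mul, hf k hk, mul_zero]

theorem resolventProd_mem_ord (p : List K) : resolventProd p ∈ VanishAt K p.length := by
  induction p with
  | nil =>
    have := aeval_mem_ord_iff.2 (show (1 : K[X]).natDegree ≤ 0 by simp)
    simpa [resolventProd] using this
  | cons c p ih =>
    have := mul_mem_ord (resolvent_mem_ord c) ih
    rw [resolventProd, List.map_cons, List.prod_cons, List.length_cons, Nat.cast_succ, add_comm]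
    exact this

variable (V x)

theorem genCoeff_zero (r : ℕ) (a : Option (Fin N)) : genCoeff V x r a 0 = 0 := by
  rw [genCoeff]
  refine Finset.sum_eq_zero fun c hc => ?_
  have := (mem_family.1 hc).2.1
  have := c.leaves_pos
  omega

theorem coeff_genCoeff_of_le_zero (r : ℕ) (a : Option (Fin N)) (m : ℕ) :
    genCoeff V x r a m ∈ VanishAt K 1 := by
  refine Submodule.sum_mem _ fun c _ => ?_
  refine algebraMap_mul_mem_ord _ (ord_mono ?_ (resolventProd_mem_ord (c.path.map x)))
  have := c.length_path_pos
  rw [List.length_map]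
  omega

/-- A root vertex with `n` corners contributes `O(x^(-n))`, and only the single edge has one corner;
it has one face. -/
theorem coeff_genCoeff_one (r : ℕ) (a : Option (Fin N)) (m : ℕ) :
    (genCoeff V x r a m).coeff 1 = if m = 1 then 1 else 0 := by
  have h : ∀ c : Code (Option (Fin N)), 2 ≤ c.path.length →
      (algebraMap K _ (codeWeight V x c) * resolventProd (c.path.map x)).coeff 1 = 0 := by
    intro c hc
    rw [coeff_algebraMap_mul, resolventProd_mem_ord _ 1, mul_zero]
    rw [List.length_map]
    omega
  rw [genCoeff, HahnSeries.coeff_sum]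
  by_cases hm : m = 1
  · rw [if_pos hm, Finset.sum_eq_single (nil a)]
    · simp [codeWeight, wt, path, resolventProd, coeff_one_resolvent]
    · intro c hc hne
      cases c with
      | nil b => exact absurd (congrArg nil (nil_mem_family.1 hc).1) hne
      | loop c d =>
        refine h _ ?_
        have := c.length_path_pos
        simp only [path, List.length_cons, List.length_append]
        omega
      | contract k c =>
        refine h _ ?_
        have := (contract_mem_family.1 hc).2.2.2
        simp only [path, List.length_cons, List.length_drop]
        omega
    · intro hn
      exact absurd (nil_mem_family.2 ⟨rfl, hm⟩) hn
  · rw [if_neg hm]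
    refine Finset.sum_eq_zero fun c hc => ?_
    cases c with
    | nil b => exact absurd (nil_mem_family.1 hc).2 hm
    | loop c d =>
      refine h _ ?_
      have := c.length_path_pos
      simp only [path, List.length_cons, List.length_append]
      omega
    | contract k c =>
      refine h _ ?_
      have := (contract_mem_family.1 hc).2.2.2
      simp only [path, List.length_cons, List.length_drop]
      omega

/-- Contraction data `k = length - 2` leaves a root vertex with two corners, both decorated by `z`.
The new edge has weight `P(z,z)` and the new vertex carries all corners of the old root vertex, so
the result has the weight of a ciliated map. -/
theorem coeff_two_contract {r : ℕ} {z : K} {lam : Fin N → K} {c : Code (Option (Fin N))}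
    (hv : c.Valid r) (hb : c.base = none) (hl : 3 ≤ c.path.length) :
    (algebraMap K _ (codeWeight V (decoration z lam) (contract (c.path.length - 2) c)) *
      resolventProd ((contract (c.path.length - 2) c).path.map (decoration z lam))).coeff 2 =
    propagator V z z * cornerWeight V (decoration z lam) c.path *
      c.wt (cornerWeight V (decoration z lam)) (edgeWeight V (decoration z lam)) := by
  obtain ⟨k, hk⟩ : ∃ k, c.path.length = k + 2 := ⟨c.path.length - 2, by omega⟩
  obtain ⟨q, hq⟩ := c.path_eq_concat hv
  have hql : q.length = k + 1 := by
    rw [hq, List.length_append, List.length_singleton] at hk; omega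
  rw [hk, Nat.add_sub_cancel, codeWeight, wt, path, hb]
  have f1 : c.path.drop (k + 1) = [none] := by rw [hq, ← hql, List.drop_left, hb]
  have f2 : c.path.getD (k + 1) none = none := by
    rw [hq, List.getD_eq_getElem?_getD, ← hql, List.getElem?_append_right le_rfl]
    simp [hb]
  rw [f1, f2, List.take_of_length_le hk.le, coeff_algebraMap_mul]
  have f3 : (resolventProd ([none, none].map (decoration z lam))).coeff 2 = 1 := by
    have := coeff_mul_of_ord (resolvent_mem_ord z) (resolvent_mem_ord z)
    rw [coeff_one_resolvent, one_mul] at this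
    rw [← this]
    simp [resolventProd, decoration]
  rw [f3, mul_one]
  rfl

theorem finsum_subtype_eq_sum {α M : Type*} [AddCommMonoid M] (p : α → Prop)
    (h : {c | p c}.Finite) (F : α → M) : ∑ᶠ c : {c // p c}, F c.1 = ∑ c ∈ h.toFinset, F c := by
  rw [← finsum_mem_eq_finite_toFinset_sum _ h]
  exact finsum_set_coe_eq_finsum_mem {c | p c}

/-- At order `x^(-2)` only root vertices with one or two corners matter. The single edge gives `z`,
loops have at least three corners, and the contractions with two corners correspond to the ciliated
maps. -/
theorem coeff_genCoeff_two {r : ℕ} (z : K) (lam : Fin N → K) (m : ℕ) :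
    (genCoeff V (decoration z lam) r none (m + 1)).coeff 2 =
      PowerSeries.coeff m (PowerSeries.C z + shiftedDisc r V z lam) := by
  set x := decoration z lam with hx
  have hxn : x none = z := rfl
  have hfin : {c : Code (Option (Fin N)) | c.Cilium r N m}.Finite :=
    (finite_leaves r (m + 1)).subset fun c hc => ⟨hc.1, hc.2.2.2.2⟩
  have h3 : ∀ c : Code (Option (Fin N)), 3 ≤ c.path.length →
      (algebraMap K _ (codeWeight V x c) * resolventProd (c.path.map x)).coeff 2 = 0 := by
    intro c hc
    rw [coeff_algebraMap_mul, resolventProd_mem_ord _ 2, mul_zero]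
    rw [List.length_map]
    omega
  rw [map_add, coeff_shiftedDisc, genCoeff, HahnSeries.coeff_sum, sum_family]
  have e1 : ∑ c ∈ (family r none (m + 1)).filter (fun c => c.kind = 0),
      (algebraMap K _ (codeWeight V x c) * resolventProd (c.path.map x)).coeff 2 =
      PowerSeries.coeff m (PowerSeries.C z) := by
    by_cases hm : m = 0
    · subst hm
      have : (family r (none : Option (Fin N)) (0 + 1)).filter (fun c => c.kind = 0) = {nil none} := by
        ext c
        rw [Finset.mem_filter, Finset.mem_singleton]
        constructor
        · rintro ⟨h1, h2⟩
          cases c with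
          | nil b => rw [(nil_mem_family.1 h1).1]
          | loop => simp [kind] at h2
          | contract => simp [kind] at h2
        · rintro rfl
          exact ⟨nil_mem_family.2 ⟨rfl, rfl⟩, rfl⟩
      rw [this, Finset.sum_singleton]
      simp [codeWeight, wt, path, resolventProd, coeff_two_resolvent, hxn]
    · rw [PowerSeries.coeff_C, if_neg hm]
      refine Finset.sum_eq_zero fun c hc => ?_
      obtain ⟨h1, h2⟩ := Finset.mem_filter.1 hc
      cases c with
      | nil b => exact absurd (nil_mem_family.1 h1).2 (by omega)
      | loop => simp [kind] at h2
      | contract => simp [kind] at h2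
  have e2 : ∑ c ∈ (family r none (m + 1)).filter (fun c => c.kind = 1),
      (algebraMap K _ (codeWeight V x c) * resolventProd (c.path.map x)).coeff 2 = 0 := by
    refine Finset.sum_eq_zero fun c hc => h3 c ?_
    by_contra hn
    exact c.kind_of_length_le_two (by omega) (Finset.mem_filter.1 hc).2
  rw [e1, e2, add_zero]
  congr 1
  rw [show ∑ᶠ c : {c : Code (Option (Fin N)) // c.Cilium r N m},
      propagator V z z * cornerWeight V x c.1.path *
        c.1.wt (cornerWeight V x) (edgeWeight V x) = _ from
      finsum_subtype_eq_sum (fun c : Code (Option (Fin N)) => c.Cilium r N m) hfin fun c =>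
        propagator V z z * cornerWeight V x c.path * c.wt (cornerWeight V x) (edgeWeight V x)]
  have e5 : hfin.toFinset = (family r none (m + 1)).filter
      fun c => 3 ≤ c.path.length ∧ c.path.length ≤ r + 1 := by
    ext c
    rw [Set.Finite.mem_toFinset, Finset.mem_filter, mem_family, if_pos rfl]
    change c.Cilium r N m ↔ _
    rw [Cilium]
    tauto
  rw [e5, sum_family_contract, Finset.sum_filter]
  refine Finset.sum_congr rfl fun c hc => ?_
  obtain ⟨hv, -, hb, -⟩ := mem_family.1 hc
  split_ifs with hl
  · rw [Finset.sum_eq_single (c.path.length - 2)]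
    · exact coeff_two_contract V (z := z) (lam := lam) hv hb hl.1
    · intro k hk hne
      simp only [Finset.mem_filter, Finset.mem_range] at hk
      refine h3 _ ?_
      simp only [path, List.length_cons, List.length_drop]
      omega
    · intro hn
      simp only [Finset.mem_filter, Finset.mem_range] at hn
      omega
  · refine Finset.sum_eq_zero fun k hk => ?_
    simp only [Finset.mem_filter, Finset.mem_range] at hk
    refine h3 _ ?_
    simp only [path, List.length_cons, List.length_drop]
    omega

end LoopEquation

/-! ### Rational functions with prescribed poles and uniqueness for the loop equations -/

section PoleRing

variable {K : Type*} [Field K] {ι : Type*} (x : ι → K)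

/-- The polynomial with given roots. -/
noncomputable def nodePoly (M : Multiset ι) : K[X] := (M.map fun c => X - C (x c)).prod

theorem nodePoly_add (M M' : Multiset ι) : nodePoly x (M + M') = nodePoly x M * nodePoly x M' := by
  simp [nodePoly]

theorem natDegree_nodePoly (M : Multiset ι) : (nodePoly x M).natDegree = Multiset.card M := by
  rw [nodePoly, natDegree_multiset_prod_of_monic]
  · simp
  · intro f hf
    obtain ⟨c, -, rfl⟩ := Multiset.mem_map.1 hf
    exact monic_X_sub_C _

/-- The rational functions of `x` without pole at infinity whose poles are among given points. -/
noncomputable def poleRing : Subalgebra K (LaurentSeries K) where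
  carrier := {f | ∃ (M : Multiset ι) (p : K[X]), p.natDegree ≤ Multiset.card M ∧
    aeval (xInf K) (nodePoly x M) * f = aeval (xInf K) p}
  mul_mem' := by
    rintro f g ⟨M, p, hp, hf⟩ ⟨M', q, hq, hg⟩
    refine ⟨M + M', p * q, ?_, ?_⟩
    · rw [Multiset.card_add]
      exact natDegree_mul_le_of_le hp hq
    · rw [nodePoly_add, map_mul, map_mul, ← hf, ← hg]
      ring
  add_mem' := by
    rintro f g ⟨M, p, hp, hf⟩ ⟨M', q, hq, hg⟩
    refine ⟨M + M', p * nodePoly x M' + q * nodePoly x M, ?_, ?_⟩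
    · rw [Multiset.card_add]
      refine natDegree_add_le_of_degree_le ?_ ?_
      · exact natDegree_mul_le_of_le hp (natDegree_nodePoly x M').le
      · rw [add_comm]
        exact natDegree_mul_le_of_le hq (natDegree_nodePoly x M).le
    · rw [nodePoly_add, map_mul, map_add, map_mul, map_mul, ← hf, ← hg]
      ring
  algebraMap_mem' c := ⟨0, C c, by simp, by simp [nodePoly]⟩

variable {x}

theorem resolv_mem_poleRing (c : ι) : resolv (x c) ∈ poleRing x :=
  ⟨{c}, 1, by simp, by simp [nodePoly, mul_resolvent]⟩

theorem mem_ord_of_nodePoly_mul {M : Multiset ι} {m : ℤ} {f : LaurentSeries K}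
    (h : aeval (xInf K) (nodePoly x M) * f ∈ VanishAt K m) :
    f ∈ VanishAt K (m + Multiset.card M) := by
  induction M using Multiset.induction_on generalizing m with
  | empty => simpa [nodePoly] using h
  | cons c M ih =>
    have e : aeval (xInf K) (nodePoly x (c ::ₘ M)) * f =
        (xInf K - algebraMap K _ (x c)) * (aeval (xInf K) (nodePoly x M) * f) := by
      simp [nodePoly, mul_assoc]
    rw [e] at h
    have h2 := mul_mem_ord (resolvent_mem_ord (x c)) h
    rw [← mul_assoc, mul_comm (resolv _), mul_resolvent, one_mul] at h2
    have := ih h2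
    rw [Multiset.card_cons, Nat.cast_succ]
    convert this using 2
    ring

theorem poleRing_le_ord {f : LaurentSeries K} (hf : f ∈ poleRing x) : f ∈ VanishAt K 0 := by
  obtain ⟨M, p, hp, h⟩ := hf
  have h1 := aeval_mem_ord_iff.2 hp
  rw [← h] at h1
  simpa using mem_ord_of_nodePoly_mul h1

variable [Algebra ℂ K] {V : ℂ[X]}

theorem dVInf_sub_eq (a : K) : dVInf K V - algebraMap K _ (dV V a) =
    aeval (xInf K) ((derivative V).map (algebraMap ℂ K) - C (dV V a)) := by
  rw [map_sub, aeval_C]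
  rfl

/-- Among the nodes, `V'(x) - V'(x_a)` vanishes only at `x_a`, and to first order. So `D` can only
have a simple pole at `x_a`, and `(x - x_a) D` is a polynomial. It is `O(1/x)`, hence zero. -/
theorem eq_zero_of_linear_equation (h1 : ∀ a b, x a ≠ x b → dV V (x a) ≠ dV V (x b))
    (h2 : ∀ a, ddV V (x a) ≠ 0) {a : ι} {D : LaurentSeries K} (hD : D ∈ poleRing x)
    (hD2 : D ∈ VanishAt K 2)
    (hP : (dVInf K V - algebraMap K _ (dV V (x a))) * D ∈ PolX K) : D = 0 := by
  obtain ⟨M, p, hp, h⟩ := hD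
  rw [dVInf_sub_eq] at hP
  set F : K[X] := (derivative V).map (algebraMap ℂ K) - C (dV V (x a)) with hF
  obtain ⟨q, hq⟩ := mem_pol.1 hP
  have heval : ∀ c : K, F.eval c = dV V c - dV V (x a) := by
    intro c
    rw [hF, eval_sub, eval_C, eval_map, dV, dV, aeval_def, aeval_def]
  obtain ⟨U, hU⟩ : X - C (x a) ∣ F := dvd_iff_isRoot.2 (by rw [IsRoot, heval, sub_self])
  have hUc : ∀ c, U.eval (x c) ≠ 0 := by
    intro c h0
    by_cases hc : x c = x a
    · have hd : (derivative F).eval (x a) = U.eval (x a) := by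
        rw [hU, derivative_mul]
        simp
      rw [← hc, h0, hF, derivative_sub, derivative_C, sub_zero, derivative_map, eval_map,
        ← aeval_def] at hd
      exact h2 c hd
    · have := heval (x c)
      rw [hU, eval_mul, h0, mul_zero] at this
      exact h1 _ _ hc (sub_eq_zero.1 this.symm)
  have hco : IsCoprime U (nodePoly x M) := by
    rw [nodePoly]
    induction M using Multiset.induction_on with
    | empty => simpa using isCoprime_one_right
    | cons c M ih =>
      rw [Multiset.map_cons, Multiset.prod_cons]
      refine IsCoprime.mul_right ?_ ?_
      · rw [isCoprime_comm, (irreducible_X_sub_C (x c)).coprime_iff_not_dvd, dvd_iff_isRoot]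
        exact hUc c
      · clear ih hp h
        induction M using Multiset.induction_on with
        | empty => simpa using isCoprime_one_right
        | cons c M ih =>
          rw [Multiset.map_cons, Multiset.prod_cons]
          refine IsCoprime.mul_right ?_ ih
          rw [isCoprime_comm, (irreducible_X_sub_C (x c)).coprime_iff_not_dvd, dvd_iff_isRoot]
          exact hUc c
  have hpq : F * p = q * nodePoly x M := by
    apply aeval_xInf_injective
    rw [map_mul, map_mul, ← h, hq]
    ring
  obtain ⟨q', rfl⟩ : U ∣ q := hco.dvd_of_dvd_mul_right ⟨(X - C (x a)) * p, by rw [← hpq, hU]; ring⟩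
  have hU0 : aeval (xInf K) U ≠ 0 := by
    intro h0
    have : U = 0 := aeval_xInf_injective (by rw [h0, map_zero])
    exact hUc a (by rw [this, eval_zero])
  have h3 : (xInf K - algebraMap K _ (x a)) * D = aeval (xInf K) q' := by
    apply mul_left_cancel₀ hU0
    rw [← map_mul, hq, hU, map_mul, map_sub, aeval_X, aeval_C]
    ring
  have h4 : (xInf K - algebraMap K _ (x a)) * D = 0 := by
    refine eq_zero_of_mem_pol_of_mem_ord (h3 ▸ aeval_mem_pol q') ?_
    have : (xInf K - algebraMap K (LaurentSeries K) (x a)) ∈ VanishAt K (-1) := by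
      have := aeval_mem_ord_iff (K := K) (p := X - C (x a)) (m := 1)
      rw [map_sub, aeval_X, aeval_C] at this
      exact this.2 (natDegree_X_sub_C_le _)
    exact mul_mem_ord this hD2
  exact (mul_eq_zero.1 h4).resolve_left (xInf_sub_ne_zero _)

/-- A family of series that solves the loop equations. -/
structure IsLoopSolution {N : ℕ} (V : ℂ[X]) (x : Option (Fin N) → K)
    (h : Option (Fin N) → ℕ → LaurentSeries K) : Prop where
  zero : ∀ a, h a 0 = 0
  mem_poleRing : ∀ a m, h a m ∈ poleRing x
  mem_ord : ∀ a m, h a m ∈ VanishAt K 1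
  coeff_one : ∀ a m, (h a m).coeff 1 = if m = 1 then 1 else 0
  loop : ∀ a m, (dVInf K V - algebraMap K _ (dV V (x a))) * h a m -
      ∑ b : Fin N, ∑ ij ∈ Finset.HasAntidiagonal.antidiagonal m, h (some b) ij.1 * h a ij.2 ∈ PolX K

/-- The functions vanish at `t = 0`, so the quadratic terms at order `m` involve lower orders only.
The difference of two solutions then satisfies the linear equation and is `O(1/x^2)`. -/
theorem IsLoopSolution.unique {N : ℕ} {x : Option (Fin N) → K}
    (h1 : ∀ a b, x a ≠ x b → dV V (x a) ≠ dV V (x b)) (h2 : ∀ a, ddV V (x a) ≠ 0)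
    {h h' : Option (Fin N) → ℕ → LaurentSeries K} (H : IsLoopSolution V x h)
    (H' : IsLoopSolution V x h') (m : ℕ) : ∀ a, h a m = h' a m := by
  induction m using Nat.strong_induction_on with | _ m ih
  intro a
  rw [← sub_eq_zero]
  refine eq_zero_of_linear_equation h1 h2 (a := a)
    (Subalgebra.sub_mem _ (H.mem_poleRing a m) (H'.mem_poleRing a m)) ?_ ?_
  · intro k hk
    rw [HahnSeries.coeff_sub]
    rcases lt_or_eq_of_le (show k ≤ 1 by omega) with hk | rfl
    · rw [H.mem_ord a m k hk, H'.mem_ord a m k hk, sub_zero]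
    · rw [H.coeff_one, H'.coeff_one, sub_self]
  · have e : ∑ b : Fin N, ∑ ij ∈ Finset.HasAntidiagonal.antidiagonal m, h (some b) ij.1 * h a ij.2 =
        ∑ b : Fin N, ∑ ij ∈ Finset.HasAntidiagonal.antidiagonal m, h' (some b) ij.1 * h' a ij.2 := by
      refine Finset.sum_congr rfl fun b _ => Finset.sum_congr rfl fun ij hij => ?_
      rw [Finset.HasAntidiagonal.mem_antidiagonal] at hij
      by_cases hi : ij.1 = 0
      · rw [hi, H.zero, H'.zero, zero_mul, zero_mul]
      by_cases hj : ij.2 = 0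
      · rw [hj, H.zero, H'.zero, mul_zero, mul_zero]
      rw [ih _ (by omega), ih _ (by omega)]
    have := Subalgebra.sub_mem _ (H.loop a m) (H'.loop a m)
    rwa [e, sub_sub_sub_cancel_right, ← mul_sub] at this

theorem resolventProd_mem_poleRing (p : List ι) : resolventProd (p.map x) ∈ poleRing x := by
  rw [resolventProd, List.map_map]
  refine Subalgebra.list_prod_mem _ fun f hf => ?_
  obtain ⟨c, -, rfl⟩ := List.mem_map.1 hf
  exact resolv_mem_poleRing c

theorem isLoopSolution_genCoeff {N r : ℕ} {x : Option (Fin N) → K} (hV : V.natDegree = r + 1)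
    (h1 : ∀ a b, x a ≠ x b → dV V (x a) ≠ dV V (x b)) (h2 : ∀ a, ddV V (x a) ≠ 0) :
    IsLoopSolution V x (genCoeff V x r) where
  zero a := genCoeff_zero V x r a
  mem_poleRing _ _ := Subalgebra.sum_mem _ fun _ _ =>
    Subalgebra.mul_mem _ (Subalgebra.algebraMap_mem _ _) (resolventProd_mem_poleRing _)
  mem_ord a m := coeff_genCoeff_of_le_zero V x r a m
  coeff_one a m := coeff_genCoeff_one V x r a m
  loop a m := loop_equation hV h1 h2 a m

end PoleRing

/-! ### Fixed points and Hensel's lemma for power series -/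

section FixedPoint

variable {R : Type*} [CommRing R]

/-- A map on vectors of power series that improves the agreement of vectors with prescribed
constant coefficients has exactly one fixed point with these constant coefficients. -/
theorem existsUnique_fixedPoint {ι : Type*} (a : ι → R)
    (Φ : (ι → PowerSeries R) → ι → PowerSeries R)
    (h0 : ∀ u, (∀ i, PowerSeries.constantCoeff (u i) = a i) →
      ∀ i, PowerSeries.constantCoeff (Φ u i) = a i)
    (h : ∀ n u v, (∀ i, PowerSeries.constantCoeff (u i) = a i) →
      (∀ i, PowerSeries.constantCoeff (v i) = a i) → (∀ i, PowerSeries.X ^ n ∣ u i - v i) →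
      ∀ i, PowerSeries.X ^ (n + 1) ∣ Φ u i - Φ v i) :
    ∃! u : ι → PowerSeries R, (∀ i, PowerSeries.constantCoeff (u i) = a i) ∧ Φ u = u := by
  -- The iterates of the constant vector: `w n` is stable modulo `X ^ n`, so the limit takes its
  -- coefficient of `X ^ n` from `w (n + 1)`.
  set w : ℕ → ι → PowerSeries R := fun n => Φ^[n] fun i => PowerSeries.C (a i) with hw
  have hs : ∀ n, w (n + 1) = Φ (w n) := fun n => Function.iterate_succ_apply' _ _ _
  have hc : ∀ n i, PowerSeries.constantCoeff (w n i) = a i := by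
    intro n
    induction n with
    | zero => intro i; simp [hw]
    | succ n ih => rw [hs]; exact h0 _ ih
  have hd : ∀ n i, PowerSeries.X ^ n ∣ w (n + 1) i - w n i := by
    intro n
    induction n with
    | zero => intro i; rw [pow_zero]; exact one_dvd _
    | succ n ih => rw [hs (n + 1)]; nth_rewrite 2 [hs n]; exact h n _ _ (hc _) (hc _) ih
  have hd' : ∀ n k i, PowerSeries.X ^ n ∣ w (n + k) i - w n i := by
    intro n k i
    induction k with
    | zero => simp
    | succ k ih =>
      have := dvd_add ((pow_dvd_pow PowerSeries.X (Nat.le_add_right n k)).trans (hd (n + k) i)) ih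
      rwa [sub_add_sub_cancel] at this
  set u : ι → PowerSeries R := fun i => PowerSeries.mk fun n => PowerSeries.coeff n (w (n + 1) i)
    with hu
  have hu' : ∀ n i, PowerSeries.X ^ n ∣ u i - w n i := by
    intro n i
    rw [PowerSeries.X_pow_dvd_iff]
    intro m hm
    have := PowerSeries.X_pow_dvd_iff.1 (hd' (m + 1) (n - (m + 1)) i) m (by omega)
    rw [show m + 1 + (n - (m + 1)) = n by omega, map_sub, sub_eq_zero] at this
    rw [map_sub, hu, PowerSeries.coeff_mk, this, sub_self]
  have huc : ∀ i, PowerSeries.constantCoeff (u i) = a i := by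
    intro i
    rw [← PowerSeries.coeff_zero_eq_constantCoeff_apply, hu, PowerSeries.coeff_mk,
      PowerSeries.coeff_zero_eq_constantCoeff_apply, hc]
  have ext : ∀ f g : PowerSeries R, (∀ n, PowerSeries.X ^ n ∣ f - g) → f = g := by
    intro f g hfg
    ext n
    have := PowerSeries.X_pow_dvd_iff.1 (hfg (n + 1)) n (Nat.lt_succ_self n)
    rwa [map_sub, sub_eq_zero] at this
  refine ⟨u, ⟨huc, funext fun i => ext _ _ fun n => ?_⟩, ?_⟩
  · have h1 := h n u (w n) huc (hc n) (hu' n) i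
    rw [← hs] at h1
    have h2 := dvd_sub ((pow_dvd_pow _ (Nat.le_succ n)).trans h1)
      ((pow_dvd_pow _ (Nat.le_succ n)).trans (hu' (n + 1) i))
    rwa [sub_sub_sub_cancel_right] at h2
  · rintro v ⟨hv, hv'⟩
    have hn : ∀ n i, PowerSeries.X ^ n ∣ v i - w n i := by
      intro n
      induction n with
      | zero => intro i; rw [pow_zero]; exact one_dvd _
      | succ n ih =>
        have := h n v (w n) hv (hc n) ih
        rwa [hv', ← hs] at this
    refine funext fun i => ext _ _ fun n => ?_
    have := dvd_sub (hn n i) (hu' n i)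
    rwa [sub_sub_sub_cancel_right] at this

/-- **Hensel's lemma** for power series: a simple root modulo `X` lifts uniquely. -/
theorem existsUnique_root (f : (PowerSeries R)[X]) (a : R)
    (hf : (f.map PowerSeries.constantCoeff).eval a = 0)
    (hf' : IsUnit ((derivative (f.map PowerSeries.constantCoeff)).eval a)) :
    ∃! u : PowerSeries R, PowerSeries.constantCoeff u = a ∧ f.eval u = 0 := by
  obtain ⟨b, hb⟩ := hf'.exists_left_inv
  have hbu : IsUnit (PowerSeries.C b) := (IsUnit.of_mul_eq_one _ hb).map PowerSeries.C
  have he : ∀ (g : (PowerSeries R)[X]) u, PowerSeries.constantCoeff (g.eval u) =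
      (g.map PowerSeries.constantCoeff).eval (PowerSeries.constantCoeff u) := by
    intro g u
    rw [eval_map, eval₂_at_apply]
  obtain ⟨u, ⟨hu, hu'⟩, huniq⟩ := existsUnique_fixedPoint (ι := Unit) (fun _ => a)
    -- Newton's iteration with the derivative frozen at the approximate root, `b` being its inverse.
    (fun u _ => u () - PowerSeries.C b * f.eval (u ()))
    (by
      intro u hu _
      rw [map_sub, map_mul, he, hu, hf, mul_zero, sub_zero])
    (by
      intro n u v hu hv huv _
      obtain ⟨k, hk⟩ := f.binomExpansion (v ()) (u () - v ())
      rw [add_sub_cancel] at hk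
      have : u () - PowerSeries.C b * f.eval (u ()) - (v () - PowerSeries.C b * f.eval (v ())) =
          (u () - v ()) * (1 - PowerSeries.C b * ((derivative f).eval (v ()) +
            k * (u () - v ()))) := by
        rw [hk]; ring
      rw [this, pow_succ]
      refine mul_dvd_mul (huv ()) (PowerSeries.X_dvd_iff.2 ?_)
      rw [map_sub, map_mul, map_add, map_mul, map_sub, hu, hv, he, hv, ← derivative_map, sub_self,
        mul_zero, add_zero, PowerSeries.constantCoeff_C, hb, map_one, sub_self])
  refine ⟨u (), ⟨hu (), ?_⟩, ?_⟩
  · have := congrFun hu' ()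
    rw [sub_eq_self] at this
    exact (hbu.mul_right_eq_zero).1 this
  · rintro v ⟨hv, hv'⟩
    exact congrFun (huniq (fun _ => v) ⟨fun _ => hv, by funext; simp [hv']⟩) ()

theorem eq_of_root {f : (PowerSeries R)[X]} {u v : PowerSeries R}
    (hf' : IsUnit ((derivative (f.map PowerSeries.constantCoeff)).eval
      (PowerSeries.constantCoeff u)))
    (hu : f.eval u = 0) (hv : f.eval v = 0)
    (huv : PowerSeries.constantCoeff v = PowerSeries.constantCoeff u) : u = v :=
  (existsUnique_root f _ (by rw [eval_map, eval₂_at_apply, hu, map_zero]) hf').unique ⟨rfl, hu⟩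
    ⟨huv, hv⟩

end FixedPoint

/-! ### Traces and norms over the roots of a polynomial -/

section SymmetricFunctions

variable {B : Type*} [CommRing B] {σ : Type*} [Fintype σ] (P : Subring B) (α : σ → B)

/-- A symmetric function of the roots of a monic polynomial lies in the ring of the coefficients. -/
theorem aeval_mem_of_isSymmetric (h : ∀ k, (∏ i, (X - C (α i))).coeff k ∈ P)
    (p : MvPolynomial σ P) (hp : p.IsSymmetric) : MvPolynomial.aeval α p ∈ P := by
  have he : ∀ k, MvPolynomial.aeval α (MvPolynomial.esymm σ P k) ∈ P := by
    intro k
    rw [MvPolynomial.aeval_esymm_eq_multiset_esymm]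
    by_cases hk : k ≤ Fintype.card σ
    · have := h (Fintype.card σ - k)
      have hv := Multiset.prod_X_sub_C_coeff (Finset.univ.val.map α) (k := Fintype.card σ - k)
        (by rw [Multiset.card_map]; exact Nat.sub_le _ _)
      rw [Multiset.map_map, Multiset.card_map] at hv
      change (∏ i, (X - C (α i))).coeff _ = _ at hv
      rw [hv, show Multiset.card (Finset.univ : Finset σ).val = Fintype.card σ from rfl,
        Nat.sub_sub_self hk] at this
      have h2 := P.mul_mem (P.pow_mem (P.neg_mem P.one_mem) k) this
      rwa [← mul_assoc, ← mul_pow, neg_one_mul, neg_neg, one_pow, one_mul] at h2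
    · rw [Multiset.esymm, Multiset.powersetCard_eq_empty]
      · simp
      · rw [Multiset.card_map]; exact not_le.1 hk
  set q := (MvPolynomial.esymmAlgEquiv σ P (n := Fintype.card σ) rfl).symm ⟨p, hp⟩ with hq
  have hpq : p = MvPolynomial.aeval (fun i : Fin (Fintype.card σ) =>
      MvPolynomial.esymm σ P (i + 1)) q := by
    rw [← MvPolynomial.esymmAlgHom_apply, ← MvPolynomial.esymmAlgEquiv_apply σ P rfl, hq,
      AlgEquiv.apply_symm_apply]
  rw [hpq]
  induction q using MvPolynomial.induction_on with
  | C a => rw [MvPolynomial.aeval_C, AlgHom.commutes]; exact a.2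
  | add p q hp hq => rw [map_add, map_add]; exact P.add_mem hp hq
  | mul_X p i hp => rw [map_mul, map_mul, MvPolynomial.aeval_X]; exact P.mul_mem hp (he _)

/-- The trace is a symmetric polynomial in the roots, with coefficients in `P`. Together with the
norm below, this yields polynomiality in `x` without a separate study of the individual roots. -/
theorem sum_eval_mem (h : ∀ k, (∏ i, (X - C (α i))).coeff k ∈ P) (g : B[X])
    (hg : ∀ k, g.coeff k ∈ P) : ∑ i, g.eval (α i) ∈ P := by
  have hg' : (↑g.coeffs : Set B) ⊆ P := by
    intro c hc
    obtain ⟨n, -, rfl⟩ := mem_coeffs_iff.1 (Finset.mem_coe.1 hc)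
    exact hg n
  have := aeval_mem_of_isSymmetric P α h
    (∑ i, aeval (MvPolynomial.X i : MvPolynomial σ P) (g.toSubring P hg')) (by
      intro e
      rw [map_sum]
      simp only [← Polynomial.aeval_algHom_apply, MvPolynomial.rename_X]
      exact Equiv.sum_comp e fun i => aeval (MvPolynomial.X i : MvPolynomial σ P)
        (g.toSubring P hg'))
  rw [map_sum] at this
  simp only [← Polynomial.aeval_algHom_apply, MvPolynomial.aeval_X] at this
  convert this using 2 with i
  rw [aeval_def, ← eval_map]
  congr 1
  ext n
  rw [coeff_map]
  exact (coeff_toSubring _ _ _).symm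

theorem prod_eval_mem (h : ∀ k, (∏ i, (X - C (α i))).coeff k ∈ P) (g : B[X])
    (hg : ∀ k, g.coeff k ∈ P) : ∏ i, g.eval (α i) ∈ P := by
  have hg' : (↑g.coeffs : Set B) ⊆ P := by
    intro c hc
    obtain ⟨n, -, rfl⟩ := mem_coeffs_iff.1 (Finset.mem_coe.1 hc)
    exact hg n
  have := aeval_mem_of_isSymmetric P α h
    (∏ i, aeval (MvPolynomial.X i : MvPolynomial σ P) (g.toSubring P hg')) (by
      intro e
      rw [map_prod]
      simp only [← Polynomial.aeval_algHom_apply, MvPolynomial.rename_X]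
      exact Equiv.prod_comp e fun i => aeval (MvPolynomial.X i : MvPolynomial σ P)
        (g.toSubring P hg'))
  rw [map_prod] at this
  simp only [← Polynomial.aeval_algHom_apply, MvPolynomial.aeval_X] at this
  convert this using 2 with i
  rw [aeval_def, ← eval_map]
  congr 1
  ext n
  rw [coeff_map]
  exact (coeff_toSubring _ _ _).symm

end SymmetricFunctions

/-! ### Orders at infinity for series in t -/

section SeriesVanishAt

variable {K : Type*} [Field K]

/-- The series in `t` all of whose coefficients are `O(x ^ (-m))`. -/
def SeriesVanishAt (K : Type*) [Field K] (m : ℤ) : AddSubgroup (PowerSeries (LaurentSeries K)) where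
  carrier := {f | ∀ n, PowerSeries.coeff n f ∈ VanishAt K m}
  add_mem' := by
    intro f g hf hg n
    rw [map_add]
    exact add_mem (hf n) (hg n)
  zero_mem' := fun n => by rw [map_zero]; exact zero_mem _
  neg_mem' := by
    intro f hf n
    rw [map_neg]
    exact neg_mem (hf n)

theorem mem_seriesVanishAt {m : ℤ} {f : PowerSeries (LaurentSeries K)} :
    f ∈ SeriesVanishAt K m ↔ ∀ n, PowerSeries.coeff n f ∈ VanishAt K m := Iff.rfl

theorem seriesVanishAt_mono {m n : ℤ} (h : m ≤ n) : SeriesVanishAt K n ≤ SeriesVanishAt K m :=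
  fun _ hf k => ord_mono h (hf k)

theorem mul_mem_seriesVanishAt {m n : ℤ} {f g : PowerSeries (LaurentSeries K)}
    (hf : f ∈ SeriesVanishAt K m) (hg : g ∈ SeriesVanishAt K n) : f * g ∈ SeriesVanishAt K (m + n) := by
  intro k
  rw [PowerSeries.coeff_mul]
  exact Submodule.sum_mem _ fun ij _ => mul_mem_ord (hf _) (hg _)

theorem algebraMap_mem_ord (c : K) : algebraMap K (LaurentSeries K) c ∈ VanishAt K 0 := by
  rw [ord_zero_iff]
  refine ⟨PowerSeries.C c, ?_⟩
  rw [HahnSeries.ofPowerSeries_C, algebraMap_laurentSeries]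
  rfl

theorem xInf_mem_ord : xInf K ∈ VanishAt K (-1) := by
  have := aeval_mem_ord_iff (K := K) (p := X) (m := 1)
  rw [aeval_X] at this
  exact this.2 natDegree_X_le

theorem coeff_xInf : (xInf K).coeff (-1) = 1 := by
  rw [xInf, HahnSeries.coeff_single_same]

theorem C_mem_seriesVanishAt {m : ℤ} {f : LaurentSeries K} (hf : f ∈ VanishAt K m) :
    PowerSeries.C f ∈ SeriesVanishAt K m := by
  intro n
  rw [PowerSeries.coeff_C]
  split_ifs
  · exact hf
  · exact zero_mem _

/-- The inclusion of the series in `t` with coefficients that do not depend on `x`. -/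
noncomputable abbrev constSeries (K : Type*) [Field K] :
    PowerSeries K →+* PowerSeries (LaurentSeries K) :=
  PowerSeries.map (algebraMap K (LaurentSeries K))

theorem constSeries_mem (f : PowerSeries K) : constSeries K f ∈ SeriesVanishAt K 0 := by
  intro n
  rw [PowerSeries.coeff_map]
  exact algebraMap_mem_ord _

theorem mem_ord_of_mul_mem {m k : ℤ} {g f : LaurentSeries K} (hg : g ∈ VanishAt K k)
    (hg' : g.coeff k ≠ 0) (h : g * f ∈ VanishAt K (k + m)) : f ∈ VanishAt K m := by
  by_cases hf : f = 0
  · rw [hf]; exact zero_mem _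
  have ho : f ∈ VanishAt K f.order := fun i hi => HahnSeries.coeff_eq_zero_of_lt_order hi
  have h2 := coeff_mul_of_ord hg ho
  have h3 : m ≤ f.order := by
    by_contra hlt
    rw [h _ (by omega)] at h2
    exact (mul_ne_zero hg' (HahnSeries.coeff_order_eq_zero.not.2 hf)) h2.symm
  exact ord_mono h3 ho

theorem coeff_neg_one_of_sub_mem {g : LaurentSeries K} (hg : g - xInf K ∈ VanishAt K 0) :
    g ∈ VanishAt K (-1) ∧ g.coeff (-1) = 1 := by
  constructor
  · have := add_mem (ord_mono (by norm_num) hg : _ ∈ VanishAt K (-1)) xInf_mem_ord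
    rwa [sub_add_cancel] at this
  · have := hg (-1) (by norm_num)
    rwa [HahnSeries.coeff_sub, coeff_xInf, sub_eq_zero] at this

variable {y : PowerSeries (LaurentSeries K)}

theorem mem_of_sub_mem (hy : y - PowerSeries.C (xInf K) ∈ SeriesVanishAt K 0) :
    y ∈ SeriesVanishAt K (-1) := by
  have := add_mem (seriesVanishAt_mono (by norm_num) hy : _ ∈ SeriesVanishAt K (-1))
    (C_mem_seriesVanishAt xInf_mem_ord)
  rwa [sub_add_cancel] at this

/-- At `t = 0` the series `y` has leading term `x`, and its other coefficients have no higher order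
at infinity than `O(1)`. Induction on the power of `t` shows that division by `y` gains one order.
-/
theorem mem_seriesVanishAt_of_mul_mem (hy : y - PowerSeries.C (xInf K) ∈ SeriesVanishAt K 0)
    {m : ℤ} {f : PowerSeries (LaurentSeries K)} (h : y * f ∈ SeriesVanishAt K (-1 + m)) :
    f ∈ SeriesVanishAt K m := by
  intro n
  induction n using Nat.strong_induction_on with | _ n ih
  have h0 := hy 0
  rw [map_sub, PowerSeries.coeff_zero_C] at h0
  obtain ⟨h1, h2⟩ := coeff_neg_one_of_sub_mem h0
  refine mem_ord_of_mul_mem h1 (by rw [h2]; exact one_ne_zero) ?_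
  have h3 := h n
  rw [PowerSeries.coeff_mul, ← Finset.add_sum_erase _ _
    (Finset.HasAntidiagonal.mem_antidiagonal.2 (zero_add n) : (0, n) ∈ _)] at h3
  refine (Submodule.add_mem_iff_left _ (Submodule.sum_mem _ fun ij hij => ?_)).1 h3
  rw [Finset.mem_erase, Finset.HasAntidiagonal.mem_antidiagonal] at hij
  have hi : ij.1 ≠ 0 := fun hi => hij.1 (Prod.ext hi (by have := hij.2; simp only; omega))
  have h4 := hy ij.1
  rw [map_sub, PowerSeries.coeff_C_of_ne_zero hi, sub_zero] at h4
  have h5 := mul_mem_ord h4 (ih ij.2 (by have := hij.2; omega))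
  exact ord_mono (by omega) h5

theorem pow_mem_seriesVanishAt {m : ℤ} {f : PowerSeries (LaurentSeries K)}
    (hf : f ∈ SeriesVanishAt K m) (k : ℕ) : f ^ k ∈ SeriesVanishAt K (k * m) := by
  induction k with
  | zero =>
    rw [pow_zero, Nat.cast_zero, zero_mul, ← map_one (constSeries K)]
    exact constSeries_mem 1
  | succ k ih =>
    rw [pow_succ, Nat.cast_succ, add_mul, one_mul]
    exact mul_mem_seriesVanishAt ih hf

theorem eval₂_mem_seriesVanishAt (hy : y - PowerSeries.C (xInf K) ∈ SeriesVanishAt K 0)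
    {B : (PowerSeries K)[X]} {m : ℕ} (hB : B.degree < m) :
    B.eval₂ (constSeries K) y ∈ SeriesVanishAt K (1 - m) := by
  rw [eval₂_eq_sum, sum_def]
  refine sum_mem fun k hk => ?_
  have hkm : k < m := by
    have := (le_degree_of_mem_supp k hk).trans_lt hB
    exact_mod_cast this
  have := mul_mem_seriesVanishAt (constSeries_mem (B.coeff k))
    (pow_mem_seriesVanishAt (mem_of_sub_mem hy) k)
  exact seriesVanishAt_mono (by omega) this

theorem coeff_eval₂_xInf (B : (PowerSeries K)[X]) (n k : ℕ) :
    (PowerSeries.coeff n (B.eval₂ (constSeries K) (PowerSeries.C (xInf K)))).coeff (-(k : ℤ)) =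
      PowerSeries.coeff n (B.coeff k) := by
  induction B using Polynomial.induction_on' with
  | add p q hp hq =>
    rw [eval₂_add, map_add, HahnSeries.coeff_add, hp, hq, coeff_add, map_add]
  | monomial l a =>
    rw [eval₂_monomial, ← map_pow, PowerSeries.coeff_mul_C, PowerSeries.coeff_map,
      coeff_algebraMap_mul, coeff_monomial, xInf, HahnSeries.single_pow, HahnSeries.coeff_single]
    simp only [one_pow, nsmul_eq_mul, mul_neg, mul_one, neg_inj, Nat.cast_inj]
    by_cases h : k = l
    · rw [if_pos h, if_pos h.symm, mul_one]
    · rw [if_neg h, if_neg (Ne.symm h), mul_zero, map_zero]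

theorem degree_lt_of_eval₂_mem {B : (PowerSeries K)[X]} {m : ℕ}
    (hB : B.eval₂ (constSeries K) (PowerSeries.C (xInf K)) ∈ SeriesVanishAt K (1 - m)) :
    B.degree < m := by
  rw [degree_lt_iff_coeff_zero]
  intro k hk
  ext n
  rw [← coeff_eval₂_xInf, hB n _ (by omega), map_zero]

end SeriesVanishAt

/-! ### The polynomial part of p(η + t ∑ c_i / (η - ξ_i)) -/

section SpectralPolynomial

variable {A : Type*} [CommRing A] {N : ℕ}

/-- The polynomial `∏ (η - ξ_i)`. -/
noncomputable def polePoly (ξ : Fin N → A) : A[X] := ∏ i, (X - C (ξ i))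

/-- The numerator of `∑ c_i / (η - ξ_i)`. -/
noncomputable def residuePoly (ξ c : Fin N → A) : A[X] :=
  ∑ i, C (c i) * ∏ j ∈ Finset.univ.erase i, (X - C (ξ j))

/-- The numerator of `(p(η + t ∑ c_i / (η - ξ_i)) - p(η)) / t`. -/
noncomputable def corrNum (r : ℕ) (p : A[X]) (t : A) (ξ c : Fin N → A) : A[X] :=
  ∑ k ∈ Finset.range (r + 1), C (p.coeff k) * polePoly ξ ^ (r - k) * (residuePoly ξ c *
    ∑ i ∈ Finset.range k, (X * polePoly ξ + C t * residuePoly ξ c) ^ i *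
      (X * polePoly ξ) ^ (k - 1 - i))

/-- The polynomial part of `(p(η + t ∑ c_i / (η - ξ_i)) - p(η)) / t`. -/
noncomputable def corrPoly (r : ℕ) (p : A[X]) (t : A) (ξ c : Fin N → A) : A[X] :=
  corrNum r p t ξ c /ₘ polePoly ξ ^ r

/-- The polynomial part of `p(η + t ∑ c_i / (η - ξ_i))`. -/
noncomputable def specPoly (r : ℕ) (p : A[X]) (t : A) (ξ c : Fin N → A) : A[X] :=
  p + C t * corrPoly r p t ξ c

theorem polePoly_monic (ξ : Fin N → A) : (polePoly ξ).Monic :=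
  monic_prod_of_monic _ _ fun _ _ => monic_X_sub_C _

theorem natDegree_polePoly [Nontrivial A] (ξ : Fin N → A) : (polePoly ξ).natDegree = N := by
  rw [polePoly, natDegree_prod_of_monic _ _ fun _ _ => monic_X_sub_C _]
  simp

theorem map_polePoly {B : Type*} [CommRing B] (φ : A →+* B) (ξ : Fin N → A) :
    (polePoly ξ).map φ = polePoly fun i => φ (ξ i) := by
  simp [polePoly, Polynomial.map_prod]

theorem map_residuePoly {B : Type*} [CommRing B] (φ : A →+* B) (ξ c : Fin N → A) :
    (residuePoly ξ c).map φ = residuePoly (fun i => φ (ξ i)) fun i => φ (c i) := by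
  simp [residuePoly, Polynomial.map_prod, Polynomial.map_sum]

theorem map_corrPoly {B : Type*} [CommRing B] (φ : A →+* B) (r : ℕ) (p : A[X]) (t : A)
    (ξ c : Fin N → A) : (corrPoly r p t ξ c).map φ =
      corrPoly r (p.map φ) (φ t) (fun i => φ (ξ i)) fun i => φ (c i) := by
  rw [corrPoly, map_divByMonic _ ((polePoly_monic ξ).pow r), Polynomial.map_pow, map_polePoly,
    corrPoly]
  congr 1
  simp only [corrNum, Polynomial.map_sum, Polynomial.map_mul, Polynomial.map_pow, map_polePoly,
    map_residuePoly, Polynomial.map_add, map_X, map_C, coeff_map]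

theorem natDegree_residuePoly_le (ξ c : Fin N → A) : (residuePoly ξ c).natDegree ≤ N - 1 := by
  nontriviality A
  refine natDegree_sum_le_of_forall_le _ _ fun i _ => (natDegree_C_mul_le _ _).trans ?_
  rw [natDegree_prod_of_monic _ _ fun _ _ => monic_X_sub_C _]
  simp

/-- A degree count for the fraction; this bound is enough to keep the coefficient of degree `r` of
`p` when `r` is positive. -/
theorem natDegree_corrPoly_le (r : ℕ) (p : A[X]) (t : A) (ξ c : Fin N → A) :
    (corrPoly r p t ξ c).natDegree ≤ r - 1 := by
  nontriviality A
  rw [corrPoly, natDegree_divByMonic _ ((polePoly_monic ξ).pow r), (polePoly_monic ξ).natDegree_pow,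
    natDegree_polePoly, Nat.sub_le_iff_le_add]
  refine natDegree_sum_le_of_forall_le _ _ fun k hk => ?_
  obtain ⟨l, rfl⟩ : ∃ l, r = k + l := ⟨r - k, by have := Finset.mem_range.1 hk; omega⟩
  cases k with
  | zero => simp
  | succ k =>
    have hD := natDegree_polePoly ξ
    have hX : (X * polePoly ξ).natDegree ≤ N + 1 := by
      rw [add_comm]
      exact natDegree_mul_le_of_le natDegree_X_le hD.le
    have hS : (X * polePoly ξ + C t * residuePoly ξ c).natDegree ≤ N + 1 :=
      natDegree_add_le_of_degree_le hX ((natDegree_C_mul_le _ _).trans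
        ((natDegree_residuePoly_le ξ c).trans (by omega)))
    have hsum : (∑ i ∈ Finset.range (k + 1), (X * polePoly ξ + C t * residuePoly ξ c) ^ i *
      (X * polePoly ξ) ^ (k + 1 - 1 - i)).natDegree ≤ k * (N + 1) := by
      refine natDegree_sum_le_of_forall_le _ _ fun i hi => ?_
      refine (natDegree_mul_le_of_le (natDegree_pow_le_of_le i hS)
        (natDegree_pow_le_of_le _ hX)).trans ?_
      rw [← add_mul]
      exact Nat.mul_le_mul_right _ (by have := Finset.mem_range.1 hi; omega)
    refine (natDegree_mul_le_of_le (natDegree_mul_le_of_le (natDegree_C _).le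
      (natDegree_pow_le_of_le _ hD.le)) (natDegree_mul_le_of_le (natDegree_residuePoly_le ξ c)
        hsum)).trans ?_
    rw [show k + 1 + l - (k + 1) = l by omega, show k + 1 + l - 1 = k + l by omega]
    have : N - 1 ≤ N := Nat.sub_le _ _
    nlinarith

/-- All denominators are cleared by `polePoly ξ ^ r`. Division with remainder then separates the
polynomial part from a fraction that vanishes at infinity. -/
theorem homogenization_eq {r : ℕ} {p : A[X]} (hp : p.natDegree ≤ r) (t : A) (ξ c : Fin N → A) :
    ∑ k ∈ Finset.range (r + 1), C (p.coeff k) * (X * polePoly ξ + C t * residuePoly ξ c) ^ k *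
      polePoly ξ ^ (r - k) =
      polePoly ξ ^ r * specPoly r p t ξ c + C t * (corrNum r p t ξ c %ₘ polePoly ξ ^ r) := by
  have h : ∑ k ∈ Finset.range (r + 1), C (p.coeff k) *
      (X * polePoly ξ + C t * residuePoly ξ c) ^ k * polePoly ξ ^ (r - k) =
      polePoly ξ ^ r * p + C t * corrNum r p t ξ c := by
    rw [show polePoly ξ ^ r * p = polePoly ξ ^ r *
      ∑ k ∈ Finset.range (r + 1), C (p.coeff k) * X ^ k by
        rw [← p.as_sum_range_C_mul_X_pow' (Nat.lt_succ_of_le hp)]]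
    rw [corrNum, Finset.mul_sum, Finset.mul_sum, ← Finset.sum_add_distrib]
    refine Finset.sum_congr rfl fun k hk => ?_
    have hg := (Commute.all (X * polePoly ξ + C t * residuePoly ξ c) (X * polePoly ξ)).geom_sum₂_mul k
    rw [add_sub_cancel_left] at hg
    have hD : polePoly ξ ^ r = polePoly ξ ^ k * polePoly ξ ^ (r - k) := by
      rw [← pow_add, Nat.add_sub_cancel' (by have := Finset.mem_range.1 hk; omega)]
    rw [eq_sub_iff_add_eq'] at hg
    rw [← hg, hD]
    ring
  rw [h, specPoly]
  nth_rewrite 1 [← modByMonic_add_div (corrNum r p t ξ c) (polePoly ξ ^ r)]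
  rw [corrPoly]
  ring

section Evaluation

variable {B : Type*} [CommRing B] (φ : A →+* B) (y : B) (ξ c : Fin N → A) (w : Fin N → B)

theorem eval₂_polePoly : (polePoly ξ).eval₂ φ y = ∏ i, (y - φ (ξ i)) := by
  rw [polePoly, eval₂_finsetProd]
  simp

theorem eval₂_residuePoly : (residuePoly ξ c).eval₂ φ y =
    ∑ i, φ (c i) * ∏ j ∈ Finset.univ.erase i, (y - φ (ξ j)) := by
  rw [residuePoly, eval₂_finsetSum]
  refine Finset.sum_congr rfl fun i _ => ?_
  rw [eval₂_mul, eval₂_finsetProd]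
  simp

variable {φ y ξ c w} (hw : ∀ i, (y - φ (ξ i)) * w i = 1)
include hw

theorem eval₂_residuePoly_of_inv : (residuePoly ξ c).eval₂ φ y =
    (polePoly ξ).eval₂ φ y * ∑ i, φ (c i) * w i := by
  rw [eval₂_residuePoly, eval₂_polePoly, Finset.mul_sum]
  refine Finset.sum_congr rfl fun i _ => ?_
  rw [← Finset.mul_prod_erase _ _ (Finset.mem_univ i)]
  linear_combination (-φ (c i) * ∏ j ∈ Finset.univ.erase i, (y - φ (ξ j))) * hw i

theorem polePoly_pow_mul_eval₂ {r : ℕ} {p : A[X]} (hp : p.natDegree ≤ r) (t : A) :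
    (polePoly ξ).eval₂ φ y ^ r * p.eval₂ φ (y + φ t * ∑ i, φ (c i) * w i) =
      (polePoly ξ).eval₂ φ y ^ r * (specPoly r p t ξ c).eval₂ φ y +
        (C t * (corrNum r p t ξ c %ₘ polePoly ξ ^ r)).eval₂ φ y := by
  rw [← eval₂_pow, ← eval₂_mul, ← eval₂_add, ← homogenization_eq hp, eval₂_finsetSum,
    eval₂_eq_sum_range' φ (Nat.lt_succ_of_le hp), Finset.mul_sum]
  refine Finset.sum_congr rfl fun k hk => ?_
  rw [eval₂_mul, eval₂_mul, eval₂_C, eval₂_pow, eval₂_pow, eval₂_add, eval₂_mul, eval₂_X, eval₂_mul,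
    eval₂_C, eval₂_residuePoly_of_inv hw, eval₂_pow]
  have hD : (polePoly ξ).eval₂ φ y ^ r =
      (polePoly ξ).eval₂ φ y ^ k * (polePoly ξ).eval₂ φ y ^ (r - k) := by
    rw [← pow_add, Nat.add_sub_cancel' (by have := Finset.mem_range.1 hk; omega)]
  rw [hD, show y * (polePoly ξ).eval₂ φ y + φ t * ((polePoly ξ).eval₂ φ y * ∑ i, φ (c i) * w i) =
    (polePoly ξ).eval₂ φ y * (y + φ t * ∑ i, φ (c i) * w i) by ring, mul_pow]
  ring

end Evaluation

section Infinity

variable {K : Type*} [Field K] {ξ c : Fin N → PowerSeries K} {y : PowerSeries (LaurentSeries K)}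
  {w : Fin N → PowerSeries (LaurentSeries K)}

theorem sub_constSeries_mem (hy : y - PowerSeries.C (xInf K) ∈ SeriesVanishAt K 0)
    (a : PowerSeries K) :
    y - constSeries K a - PowerSeries.C (xInf K) ∈ SeriesVanishAt K 0 := by
  rw [sub_right_comm]
  exact sub_mem hy (constSeries_mem a)

theorem mem_of_polePoly_pow_mul_mem (hy : y - PowerSeries.C (xInf K) ∈ SeriesVanishAt K 0)
    {f : PowerSeries (LaurentSeries K)} {r : ℕ} {m : ℤ}
    (h : (polePoly ξ).eval₂ (constSeries K) y ^ r * f ∈ SeriesVanishAt K (m - (N * r : ℕ))) :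
    f ∈ SeriesVanishAt K m := by
  have hprod : ∀ (s : Finset (Fin N)) (f : PowerSeries (LaurentSeries K)) (m : ℤ),
      (∏ i ∈ s, (y - constSeries K (ξ i))) * f ∈ SeriesVanishAt K (m - s.card) →
        f ∈ SeriesVanishAt K m := by
    intro s
    induction s using Finset.induction_on with
    | empty => intro f m h; simpa using h
    | insert i s hi ih =>
      intro f m h
      rw [Finset.prod_insert hi, Finset.card_insert_of_notMem hi, mul_assoc] at h
      refine ih f m (mem_seriesVanishAt_of_mul_mem (sub_constSeries_mem hy (ξ i)) ?_)
      convert h using 2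
      push_cast
      ring
  rw [eval₂_polePoly] at h
  induction r generalizing m with
  | zero => simpa using h
  | succ r ih =>
    refine ih ?_
    refine hprod Finset.univ _ _ ?_
    rw [← mul_assoc, ← pow_succ']
    convert h using 2
    simp only [Finset.card_univ, Fintype.card_fin]
    push_cast
    ring

/-- The difference is the remainder divided by `polePoly ξ ^ r`. The remainder has smaller degree,
and `y = x + O(1)` has the same orders at infinity as `x`. -/
theorem eval₂_sub_specPoly_mem (hy : y - PowerSeries.C (xInf K) ∈ SeriesVanishAt K 0)
    (hw : ∀ i, (y - constSeries K (ξ i)) * w i = 1) {r : ℕ} {p : (PowerSeries K)[X]}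
    (hp : p.natDegree ≤ r) (t : PowerSeries K) :
    p.eval₂ (constSeries K) (y + constSeries K t * ∑ i, constSeries K (c i) * w i) -
      (specPoly r p t ξ c).eval₂ (constSeries K) y ∈ SeriesVanishAt K 1 := by
  refine mem_of_polePoly_pow_mul_mem (ξ := ξ) (r := r) hy ?_
  rw [mul_sub, polePoly_pow_mul_eval₂ hw hp, add_sub_cancel_left]
  rw [eval₂_mul, eval₂_C, ← zero_add (1 - _)]
  refine mul_mem_seriesVanishAt (constSeries_mem t) (eval₂_mem_seriesVanishAt hy ?_)
  refine (degree_modByMonic_lt _ ((polePoly_monic ξ).pow r)).trans_eq ?_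
  rw [degree_eq_natDegree ((polePoly_monic ξ).pow r).ne_zero, (polePoly_monic ξ).natDegree_pow,
    natDegree_polePoly, mul_comm]

/-- Two polynomials with the same asymptotics differ by one that vanishes at infinity. -/
theorem eq_specPoly {w : Fin N → PowerSeries (LaurentSeries K)}
    (hw : ∀ i, (PowerSeries.C (xInf K) - constSeries K (ξ i)) * w i = 1) {r : ℕ}
    {p : (PowerSeries K)[X]} (hp : p.natDegree ≤ r) (t : PowerSeries K) {Q : (PowerSeries K)[X]}
    (hQ : p.eval₂ (constSeries K) (PowerSeries.C (xInf K) +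
      constSeries K t * ∑ i, constSeries K (c i) * w i) -
        Q.eval₂ (constSeries K) (PowerSeries.C (xInf K)) ∈ SeriesVanishAt K 1) :
    Q = specPoly r p t ξ c := by
  have hy : PowerSeries.C (xInf K) - PowerSeries.C (xInf K) ∈ SeriesVanishAt K 0 := by
    rw [sub_self]; exact zero_mem _
  have h1 := sub_mem hQ (eval₂_sub_specPoly_mem (c := c) hy hw hp t)
  rw [sub_sub_sub_cancel_left, ← eval₂_sub] at h1
  have h2 : (specPoly r p t ξ c - Q).degree < (0 : ℕ) → Q = specPoly r p t ξ c := by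
    intro h
    rw [degree_lt_iff_coeff_zero] at h
    ext1 n
    exact (sub_eq_zero.1 ((coeff_sub _ _ _).symm.trans (h n (Nat.zero_le _)))).symm
  refine h2 (degree_lt_of_eval₂_mem ?_)
  rw [Nat.cast_zero, sub_zero]
  exact h1

end Infinity

end SpectralPolynomial

/-! ### The spectral polynomial as a fixed point -/

section SpectralFixedPoint

variable {K : Type*} [Field K] {N : ℕ}

/-- Congruences pass through division by monic polynomials when one works over the quotient ring. -/
theorem C_pow_dvd_sub_of_map_eq {A : Type*} [CommRing A] {a : A} {f g : A[X]}
    (h : f.map (Ideal.Quotient.mk (Ideal.span {a})) = g.map (Ideal.Quotient.mk (Ideal.span {a}))) :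
    C a ∣ f - g := by
  rw [C_dvd_iff_dvd_coeff]
  intro i
  have := congrArg (fun q => q.coeff i) h
  simp only [coeff_map] at this
  rw [Ideal.Quotient.eq, Ideal.mem_span_singleton] at this
  rwa [coeff_sub]

theorem map_constantCoeff_specPoly (r : ℕ) (p : K[X]) (ξ c : Fin N → PowerSeries K) :
    (specPoly r (p.map PowerSeries.C) PowerSeries.X ξ c).map PowerSeries.constantCoeff = p := by
  rw [specPoly, Polynomial.map_add, Polynomial.map_mul, map_C, PowerSeries.constantCoeff_X, C_0,
    zero_mul, add_zero, Polynomial.map_map,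
    PowerSeries.constantCoeff_comp_C, Polynomial.map_id]

theorem constantCoeff_eval (Q : (PowerSeries K)[X]) (u : PowerSeries K) :
    PowerSeries.constantCoeff (Q.eval u) =
      (Q.map PowerSeries.constantCoeff).eval (PowerSeries.constantCoeff u) := by
  rw [eval_map, eval₂_at_apply]

/-- The factor `t` in front of the correction gains one order: knowing `ξ` and `c` modulo `t ^ n`
determines the polynomial modulo `t ^ (n + 1)`. -/
theorem specPoly_sub_dvd (r n : ℕ) (p : (PowerSeries K)[X]) {ξ c ξ' c' : Fin N → PowerSeries K}
    (h : ∀ i, PowerSeries.X ^ n ∣ ξ i - ξ' i) (h' : ∀ i, PowerSeries.X ^ n ∣ c i - c' i) :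
    C (PowerSeries.X ^ (n + 1)) ∣ specPoly r p PowerSeries.X ξ c - specPoly r p PowerSeries.X ξ' c' := by
  rw [specPoly, specPoly, add_sub_add_left_eq_sub, ← mul_sub, pow_succ', C_mul]
  refine mul_dvd_mul_left _ (C_pow_dvd_sub_of_map_eq ?_)
  rw [map_corrPoly, map_corrPoly]
  congr 1
  · funext i
    exact Ideal.Quotient.eq.2 (Ideal.mem_span_singleton.2 (h i))
  · funext i
    exact Ideal.Quotient.eq.2 (Ideal.mem_span_singleton.2 (h' i))

theorem X_pow_dvd_inv_sub_inv {n : ℕ} {a b : PowerSeries K}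
    (ha : PowerSeries.constantCoeff a ≠ 0) (hb : PowerSeries.constantCoeff b ≠ 0)
    (h : PowerSeries.X ^ n ∣ a - b) : PowerSeries.X ^ n ∣ a⁻¹ - b⁻¹ := by
  have : a⁻¹ - b⁻¹ = (a - b) * (-(a⁻¹ * b⁻¹)) := by
    have h1 := PowerSeries.mul_inv_cancel a ha
    have h2 := PowerSeries.mul_inv_cancel b hb
    linear_combination b⁻¹ * h1 - a⁻¹ * h2
  rw [this]
  exact h.mul_right _

/-- The equations for the spectral polynomial have exactly one solution. -/
theorem existsUnique_spectral (r : ℕ) (p : K[X]) (lam : Fin N → K)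
    (hd : ∀ j, (derivative p).eval (lam j) ≠ 0) :
    ∃! u : (Fin N → PowerSeries K) × (Fin N → PowerSeries K),
      (∀ j, PowerSeries.constantCoeff (u.1 j) = lam j) ∧
      (∀ j, (specPoly r (p.map PowerSeries.C) PowerSeries.X u.1 u.2).eval (u.1 j) =
        PowerSeries.C (p.eval (lam j))) ∧
      ∀ j, u.2 j = ((derivative (specPoly r (p.map PowerSeries.C) PowerSeries.X u.1 u.2)).eval
        (u.1 j))⁻¹ := by
  set q : (Fin N → PowerSeries K) → (Fin N → PowerSeries K) → (PowerSeries K)[X] :=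
    fun ξ c => specPoly r (p.map PowerSeries.C) PowerSeries.X ξ c with hq
  -- A Newton step for `Q(ξ_j) = p(λ_j)`, with the derivative frozen at its value for `t = 0`.
  set S : (Fin N → PowerSeries K) → (Fin N → PowerSeries K) → Fin N → PowerSeries K :=
    fun ξ c j => ξ j - PowerSeries.C ((derivative p).eval (lam j))⁻¹ *
      ((q ξ c).eval (ξ j) - PowerSeries.C (p.eval (lam j))) with hS
  have hS0 : ∀ ξ c, (∀ j, PowerSeries.constantCoeff (ξ j) = lam j) →
      ∀ j, PowerSeries.constantCoeff (S ξ c j) = lam j := by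
    intro ξ c hξ j
    rw [hS]
    simp only [map_sub, map_mul, constantCoeff_eval, hq, map_constantCoeff_specPoly, hξ,
      PowerSeries.constantCoeff_C, sub_self, mul_zero, sub_zero]
  have hD0 : ∀ ξ c (x : PowerSeries K) j, PowerSeries.constantCoeff x = lam j →
      PowerSeries.constantCoeff ((derivative (q ξ c)).eval x) = (derivative p).eval (lam j) := by
    intro ξ c x j hx
    rw [constantCoeff_eval, ← derivative_map, hq, map_constantCoeff_specPoly, hx]
  obtain ⟨u, ⟨hu0, hu⟩, huniq⟩ := existsUnique_fixedPoint (ι := Fin N ⊕ Fin N)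
    (Sum.elim lam fun j => ((derivative p).eval (lam j))⁻¹)
    (fun u => Sum.elim (S (fun j => u (Sum.inl j)) fun j => u (Sum.inr j))
      -- The derivative is evaluated at the updated `ξ`, not at the old one; otherwise this
      -- component would not gain an order in `t`.
      fun j => ((derivative (q (fun j => u (Sum.inl j)) fun j => u (Sum.inr j))).eval
        (S (fun j => u (Sum.inl j)) (fun j => u (Sum.inr j)) j))⁻¹)
    (by
      rintro u hu (j | j)
      · exact hS0 _ _ (fun j => hu (Sum.inl j)) j
      · simp only [Sum.elim_inr]
        rw [PowerSeries.constantCoeff_inv, hD0 _ _ _ j (hS0 _ _ (fun j => hu (Sum.inl j)) j)])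
    (by
      intro n u v hu hv huv
      have hqd : C (PowerSeries.X ^ (n + 1)) ∣ q (fun j => u (Sum.inl j)) (fun j => u (Sum.inr j)) -
          q (fun j => v (Sum.inl j)) (fun j => v (Sum.inr j)) :=
        specPoly_sub_dvd r n _ (fun i => huv _) fun i => huv _
      have hcu : ∀ j, PowerSeries.constantCoeff (u (Sum.inl j)) = lam j := fun j => hu (Sum.inl j)
      have hcv : ∀ j, PowerSeries.constantCoeff (v (Sum.inl j)) = lam j := fun j => hv (Sum.inl j)
      have hSu := hS0 (fun j => u (Sum.inl j)) (fun j => u (Sum.inr j)) hcu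
      have hSv := hS0 (fun j => v (Sum.inl j)) (fun j => v (Sum.inr j)) hcv
      obtain ⟨R, hR⟩ := hqd
      rw [sub_eq_iff_eq_add] at hR
      have h1 : ∀ j, PowerSeries.X ^ (n + 1) ∣
          S (fun j => u (Sum.inl j)) (fun j => u (Sum.inr j)) j -
            S (fun j => v (Sum.inl j)) (fun j => v (Sum.inr j)) j := by
        intro j
        simp only [hS]
        rw [hR]
        set g := q (fun j => v (Sum.inl j)) (fun j => v (Sum.inr j)) with hg
        obtain ⟨k, hk⟩ := g.binomExpansion (v (Sum.inl j)) (u (Sum.inl j) - v (Sum.inl j))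
        rw [add_sub_cancel] at hk
        rw [eval_add, eval_mul, eval_C, hk]
        set b := PowerSeries.C ((derivative p).eval (lam j))⁻¹ with hb
        rw [show ∀ a a' y z d e f : PowerSeries K, a - b * (z + (y + d + e) - f) - (a' - b * (y - f)) =
          (a - a' - b * (d + e)) - b * z by intros; ring]
        refine dvd_sub ?_ ((dvd_mul_right _ _).mul_left _)
        rw [show ∀ D d : PowerSeries K, d - b * (D * d + k * d ^ 2) =
          d * (1 - b * (D + k * d)) by intros; ring, pow_succ]
        refine mul_dvd_mul (huv (Sum.inl j)) (PowerSeries.X_dvd_iff.2 ?_)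
        rw [map_sub, map_mul, map_add, map_mul, map_sub, hcu, hcv, hg, hD0 _ _ _ j (hcv j),
          sub_self, mul_zero, add_zero, hb, PowerSeries.constantCoeff_C, inv_mul_cancel₀ (hd j),
          map_one, sub_self]
      rintro (j | j)
      · exact h1 j
      · simp only [Sum.elim_inr]
        refine X_pow_dvd_inv_sub_inv ?_ ?_ ?_
        · rw [hD0 _ _ _ j (hSu j)]; exact hd j
        · rw [hD0 _ _ _ j (hSv j)]; exact hd j
        · rw [hR, derivative_add, derivative_C_mul, eval_add, eval_mul, eval_C, add_sub_assoc]
          exact dvd_add (dvd_mul_right _ _) ((h1 j).trans (sub_dvd_eval_sub _ _ _)))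
  have hbu : ∀ j, PowerSeries.C ((derivative p).eval (lam j))⁻¹ ≠ 0 := by
    intro j h
    rw [← map_zero PowerSeries.C] at h
    exact inv_ne_zero (hd j) (PowerSeries.C_injective h)
  refine ⟨(fun j => u (Sum.inl j), fun j => u (Sum.inr j)), ⟨fun j => hu0 (Sum.inl j), ?_, ?_⟩, ?_⟩
  · intro j
    have := congrFun hu (Sum.inl j)
    simp only [Sum.elim_inl, hS, sub_eq_self] at this
    exact sub_eq_zero.1 ((mul_eq_zero.1 this).resolve_left (hbu j))
  · intro j
    have := congrFun hu (Sum.inr j)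
    simp only [Sum.elim_inr] at this
    have h2 := congrFun hu (Sum.inl j)
    simp only [Sum.elim_inl] at h2
    rw [h2] at this
    exact this.symm
  · rintro ⟨ξ, c⟩ ⟨h1, h2, h3⟩
    simp only at h1 h2 h3
    have hSξ : S ξ c = ξ := by
      funext j
      simp only [hS, hq]
      rw [h2, sub_self, mul_zero, sub_zero]
    have := huniq (Sum.elim ξ c) ⟨?_, ?_⟩
    · rw [← this]
      rfl
    · rintro (j | j)
      · exact h1 j
      · simp only [Sum.elim_inr]
        rw [h3, PowerSeries.constantCoeff_inv]
        congr 1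
        exact hD0 ξ c _ j (h1 j)
    · funext i
      rcases i with j | j
      · exact congrFun hSξ j
      · simp only [Sum.elim_inr, Sum.elim_inl]
        rw [hSξ, h3]

end SpectralFixedPoint

/-! ### Rational functions of z and their expansions at infinity -/

section ExpansionAtInfinity

/-- The coefficientwise expansion at infinity. -/
noncomputable abbrev expandSeries : PowerSeries (RatFunc ℂ) →+* PowerSeries (LaurentSeries ℂ) :=
  PowerSeries.map expandAtInfty.toRingHom

theorem expandAtInfty_apply (f : RatFunc ℂ) :
    expandAtInfty f = aeval (xInf ℂ) f.num / aeval (xInf ℂ) f.denom :=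
  RatFunc.liftAlgHom_apply _ _ _

theorem aeval_denom_mul_expandAtInfty (f : RatFunc ℂ) :
    aeval (xInf ℂ) f.denom * expandAtInfty f = aeval (xInf ℂ) f.num := by
  rw [expandAtInfty_apply]
  exact mul_div_cancel₀ _ (aeval_zInfty_ne_zero _ f.denom_ne_zero)

theorem expandAtInfty_X : expandAtInfty RatFunc.X = xInf ℂ := by
  rw [expandAtInfty_apply, RatFunc.num_X, RatFunc.denom_X, aeval_X, map_one, div_one]

theorem expandAtInfty_algebraMap (c : ℂ) :
    expandAtInfty (algebraMap ℂ (RatFunc ℂ) c) = algebraMap ℂ (LaurentSeries ℂ) c := by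
  rw [AlgHom.commutes, algebraMap_laurent]

theorem aeval_mul_mem_ord_iff {K : Type*} [Field K] {q : K[X]} (hq : q ≠ 0) {f : LaurentSeries K}
    {m : ℤ} : aeval (xInf K) q * f ∈ VanishAt K (-(q.natDegree : ℤ) + m) ↔ f ∈ VanishAt K m := by
  have h := (aeval_mem_ord_iff (p := q)).2 le_rfl
  refine ⟨mem_ord_of_mul_mem h ?_, mul_mem_ord h⟩
  rw [coeff_aeval_xInf, if_pos (by omega), neg_neg, Int.toNat_natCast]
  exact leadingCoeff_ne_zero.2 hq

theorem aeval_mem_ord_iff_lt {K : Type*} [Field K] {p : K[X]} {m : ℕ} :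
    aeval (xInf K) p ∈ VanishAt K (1 - m) ↔ p.degree < m := by
  rw [degree_lt_iff_coeff_zero]
  constructor
  · intro h k hk
    have := h (-(k : ℤ)) (by omega)
    rwa [coeff_aeval_xInf, if_pos (by omega), neg_neg, Int.toNat_natCast] at this
  · intro h k hk
    rw [coeff_aeval_xInf]
    split_ifs with h0
    · exact h _ (by omega)
    · rfl

/-- Multiplication by the denominator shifts the order at infinity by exactly its degree, so
comparing degrees amounts to comparing orders. -/
theorem bigOInv_iff {F : PowerSeries (RatFunc ℂ)} :
    BigOInv F ↔ expandSeries F ∈ SeriesVanishAt ℂ 1 := by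
  refine forall_congr' fun n => ?_
  rw [PowerSeries.coeff_map]
  set f := PowerSeries.coeff n F
  change _ ↔ expandAtInfty f ∈ _
  rw [← aeval_mul_mem_ord_iff f.denom_ne_zero, aeval_denom_mul_expandAtInfty, neg_add_eq_sub,
    aeval_mem_ord_iff_lt, degree_eq_natDegree f.denom_ne_zero]

theorem bigOOne_iff {F : PowerSeries (RatFunc ℂ)} :
    BigOOne F ↔ expandSeries F ∈ SeriesVanishAt ℂ 0 := by
  refine forall_congr' fun n => ?_
  rw [PowerSeries.coeff_map]
  set f := PowerSeries.coeff n F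
  change _ ↔ expandAtInfty f ∈ _
  rw [← aeval_mul_mem_ord_iff f.denom_ne_zero, aeval_denom_mul_expandAtInfty, add_zero,
    aeval_mem_ord_iff, degree_eq_natDegree f.denom_ne_zero, natDegree_le_iff_degree_le]

theorem expandSeries_C_X : expandSeries (PowerSeries.C RatFunc.X) = PowerSeries.C (xInf ℂ) := by
  rw [PowerSeries.map_C]
  exact congrArg _ expandAtInfty_X

theorem expandSeries_scalarSeries (f : PowerSeries ℂ) :
    expandSeries (scalarSeries (RatFunc ℂ) f) = constSeries ℂ f := by
  ext1 n
  rw [PowerSeries.coeff_map, PowerSeries.coeff_map, PowerSeries.coeff_map]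
  exact expandAtInfty_algebraMap _

theorem expandSeries_evalSeries (Q : (PowerSeries ℂ)[X]) (s : PowerSeries (RatFunc ℂ)) :
    expandSeries (evalSeries Q s) = Q.eval₂ (constSeries ℂ) (expandSeries s) := by
  rw [evalSeries, hom_eval₂]
  congr 1
  exact RingHom.ext expandSeries_scalarSeries

theorem evalSeries_map_C {K : Type*} [Field K] [Algebra ℂ K] (p : ℂ[X]) (s : PowerSeries K) :
    evalSeries (p.map PowerSeries.C) s = aeval s p := by
  rw [evalSeries, eval₂_map, aeval_def]
  congr 1

theorem scalarSeries_inv {K : Type*} [Field K] [Algebra ℂ K] (f : PowerSeries ℂ) :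
    scalarSeries K f⁻¹ = (scalarSeries K f)⁻¹ := by
  by_cases hf : PowerSeries.constantCoeff f = 0
  -- A series without constant term has inverse `0` by convention, on both sides.
  · rw [PowerSeries.inv_eq_zero.2 hf, map_zero, eq_comm, PowerSeries.inv_eq_zero,
      ← PowerSeries.coeff_zero_eq_constantCoeff_apply, PowerSeries.coeff_map,
      PowerSeries.coeff_zero_eq_constantCoeff_apply, hf, map_zero]
  · rw [eq_comm, PowerSeries.inv_eq_iff_mul_eq_one, ← map_mul, PowerSeries.inv_mul_cancel _ hf,
      map_one]
    rw [← PowerSeries.coeff_zero_eq_constantCoeff_apply, PowerSeries.coeff_map,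
      PowerSeries.coeff_zero_eq_constantCoeff_apply]
    exact (_root_.map_ne_zero _).2 hf

theorem ratParam_eq {K : Type*} [Field K] [Algebra ℂ K] {N : ℕ} (Q : (PowerSeries ℂ)[X])
    (ξ : Fin N → PowerSeries ℂ) (s : PowerSeries K) :
    ratParam Q ξ s = s + PowerSeries.X * ∑ j, scalarSeries K (((derivative Q).eval (ξ j))⁻¹) *
      (s - scalarSeries K (ξ j))⁻¹ := by
  rw [ratParam]
  refine congrArg _ (congrArg _ (Finset.sum_congr rfl fun j _ => ?_))
  rw [PowerSeries.mul_inv_rev, scalarSeries_inv, mul_comm]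

theorem C_X_sub_scalarSeries_mul_inv (a : PowerSeries ℂ) :
    (PowerSeries.C RatFunc.X - scalarSeries (RatFunc ℂ) a) *
      (PowerSeries.C RatFunc.X - scalarSeries (RatFunc ℂ) a)⁻¹ = 1 := by
  refine PowerSeries.mul_inv_cancel _ ?_
  rw [map_sub, PowerSeries.constantCoeff_C, ← PowerSeries.coeff_zero_eq_constantCoeff_apply,
    PowerSeries.coeff_map, sub_ne_zero]
  intro h
  have h2 := congrArg (fun f => (expandAtInfty f).coeff (-1)) h
  simp only [expandAtInfty_X, expandAtInfty_algebraMap, coeff_xInf,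
    algebraMap_mem_ord (K := ℂ) _ (-1) (by norm_num)] at h2
  exact one_ne_zero h2

end ExpansionAtInfinity

/-! ### Existence, uniqueness and first properties of Q -/

section SpectralPolynomial

variable {N r : ℕ} {V : ℂ[X]} {lam : Fin N → ℂ}

/-- The asymptotic condition says that `Q` is the polynomial part of `V'(y(ζ))` for the residues
`c_j = 1/Q'(ξ_j)`. The implicit conditions thus become the system solved in `existsUnique_spectral`.
-/
theorem isSpectralPolynomial_iff (hV : V.natDegree = r + 1) {Q : (PowerSeries ℂ)[X]}
    {ξ : Fin N → PowerSeries ℂ} : IsSpectralPolynomial V lam Q ξ ↔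
      (∀ j, IsPreimage V Q (lam j) (ξ j)) ∧ Q = specPoly r ((derivative V).map PowerSeries.C)
        PowerSeries.X ξ fun j => ((derivative Q).eval (ξ j))⁻¹ := by
  rw [IsSpectralPolynomial]
  refine and_congr_right fun _ => ?_
  set c : Fin N → PowerSeries ℂ := fun j => ((derivative Q).eval (ξ j))⁻¹ with hc
  set w : Fin N → PowerSeries (LaurentSeries ℂ) := fun j =>
    expandSeries (PowerSeries.C RatFunc.X - scalarSeries (RatFunc ℂ) (ξ j))⁻¹ with hw
  have hw1 : ∀ i, (PowerSeries.C (xInf ℂ) - constSeries ℂ (ξ i)) * w i = 1 := by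
    intro i
    rw [hw, ← expandSeries_C_X, ← expandSeries_scalarSeries, ← map_sub, ← map_mul,
      C_X_sub_scalarSeries_mul_inv, map_one]
  have hp : ((derivative V).map (PowerSeries.C : ℂ →+* _)).natDegree ≤ r := by
    refine natDegree_map_le.trans ((natDegree_derivative_le V).trans ?_)
    rw [hV]; exact le_rfl
  have hy : PowerSeries.C (xInf ℂ) - PowerSeries.C (xInf ℂ) ∈ SeriesVanishAt ℂ 0 := by
    rw [sub_self]; exact zero_mem _
  have he : expandSeries (aeval (ratParam Q ξ (PowerSeries.C (RatFunc.X : RatFunc ℂ)))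
      (derivative V) - evalSeries Q (PowerSeries.C (RatFunc.X : RatFunc ℂ))) =
      ((derivative V).map PowerSeries.C).eval₂ (constSeries ℂ) (PowerSeries.C (xInf ℂ) +
        constSeries ℂ PowerSeries.X * ∑ i, constSeries ℂ (c i) * w i) -
        Q.eval₂ (constSeries ℂ) (PowerSeries.C (xInf ℂ)) := by
    rw [map_sub, ← evalSeries_map_C, expandSeries_evalSeries, expandSeries_evalSeries,
      expandSeries_C_X, ratParam_eq, map_add, map_mul, map_sum, expandSeries_C_X, PowerSeries.map_X,
      PowerSeries.map_X]
    simp only [map_mul, expandSeries_scalarSeries, hc, hw]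
  rw [bigOInv_iff, he]
  constructor
  · exact fun h => eq_specPoly hw1 hp _ h
  · intro h
    have := eval₂_sub_specPoly_mem (c := c) hy hw1 hp PowerSeries.X
    rwa [← h] at this

theorem exists_isSpectralPolynomial (hV : V.natDegree = r + 1) (hd : ∀ i, ddV V (lam i) ≠ 0) :
    ∃ (Q : (PowerSeries ℂ)[X]) (ξ : Fin N → PowerSeries ℂ), IsSpectralPolynomial V lam Q ξ ∧
      ∀ Q' ξ', IsSpectralPolynomial V lam Q' ξ' → Q' = Q ∧ ξ' = ξ := by
  have hev : ∀ a : ℂ, dV V a = (derivative V).eval a := fun a => by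
    rw [dV, coe_aeval_eq_eval]
  obtain ⟨⟨ξ, c⟩, ⟨h1, h2, h3⟩, huniq⟩ := existsUnique_spectral r (derivative V) lam (fun j => by
    have := hd j
    rwa [ddV, coe_aeval_eq_eval] at this)
  simp only at h1 h2 h3
  refine ⟨_, ξ, (isSpectralPolynomial_iff hV).2 ⟨fun j => ⟨h1 j, (h2 j).trans (by rw [hev])⟩, ?_⟩, ?_⟩
  · congr 1
    exact funext h3
  · intro Q' ξ' h
    obtain ⟨hpre, hQ'⟩ := (isSpectralPolynomial_iff hV).1 h
    have := huniq (ξ', fun j => ((derivative Q').eval (ξ' j))⁻¹) ⟨fun j => (hpre j).1, fun j => ?_,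
      fun j => ?_⟩
    · rw [Prod.mk.injEq] at this
      obtain ⟨rfl, hc⟩ := this
      rw [hc] at hQ'
      exact ⟨hQ', rfl⟩
    · simp only
      rw [← hQ', (hpre j).2, hev]
    · simp only
      rw [← hQ']

theorem IsSpectralPolynomial.map_constantCoeff (hV : V.natDegree = r + 1) {Q : (PowerSeries ℂ)[X]}
    {ξ : Fin N → PowerSeries ℂ} (h : IsSpectralPolynomial V lam Q ξ) :
    Q.map PowerSeries.constantCoeff = derivative V := by
  rw [((isSpectralPolynomial_iff hV).1 h).2, map_constantCoeff_specPoly]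

theorem IsSpectralPolynomial.coeff_eq (hr : 1 ≤ r) (hV : V.natDegree = r + 1)
    {Q : (PowerSeries ℂ)[X]} {ξ : Fin N → PowerSeries ℂ} (h : IsSpectralPolynomial V lam Q ξ) {k : ℕ}
    (hk : r ≤ k) : Q.coeff k = PowerSeries.C ((derivative V).coeff k) := by
  rw [((isSpectralPolynomial_iff hV).1 h).2, specPoly, coeff_add, coeff_map, coeff_C_mul,
    coeff_eq_zero_of_natDegree_lt ((natDegree_corrPoly_le _ _ _ _ _).trans_lt (by omega)), mul_zero,
    add_zero]

theorem natDegree_derivative_eq (hV : V.natDegree = r + 1) : (derivative V).natDegree = r := by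
  rw [natDegree_derivative, hV, Nat.add_sub_cancel]

theorem IsSpectralPolynomial.natDegree_eq (hr : 1 ≤ r) (hV : V.natDegree = r + 1)
    {Q : (PowerSeries ℂ)[X]} {ξ : Fin N → PowerSeries ℂ} (h : IsSpectralPolynomial V lam Q ξ) :
    Q.natDegree = r := by
  have hd := natDegree_derivative_eq hV
  refine natDegree_eq_of_le_of_coeff_ne_zero ?_ ?_
  · rw [natDegree_le_iff_coeff_eq_zero]
    intro k hk
    rw [h.coeff_eq hr hV hk.le, coeff_eq_zero_of_natDegree_lt (hd.trans_lt hk), map_zero]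
  · rw [h.coeff_eq hr hV le_rfl]
    intro h0
    rw [← map_zero PowerSeries.C] at h0
    have := PowerSeries.C_injective h0
    rw [show r = (derivative V).natDegree from hd.symm, coeff_natDegree, leadingCoeff_eq_zero] at this
    rw [this, natDegree_zero] at hd
    omega

theorem IsSpectralPolynomial.isUnit_eval (hV : V.natDegree = r + 1) (hd : ∀ i, ddV V (lam i) ≠ 0)
    {Q : (PowerSeries ℂ)[X]} {ξ : Fin N → PowerSeries ℂ} (h : IsSpectralPolynomial V lam Q ξ)
    (j : Fin N) : IsUnit ((derivative Q).eval (ξ j)) := by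
  rw [PowerSeries.isUnit_iff_constantCoeff, constantCoeff_eval, ← derivative_map,
    h.map_constantCoeff hV, (h.1 j).1, isUnit_iff_ne_zero]
  have := hd j
  rwa [ddV, coe_aeval_eq_eval] at this

theorem IsSpectralPolynomial.eq_of_isPreimage (hV : V.natDegree = r + 1)
    (hd : ∀ i, ddV V (lam i) ≠ 0) {Q : (PowerSeries ℂ)[X]} {ξ : Fin N → PowerSeries ℂ}
    (h : IsSpectralPolynomial V lam Q ξ) (j : Fin N) {x : PowerSeries ℂ}
    (hx : IsPreimage V Q (lam j) x) : x = ξ j := by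
  refine (eq_of_root (f := Q - C (PowerSeries.C (dV V (lam j)))) ?_ ?_ ?_ ?_).symm
  · rw [Polynomial.map_sub, map_C, derivative_sub, derivative_C, sub_zero, h.map_constantCoeff hV,
      (h.1 j).1, isUnit_iff_ne_zero]
    have := hd j
    rwa [ddV, coe_aeval_eq_eval] at this
  · rw [eval_sub, eval_C, (h.1 j).2, sub_self]
  · rw [eval_sub, eval_C, hx.2, sub_self]
  · rw [hx.1, (h.1 j).1]

end SpectralPolynomial

/-! ### Homogenization of polynomials -/

section Homogenization

/-- The homogenization of a polynomial of degree at most `r`. -/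
noncomputable def homog {B : Type*} [CommRing B] (s : B) (r : ℕ) (q : B[X]) : B[X] :=
  ∑ k ∈ Finset.range (r + 1), C (q.coeff k * s ^ (r - k)) * X ^ k

theorem map_homog {B B' : Type*} [CommRing B] [CommRing B'] (φ : B →+* B') (s : B) (r : ℕ) (q : B[X]) :
    (homog s r q).map φ = homog (φ s) r (q.map φ) := by
  simp [homog, Polynomial.map_sum]

theorem eval_homog {B : Type*} [CommRing B] {s u : B} (h : u * s = 1) {r : ℕ} {q : B[X]}
    (hq : q.natDegree ≤ r) (w : B) : q.eval (u * w) = u ^ r * (homog s r q).eval w := by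
  rw [eval_eq_sum_range' (Nat.lt_succ_of_le hq), homog, eval_finsetSum, Finset.mul_sum]
  refine Finset.sum_congr rfl fun k hk => ?_
  rw [eval_mul, eval_C, eval_pow, eval_X]
  have hu : u ^ r * s ^ (r - k) = u ^ k := by
    rw [← Nat.add_sub_cancel' (show k ≤ r by have := Finset.mem_range.1 hk; omega), pow_add,
      Nat.add_sub_cancel' (show k ≤ r by have := Finset.mem_range.1 hk; omega), mul_assoc, ← mul_pow,
      h, one_pow, mul_one]
  rw [mul_pow]
  linear_combination (-q.coeff k * w ^ k) * hu

theorem homog_zero {B : Type*} [CommRing B] (r : ℕ) (q : B[X]) :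
    homog 0 r q = C (q.coeff r) * X ^ r := by
  rw [homog, Finset.sum_range_succ, Finset.sum_eq_zero, zero_add, Nat.sub_self, pow_zero, mul_one]
  intro k hk
  rw [zero_pow (by have := Finset.mem_range.1 hk; omega), mul_zero, C_0, zero_mul]

end Homogenization

/-! ### Branches of algebraic functions at infinity -/

section AlgebraicFunctions

variable {K : Type*} [Field K]

theorem xInf_mul_ofPowerSeries_X : xInf K * HahnSeries.ofPowerSeries ℤ K PowerSeries.X = 1 := by
  rw [HahnSeries.ofPowerSeries_X, xInf, HahnSeries.single_mul_single]
  simp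

theorem ofPowerSeries_C' (c : K) :
    HahnSeries.ofPowerSeries ℤ K (PowerSeries.C c) = algebraMap K (LaurentSeries K) c := by
  rw [algebraMap_laurentSeries, HahnSeries.ofPowerSeries_C]
  rfl

theorem aeval_xInf_mul {p : K[X]} {r : ℕ} (hp : p.natDegree ≤ r) (w : PowerSeries K) :
    aeval (xInf K * HahnSeries.ofPowerSeries ℤ K w) p = xInf K ^ r *
      HahnSeries.ofPowerSeries ℤ K ((homog PowerSeries.X r (p.map PowerSeries.C)).eval w) := by
  have h := eval_homog (xInf_mul_ofPowerSeries_X (K := K))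
    (q := (p.map PowerSeries.C).map (HahnSeries.ofPowerSeries ℤ K))
    (natDegree_map_le.trans (natDegree_map_le.trans hp)) (HahnSeries.ofPowerSeries ℤ K w)
  rw [← map_homog, eval_map_apply, Polynomial.map_map, eval_map] at h
  rw [← h, aeval_def]
  congr 1

theorem constantCoeff_eval_homog {p : K[X]} {r : ℕ} (w : PowerSeries K) :
    PowerSeries.constantCoeff ((homog PowerSeries.X r (p.map PowerSeries.C)).eval w) =
      p.coeff r * PowerSeries.constantCoeff w ^ r := by
  rw [constantCoeff_eval, map_homog, PowerSeries.constantCoeff_X, homog_zero, Polynomial.map_map,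
    PowerSeries.constantCoeff_comp_C, Polynomial.map_id]
  simp

/-- The substitution `y = x w` with `w` a power series in `1/x`. It turns asymptotics at infinity
into a condition on the constant coefficient, to which Hensel's lemma applies. -/
theorem sub_mem_ord_zero_iff {y : LaurentSeries K} {θ : K} :
    y - algebraMap K _ θ * xInf K ∈ VanishAt K 0 ↔ ∃ w : PowerSeries K,
      PowerSeries.constantCoeff w = θ ∧ xInf K * HahnSeries.ofPowerSeries ℤ K w = y := by
  constructor
  · intro h
    obtain ⟨g, hg⟩ := ord_zero_iff.1 h
    refine ⟨PowerSeries.C θ + PowerSeries.X * g, by simp, ?_⟩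
    rw [map_add, map_mul, hg, ofPowerSeries_C', mul_add, ← mul_assoc, xInf_mul_ofPowerSeries_X]
    ring
  · rintro ⟨w, hw, rfl⟩
    obtain ⟨g, hg⟩ := PowerSeries.X_dvd_iff.2 (show PowerSeries.constantCoeff (w - PowerSeries.C θ) = 0
      by rw [map_sub, hw, PowerSeries.constantCoeff_C, sub_self])
    refine ord_zero_iff.2 ⟨g, ?_⟩
    rw [sub_eq_iff_eq_add] at hg
    rw [hg, map_add, map_mul, ofPowerSeries_C', mul_add, ← mul_assoc, xInf_mul_ofPowerSeries_X]
    ring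

theorem aeval_ne_zero_of_sub_mem {p : K[X]} (hp : p ≠ 0) {y : LaurentSeries K} {θ : K} (hθ : θ ≠ 0)
    (hy : y - algebraMap K _ θ * xInf K ∈ VanishAt K 0) : aeval y p ≠ 0 := by
  obtain ⟨w, hw, rfl⟩ := sub_mem_ord_zero_iff.1 hy
  rw [aeval_xInf_mul le_rfl]
  refine mul_ne_zero (pow_ne_zero _ xInf_ne_zero) fun h => ?_
  rw [← map_zero (HahnSeries.ofPowerSeries ℤ K)] at h
  have := congrArg PowerSeries.constantCoeff (HahnSeries.ofPowerSeries_injective h)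
  rw [constantCoeff_eval_homog, hw, map_zero] at this
  exact mul_ne_zero (leadingCoeff_ne_zero.2 hp) (pow_ne_zero _ hθ) this

theorem isUnit_eval_derivative_homog [CharZero K] {p : K[X]} {r : ℕ} (hr : 1 ≤ r)
    (hp : p.natDegree = r) {θ : K} (hθ : θ ≠ 0) : IsUnit ((derivative
      ((homog PowerSeries.X r (p.map PowerSeries.C)).map PowerSeries.constantCoeff)).eval θ) := by
  rw [map_homog, PowerSeries.constantCoeff_X, homog_zero, Polynomial.map_map,
    PowerSeries.constantCoeff_comp_C, Polynomial.map_id, isUnit_iff_ne_zero]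
  rw [derivative_C_mul, derivative_X_pow, eval_mul, eval_C, eval_mul, eval_C, eval_pow, eval_X]
  have hp0 : p ≠ 0 := by
    rintro rfl
    rw [natDegree_zero] at hp
    omega
  refine mul_ne_zero ?_ (mul_ne_zero (Nat.cast_ne_zero.2 (by omega)) (pow_ne_zero _ hθ))
  rw [← hp]
  exact leadingCoeff_ne_zero.2 hp0

/-- The branches at infinity of the algebraic function `y` with `p(y) = p(x)`. -/
theorem existsUnique_branch [CharZero K] {p : K[X]} {r : ℕ} (hr : 1 ≤ r) (hp : p.natDegree = r)
    {θ : K} (hθ : θ ^ r = 1) : ∃! y : LaurentSeries K,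
      aeval y p = aeval (xInf K) p ∧ y - algebraMap K _ θ * xInf K ∈ VanishAt K 0 := by
  have hθ0 : θ ≠ 0 := by
    rintro rfl
    rw [zero_pow (by omega)] at hθ
    exact zero_ne_one hθ
  set P := homog PowerSeries.X r (p.map PowerSeries.C) with hP
  have hx : aeval (xInf K) p = xInf K ^ r * HahnSeries.ofPowerSeries ℤ K (P.eval 1) := by
    rw [← aeval_xInf_mul hp.le, map_one, mul_one]
  have h0 : P.map PowerSeries.constantCoeff = C (p.coeff r) * X ^ r := by
    rw [hP, map_homog, PowerSeries.constantCoeff_X, homog_zero, Polynomial.map_map,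
      PowerSeries.constantCoeff_comp_C, Polynomial.map_id]
  -- For `y = x w` the equation, divided by `x ^ r`, reads `P(w) = P(1)`. Modulo `1/x` it is `p_r w
  -- ^ r = p_r`, of which `θ` is a simple root.
  obtain ⟨w, ⟨hw, hw'⟩, huniq⟩ := existsUnique_root (P - C (P.eval 1)) θ
    (by
      rw [Polynomial.map_sub, map_C, constantCoeff_eval, h0]
      simp [hθ])
    (by
      rw [Polynomial.map_sub, map_C, derivative_sub, derivative_C, sub_zero]
      exact isUnit_eval_derivative_homog hr hp hθ0)
  refine ⟨xInf K * HahnSeries.ofPowerSeries ℤ K w, ⟨?_, sub_mem_ord_zero_iff.2 ⟨w, hw, rfl⟩⟩, ?_⟩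
  · rw [aeval_xInf_mul hp.le, hx, ← hP]
    rw [eval_sub, eval_C, sub_eq_zero] at hw'
    rw [hw']
  · rintro y ⟨hy, hy'⟩
    obtain ⟨v, hv, rfl⟩ := sub_mem_ord_zero_iff.1 hy'
    rw [huniq v ⟨hv, ?_⟩]
    rw [aeval_xInf_mul hp.le, hx, ← hP] at hy
    rw [eval_sub, eval_C, sub_eq_zero]
    exact HahnSeries.ofPowerSeries_injective (mul_left_cancel₀ (pow_ne_zero _ xInf_ne_zero) hy)

/-- Let `Q` be a deformation of `p` with the same leading term. The solution of `Q(y) = p(x)` that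
deforms `x` is `x + O(1)`. -/
theorem exists_root_sub_mem [CharZero K] {p : K[X]} {r : ℕ} (hr : 1 ≤ r) (hp : p.natDegree = r)
    {Q : (PowerSeries K)[X]} (hQ : Q.map PowerSeries.constantCoeff = p) (hQr : Q.natDegree ≤ r)
    (hQc : Q.coeff r = PowerSeries.C (p.coeff r)) :
    ∃ y : PowerSeries (LaurentSeries K), y - PowerSeries.C (xInf K) ∈ SeriesVanishAt K 0 ∧
      PowerSeries.constantCoeff y = xInf K ∧
      Q.eval₂ (constSeries K) y = PowerSeries.C (aeval (xInf K) p) := by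
  set ι := HahnSeries.ofPowerSeries ℤ K
  -- Two variables occur: the outer one is `t`, the inner one is `1/x`. The map `j` embeds series in
  -- `t` alone.
  set j : PowerSeries K →+* PowerSeries (PowerSeries K) := PowerSeries.map PowerSeries.C with hj
  set P := homog PowerSeries.X r (p.map PowerSeries.C) with hP
  set H := homog (PowerSeries.C PowerSeries.X) r (Q.map j) with hH
  have hjc : (PowerSeries.constantCoeff (R := PowerSeries K)).comp j =
      (PowerSeries.C (R := K)).comp PowerSeries.constantCoeff := by
    ext1 f
    rw [RingHom.comp_apply, RingHom.comp_apply, ← PowerSeries.coeff_zero_eq_constantCoeff_apply,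
      hj, PowerSeries.coeff_map, PowerSeries.coeff_zero_eq_constantCoeff_apply]
  have hH0 : H.map PowerSeries.constantCoeff = P := by
    rw [hH, map_homog, PowerSeries.constantCoeff_C, Polynomial.map_map, hjc, ← Polynomial.map_map, hQ]
  have hx : aeval (xInf K) p = xInf K ^ r * ι (P.eval 1) := by
    rw [← aeval_xInf_mul hp.le, map_one, mul_one]
  have hunit : IsUnit ((derivative P).eval 1) := by
    rw [PowerSeries.isUnit_iff_constantCoeff, constantCoeff_eval, ← derivative_map, map_one]
    exact isUnit_eval_derivative_homog hr hp one_ne_zero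
  obtain ⟨w, ⟨hw, hw'⟩, -⟩ := existsUnique_root (H - C (PowerSeries.C (P.eval 1))) 1
    (by rw [Polynomial.map_sub, map_C, hH0, PowerSeries.constantCoeff_C, eval_sub, eval_C, sub_self])
    (by rwa [Polynomial.map_sub, map_C, derivative_sub, derivative_C, sub_zero, hH0])
  rw [eval_sub, eval_C, sub_eq_zero] at hw'
  -- The map `κ` sets `1/x = 0`. Since `Q` has the same leading coefficient as `p`, the equation
  -- becomes `p_r (w ^ r - 1) = 0`, whose root that is `1` at `t = 0` is `1`. Hence `x w = x + O(1)`
  -- at every order in `t`.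
  set κ : PowerSeries (PowerSeries K) →+* PowerSeries K :=
    PowerSeries.map PowerSeries.constantCoeff with hκ
  have hκj : κ.comp j = RingHom.id _ := by
    ext1 f
    ext1 n
    rw [RingHom.comp_apply, hκ, hj, PowerSeries.coeff_map, PowerSeries.coeff_map,
      PowerSeries.constantCoeff_C, RingHom.id_apply]
  have hκw : κ w = 1 := by
    have h1 : (H - C (PowerSeries.C (P.eval 1))).map κ =
        (C (p.coeff r) * X ^ r - C (p.coeff r)).map PowerSeries.C := by
      rw [Polynomial.map_sub, hH, map_homog, Polynomial.map_map, hκj, Polynomial.map_id, map_C, hκ,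
        PowerSeries.map_C, PowerSeries.map_C, PowerSeries.constantCoeff_X, map_zero, homog_zero, hQc,
        constantCoeff_eval_homog, map_one, one_pow, mul_one]
      simp
    refine (eq_of_root (f := (H - C (PowerSeries.C (P.eval 1))).map κ) (v := κ w) ?_ ?_ ?_ ?_).symm
    · rw [h1, Polynomial.map_map, PowerSeries.constantCoeff_comp_C, Polynomial.map_id, map_one,
        isUnit_iff_ne_zero]
      have := (isUnit_eval_derivative_homog hr hp (one_ne_zero (α := K))).ne_zero
      rw [map_homog, PowerSeries.constantCoeff_X, homog_zero, Polynomial.map_map,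
        PowerSeries.constantCoeff_comp_C, Polynomial.map_id] at this
      rwa [derivative_sub, derivative_C, sub_zero]
    · rw [h1]
      simp
    · rw [eval_map, eval₂_at_apply, eval_sub, eval_C, hw', sub_self, map_zero]
    · rw [map_one, ← PowerSeries.coeff_zero_eq_constantCoeff_apply, hκ, PowerSeries.coeff_map,
        PowerSeries.coeff_zero_eq_constantCoeff_apply, hw, map_one]
  set I : PowerSeries (PowerSeries K) →+* PowerSeries (LaurentSeries K) := PowerSeries.map ι with hI
  have hIj : I.comp j = constSeries K := by
    ext1 f
    ext1 n
    rw [RingHom.comp_apply, hI, hj, PowerSeries.coeff_map, PowerSeries.coeff_map,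
      PowerSeries.coeff_map, ofPowerSeries_C']
  refine ⟨PowerSeries.C (xInf K) * I w, ?_, ?_, ?_⟩
  · intro n
    rw [map_sub, PowerSeries.coeff_C_mul, hI, PowerSeries.coeff_map, PowerSeries.coeff_C]
    have := (sub_mem_ord_zero_iff (θ := if n = 0 then (1 : K) else 0)).2
      ⟨PowerSeries.coeff n w, ?_, rfl⟩
    · split_ifs at this ⊢ with h
      · rwa [map_one, one_mul] at this
      · rwa [map_zero, zero_mul] at this
    · have := congrArg (PowerSeries.coeff n) hκw
      rwa [hκ, PowerSeries.coeff_map, PowerSeries.coeff_one] at this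
  · rw [map_mul, PowerSeries.constantCoeff_C, ← PowerSeries.coeff_zero_eq_constantCoeff_apply, hI,
      PowerSeries.coeff_map, PowerSeries.coeff_zero_eq_constantCoeff_apply, hw, map_one, mul_one]
  · have hus : PowerSeries.C (xInf K) * I (PowerSeries.C PowerSeries.X) = 1 := by
      rw [hI, PowerSeries.map_C, ← map_mul, xInf_mul_ofPowerSeries_X, map_one]
    have h := eval_homog hus (q := (Q.map j).map I)
      (natDegree_map_le.trans (natDegree_map_le.trans hQr)) (I w)
    rw [← map_homog, eval_map_apply, hw', Polynomial.map_map, eval_map, hIj] at h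
    rw [h, hx, hI, PowerSeries.map_C, ← map_pow, ← map_mul]

end AlgebraicFunctions

/-! ### The implicit function ζ(z) and the deck transformations -/

section Uniformizer

variable {N r : ℕ} {V : ℂ[X]} {lam : Fin N → ℂ} {Q : (PowerSeries ℂ)[X]}
  {ξ : Fin N → PowerSeries ℂ}

theorem expandAtInfty_aeval (p : ℂ[X]) (f : RatFunc ℂ) :
    expandAtInfty (aeval f p) = aeval (expandAtInfty f) p :=
  (aeval_algHom_apply expandAtInfty f p).symm

theorem scalarSeries_comp_C {K : Type*} [Field K] [Algebra ℂ K] :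
    (scalarSeries K).comp (PowerSeries.C (R := ℂ)) = (PowerSeries.C (R := K)).comp (algebraMap ℂ K) :=
  RingHom.ext fun c => by rw [RingHom.comp_apply, PowerSeries.map_C, RingHom.comp_apply]

theorem constantCoeff_comp_scalarSeries {K : Type*} [Field K] [Algebra ℂ K] :
    (PowerSeries.constantCoeff (R := K)).comp (scalarSeries K) =
      (algebraMap ℂ K).comp PowerSeries.constantCoeff :=
  RingHom.ext fun f => by
    rw [RingHom.comp_apply, ← PowerSeries.coeff_zero_eq_constantCoeff_apply, PowerSeries.coeff_map,
      RingHom.comp_apply, PowerSeries.coeff_zero_eq_constantCoeff_apply]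

theorem constantCoeff_evalSeries {K : Type*} [Field K] [Algebra ℂ K] (Q : (PowerSeries ℂ)[X])
    (s : PowerSeries K) : PowerSeries.constantCoeff (evalSeries Q s) =
      aeval (PowerSeries.constantCoeff s) (Q.map PowerSeries.constantCoeff) := by
  rw [evalSeries, hom_eval₂, constantCoeff_comp_scalarSeries, ← eval₂_map, aeval_def]

/-- Hensel's lemma in `t`: a solution at `t = 0` where `p'` does not vanish deforms uniquely. What
remains is to determine the possible constant coefficients. -/
theorem existsUnique_evalSeries_eq {K : Type*} [Field K] [Algebra ℂ K] {p : ℂ[X]}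
    (hQ : Q.map PowerSeries.constantCoeff = p) {y b : K} (hy : aeval y p = b)
    (hy' : aeval y (derivative p) ≠ 0) :
    ∃! ζ : PowerSeries K, PowerSeries.constantCoeff ζ = y ∧ evalSeries Q ζ = PowerSeries.C b := by
  have h0 : (Q.map (scalarSeries K)).map PowerSeries.constantCoeff = p.map (algebraMap ℂ K) := by
    rw [Polynomial.map_map, constantCoeff_comp_scalarSeries, ← Polynomial.map_map, hQ]
  have h := existsUnique_root (Q.map (scalarSeries K) - C (PowerSeries.C b)) y
    (by rw [Polynomial.map_sub, map_C, h0, PowerSeries.constantCoeff_C, eval_sub, eval_C,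
          eval_map_algebraMap, hy, sub_self])
    (by rwa [Polynomial.map_sub, map_C, h0, derivative_sub, derivative_C, sub_zero, derivative_map,
          eval_map_algebraMap, isUnit_iff_ne_zero])
  simp only [eval_sub, eval_C, sub_eq_zero, eval_map] at h
  exact h

theorem derivative_ne_zero_of_natDegree {p : ℂ[X]} (hp : 1 ≤ p.natDegree) : derivative p ≠ 0 := by
  intro h
  have := Polynomial.derivative_eq_zero.1 h
  omega

theorem aeval_expandAtInfty_X (p : ℂ[X]) :
    aeval (xInf ℂ) p = expandAtInfty (aeval (RatFunc.X : RatFunc ℂ) p) := by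
  rw [expandAtInfty_aeval, expandAtInfty_X]

theorem aeval_X_ne_zero {p : ℂ[X]} (hp : p ≠ 0) : aeval (RatFunc.X : RatFunc ℂ) p ≠ 0 := by
  intro h
  apply aeval_zInfty_ne_zero p hp
  change aeval (xInf ℂ) p = 0
  rw [aeval_expandAtInfty_X, h, map_zero]

theorem expandAtInfty_injective : Function.Injective expandAtInfty :=
  expandAtInfty.toRingHom.injective

/-- The constant coefficient of a solution satisfies `V'(ζ_0) = V'(z)` and `ζ_0 = z + O(1)`, which
forces `ζ_0 = z`: it is the branch at infinity for `θ = 1`. Conversely, the deformation of `z`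
agrees after expansion with the root of `exists_root_sub_mem`, so it is `z + O(1)`. -/
theorem exists_isUniformizer (hr : 1 ≤ r) (hV : V.natDegree = r + 1)
    (h : IsSpectralPolynomial V lam Q ξ) : ∃ ζ : PowerSeries (RatFunc ℂ),
      PowerSeries.constantCoeff ζ = RatFunc.X ∧ IsUniformizer V Q ζ ∧
        ∀ ζ', IsUniformizer V Q ζ' → ζ' = ζ := by
  have hd := natDegree_derivative_eq hV
  have hQ := h.map_constantCoeff hV
  have hd0 : derivative (derivative V) ≠ 0 := derivative_ne_zero_of_natDegree (by rw [hd]; exact hr)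
  obtain ⟨ζ, ⟨hζ, hζ'⟩, huniq⟩ := existsUnique_evalSeries_eq hQ (K := RatFunc ℂ) (y := RatFunc.X) rfl
    (aeval_X_ne_zero hd0)
  refine ⟨ζ, hζ, ⟨hζ', ?_⟩, ?_⟩
  · rw [bigOOne_iff, map_sub, expandSeries_C_X]
    obtain ⟨y, hy, hy0, hy'⟩ := exists_root_sub_mem hr hd hQ (h.natDegree_eq hr hV).le
      (h.coeff_eq hr hV le_rfl)
    have hy1 : PowerSeries.constantCoeff (expandSeries ζ) = xInf ℂ := by
      rw [← PowerSeries.coeff_zero_eq_constantCoeff_apply, PowerSeries.coeff_map,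
        PowerSeries.coeff_zero_eq_constantCoeff_apply, hζ]
      exact expandAtInfty_X
    have hy2 : Q.eval₂ (constSeries ℂ) (expandSeries ζ) =
        PowerSeries.C (aeval (xInf ℂ) (derivative V)) := by
      rw [← expandSeries_evalSeries, hζ', PowerSeries.map_C, aeval_expandAtInfty_X]
      rfl
    rwa [(existsUnique_evalSeries_eq hQ (K := LaurentSeries ℂ) (y := xInf ℂ) rfl
      (aeval_zInfty_ne_zero _ hd0)).unique ⟨hy1, hy2⟩ ⟨hy0, hy'⟩]
  · rintro ζ' ⟨h1, h2⟩
    refine huniq ζ' ⟨?_, h1⟩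
    apply expandAtInfty_injective
    rw [bigOOne_iff] at h2
    have h3 := h2 0
    rw [PowerSeries.coeff_map, PowerSeries.coeff_zero_eq_constantCoeff_apply, map_sub,
      PowerSeries.constantCoeff_C] at h3
    have h4 := congrArg PowerSeries.constantCoeff h1
    rw [constantCoeff_evalSeries, hQ, PowerSeries.constantCoeff_C] at h4
    have h5 : expandAtInfty (PowerSeries.constantCoeff ζ') - xInf ℂ ∈ VanishAt ℂ 0 := by
      rw [← expandAtInfty_X, ← map_sub]
      exact h3
    rw [expandAtInfty_X]
    refine (existsUnique_branch hr hd (one_pow r)).unique ⟨?_, ?_⟩ ⟨rfl, ?_⟩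
    · rw [← expandAtInfty_aeval, h4, aeval_expandAtInfty_X, dV]
    · rwa [map_one, one_mul]
    · rw [map_one, one_mul, sub_self]
      exact zero_mem _

/-- The same argument with the branch for the `r`-th root of unity `θ`. The constant coefficient is
asymptotic to `θ z`, so `V''` does not vanish on it. -/
theorem existsUnique_isDeckTransformation (hr : 1 ≤ r) (hV : V.natDegree = r + 1)
    (h : IsSpectralPolynomial V lam Q ξ) {ζ : PowerSeries (RatFunc ℂ)} (hζ : IsUniformizer V Q ζ)
    (k : Fin r) : ∃! ζk : PowerSeries (LaurentSeries ℂ), IsDeckTransformation r Q ζ k ζk := by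
  have hd := natDegree_derivative_eq hV
  have hQ := h.map_constantCoeff hV
  have hd0 : derivative (derivative V) ≠ 0 := derivative_ne_zero_of_natDegree (by rw [hd]; exact hr)
  set θ : ℂ := Complex.exp (2 * Real.pi * Complex.I * (k : ℕ) / r) with hθ
  have hθr : θ ^ r = 1 := by
    rw [hθ, ← Complex.exp_nat_mul, mul_div_cancel₀ _ (Nat.cast_ne_zero.2 (by omega)), mul_comm,
      Complex.exp_nat_mul_two_pi_mul_I]
  have hrhs : evalSeries Q (PowerSeries.map expandAtInfty.toRingHom ζ) =
      PowerSeries.C (aeval (xInf ℂ) (derivative V)) := by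
    change Q.eval₂ (constSeries ℂ) (expandSeries ζ) = _
    rw [← expandSeries_evalSeries, hζ.1, PowerSeries.map_C, aeval_expandAtInfty_X]
    rfl
  obtain ⟨y, ⟨hy, hy'⟩, hyuniq⟩ := existsUnique_branch hr hd hθr
  obtain ⟨s, ⟨hs, hs'⟩, huniq⟩ := existsUnique_evalSeries_eq hQ (K := LaurentSeries ℂ) hy
    (aeval_ne_zero_of_sub_mem hd0 (Complex.exp_ne_zero _) hy')
  refine ⟨s, ⟨by rw [hrhs, hs'], by rw [hs]; exact hy'⟩, ?_⟩
  rintro s' ⟨h1, h2⟩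
  rw [hrhs] at h1
  refine huniq s' ⟨hyuniq _ ⟨?_, h2⟩, h1⟩
  have := congrArg PowerSeries.constantCoeff h1
  rwa [constantCoeff_evalSeries, hQ, PowerSeries.constantCoeff_C] at this

end Uniformizer

/-! ### The roots near the λ_i -/

section RootPolynomial

variable {K : Type*} [Field K] {N : ℕ}

/-- The polynomial `(u (η - l) - 1) ∏ (η - ξ_i) + t u ∑ c_i ∏_{j ≠ i} (η - ξ_j)`. -/
noncomputable def rootPoly {R : Type*} [CommRing R] (φ : K →+* R) (u : R) (l : K)
    (ξ c : Fin N → PowerSeries K) : (PowerSeries R)[X] :=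
  (C (PowerSeries.C u) * (X - C (PowerSeries.C (φ l))) - 1) *
      (polePoly ξ).map (PowerSeries.map φ) +
    C (PowerSeries.X * PowerSeries.C u) * (residuePoly ξ c).map (PowerSeries.map φ)

theorem powerSeries_map_comp {R R' R'' : Type*} [CommRing R] [CommRing R'] [CommRing R'']
    (φ : R →+* R') (ψ : R' →+* R'') :
    (PowerSeries.map ψ).comp (PowerSeries.map φ) = PowerSeries.map (ψ.comp φ) := by
  ext1 f
  ext1 n
  simp [PowerSeries.coeff_map]

theorem constantCoeff_comp_map {R R' : Type*} [CommRing R] [CommRing R'] (φ : R →+* R') :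
    (PowerSeries.constantCoeff (R := R')).comp (PowerSeries.map φ) =
      φ.comp PowerSeries.constantCoeff := by
  ext1 f
  rw [RingHom.comp_apply, ← PowerSeries.coeff_zero_eq_constantCoeff_apply, PowerSeries.coeff_map,
    RingHom.comp_apply, PowerSeries.coeff_zero_eq_constantCoeff_apply]

variable {R : Type*} [CommRing R] (φ : K →+* R) (u : R) (l : K) {ξ c : Fin N → PowerSeries K}

theorem map_rootPoly {R' : Type*} [CommRing R'] (ψ : R →+* R') :
    (rootPoly φ u l ξ c).map (PowerSeries.map ψ) = rootPoly (ψ.comp φ) (ψ u) l ξ c := by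
  simp only [rootPoly, Polynomial.map_add, Polynomial.map_mul, Polynomial.map_sub, map_C, map_X,
    PowerSeries.map_C, PowerSeries.map_X, Polynomial.map_map, powerSeries_map_comp, map_mul,
    Polynomial.map_one, RingHom.comp_apply]

/-- For `u = 1/(x - l)` the polynomial is `u` times `branchPoly`, in a form that stays regular as `u
→ 0`. At `t = 0` its derivative at `λ_i` is `-∏ (λ_i - λ_k)`, a unit over every coefficient ring, so
one argument serves both functions of `x` and dual numbers. -/
theorem existsUnique_root_rootPoly {lam : Fin N → K} (hlam : Function.Injective lam)
    (hξ : ∀ i, PowerSeries.constantCoeff (ξ i) = lam i) (i : Fin N) :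
    ∃! η : PowerSeries R, PowerSeries.constantCoeff η = φ (lam i) ∧
      (rootPoly φ u (lam i) ξ c).eval η = 0 := by
  have h0 : (rootPoly φ u (lam i) ξ c).map PowerSeries.constantCoeff =
      (C u * (X - C (φ (lam i))) - 1) * ((X - C (φ (lam i))) *
        ∏ k ∈ Finset.univ.erase i, (X - C (φ (lam k)))) := by
    have hC : (C (PowerSeries.X * PowerSeries.C u)).map
        (PowerSeries.constantCoeff (R := R)) = 0 := by simp
    rw [rootPoly, Polynomial.map_add, Polynomial.map_mul, Polynomial.map_mul, hC, zero_mul, add_zero,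
      Polynomial.map_map,
      constantCoeff_comp_map, map_polePoly, polePoly,
      ← Finset.mul_prod_erase _ _ (Finset.mem_univ i)]
    simp [hξ]
  refine existsUnique_root _ _ (by rw [h0]; simp) ?_
  rw [h0]
  have : (derivative ((C u * (X - C (φ (lam i))) - 1) * ((X - C (φ (lam i))) *
        ∏ k ∈ Finset.univ.erase i, (X - C (φ (lam k)))))).eval (φ (lam i)) =
      φ (-∏ k ∈ Finset.univ.erase i, (lam i - lam k)) := by
    rw [derivative_mul, derivative_mul (f := X - C _)]
    simp [eval_prod]
  rw [this]
  refine IsUnit.map φ (isUnit_iff_ne_zero.2 (neg_ne_zero.2 (Finset.prod_ne_zero_iff.2 ?_)))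
  intro k hk
  exact sub_ne_zero.2 fun h => (Finset.mem_erase.1 hk).1 (hlam h).symm

theorem eval_rootPoly (η : PowerSeries R) : (rootPoly φ u l ξ c).eval η =
    (PowerSeries.C u * (η - PowerSeries.C (φ l)) - 1) * (polePoly ξ).eval₂ (PowerSeries.map φ) η +
      PowerSeries.X * PowerSeries.C u * (residuePoly ξ c).eval₂ (PowerSeries.map φ) η := by
  rw [rootPoly]
  simp [eval_map]

theorem eval₂_residuePoly_eq (i : Fin N) {S : Type*} [CommRing S] (ψ : PowerSeries K →+* S) (η : S) :
    ∃ R, (residuePoly ξ c).eval₂ ψ η =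
      ψ (c i) * (∏ k ∈ Finset.univ.erase i, (η - ψ (ξ k))) + (η - ψ (ξ i)) * R := by
  rw [eval₂_residuePoly, ← Finset.add_sum_erase _ _ (Finset.mem_univ i)]
  have : (η - ψ (ξ i)) ∣ ∑ k ∈ Finset.univ.erase i,
      ψ (c k) * ∏ j ∈ Finset.univ.erase k, (η - ψ (ξ j)) := by
    refine Finset.dvd_sum fun k hk => Dvd.dvd.mul_left (Finset.dvd_prod_of_mem _ ?_) _
    exact Finset.mem_erase.2 ⟨(Finset.mem_erase.1 hk).1.symm, Finset.mem_univ _⟩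
  obtain ⟨R, hR⟩ := this
  exact ⟨R, by rw [hR]⟩

/-- The root modulo `u ^ 2`. -/
theorem root_rootPoly_of_sq_eq_zero {lam : Fin N → K} (hlam : Function.Injective lam)
    (hξ : ∀ i, PowerSeries.constantCoeff (ξ i) = lam i) (i : Fin N) (hu : u * u = 0)
    {η : PowerSeries R} (h : PowerSeries.constantCoeff η = φ (lam i))
    (h' : (rootPoly φ u (lam i) ξ c).eval η = 0) : η = PowerSeries.map φ (ξ i) +
      PowerSeries.X * PowerSeries.C u * PowerSeries.map φ (c i) := by
  refine (existsUnique_root_rootPoly φ u hlam hξ i).unique ⟨h, h'⟩ ⟨?_, ?_⟩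
  · rw [map_add, mul_assoc, map_mul, PowerSeries.constantCoeff_X, zero_mul, add_zero,
      ← RingHom.comp_apply, constantCoeff_comp_map, RingHom.comp_apply, hξ]
  · have hu' : (PowerSeries.C u : PowerSeries R) * PowerSeries.C u = 0 := by
      rw [← map_mul, hu, map_zero]
    rw [eval_rootPoly, eval₂_polePoly, ← Finset.mul_prod_erase _ _ (Finset.mem_univ i)]
    obtain ⟨S, hS⟩ := eval₂_residuePoly_eq (c := c) i (PowerSeries.map φ) (PowerSeries.map φ (ξ i) +
      PowerSeries.X * PowerSeries.C u * PowerSeries.map φ (c i))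
    rw [hS]
    simp only [add_sub_cancel_left]
    set P := ∏ k ∈ Finset.univ.erase i, (PowerSeries.map φ (ξ i) +
      PowerSeries.X * PowerSeries.C u * PowerSeries.map φ (c i) - PowerSeries.map φ (ξ k))
    linear_combination (PowerSeries.X * PowerSeries.map φ (c i) * P * (PowerSeries.map φ (ξ i) +
      PowerSeries.X * PowerSeries.C u * PowerSeries.map φ (c i) - PowerSeries.C (φ (lam i))) +
      PowerSeries.X * PowerSeries.X * PowerSeries.map φ (c i) * S) * hu'

end RootPolynomial

/-! ### First-order expansion at x = ∞ -/

section Jet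

variable {K : Type*} [Field K] {ι : Type*} (x : ι → K)

theorem coeff_zero_mul_of_ord {f g : LaurentSeries K} (hf : f ∈ VanishAt K 0) (hg : g ∈ VanishAt K 0) :
    (f * g).coeff 0 = f.coeff 0 * g.coeff 0 := by
  have := coeff_mul_of_ord hf hg
  rwa [add_zero] at this

theorem coeff_one_mul_of_ord {f g : LaurentSeries K} (hf : f ∈ VanishAt K 0) (hg : g ∈ VanishAt K 0) :
    (f * g).coeff 1 = f.coeff 0 * g.coeff 1 + f.coeff 1 * g.coeff 0 := by
  obtain ⟨a, rfl⟩ := ord_zero_iff.1 hf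
  obtain ⟨b, rfl⟩ := ord_zero_iff.1 hg
  rw [← map_mul]
  have h : ∀ (f : PowerSeries K) (n : ℕ), (HahnSeries.ofPowerSeries ℤ K f).coeff n =
      PowerSeries.coeff n f := fun f n => by
    rw [PowerSeries.coeff_coe, if_neg (by omega), Int.natAbs_natCast]
  have h0 := fun f => h f 0
  have h1 := fun f => h f 1
  rw [Nat.cast_zero] at h0
  rw [Nat.cast_one] at h1
  rw [h1, h1, h1, h0, h0, PowerSeries.coeff_mul]
  simp [Finset.Nat.antidiagonal_succ]

/-- The expansion `f(∞) + f_1 / x` of a function without pole at infinity, as a dual number. -/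
noncomputable def jet : poleRing x →+* DualNumber K where
  toFun f := TrivSqZeroExt.inl ((f : LaurentSeries K).coeff 0) +
    TrivSqZeroExt.inr ((f : LaurentSeries K).coeff 1)
  map_one' := by
    have h : ((1 : poleRing x) : LaurentSeries K) = algebraMap K _ 1 := by simp
    rw [h, algebraMap_laurentSeries]
    ext <;> simp
  map_zero' := by
    ext <;> simp
  map_add' f g := by
    ext <;> simp
  map_mul' f g := by
    have hf := poleRing_le_ord f.2
    have hg := poleRing_le_ord g.2
    ext
    · simp [coeff_zero_mul_of_ord hf hg]
    · simp [coeff_one_mul_of_ord hf hg, mul_comm]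

theorem fst_jet (f : poleRing x) : (jet x f).fst = (f : LaurentSeries K).coeff 0 := by
  simp [jet]

theorem snd_jet (f : poleRing x) : (jet x f).snd = (f : LaurentSeries K).coeff 1 := by
  simp [jet]

theorem jet_comp_algebraMap :
    (jet x).comp (algebraMap K (poleRing x)) = algebraMap K (DualNumber K) := by
  ext1 c
  have h : ((algebraMap K (poleRing x) c : poleRing x) : LaurentSeries K) = HahnSeries.single 0 c :=
    algebraMap_laurentSeries c
  ext
  · rw [RingHom.comp_apply, fst_jet, h]
    simp [TrivSqZeroExt.algebraMap_eq_inl]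
  · rw [RingHom.comp_apply, snd_jet, h]
    simp [TrivSqZeroExt.algebraMap_eq_inl]

/-- The function `1 / (x - x_i)`. -/
noncomputable def resolvElt (i : ι) : poleRing x := ⟨resolv (x i), resolv_mem_poleRing i⟩

theorem jet_resolvElt (i : ι) : jet x (resolvElt x i) = DualNumber.eps := by
  ext
  · rw [fst_jet, DualNumber.fst_eps]
    exact resolvent_mem_ord (x i) 0 (by norm_num)
  · rw [snd_jet, DualNumber.snd_eps]
    exact coeff_one_resolvent (x i)

end Jet

/-- The data of the rational parametrisation for the potential with derivative `p`, the parameters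
`x (some i)`, and the variable `x none`. -/
structure IsSpectralData {K : Type*} [Field K] {N : ℕ} (r : ℕ) (p : K[X]) (x : Option (Fin N) → K)
    (Q : (PowerSeries K)[X]) (ξ c : Fin N → PowerSeries K) (ζ : PowerSeries K) : Prop where
  natDegree_le : p.natDegree ≤ r
  distinct : ∀ a b, a ≠ b → p.eval (x a) ≠ p.eval (x b)
  spec : Q = specPoly r (p.map PowerSeries.C) PowerSeries.X ξ c
  constantCoeff_pole : ∀ i, PowerSeries.constantCoeff (ξ i) = x (some i)
  eval_pole : ∀ i, Q.eval (ξ i) = PowerSeries.C (p.eval (x (some i)))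
  residue : ∀ i, c i * (derivative Q).eval (ξ i) = 1
  constantCoeff_var : PowerSeries.constantCoeff ζ = x none
  eval_var : Q.eval ζ = PowerSeries.C (p.eval (x none))

/-! ### The roots η of η + t ∑ c_i / (η - ξ_i) = x -/

section Roots

variable {K : Type*} [Field K] {N : ℕ}

/-- The polynomial whose roots are the solutions `η` of `η + t ∑ c_i / (η - ξ_i) = x`. -/
noncomputable def branchPoly (ξ c : Fin N → PowerSeries K) : (PowerSeries (LaurentSeries K))[X] :=
  (X - C (PowerSeries.C (xInf K))) * (polePoly ξ).map (constSeries K) +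
    C PowerSeries.X * (residuePoly ξ c).map (constSeries K)

theorem degree_residuePoly_lt {A : Type*} [CommRing A] (ξ c : Fin N → A) :
    (residuePoly ξ c).degree < N := by
  rcases Nat.eq_zero_or_pos N with rfl | hN
  · simp [residuePoly]
  · refine lt_of_le_of_lt degree_le_natDegree ?_
    exact_mod_cast (natDegree_residuePoly_le ξ c).trans_lt (by omega)

theorem degree_residue_part_lt (ξ c : Fin N → PowerSeries K) :
    (C PowerSeries.X * (residuePoly ξ c).map (constSeries K)).degree < (N : WithBot ℕ) := by
  rw [degree_lt_iff_coeff_zero]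
  intro k hk
  rw [coeff_C_mul, coeff_map, coeff_eq_zero_of_degree_lt
    ((degree_residuePoly_lt ξ c).trans_le (by exact_mod_cast hk)), map_zero, mul_zero]

theorem pole_part_monic (ξ : Fin N → PowerSeries K) :
    ((X - C (PowerSeries.C (xInf K))) * (polePoly ξ).map (constSeries K)).Monic :=
  (monic_X_sub_C _).mul ((polePoly_monic ξ).map _)

theorem natDegree_pole_part (ξ : Fin N → PowerSeries K) :
    ((X - C (PowerSeries.C (xInf K))) * (polePoly ξ).map (constSeries K)).natDegree = N + 1 := by
  rw [(monic_X_sub_C _).natDegree_mul ((polePoly_monic ξ).map _), natDegree_X_sub_C,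
    (polePoly_monic ξ).natDegree_map, natDegree_polePoly, add_comm]

theorem degree_residue_part_lt_pole_part (ξ c : Fin N → PowerSeries K) :
    (C PowerSeries.X * (residuePoly ξ c).map (constSeries K)).degree <
      ((X - C (PowerSeries.C (xInf K))) * (polePoly ξ).map (constSeries K)).degree := by
  rw [degree_eq_natDegree (pole_part_monic ξ).ne_zero, natDegree_pole_part]
  exact (degree_residue_part_lt ξ c).trans (by exact_mod_cast Nat.lt_succ_self N)

theorem branchPoly_monic (ξ c : Fin N → PowerSeries K) : (branchPoly ξ c).Monic :=
  (pole_part_monic ξ).add_of_left (degree_residue_part_lt_pole_part ξ c)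

theorem natDegree_branchPoly (ξ c : Fin N → PowerSeries K) : (branchPoly ξ c).natDegree = N + 1 := by
  rw [branchPoly, natDegree_add_eq_left_of_degree_lt (degree_residue_part_lt_pole_part ξ c),
    natDegree_pole_part]

theorem nextCoeff_branchPoly (ξ c : Fin N → PowerSeries K) : (branchPoly ξ c).nextCoeff =
    -PowerSeries.C (xInf K) - ∑ i, constSeries K (ξ i) := by
  have h : (branchPoly ξ c).nextCoeff =
      ((X - C (PowerSeries.C (xInf K))) * (polePoly ξ).map (constSeries K)).nextCoeff := by
    rw [nextCoeff_of_natDegree_pos (by rw [natDegree_branchPoly]; omega),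
      nextCoeff_of_natDegree_pos (by rw [natDegree_pole_part]; omega), natDegree_branchPoly,
      natDegree_pole_part, branchPoly, coeff_add, Nat.add_sub_cancel,
      coeff_eq_zero_of_degree_lt (degree_residue_part_lt ξ c), add_zero]
  rw [h, (monic_X_sub_C _).nextCoeff_mul ((polePoly_monic ξ).map _), nextCoeff_X_sub_C, map_polePoly,
    polePoly, prod_X_sub_C_nextCoeff, sub_eq_add_neg]

theorem eval_branchPoly (ξ c : Fin N → PowerSeries K) (y : PowerSeries (LaurentSeries K)) :
    (branchPoly ξ c).eval y = (y - PowerSeries.C (xInf K)) * (polePoly ξ).eval₂ (constSeries K) y +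
      PowerSeries.X * (residuePoly ξ c).eval₂ (constSeries K) y := by
  simp [branchPoly, eval_map]

/-- The power series over `poleRing x`, as series in `t` with coefficients in `K((1/x))`. -/
noncomputable abbrev poleSeries {ι : Type*} (x : ι → K) :
    PowerSeries (poleRing x) →+* PowerSeries (LaurentSeries K) :=
  PowerSeries.map (poleRing x).val.toRingHom

/-- The coefficientwise 1-jet at infinity. -/
noncomputable abbrev jetSeries {ι : Type*} (x : ι → K) :
    PowerSeries (poleRing x) →+* PowerSeries (DualNumber K) :=
  PowerSeries.map (jet x)

variable {ξ c : Fin N → PowerSeries K} {x : Option (Fin N) → K}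

/-- Hensel's lemma over `poleRing x` gives roots whose coefficients are rational functions with the
required poles. By uniqueness of the lift over dual numbers, their expansion is `ξ_i + t c_i / x +
O(1/x^2)`. -/
theorem exists_roots (hx : Function.Injective fun i => x (some i))
    (hξ : ∀ i, PowerSeries.constantCoeff (ξ i) = x (some i)) :
    ∃ η : Fin N → PowerSeries (poleRing x),
      (∀ i, PowerSeries.constantCoeff (η i) = algebraMap K _ (x (some i))) ∧
      (∀ i, jetSeries x (η i) = PowerSeries.map (algebraMap K (DualNumber K)) (ξ i) +
        PowerSeries.X * PowerSeries.C DualNumber.eps *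
          PowerSeries.map (algebraMap K (DualNumber K)) (c i)) ∧
      ∀ i, (branchPoly ξ c).eval (poleSeries x (η i)) = 0 := by
  have h := fun i => (existsUnique_root_rootPoly (c := c) (algebraMap K (poleRing x))
    (resolvElt x (some i)) hx hξ i).exists
  choose η h1 h2 using h
  refine ⟨η, h1, fun i => ?_, fun i => ?_⟩
  · refine root_rootPoly_of_sq_eq_zero (c := c) (algebraMap K (DualNumber K)) DualNumber.eps hx hξ i
      (DualNumber.eps_mul_eps) ?_ ?_
    · rw [← RingHom.comp_apply, constantCoeff_comp_map, RingHom.comp_apply, h1, ← RingHom.comp_apply,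
        jet_comp_algebraMap]
    · rw [← jet_comp_algebraMap x, ← jet_resolvElt x (some i), ← map_rootPoly, eval_map_apply, h2,
        map_zero]
  · have h3 := congrArg (poleSeries x) (h2 i)
    rw [← eval_map_apply, map_rootPoly, map_zero, eval_rootPoly] at h3
    have e : (poleRing x).val.toRingHom (resolvElt x (some i)) = resolv (x (some i)) := rfl
    have e' : (poleRing x).val.toRingHom.comp (algebraMap K (poleRing x)) =
      algebraMap K (LaurentSeries K) := rfl
    rw [e, e'] at h3
    rw [eval_branchPoly]
    have h4 : PowerSeries.C (resolv (x (some i))) * (PowerSeries.C (xInf K) -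
        PowerSeries.C (algebraMap K (LaurentSeries K) (x (some i)))) = 1 := by
      rw [← map_sub, ← map_mul, mul_comm, mul_resolvent, map_one]
    have h5 : (PowerSeries.C (resolv (x (some i))) : PowerSeries (LaurentSeries K)) ≠ 0 := by
      intro h0
      rw [h0, zero_mul] at h4
      exact zero_ne_one h4
    refine (mul_eq_zero.1 ?_).resolve_left h5
    rw [← h3]
    linear_combination (-(polePoly ξ).eval₂ (constSeries K) (poleSeries x (η i))) * h4

theorem poleSeries_mem {ι : Type*} {x : ι → K} (f : PowerSeries (poleRing x)) : poleSeries x f ∈ SeriesVanishAt K 0 := by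
  intro n
  rw [PowerSeries.coeff_map]
  exact poleRing_le_ord (PowerSeries.coeff n f).2

/-- The remaining root. -/
theorem exists_last_root (hx : Function.Injective fun i => x (some i))
    (hξ : ∀ i, PowerSeries.constantCoeff (ξ i) = x (some i)) {η : Fin N → PowerSeries (poleRing x)}
    (h1 : ∀ i, PowerSeries.constantCoeff (η i) = algebraMap K _ (x (some i)))
    (h2 : ∀ i, (branchPoly ξ c).eval (poleSeries x (η i)) = 0) :
    ∃ y : PowerSeries (LaurentSeries K), PowerSeries.constantCoeff y = xInf K ∧
      y - PowerSeries.C (xInf K) ∈ SeriesVanishAt K 0 ∧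
      branchPoly ξ c = (X - C y) * ∏ i, (X - C (poleSeries x (η i))) := by
  have hc : ∀ i, PowerSeries.constantCoeff (poleSeries x (η i)) = algebraMap K _ (x (some i)) := by
    intro i
    rw [← RingHom.comp_apply, constantCoeff_comp_map, RingHom.comp_apply, h1]
    rfl
  -- At `t = 0` the roots are the distinct `λ_i`, so their differences are units and the linear
  -- factors are coprime.
  have hdvd : ∏ i, (X - C (poleSeries x (η i))) ∣ branchPoly ξ c := by
    refine Fintype.prod_dvd_of_coprime (fun i j hij => ?_) fun i => dvd_iff_isRoot.2 (h2 i)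
    refine isCoprime_X_sub_C_of_isUnit_sub ?_
    rw [PowerSeries.isUnit_iff_constantCoeff, map_sub, hc, hc, isUnit_iff_ne_zero, ← map_sub]
    exact (_root_.map_ne_zero _).2 (sub_ne_zero.2 fun h => hij (hx h))
  obtain ⟨g, hg⟩ := hdvd
  have hm : (∏ i, (X - C (poleSeries x (η i)))).Monic :=
    monic_prod_of_monic _ _ fun _ _ => monic_X_sub_C _
  have hgm : g.Monic := hm.of_mul_monic_left (hg ▸ branchPoly_monic ξ c)
  have hgd : g.natDegree = 1 := by
    have := natDegree_branchPoly ξ c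
    rw [hg, hm.natDegree_mul hgm, natDegree_prod_of_monic _ _ fun _ _ => monic_X_sub_C _] at this
    simp only [natDegree_X_sub_C, Finset.sum_const, Finset.card_univ, Fintype.card_fin,
      smul_eq_mul, mul_one] at this
    omega
  have hgX := hgm.eq_X_add_C hgd
  have hfac : branchPoly ξ c = (X - C (-g.coeff 0)) * ∏ i, (X - C (poleSeries x (η i))) := by
    rw [hg, mul_comm, map_neg, sub_neg_eq_add, ← hgX]
  have hnext := nextCoeff_branchPoly ξ c
  rw [hfac, (monic_X_sub_C _).nextCoeff_mul hm, nextCoeff_X_sub_C, prod_X_sub_C_nextCoeff] at hnext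
  -- The sum of all roots is `x + ∑ ξ_i`. So the last root is `x` plus a sum of differences `ξ_i -
  -- η_i`, which are `O(1)` and vanish at `t = 0`.
  have hy : -g.coeff 0 - PowerSeries.C (xInf K) =
      ∑ i, (constSeries K (ξ i) - poleSeries x (η i)) := by
    rw [Finset.sum_sub_distrib]
    linear_combination -hnext
  refine ⟨-g.coeff 0, ?_, ?_, hfac⟩
  · have := congrArg PowerSeries.constantCoeff hy
    rw [map_sub, PowerSeries.constantCoeff_C, map_sum, Finset.sum_eq_zero, sub_eq_zero] at this
    · exact this
    · intro i _
      rw [map_sub, hc, ← RingHom.comp_apply PowerSeries.constantCoeff, constantCoeff_comp_map,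
        RingHom.comp_apply, hξ, sub_self]
  · rw [hy]
    exact sum_mem fun i _ => sub_mem (constSeries_mem _) (poleSeries_mem _)

end Roots

/-! ### An interpolation identity and products of dual numbers -/

section Lagrange

/-- Compare coefficients of degree `N - 1`: the polynomial `∏ (X - Y_i) - ∏ (X - q_i)` has degree
less than `N` and is interpolated at the `Y_j`, where its first product vanishes. -/
theorem sum_prod_sub_div {F : Type*} [Field F] {N : ℕ} {Y : Fin N → F} (hY : Function.Injective Y)
    (q : Fin N → F) : ∑ j, -(∏ k ∈ Finset.univ.erase j, (Y j - Y k))⁻¹ * ∏ i, (Y j - q i) =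
      ∑ i, (q i - Y i) := by
  rcases Nat.eq_zero_or_pos N with rfl | hN
  · simp
  have hq := monic_prod_X_sub_C q Finset.univ
  have hy := monic_prod_X_sub_C Y Finset.univ
  have hd : ∀ f : Fin N → F, (∏ i, (X - C (f i))).degree = (N : WithBot ℕ) := by
    intro f
    rw [degree_prod]
    simp
  have hdeg : (∏ i, (X - C (Y i)) - ∏ i, (X - C (q i))).degree <
      ((Finset.univ : Finset (Fin N)).card : WithBot ℕ) := by
    rw [Finset.card_univ, Fintype.card_fin, ← hd Y]
    exact degree_sub_lt_left (by rw [hd, hd]) hy.ne_zero (by rw [hy.leadingCoeff, hq.leadingCoeff])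
  have h := Lagrange.coeff_eq_sum hY.injOn hdeg
  rw [coeff_sub, prod_X_sub_C_coeff_card_pred _ _ (by simpa using hN),
    prod_X_sub_C_coeff_card_pred _ _ (by simpa using hN)] at h
  rw [Finset.sum_sub_distrib, show ∑ i, q i - ∑ i, Y i = -∑ i, Y i - -∑ i, q i by ring, h]
  refine Finset.sum_congr rfl fun j _ => ?_
  have h0 : (∏ i, (X - C (Y i))).eval (Y j) = 0 := by
    rw [eval_prod]
    exact Finset.prod_eq_zero (Finset.mem_univ j) (by simp)
  rw [eval_sub, h0, eval_prod]
  simp [div_eq_mul_inv, mul_comm]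

theorem prod_one_add_of_sq_eq_zero {R : Type*} [CommRing R] {ι : Type*} (s : Finset ι) {e : R}
    (he : e * e = 0) (a : ι → R) : ∏ i ∈ s, (1 + e * a i) = 1 + e * ∑ i ∈ s, a i := by
  classical
  induction s using Finset.induction_on with
  | empty => simp
  | insert i s hi ih =>
    rw [Finset.prod_insert hi, Finset.sum_insert hi, ih]
    linear_combination (a i * ∑ j ∈ s, a j) * he

end Lagrange

/-! ### Series in t with polynomial coefficients in x -/

section PolynomialSeries

variable {K : Type*} [Field K]

/-- The power series in `t` whose coefficients are polynomials in `x`. -/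
noncomputable abbrev polSeries (K : Type*) [Field K] :
    PowerSeries K[X] →+* PowerSeries (LaurentSeries K) :=
  PowerSeries.map (aeval (xInf K)).toRingHom

theorem polSeries_map_C (a : PowerSeries K) :
    polSeries K (PowerSeries.map C a) = constSeries K a := by
  ext1 n
  rw [PowerSeries.coeff_map, PowerSeries.coeff_map, PowerSeries.coeff_map]
  exact aeval_C _ _

theorem constSeries_mem_range (a : PowerSeries K) : constSeries K a ∈ (polSeries K).range :=
  ⟨_, polSeries_map_C a⟩

theorem coeff_mem_pol {f : PowerSeries (LaurentSeries K)} (hf : f ∈ (polSeries K).range) (n : ℕ) :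
    PowerSeries.coeff n f ∈ PolX K := by
  obtain ⟨g, rfl⟩ := hf
  rw [PowerSeries.coeff_map]
  exact aeval_mem_pol _

theorem C_aeval_mem_range (p : K[X]) : PowerSeries.C (aeval (xInf K) p) ∈ (polSeries K).range :=
  ⟨PowerSeries.C p, PowerSeries.map_C _ _⟩

theorem eq_zero_of_mem_range {f : PowerSeries (LaurentSeries K)} (hf : f ∈ (polSeries K).range)
    (hf' : f ∈ SeriesVanishAt K 1) : f = 0 := by
  ext1 n
  rw [map_zero]
  exact eq_zero_of_mem_pol_of_mem_ord (coeff_mem_pol hf n) (hf' n)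

theorem coeff_branchPoly_mem {N : ℕ} (ξ c : Fin N → PowerSeries K) (k : ℕ) :
    (branchPoly ξ c).coeff k ∈ (polSeries K).range := by
  have h : (polSeries K).comp (PowerSeries.map C) = constSeries K := RingHom.ext polSeries_map_C
  have : branchPoly ξ c = ((X - C (PowerSeries.C X)) * (polePoly ξ).map (PowerSeries.map C) +
      C PowerSeries.X * (residuePoly ξ c).map (PowerSeries.map C)).map (polSeries K) := by
    rw [branchPoly, Polynomial.map_add, Polynomial.map_mul, Polynomial.map_mul, Polynomial.map_map,
      Polynomial.map_map, h, Polynomial.map_sub, map_X, map_C, map_C, PowerSeries.map_C,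
      PowerSeries.map_X]
    congr 6
    exact (aeval_X _).symm
  rw [this, coeff_map]
  exact ⟨_, rfl⟩

end PolynomialSeries

/-! ### Expansions of series over the ring of functions -/

section Jets

variable {K : Type*} [Field K] {ι : Type*} (x : ι → K)

/-- Series with constant coefficients, as series over `poleRing x`. -/
noncomputable abbrev cstSeries : PowerSeries K →+* PowerSeries (poleRing x) :=
  PowerSeries.map (algebraMap K (poleRing x))

/-- Series with constant coefficients, as series over the dual numbers. -/
noncomputable abbrev dualSeries (K : Type*) [Field K] : PowerSeries K →+* PowerSeries (DualNumber K) :=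
  PowerSeries.map (algebraMap K (DualNumber K))

/-- The series `t ε`. -/
noncomputable def tEps (K : Type*) [Field K] : PowerSeries (DualNumber K) :=
  PowerSeries.X * PowerSeries.C DualNumber.eps

theorem tEps_mul_tEps : tEps K * tEps K = 0 := by
  rw [tEps, mul_mul_mul_comm, ← map_mul, DualNumber.eps_mul_eps, map_zero, mul_zero]

theorem poleSeries_cstSeries (a : PowerSeries K) : poleSeries x (cstSeries x a) = constSeries K a := by
  rw [← RingHom.comp_apply, powerSeries_map_comp]
  rfl

theorem jetSeries_cstSeries (a : PowerSeries K) : jetSeries x (cstSeries x a) = dualSeries K a := by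
  rw [← RingHom.comp_apply, powerSeries_map_comp, jet_comp_algebraMap]

variable {x}

theorem coeff_poleSeries_of_jet {f : PowerSeries (poleRing x)} {a b : PowerSeries K}
    (h : jetSeries x f = dualSeries K a + PowerSeries.C DualNumber.eps * dualSeries K b) (n : ℕ) :
    (PowerSeries.coeff n (poleSeries x f)).coeff 0 = PowerSeries.coeff n a ∧
      (PowerSeries.coeff n (poleSeries x f)).coeff 1 = PowerSeries.coeff n b := by
  have h1 := congrArg (PowerSeries.coeff n) h
  rw [PowerSeries.coeff_map, map_add, PowerSeries.coeff_C_mul, PowerSeries.coeff_map,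
    PowerSeries.coeff_map, TrivSqZeroExt.algebraMap_eq_inl] at h1
  rw [PowerSeries.coeff_map]
  change ((PowerSeries.coeff n f : poleRing x) : LaurentSeries K).coeff 0 = _ ∧
    ((PowerSeries.coeff n f : poleRing x) : LaurentSeries K).coeff 1 = _
  rw [← fst_jet, ← snd_jet, h1]
  simp

theorem poleSeries_mem_of_jet {f : PowerSeries (poleRing x)} {b : PowerSeries K}
    (h : jetSeries x f = PowerSeries.C DualNumber.eps * dualSeries K b) :
    poleSeries x f ∈ SeriesVanishAt K 1 := by
  have h' := coeff_poleSeries_of_jet (f := f) (a := 0) (b := b) (by rw [map_zero, zero_add, h])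
  refine mem_seriesVanishAt.2 fun n => mem_ord.2 fun k hk => ?_
  rcases lt_or_eq_of_le (show k ≤ 0 by omega) with hk | rfl
  · exact mem_ord.1 (mem_seriesVanishAt.1 (poleSeries_mem f) n) k hk
  · exact (h' n).1.trans (PowerSeries.coeff n).map_zero

end Jets

/-- The roots of `branchPoly`. -/
structure IsRootData {K : Type*} [Field K] {N : ℕ} {x : Option (Fin N) → K}
    (ξ c : Fin N → PowerSeries K) (η : Fin N → PowerSeries (poleRing x))
    (y : PowerSeries (LaurentSeries K)) : Prop where
  constantCoeff_root : ∀ i, PowerSeries.constantCoeff (η i) = algebraMap K _ (x (some i))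
  jet_root : ∀ i, jetSeries x (η i) = dualSeries K (ξ i) + tEps K * dualSeries K (c i)
  constantCoeff_last : PowerSeries.constantCoeff y = xInf K
  sub_mem : y - PowerSeries.C (xInf K) ∈ SeriesVanishAt K 0
  factor : branchPoly ξ c = (X - C y) * ∏ i, (X - C (poleSeries x (η i)))

/-! ### The solution of the loop equations with base λ_j -/

section LoopFunctions

variable {K : Type*} [Field K] {N r : ℕ} {p : K[X]} {x : Option (Fin N) → K}
  {Q : (PowerSeries K)[X]} {ξ c : Fin N → PowerSeries K} {ζ : PowerSeries K}
  {η : Fin N → PowerSeries (poleRing x)} {y : PowerSeries (LaurentSeries K)}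

theorem sum_prod_sub_map {B : Type*} [CommRing B] [IsDomain B] (θ : K →+* B) {Y : Fin N → K}
    (hY : Function.Injective Y) (q : Fin N → B) :
    ∑ j, θ (-(∏ k ∈ Finset.univ.erase j, (Y j - Y k))⁻¹) * ∏ i, (θ (Y j) - q i) =
      ∑ i, (q i - θ (Y i)) := by
  apply IsFractionRing.injective B (FractionRing B)
  set τ := (algebraMap B (FractionRing B)).comp θ with hτ
  have h := sum_prod_sub_div (τ.injective.comp hY) fun i => algebraMap B (FractionRing B) (q i)
  simp only [map_sum, map_mul, map_prod, map_sub, map_neg, ← RingHom.comp_apply, ← hτ, map_inv₀]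
  simpa using h

/-- The product of the differences `Y - Q(η_i)`. -/
noncomputable def rootProd (Q : (PowerSeries K)[X]) (η : Fin N → PowerSeries (poleRing x)) (Y : K) :
    PowerSeries (poleRing x) :=
  ∏ i, (cstSeries x (PowerSeries.C Y) - Q.eval₂ (cstSeries x) (η i))

/-- To first order `Q(η_i) = Q(ξ_i) + Q'(ξ_i) c_i t/x`, and the residue condition is `Q'(ξ_i) c_i =
1`. -/
theorem IsRootData.jet_eval (hR : IsRootData ξ c η y) (hS : IsSpectralData r p x Q ξ c ζ) (i : Fin N) :
    jetSeries x (Q.eval₂ (cstSeries x) (η i)) =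
      dualSeries K (PowerSeries.C (p.eval (x (some i)))) + tEps K := by
  have hcomp : (jetSeries x).comp (cstSeries x) = dualSeries K := RingHom.ext (jetSeries_cstSeries x)
  rw [hom_eval₂, hcomp, hR.jet_root, ← eval_map]
  obtain ⟨k, hk⟩ := (Q.map (dualSeries K)).binomExpansion (dualSeries K (ξ i))
    (tEps K * dualSeries K (c i))
  have h1 := congrArg (dualSeries K) (hS.residue i)
  rw [map_mul, map_one] at h1
  rw [hk, derivative_map, eval_map_apply, eval_map_apply, hS.eval_pole]
  linear_combination tEps K * h1 + (k * dualSeries K (c i) ^ 2) * tEps_mul_tEps (K := K)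

theorem dualSeries_prod_sub {ι : Type*} (s : Finset ι) (a : ι → K) (ha : ∀ i ∈ s, a i ≠ 0) :
    dualSeries K (PowerSeries.C (∏ i ∈ s, a i)⁻¹) *
        ∏ i ∈ s, (dualSeries K (PowerSeries.C (a i)) - tEps K) =
      1 - tEps K * dualSeries K (PowerSeries.C (∑ i ∈ s, (a i)⁻¹)) := by
  rw [← Finset.prod_inv_distrib, map_prod, map_prod, ← Finset.prod_mul_distrib]
  have : ∀ i ∈ s, dualSeries K (PowerSeries.C (a i)⁻¹) *
      (dualSeries K (PowerSeries.C (a i)) - tEps K) =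
      1 + tEps K * -dualSeries K (PowerSeries.C (a i)⁻¹) := by
    intro i hi
    rw [mul_sub, ← map_mul, ← map_mul, inv_mul_cancel₀ (ha i hi), map_one, map_one]
    ring
  rw [Finset.prod_congr rfl this, prod_one_add_of_sq_eq_zero s tEps_mul_tEps, Finset.sum_neg_distrib,
    map_sum, map_sum]
  ring

theorem IsRootData.jet_rootProd (hR : IsRootData ξ c η y) (hS : IsSpectralData r p x Q ξ c ζ) :
    jetSeries x (cstSeries x (PowerSeries.C
      (∏ i, (p.eval (x none) - p.eval (x (some i))))⁻¹) * rootProd Q η (p.eval (x none))) =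
      1 - tEps K * dualSeries K (PowerSeries.C
        (∑ i, (p.eval (x none) - p.eval (x (some i)))⁻¹)) := by
  rw [← dualSeries_prod_sub _ _ fun i _ => sub_ne_zero.2 (hS.distinct _ _ (by simp)), rootProd,
    map_mul, map_prod, jetSeries_cstSeries]
  congr 1
  refine Finset.prod_congr rfl fun i _ => ?_
  rw [map_sub, jetSeries_cstSeries, hR.jet_eval hS, map_sub, map_sub]
  ring

/-- The candidate for the generating function of the base `some j`. -/
noncomputable def loopFun (p : K[X]) (Q : (PowerSeries K)[X]) (η : Fin N → PowerSeries (poleRing x))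
    (j : Fin N) : PowerSeries (poleRing x) :=
  cstSeries x (PowerSeries.C (-(∏ k ∈ Finset.univ.erase j,
    (p.eval (x (some j)) - p.eval (x (some k))))⁻¹)) * rootProd Q η (p.eval (x (some j)))

/-- The factor `i = j` is `-t/x + O(1/x^2)`, so the others count only at `x = ∞`, where they cancel
the denominator. This is the normalisation `H_j = t/x + O(1/x^2)`. -/
theorem IsRootData.jet_loopFun (hR : IsRootData ξ c η y) (hS : IsSpectralData r p x Q ξ c ζ)
    (j : Fin N) : jetSeries x (loopFun p Q η j) = tEps K := by
  have h := dualSeries_prod_sub (Finset.univ.erase j)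
    (fun k => p.eval (x (some j)) - p.eval (x (some k))) fun k hk =>
      sub_ne_zero.2 (hS.distinct _ _ fun h => (Finset.mem_erase.1 hk).1 (Option.some_injective _ h).symm)
  have h2 : jetSeries x (rootProd Q η (p.eval (x (some j)))) =
      -tEps K * ∏ k ∈ Finset.univ.erase j,
        (dualSeries K (PowerSeries.C (p.eval (x (some j)) - p.eval (x (some k)))) - tEps K) := by
    rw [rootProd, map_prod, ← Finset.mul_prod_erase _ _ (Finset.mem_univ j), map_sub,
      jetSeries_cstSeries, hR.jet_eval hS, sub_add_cancel_left]
    congr 1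
    refine Finset.prod_congr rfl fun i _ => ?_
    rw [map_sub, jetSeries_cstSeries, hR.jet_eval hS, map_sub, map_sub]
    ring
  rw [loopFun, map_mul, h2, jetSeries_cstSeries, map_neg, map_neg]
  linear_combination tEps K * h - dualSeries K (PowerSeries.C (∑ k ∈ Finset.univ.erase j,
    (p.eval (x (some j)) - p.eval (x (some k)))⁻¹)) * tEps_mul_tEps (K := K)

theorem poleSeries_eval₂ (Q : (PowerSeries K)[X]) (f : PowerSeries (poleRing x)) :
    poleSeries x (Q.eval₂ (cstSeries x) f) = Q.eval₂ (constSeries K) (poleSeries x f) := by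
  rw [hom_eval₂]
  congr 1

theorem poleSeries_rootProd (Q : (PowerSeries K)[X]) (Y : K) : poleSeries x (rootProd Q η Y) =
    ∏ i, (constSeries K (PowerSeries.C Y) - Q.eval₂ (constSeries K) (poleSeries x (η i))) := by
  rw [rootProd, map_prod]
  refine Finset.prod_congr rfl fun i _ => ?_
  rw [map_sub, poleSeries_cstSeries, poleSeries_eval₂]

/-- The Lagrange identity for the nodes `V'(λ_j)` and the values `Q(η_i)`. -/
theorem sum_loopFun (hS : IsSpectralData r p x Q ξ c ζ) : ∑ j, poleSeries x (loopFun p Q η j) =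
    ∑ i, (Q.eval₂ (constSeries K) (poleSeries x (η i)) -
      constSeries K (PowerSeries.C (p.eval (x (some i))))) := by
  have hY : Function.Injective fun i => p.eval (x (some i)) := by
    intro i j hij
    by_contra h
    exact hS.distinct _ _ (fun h' => h (Option.some_injective _ h')) hij
  refine Eq.trans ?_ (sum_prod_sub_map ((constSeries K).comp PowerSeries.C) hY _)
  refine Finset.sum_congr rfl fun j _ => ?_
  rw [loopFun, map_mul, poleSeries_cstSeries, poleSeries_rootProd]
  rfl

/-- All roots of `branchPoly`. -/
noncomputable def allRoots (η : Fin N → PowerSeries (poleRing x)) (y : PowerSeries (LaurentSeries K)) :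
    Option (Fin N) → PowerSeries (LaurentSeries K) :=
  fun a => a.elim y fun i => poleSeries x (η i)

theorem IsRootData.factor_all (hR : IsRootData ξ c η y) :
    ∏ a, (X - C (allRoots η y a)) = branchPoly ξ c := by
  rw [hR.factor, Fintype.prod_option]
  rfl

theorem coeff_map_constSeries_mem (g : (PowerSeries K)[X]) (k : ℕ) :
    (g.map (constSeries K)).coeff k ∈ (polSeries K).range := by
  rw [coeff_map]
  exact constSeries_mem_range _

theorem IsRootData.prod_mem (hR : IsRootData ξ c η y) (g : (PowerSeries K)[X]) :
    ∏ a, g.eval₂ (constSeries K) (allRoots η y a) ∈ (polSeries K).range := by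
  have := prod_eval_mem (polSeries K).range (allRoots η y)
    (by rw [hR.factor_all]; exact coeff_branchPoly_mem ξ c) (g.map (constSeries K))
    (coeff_map_constSeries_mem g)
  simpa only [eval_map] using this

theorem IsRootData.sum_mem (hR : IsRootData ξ c η y) (g : (PowerSeries K)[X]) :
    ∑ a, g.eval₂ (constSeries K) (allRoots η y a) ∈ (polSeries K).range := by
  have := sum_eval_mem (polSeries K).range (allRoots η y)
    (by rw [hR.factor_all]; exact coeff_branchPoly_mem ξ c) (g.map (constSeries K))
    (coeff_map_constSeries_mem g)
  simpa only [eval_map] using this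


theorem IsRootData.last_sub_mul_inv (hR : IsRootData ξ c η y) (hS : IsSpectralData r p x Q ξ c ζ)
    (i : Fin N) : (y - constSeries K (ξ i)) * (y - constSeries K (ξ i))⁻¹ = 1 := by
  refine PowerSeries.mul_inv_cancel _ ?_
  rw [map_sub, hR.constantCoeff_last, ← RingHom.comp_apply, constantCoeff_comp_map,
    RingHom.comp_apply, hS.constantCoeff_pole]
  exact xInf_sub_ne_zero _

/-- At `t = 0` the last root is `x`, so every `y - ξ_i` is invertible and `branchPoly` can be
divided by its pole factors. -/
theorem IsRootData.last_spec (hR : IsRootData ξ c η y) (hS : IsSpectralData r p x Q ξ c ζ) :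
    y + constSeries K PowerSeries.X *
      ∑ i, constSeries K (c i) * (y - constSeries K (ξ i))⁻¹ = PowerSeries.C (xInf K) := by
  have hw := hR.last_sub_mul_inv hS
  have h0 : (branchPoly ξ c).eval y = 0 := by
    rw [hR.factor, eval_mul]
    simp
  rw [eval_branchPoly, eval₂_residuePoly_of_inv hw] at h0
  have hD : (polePoly ξ).eval₂ (constSeries K) y ≠ 0 := by
    rw [eval₂_polePoly]
    exact Finset.prod_ne_zero_iff.2 fun i _ => left_ne_zero_of_mul_eq_one (hw i)
  rw [PowerSeries.map_X, ← sub_eq_zero]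
  refine (mul_eq_zero.1 ?_).resolve_left hD
  linear_combination h0

/-- `Q(y)` and `V'(x)` are the polynomial part and the whole of `V'(y + t ∑ c_i/(y - ξ_i))`, so they
differ by `O(1/x)`. -/
theorem IsRootData.last_sub_mem (hR : IsRootData ξ c η y) (hS : IsSpectralData r p x Q ξ c ζ) :
    Q.eval₂ (constSeries K) y - PowerSeries.C (aeval (xInf K) p) ∈ SeriesVanishAt K 1 := by
  have h := eval₂_sub_specPoly_mem (c := c) hR.sub_mem (hR.last_sub_mul_inv hS)
    (natDegree_map_le.trans hS.natDegree_le : (p.map PowerSeries.C).natDegree ≤ r) PowerSeries.X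
  rw [hR.last_spec hS, ← hS.spec] at h
  have e : (p.map PowerSeries.C).eval₂ (constSeries K) (PowerSeries.C (xInf K)) =
      PowerSeries.C (aeval (xInf K) p) := by
    rw [eval₂_map, aeval_def, hom_eval₂]
    congr 1
    exact RingHom.ext fun a => PowerSeries.map_C (algebraMap K (LaurentSeries K)) a
  rw [e] at h
  rw [← neg_sub]
  exact neg_mem h

/-- The relation between `Q(y)` and the generating functions. -/
theorem IsRootData.eval_last (hR : IsRootData ξ c η y) (hS : IsSpectralData r p x Q ξ c ζ) :
    Q.eval₂ (constSeries K) y =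
      PowerSeries.C (aeval (xInf K) p) - ∑ j, poleSeries x (loopFun p Q η j) := by
  rw [sum_loopFun hS, ← sub_eq_zero]
  -- The trace of `Q` over all roots is polynomial in `x`, and each of `Q(y) - V'(x)` and `Q(η_i) -
  -- V'(λ_i)` is `O(1/x)`.
  refine eq_zero_of_mem_range ?_ ?_
  · have h := hR.sum_mem Q
    rw [Fintype.sum_option] at h
    have h2 : ∑ i, constSeries K (PowerSeries.C (p.eval (x (some i)))) ∈ (polSeries K).range :=
      _root_.sum_mem fun i _ => constSeries_mem_range _
    have h3 := Subring.sub_mem _ (Subring.sub_mem _ h h2) (C_aeval_mem_range p)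
    convert h3 using 1
    rw [Finset.sum_sub_distrib]
    simp only [allRoots, Option.elim_none, Option.elim_some]
    ring
  · have h1 : ∀ i, Q.eval₂ (constSeries K) (poleSeries x (η i)) -
        constSeries K (PowerSeries.C (p.eval (x (some i)))) ∈ SeriesVanishAt K 1 := by
      intro i
      rw [← poleSeries_eval₂, ← poleSeries_cstSeries, ← map_sub]
      refine poleSeries_mem_of_jet (b := PowerSeries.X) ?_
      rw [map_sub, hR.jet_eval hS, jetSeries_cstSeries, add_sub_cancel_left, tEps, PowerSeries.map_X,
        mul_comm]
    have h2 := add_mem (hR.last_sub_mem hS) (_root_.sum_mem fun i (_ : i ∈ Finset.univ) => h1 i)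
    convert h2 using 1
    ring

/-- Multiplying `H_j` by `Q(y) - Y_j` supplies the missing factor of the norm of `Y_j - Q` over all
roots, up to a constant. -/
theorem IsRootData.loop_mem (hR : IsRootData ξ c η y) (j : Fin N) :
    (Q.eval₂ (constSeries K) y - constSeries K (PowerSeries.C (p.eval (x (some j))))) *
      poleSeries x (loopFun p Q η j) ∈ (polSeries K).range := by
  have h := hR.prod_mem (C (PowerSeries.C (p.eval (x (some j)))) - Q)
  rw [Fintype.prod_option] at h
  have h2 := Subring.mul_mem _ (Subring.neg_mem _ (constSeries_mem_range (PowerSeries.C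
    (-(∏ k ∈ Finset.univ.erase j, (p.eval (x (some j)) - p.eval (x (some k))))⁻¹)))) h
  convert h2 using 1
  rw [loopFun, map_mul, poleSeries_cstSeries, poleSeries_rootProd]
  simp only [allRoots, Option.elim_none, Option.elim_some, eval₂_sub, eval₂_C]
  ring

end LoopFunctions

/-! ### The solution of the loop equations with base z -/

section VariableFunction

variable {K : Type*} [Field K] {N r : ℕ} {p : K[X]} {x : Option (Fin N) → K}
  {Q : (PowerSeries K)[X]} {ξ c : Fin N → PowerSeries K} {ζ : PowerSeries K}
  {η : Fin N → PowerSeries (poleRing x)} {y : PowerSeries (LaurentSeries K)}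

/-- The value `ζ + t ∑ c_i / (ζ - ξ_i)`. -/
noncomputable def paramValue (ξ c : Fin N → PowerSeries K) (ζ : PowerSeries K) : PowerSeries K :=
  ζ + PowerSeries.X * ∑ i, c i * (ζ - ξ i)⁻¹

theorem constantCoeff_paramValue (ξ c : Fin N → PowerSeries K) (ζ : PowerSeries K) :
    PowerSeries.constantCoeff (paramValue ξ c ζ) = PowerSeries.constantCoeff ζ := by
  rw [paramValue, map_add, map_mul, PowerSeries.constantCoeff_X, zero_mul, add_zero]

theorem IsSpectralData.var_sub_mul_inv (hS : IsSpectralData r p x Q ξ c ζ) (i : Fin N) :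
    (ζ - ξ i) * (ζ - ξ i)⁻¹ = 1 := by
  refine PowerSeries.mul_inv_cancel _ ?_
  rw [map_sub, hS.constantCoeff_var, hS.constantCoeff_pole, sub_ne_zero]
  intro h
  exact hS.distinct none (some i) (by simp) (by rw [h])

/-- The pole factors are units at `ζ`, as `V'(z) ≠ V'(λ_i)`; taking them out leaves the value `y(ζ)
- x`. -/
theorem IsSpectralData.eval_branchPoly (hS : IsSpectralData r p x Q ξ c ζ) :
    (branchPoly ξ c).eval (constSeries K ζ) = constSeries K ((polePoly ξ).eval ζ) *
      (constSeries K (paramValue ξ c ζ) - PowerSeries.C (xInf K)) := by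
  have h := eval₂_residuePoly_of_inv (φ := RingHom.id (PowerSeries K)) (c := c) hS.var_sub_mul_inv
  simp only [RingHom.id_apply] at h
  change (residuePoly ξ c).eval ζ = (polePoly ξ).eval ζ * _ at h
  rw [_root_.eval_branchPoly, eval₂_at_apply, eval₂_at_apply, h, paramValue, map_add, map_mul, map_mul,
    PowerSeries.map_X]
  ring

variable (x) in
/-- The function `1 / (x - a)` for a series `a = x none + O(t)`. -/
theorem exists_inv_sub {a : PowerSeries K} (ha : PowerSeries.constantCoeff a = x none) :
    ∃ g : PowerSeries (poleRing x),
      (PowerSeries.C (xInf K) - constSeries K a) * poleSeries x g = 1 ∧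
      jetSeries x g = PowerSeries.C DualNumber.eps := by
  set u := resolvElt x none with hu
  set d := a - PowerSeries.C (x none) with hd
  -- With `u = 1/(x - z)` and `d = a - z`, which vanishes at `t = 0`, one has `1/(x - a) = u/(1 - u
  -- d)`.
  have hunit : IsUnit (1 - PowerSeries.C u * cstSeries x d) := by
    rw [PowerSeries.isUnit_iff_constantCoeff, map_sub, map_mul, map_one,
      ← RingHom.comp_apply _ (cstSeries x), constantCoeff_comp_map, RingHom.comp_apply, hd, map_sub, ha,
      PowerSeries.constantCoeff_C, PowerSeries.constantCoeff_C, sub_self, map_zero, mul_zero, sub_zero]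
    exact isUnit_one
  obtain ⟨g, hg⟩ := hunit.exists_right_inv
  have hg' : (1 - PowerSeries.C u * cstSeries x d) * (PowerSeries.C u * g) = PowerSeries.C u := by
    linear_combination PowerSeries.C u * hg
  refine ⟨PowerSeries.C u * g, ?_, ?_⟩
  · have h := congrArg (poleSeries x) hg'
    rw [map_mul, map_sub, map_mul, map_one, poleSeries_cstSeries, PowerSeries.map_C] at h
    have hux : PowerSeries.C ((poleRing x).val.toRingHom u) * (PowerSeries.C (xInf K) -
        constSeries K (PowerSeries.C (x none))) = 1 := by
      rw [PowerSeries.map_C, ← map_sub, ← map_mul, mul_comm]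
      exact (congrArg _ (mul_resolvent (x none))).trans (map_one _)
    have hd' : constSeries K a = constSeries K d + constSeries K (PowerSeries.C (x none)) := by
      rw [← map_add, hd, sub_add_cancel]
    rw [hd']
    linear_combination (PowerSeries.C (xInf K) - constSeries K (PowerSeries.C (x none))) * h +
      (constSeries K d * poleSeries x (PowerSeries.C u * g) + 1) * hux
  · have h := congrArg (jetSeries x) hg'
    have he : (PowerSeries.C DualNumber.eps : PowerSeries (DualNumber K)) *
        PowerSeries.C DualNumber.eps = 0 := by
      rw [← map_mul, DualNumber.eps_mul_eps, map_zero]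
    rw [map_mul, map_sub, map_mul, map_one, jetSeries_cstSeries, PowerSeries.map_C, hu,
      jet_resolvElt] at h
    linear_combination (1 + PowerSeries.C DualNumber.eps * dualSeries K d) * h +
      (dualSeries K d) * (1 + dualSeries K d * jetSeries x (PowerSeries.C (resolvElt x none) * g)) * he

/-- The product of the quotients `(Y_z - Q(η_i)) / (Y_z - Y_i)`. -/
noncomputable def varProd (p : K[X]) (Q : (PowerSeries K)[X]) (η : Fin N → PowerSeries (poleRing x)) :
    PowerSeries (poleRing x) :=
  cstSeries x (PowerSeries.C (∏ i, (p.eval (x none) - p.eval (x (some i))))⁻¹) *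
    rootProd Q η (p.eval (x none))

/-- The candidate for the generating function of the base `none`. -/
noncomputable def varFun (p : K[X]) (Q : (PowerSeries K)[X]) (η : Fin N → PowerSeries (poleRing x))
    (g : PowerSeries (poleRing x)) : PowerSeries (poleRing x) :=
  PowerSeries.X * varProd p Q η * g

variable {g : PowerSeries (poleRing x)}

theorem IsRootData.jet_varFun (hR : IsRootData ξ c η y) (hS : IsSpectralData r p x Q ξ c ζ)
    (hg : jetSeries x g = PowerSeries.C DualNumber.eps) :
    jetSeries x (varFun p Q η g) = tEps K := by
  have he : (PowerSeries.C DualNumber.eps : PowerSeries (DualNumber K)) *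
      PowerSeries.C DualNumber.eps = 0 := by
    rw [← map_mul, DualNumber.eps_mul_eps, map_zero]
  rw [varFun, map_mul, map_mul, varProd, hR.jet_rootProd hS, hg, PowerSeries.map_X, tEps]
  linear_combination (-PowerSeries.X * PowerSeries.X * dualSeries K (PowerSeries.C
    (∑ i, (p.eval (x none) - p.eval (x (some i)))⁻¹))) * he

theorem coeff_xInf_mul (f : LaurentSeries K) (k : ℤ) : (xInf K * f).coeff k = f.coeff (k + 1) := by
  have := HahnSeries.coeff_single_mul_add (r := (1 : K)) (x := f) (a := k + 1) (b := (-1 : ℤ))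
  rw [one_mul, show k + 1 + -1 = k by ring] at this
  exact this

/-- Multiplication by `x` turns `1/(x - a)` into `1 + a/(x - a)`. The coefficient sought is then the
first-order coefficient of `t (1 - t S/x)(1 + a/x)`, which is `t (a - t S)`. -/
theorem IsRootData.coeff_two_varFun (hR : IsRootData ξ c η y) (hS : IsSpectralData r p x Q ξ c ζ)
    {a : PowerSeries K} (hg : jetSeries x g = PowerSeries.C DualNumber.eps)
    (hg' : (PowerSeries.C (xInf K) - constSeries K a) * poleSeries x g = 1) (m : ℕ) :
    (PowerSeries.coeff (m + 1) (poleSeries x (varFun p Q η g))).coeff 2 =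
      PowerSeries.coeff m (a - PowerSeries.X *
        PowerSeries.C (∑ i, (p.eval (x none) - p.eval (x (some i)))⁻¹)) := by
  have he : (PowerSeries.C DualNumber.eps : PowerSeries (DualNumber K)) *
      PowerSeries.C DualNumber.eps = 0 := by
    rw [← map_mul, DualNumber.eps_mul_eps, map_zero]
  have h1 : PowerSeries.C (xInf K) * poleSeries x (varFun p Q η g) =
      poleSeries x (PowerSeries.X * varProd p Q η * (1 + cstSeries x a * g)) := by
    rw [varFun, map_mul, map_mul _ _ (1 + _), map_add, map_mul _ (cstSeries x a),
      poleSeries_cstSeries, map_one]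
    linear_combination poleSeries x (PowerSeries.X * varProd p Q η) * hg'
  set S : PowerSeries K := PowerSeries.C (∑ i, (p.eval (x none) - p.eval (x (some i)))⁻¹) with hSS
  have h2 : jetSeries x (PowerSeries.X * varProd p Q η * (1 + cstSeries x a * g)) =
      dualSeries K PowerSeries.X +
        PowerSeries.C DualNumber.eps * dualSeries K (PowerSeries.X * (a - PowerSeries.X * S)) := by
    rw [map_mul, map_mul, varProd, hR.jet_rootProd hS, map_add, map_mul, jetSeries_cstSeries, hg,
      PowerSeries.map_X, tEps, map_one, map_mul, map_sub, map_mul, PowerSeries.map_X]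
    linear_combination (-PowerSeries.X * PowerSeries.X * dualSeries K S * dualSeries K a) * he
  have h3 := (coeff_poleSeries_of_jet h2 (m + 1)).2
  rwa [← h1, PowerSeries.coeff_C_mul, coeff_xInf_mul, PowerSeries.coeff_succ_X_mul] at h3

/-- The norm of `Y_z - Q` over all roots contains the factor `∏ (η_a - ζ)`, which up to sign and a
constant series is `x - y(ζ)`. It cancels the denominator of `H_z`; the quotient is the norm of `q`,
a polynomial in `x`. -/
theorem IsRootData.var_mem (hR : IsRootData ξ c η y) (hS : IsSpectralData r p x Q ξ c ζ)
    (hg' : (PowerSeries.C (xInf K) - constSeries K (paramValue ξ c ζ)) * poleSeries x g = 1) :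
    (Q.eval₂ (constSeries K) y - constSeries K (PowerSeries.C (p.eval (x none)))) *
      poleSeries x (varFun p Q η g) ∈ (polSeries K).range := by
  obtain ⟨q, hq⟩ : X - C ζ ∣ C (PowerSeries.C (p.eval (x none))) - Q :=
    dvd_iff_isRoot.2 (by rw [IsRoot, eval_sub, eval_C, hS.eval_var, sub_self])
  have h1 : ∏ a, (C (PowerSeries.C (p.eval (x none))) - Q).eval₂ (constSeries K) (allRoots η y a) =
      (∏ a, (allRoots η y a - constSeries K ζ)) *
        ∏ a, q.eval₂ (constSeries K) (allRoots η y a) := by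
    rw [← Finset.prod_mul_distrib]
    refine Finset.prod_congr rfl fun a _ => ?_
    rw [hq, eval₂_mul, eval₂_sub, eval₂_X, eval₂_C]
  have h2 : ∏ a, (allRoots η y a - constSeries K ζ) =
      (-1) ^ (N + 1) * (branchPoly ξ c).eval (constSeries K ζ) := by
    rw [← hR.factor_all, eval_prod]
    simp only [eval_sub, eval_X, eval_C]
    have hcard : (-1 : PowerSeries (LaurentSeries K)) ^ (N + 1) = ∏ _a : Option (Fin N), (-1) := by
      simp
    rw [hcard, ← Finset.prod_mul_distrib]
    exact Finset.prod_congr rfl fun a _ => by ring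
  rw [hS.eval_branchPoly] at h2
  rw [h2, Fintype.prod_option] at h1
  have h3 := Subring.mul_mem _ (Subring.mul_mem _
    (Subring.pow_mem _ (Subring.neg_mem _ (Subring.one_mem _)) (N + 1)) (constSeries_mem_range
      (PowerSeries.X * PowerSeries.C (∏ i, (p.eval (x none) - p.eval (x (some i))))⁻¹ *
        (polePoly ξ).eval ζ))) (hR.prod_mem q)
  convert h3 using 1
  simp only [allRoots, Option.elim_none, Option.elim_some, eval₂_sub, eval₂_C] at h1 ⊢
  rw [varFun, varProd, map_mul, map_mul, map_mul, PowerSeries.map_X, poleSeries_cstSeries,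
    poleSeries_rootProd, map_mul, map_mul, PowerSeries.map_X]
  set D := constSeries K ((polePoly ξ).eval ζ)
  set k := constSeries K (PowerSeries.C (∏ i, (p.eval (x none) - p.eval (x (some i))))⁻¹)
  linear_combination (-PowerSeries.X * k * poleSeries x g) * h1 +
    ((-1) ^ (N + 1) * PowerSeries.X * k * D * (∏ a : Option (Fin N), q.eval₂ (constSeries K)
      (a.elim y fun i => poleSeries x (η i)))) * hg'

/-- At `t = 0` the factor `i = j` is `V'(λ_j) - V'(λ_j)`. -/
theorem IsRootData.constantCoeff_loopFun (hR : IsRootData ξ c η y)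
    (hS : IsSpectralData r p x Q ξ c ζ) (j : Fin N) :
    PowerSeries.constantCoeff (loopFun p Q η j) = 0 := by
  have hcst : ∀ a, PowerSeries.constantCoeff (cstSeries x a) =
      algebraMap K _ (PowerSeries.constantCoeff a) := fun a => by
    rw [← RingHom.comp_apply, constantCoeff_comp_map, RingHom.comp_apply]
  rw [loopFun, map_mul, rootProd, map_prod, Finset.prod_eq_zero (Finset.mem_univ j), mul_zero]
  rw [map_sub, hcst, PowerSeries.constantCoeff_C, hom_eval₂, constantCoeff_comp_map, ← eval₂_map,
    hS.spec, map_constantCoeff_specPoly, hR.constantCoeff_root, eval₂_at_apply, sub_self]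

end VariableFunction

/-! ### The candidates solve the loop equations -/

section Candidate

variable {K : Type*} [Field K] [Algebra ℂ K] {N r : ℕ} {V : ℂ[X]} {x : Option (Fin N) → K}
  {Q : (PowerSeries K)[X]} {ξ c : Fin N → PowerSeries K} {ζ : PowerSeries K}

/-- The dual-number expansion of each candidate is `t ε`, which gives the normalisation at infinity.
The formula for `Q(y)` turns the polynomiality of the norms into the loop equations. -/
theorem exists_isLoopSolution
    (hS : IsSpectralData r ((derivative V).map (algebraMap ℂ K)) x Q ξ c ζ) :
    ∃ h : Option (Fin N) → ℕ → LaurentSeries K, IsLoopSolution V x h ∧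
      ∀ m, (h none (m + 1)).coeff 2 = PowerSeries.coeff m (paramValue ξ c ζ - PowerSeries.X *
        PowerSeries.C (∑ i, (dV V (x none) - dV V (x (some i)))⁻¹)) := by
  set p := (derivative V).map (algebraMap ℂ K) with hp
  have hY : ∀ a : K, dV V a = p.eval a := fun a => by rw [dV, hp, eval_map_algebraMap]
  have hx : Function.Injective fun i => x (some i) := by
    intro i j hij
    by_contra h
    exact hS.distinct _ _ (fun h' => h (Option.some_injective _ h')) (congrArg (p.eval ·) hij)
  obtain ⟨η, h1, h2, h3⟩ := exists_roots (c := c) hx hS.constantCoeff_pole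
  obtain ⟨y, hy, hy', hfac⟩ := exists_last_root hx hS.constantCoeff_pole h1 h3
  have hR : IsRootData ξ c η y := ⟨h1, h2, hy, hy', hfac⟩
  obtain ⟨g, hg, hg'⟩ := exists_inv_sub x (a := paramValue ξ c ζ)
    (by rw [constantCoeff_paramValue, hS.constantCoeff_var])
  set F : Option (Fin N) → PowerSeries (poleRing x) := fun a =>
    a.elim (varFun p Q η g) fun j => loopFun p Q η j with hF
  have hjet : ∀ a, jetSeries x (F a) = dualSeries K 0 +
      PowerSeries.C DualNumber.eps * dualSeries K PowerSeries.X := by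
    intro a
    rw [map_zero, zero_add, PowerSeries.map_X, mul_comm, ← tEps]
    cases a with
    | none => exact hR.jet_varFun hS hg'
    | some j => exact hR.jet_loopFun hS j
  have hcoeff := fun a n => coeff_poleSeries_of_jet (hjet a) n
  refine ⟨fun a m => PowerSeries.coeff m (poleSeries x (F a)), ⟨?_, ?_, ?_, ?_, ?_⟩, ?_⟩
  · intro a
    have h0 : PowerSeries.constantCoeff (F a) = 0 := by
      cases a with
      | none =>
        change PowerSeries.constantCoeff (varFun p Q η g) = 0
        rw [varFun, map_mul, map_mul, PowerSeries.constantCoeff_X, zero_mul, zero_mul]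
      | some j => exact hR.constantCoeff_loopFun hS j
    rw [PowerSeries.coeff_map, PowerSeries.coeff_zero_eq_constantCoeff_apply, h0, map_zero]
  · intro a m
    rw [PowerSeries.coeff_map]
    exact (PowerSeries.coeff m (F a)).2
  · intro a m
    refine mem_ord.2 fun k hk => ?_
    rcases lt_or_eq_of_le (show k ≤ 0 by omega) with hk | rfl
    · exact mem_ord.1 (mem_seriesVanishAt.1 (poleSeries_mem (F a)) m) k hk
    · rw [(hcoeff a m).1, map_zero]
  · intro a m
    rw [(hcoeff a m).2, PowerSeries.coeff_X]
  · intro a m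
    have h4 : (Q.eval₂ (constSeries K) y - constSeries K (PowerSeries.C (p.eval (x a)))) *
        poleSeries x (F a) ∈ (polSeries K).range := by
      cases a with
      | none => exact hR.var_mem hS hg
      | some j => exact hR.loop_mem j
    have h5 := coeff_mem_pol h4 m
    -- Replacing `Q(y)` by `V'(x) - ∑ H_j` produces the quadratic term.
    rw [hR.eval_last hS, PowerSeries.map_C, sub_right_comm, ← map_sub, sub_mul, map_sub,
      PowerSeries.coeff_C_mul, Finset.sum_mul, map_sum] at h5
    simp only [PowerSeries.coeff_mul] at h5
    rw [hY]
    exact h5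
  · intro m
    rw [← show ∑ i, (p.eval (x none) - p.eval (x (some i)))⁻¹ =
      ∑ i, (dV V (x none) - dV V (x (some i)))⁻¹ by simp only [hY]]
    exact hR.coeff_two_varFun hS hg' hg m

end Candidate

/-! ### Specialisation to rational functions of z and conclusion -/

section MainTheorem

variable {N r : ℕ} {V : ℂ[X]} {lam : Fin N → ℂ} {Q : (PowerSeries ℂ)[X]}
  {ξ : Fin N → PowerSeries ℂ} {ζ : PowerSeries (RatFunc ℂ)}

theorem dV_algebraMap {K : Type*} [Field K] [Algebra ℂ K] (V : ℂ[X]) (a : ℂ) :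
    dV V (algebraMap ℂ K a) = algebraMap ℂ K (dV V a) := by
  rw [dV, dV, aeval_algebraMap_apply]

theorem ddV_algebraMap {K : Type*} [Field K] [Algebra ℂ K] (V : ℂ[X]) (a : ℂ) :
    ddV V (algebraMap ℂ K a) = algebraMap ℂ K (ddV V a) := by
  rw [ddV, ddV, aeval_algebraMap_apply]

theorem dV_X_ne (hr : 1 ≤ r) (hV : V.natDegree = r + 1) (a : ℂ) :
    dV V (RatFunc.X : RatFunc ℂ) ≠ algebraMap ℂ (RatFunc ℂ) a := by
  have h : derivative V - C a ≠ 0 := by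
    intro h
    have h2 := natDegree_derivative_eq hV
    rw [sub_eq_zero.1 h, natDegree_C] at h2
    omega
  have := aeval_X_ne_zero h
  rwa [map_sub, aeval_C, sub_ne_zero] at this

theorem dV_decoration_ne (hr : 1 ≤ r) (hV : V.natDegree = r + 1) (hgen : GenericParameters V lam)
    (a b : Option (Fin N)) (hab : a ≠ b) :
    dV V (decoration RatFunc.X (fun j => algebraMap ℂ (RatFunc ℂ) (lam j)) a) ≠
      dV V (decoration RatFunc.X (fun j => algebraMap ℂ (RatFunc ℂ) (lam j)) b) := by
  cases a with
  | none =>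
    cases b with
    | none => exact absurd rfl hab
    | some j =>
      change dV V RatFunc.X ≠ dV V (algebraMap ℂ (RatFunc ℂ) (lam j))
      rw [dV_algebraMap]
      exact dV_X_ne hr hV _
  | some i =>
    cases b with
    | none =>
      change dV V (algebraMap ℂ (RatFunc ℂ) (lam i)) ≠ dV V RatFunc.X
      rw [dV_algebraMap]
      exact (dV_X_ne hr hV _).symm
    | some j =>
      change dV V (algebraMap ℂ (RatFunc ℂ) (lam i)) ≠ dV V (algebraMap ℂ (RatFunc ℂ) (lam j))
      rw [dV_algebraMap, dV_algebraMap]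
      exact fun h => hgen.dV_injective i j (fun h' => hab (by rw [h']))
        ((algebraMap ℂ (RatFunc ℂ)).injective h)

theorem ddV_decoration_ne_zero (hr : 1 ≤ r) (hV : V.natDegree = r + 1)
    (hgen : GenericParameters V lam) (a : Option (Fin N)) :
    ddV V (decoration RatFunc.X (fun j => algebraMap ℂ (RatFunc ℂ) (lam j)) a) ≠ 0 := by
  cases a with
  | none =>
    exact aeval_X_ne_zero (derivative_ne_zero_of_natDegree (by
      rw [natDegree_derivative_eq hV]; exact hr))
  | some i =>
    change ddV V (algebraMap ℂ (RatFunc ℂ) (lam i)) ≠ 0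
    rw [ddV_algebraMap]
    exact (_root_.map_ne_zero _).2 (hgen.ddV_ne_zero i)

theorem map_specPoly {A B : Type*} [CommRing A] [CommRing B] (φ : A →+* B) (r : ℕ) (p : A[X]) (t : A)
    (ξ c : Fin N → A) : (specPoly r p t ξ c).map φ =
      specPoly r (p.map φ) (φ t) (fun i => φ (ξ i)) fun i => φ (c i) := by
  rw [specPoly, Polynomial.map_add, Polynomial.map_mul, map_corrPoly, map_C, specPoly]

theorem IsSpectralPolynomial.isSpectralData (hr : 1 ≤ r) (hV : V.natDegree = r + 1)
    (hgen : GenericParameters V lam) (h : IsSpectralPolynomial V lam Q ξ)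
    (hζ : PowerSeries.constantCoeff ζ = RatFunc.X)
    (hζ' : evalSeries Q ζ = PowerSeries.C (dV V RatFunc.X)) :
    IsSpectralData r ((derivative V).map (algebraMap ℂ (RatFunc ℂ)))
      (decoration RatFunc.X fun j => algebraMap ℂ (RatFunc ℂ) (lam j))
      (Q.map (scalarSeries (RatFunc ℂ))) (fun i => scalarSeries (RatFunc ℂ) (ξ i))
      (fun i => scalarSeries (RatFunc ℂ) ((derivative Q).eval (ξ i))⁻¹) ζ := by
  have hY : ∀ a : RatFunc ℂ, ((derivative V).map (algebraMap ℂ (RatFunc ℂ))).eval a = dV V a :=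
    fun a => by rw [dV, eval_map_algebraMap]
  refine ⟨?_, ?_, ?_, ?_, ?_, ?_, hζ, ?_⟩
  · exact natDegree_map_le.trans (natDegree_derivative_eq hV).le
  · intro a b hab
    rw [hY, hY]
    exact dV_decoration_ne hr hV hgen a b hab
  · nth_rewrite 1 [((isSpectralPolynomial_iff hV).1 h).2]
    rw [map_specPoly, Polynomial.map_map, scalarSeries_comp_C, ← Polynomial.map_map, PowerSeries.map_X]
  · intro i
    rw [← RingHom.comp_apply, constantCoeff_comp_scalarSeries, RingHom.comp_apply, (h.1 i).1]
    rfl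
  · intro i
    rw [eval_map_apply, (h.1 i).2, PowerSeries.map_C, hY]
    exact congrArg _ (dV_algebraMap V (lam i)).symm
  · intro i
    rw [derivative_map, eval_map_apply, ← map_mul, PowerSeries.inv_mul_cancel, map_one]
    rw [← isUnit_iff_ne_zero, ← PowerSeries.isUnit_iff_constantCoeff]
    exact h.isUnit_eval hV hgen.ddV_ne_zero i
  · rw [eval_map, hY]
    exact hζ'

/-- The sum over maps and the explicit candidate solve the same loop equations, hence agree. Their
coefficients of `x^(-2)` in `H_z` are compared; the term `t ∑ 1/(V'(z) - V'(λ_j))` in the definition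
of `y` compensates the correction from the product over the roots. -/
theorem discFunction_eq_ratParam (hr : 1 ≤ r) (hV : V.natDegree = r + 1)
    (hgen : GenericParameters V lam) (h : IsSpectralPolynomial V lam Q ξ)
    (hζ : PowerSeries.constantCoeff ζ = RatFunc.X)
    (hζ' : evalSeries Q ζ = PowerSeries.C (dV V RatFunc.X)) :
    discFunction r V lam = ratParam Q ξ ζ := by
  have h1 := dV_decoration_ne hr hV hgen
  obtain ⟨g, hg, hg2⟩ := exists_isLoopSolution (h.isSpectralData hr hV hgen hζ hζ')
  have h1' : ∀ a b, decoration RatFunc.X (fun j => algebraMap ℂ (RatFunc ℂ) (lam j)) a ≠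
      decoration RatFunc.X (fun j => algebraMap ℂ (RatFunc ℂ) (lam j)) b → _ :=
    fun a b hab => h1 a b fun h => hab (by rw [h])
  have h2 := ddV_decoration_ne_zero hr hV hgen
  have huniq := (isLoopSolution_genCoeff (r := r) hV h1' h2).unique h1' h2 hg
  have key : PowerSeries.C RatFunc.X + shiftedDisc r V RatFunc.X
      (fun j => algebraMap ℂ (RatFunc ℂ) (lam j)) = ratParam Q ξ ζ - PowerSeries.X *
        PowerSeries.C (∑ j, (dV V (RatFunc.X : RatFunc ℂ) -
          dV V (algebraMap ℂ (RatFunc ℂ) (lam j)))⁻¹) := by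
    ext1 m
    rw [← coeff_genCoeff_two, huniq, hg2, ratParam_eq]
    rfl
  rw [discFunction, key, ← map_sum]
  simp only [one_div]
  ring

end MainTheorem

theorem mainTheorem5 (r N : ℕ) (hr : 2 ≤ r) (V : ℂ[X]) (hV : V.natDegree = r + 1)
    (lam : Fin N → ℂ) (hgen : GenericParameters V lam) :
    ∃ (Q : (PowerSeries ℂ)[X]) (ξ : Fin N → PowerSeries ℂ) (ζ : PowerSeries (RatFunc ℂ)),
      -- `Q` has degree `r`, it and the `ξ_j` are determined by the stated conditions
      Q.natDegree = r ∧
      Q.map PowerSeries.constantCoeff = derivative V ∧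
      IsSpectralPolynomial V lam Q ξ ∧
      (∀ Q' ξ', IsSpectralPolynomial V lam Q' ξ' → Q' = Q ∧ ξ' = ξ) ∧
      (∀ j x, IsPreimage V Q (lam j) x → x = ξ j) ∧
      (∀ j, IsUnit ((derivative Q).eval (ξ j))) ∧
      -- `ζ` is determined by `Q(ζ) = V'(z)` and `ζ = z + O(1)`
      IsUniformizer V Q ζ ∧
      (∀ ζ', IsUniformizer V Q ζ' → ζ' = ζ) ∧
      PowerSeries.constantCoeff ζ = RatFunc.X ∧
      -- the formula for `y`
      discFunction r V lam = ratParam Q ξ ζ ∧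
      -- the deck transformations are formal power series in `t`
      ∀ k : Fin r, ∃! ζk : PowerSeries (LaurentSeries ℂ), IsDeckTransformation r Q ζ k ζk := by
  have hr1 : 1 ≤ r := le_trans one_le_two hr
  obtain ⟨Q, ξ, hQ, huniq⟩ := exists_isSpectralPolynomial hV hgen.ddV_ne_zero
  obtain ⟨ζ, hζ, hζ', hζuniq⟩ := exists_isUniformizer hr1 hV hQ
  exact ⟨Q, ξ, ζ, hQ.natDegree_eq hr1 hV, hQ.map_constantCoeff hV, hQ, huniq,
    fun j x hx => hQ.eq_of_isPreimage hV hgen.ddV_ne_zero j hx,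
    hQ.isUnit_eval hV hgen.ddV_ne_zero, hζ', hζuniq, hζ,
    discFunction_eq_ratParam hr1 hV hgen hQ hζ hζ'.1,
    fun k => existsUnique_isDeckTransformation hr1 hV hQ hζ' k⟩
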